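/- Let $d\in\{2,3\}$, let $\Omega\subset\mathbb R^d$ be a bounded convex domain, and let $A\in L^\infty(\Omega)^{d\times d}$ be uniformly elliptic, i.e. for some constants $0<\underline\nu\le\overline\nu$ and a.e. $x\in\Omega$ one has $\underline\nu|\xi|^2\le\xi^TA(x)\xi\le\overline\nu|\xi|^2$ for all $\xi\in\mathbb R^d$, and satisfy the Cordes condition: there is $\varepsilon\in(0,1]$ with $|A|^2/(\operatorname{tr}A)^2\le 1/(d-1+\varepsilon)$ a.e. in $\Omega$, where $|A|^2=A:A$ and $:$ is the Frobenius inner product. Let $\mu>0$ and $\sigma>0$. For a conforming subdivision $\mathcal T_h$ of $\overline\Omega$ into finitely many $d$-simplices $K$, let $\mathcal E_h^i$ and $\mathcal E_h^b$ be the sets of its interior faces and of its faces lying on $\partial\Omega$, $h_e=\operatorname{diam}(e)$ and $\mathbf n$ the unit outward normal; on $e=\partial K^+\cap\partial K^-\in\mathcal E_h^i$ put $[\![\mathbf q\otimes\mathbf n]\!]=\mathbf q^+\otimes\mathbf n^++\mathbf q^-\otimes\mathbf n^-$, the values on faces being traces. Call $\mathcal T_h$ shape-regular with parameter $\sigma$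 if every $K\in\mathcal T_h$ contains a ball whose diameter is at least $\operatorname{diam}(K)/\sigma$. Let $H^1(\mathcal T_h)^d$ be the broken Sobolev space of all $\mathbf q\in L^2(\Omega)^d$ with $\mathbf q|_K\in H^1(K)^d$ for all $K\in\mathcal T_h$, and for an integer $m\ge0$ let $$\mathbf S_h^m=\{\mathbf v\in L^2(\Omega)^d:\ \mathbf v|_K\in\mathbb P_m(K)^d,\ \nabla\times(\mathbf v|_K)=0\ \ \forall K\in\mathcal T_h\},$$ where $\mathbb P_m(K)$ is the space of polynomials of degree at most $m$. On $H^1(\mathcal T_h)^d$ define $$a_h^{\mathbf p}(\mathbf p,\mathbf q)=\sum_{K\in\mathcal T_h}\int_K(A:\nabla\mathbf p)(A:\nabla\mathbf q)\,dx+\sum_{e\in\mathcal E_h^i}\int_e\frac{\mu}{h_e}[\![\mathbf p\otimes\mathbf n]\!]:[\![\mathbf q\otimes\mathbf n]\!]\,ds+\sum_{e\in\mathcal E_h^b}\int_e\frac{\mu}{h_e}(\mathbf p\times\mathbf n)\cdot(\mathbf q\times\mathbf n)\,ds,$$ $$|||\mathbf q|||_{\mathbf p}=\Big(\sum_{K\in\mathcal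 T_h}\|\nabla\mathbf q\|_{L^2(K)}^2+\sum_{e\in\mathcal E_h^i}\frac1{h_e}\|[\![\mathbf q\otimes\mathbf n]\!]\|_{L^2(e)}^2+\sum_{e\in\mathcal E_h^b}\frac1{h_e}\|\mathbf q\times\mathbf n\|_{L^2(e)}^2\Big)^{1/2}.$$ Then the following hold. 1. (Boundedness.) There is a constant $C>0$ such that for every subdivision $\mathcal T_h$ that is shape-regular with parameter $\sigma$ $$|a_h^{\mathbf p}(\mathbf p,\mathbf q)|\le C\,|||\mathbf p|||_{\mathbf p}\,|||\mathbf q|||_{\mathbf p}\qquad\forall\,\mathbf p,\mathbf q\in H^1(\mathcal T_h)^d.$$ 2. (Coercivity.) For every integer $m\ge0$ there is a constant $C>0$ such that for every subdivision $\mathcal T_h$ that is shape-regular with parameter $\sigma$ $$a_h^{\mathbf p}(\mathbf p_h,\mathbf p_h)\ge C\,|||\mathbf p_h|||_{\mathbf p}^2\qquad\forall\,\mathbf p_h\in\mathbf S_h^m.$$ 3. (Existence and uniqueness.) For every $m\ge0$, every such subdivision $\mathcal T_h$, every $f\in L^2(\Omega)$ and every boundary datum $g$ that is in $H^1(e)$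 on each boundary face $e\in\mathcal E_h^b$, there is exactly one $\mathbf p_h\in\mathbf S_h^m$ with $$a_h^{\mathbf p}(\mathbf p_h,\mathbf q_h)=\sum_{K\in\mathcal T_h}\int_Kf\,(A:\nabla\mathbf q_h)\,dx+\sum_{e\in\mathcal E_h^b}\int_e\frac{\mu}{h_e}(\mathbf q_h\times\mathbf n)\cdot(\nabla g\times\mathbf n)\,ds\qquad\forall\,\mathbf q_h\in\mathbf S_h^m.$$ Moreover an element of $\mathbf S_h^m$ satisfies this equation if and only if it minimizes over $\mathbf S_h^m$ the functional $$J_h^{\mathbf p}(\mathbf q)=\sum_{K\in\mathcal T_h}\|A:\nabla\mathbf q-f\|_{L^2(K)}^2+\sum_{e\in\mathcal E_h^i}\frac{\mu}{h_e}\|[\![\mathbf q\otimes\mathbf n]\!]\|_{L^2(e)}^2+\sum_{e\in\mathcal E_h^b}\frac{\mu}{h_e}\|\mathbf q\times\mathbf n-\nabla g\times\mathbf n\|_{L^2(e)}^2.$$ -/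

import Mathlib

open MeasureTheory Filter Topology
open scoped ENNReal ContDiff

noncomputable section

namespace CordesLS

/-- The Euclidean space `ℝ^d`. -/
abbrev Pt (d : ℕ) := EuclideanSpace ℝ (Fin d)

/-- The space `L²(Ω)^d` (classes of vector fields modulo equality a.e. in `Ω`). -/
abbrev L2Vec {d : ℕ} (Ω : Set (Pt d)) := Lp (Pt d) 2 (volume.restrict Ω)

/-! ### Weak derivatives, `H¹` and traces -/

/-- The classical partial derivative `∂_j φ`. -/
def pd {d : ℕ} (j : Fin d) (φ : Pt d → ℝ) (x : Pt d) : ℝ :=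
  fderiv ℝ φ x (EuclideanSpace.single j 1)

/-- `w` is a square integrable weak `j`-th partial derivative of `v` on the open set `D`. -/
def IsWeakPd {d : ℕ} (D : Set (Pt d)) (j : Fin d) (v w : Pt d → ℝ) : Prop :=
  MemLp w 2 (volume.restrict D) ∧
    ∀ φ : Pt d → ℝ, ContDiff ℝ ∞ φ → HasCompactSupport φ → tsupport φ ⊆ D →
      ∫ x in D, v x * pd j φ x = -∫ x in D, w x * φ x

/-- `v ∈ H¹(D)`. -/
def MemH1 {d : ℕ} (D : Set (Pt d)) (v : Pt d → ℝ) : Prop :=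
  MemLp v 2 (volume.restrict D) ∧ ∀ j, ∃ w, IsWeakPd D j v w

open Classical in
/-- The weak partial derivative `∂_j v` on `D` (unique up to equality a.e. in `D`); it is set to
`0` if there is none. -/
def weakPd {d : ℕ} (D : Set (Pt d)) (j : Fin d) (v : Pt d → ℝ) : Pt d → ℝ :=
  if h : ∃ w, IsWeakPd D j v w then h.choose else 0

/-- The simplex with vertex set `s`, as a subset of `ℝ^d`. -/
def hull {d : ℕ} (s : Finset (Pt d)) : Set (Pt d) := convexHull ℝ (s : Set (Pt d))

/-- The open `d`-simplex with vertex set `K`. -/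
def cell {d : ℕ} (K : Finset (Pt d)) : Set (Pt d) := interior (hull K)

/-- The surface measure (length for `d = 2`, area for `d = 3`) on the `(d-1)`-simplex with vertex
set `e`. -/
def faceMeasure {d : ℕ} (e : Finset (Pt d)) : Measure (Pt d) :=
  (Measure.euclideanHausdorffMeasure (d - 1)).restrict (hull e)

/-- `g ∈ L²(e)` is the trace on the face `e` of the function `v ∈ H¹(D)`: the trace operator is the
continuous extension, from smooth functions to `H¹(D)`, of the restriction to `e`. -/
def IsTrace {d : ℕ} (D : Set (Pt d)) (e : Finset (Pt d)) (v g : Pt d → ℝ) : Prop :=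
  MemLp g 2 (faceMeasure e) ∧
    ∃ φ : ℕ → Pt d → ℝ, (∀ k, ContDiff ℝ ∞ (φ k)) ∧
      Tendsto (fun k => eLpNorm (v - φ k) 2 (volume.restrict D)) atTop (𝓝 0) ∧
      (∀ j, Tendsto (fun k => eLpNorm (weakPd D j v - pd j (φ k)) 2 (volume.restrict D))
        atTop (𝓝 0)) ∧
      Tendsto (fun k => eLpNorm (g - φ k) 2 (faceMeasure e)) atTop (𝓝 0)

open Classical in
/-- The trace of `v` on `e`. For `D` an open simplex, `e` one of its faces of codimension one and
`v ∈ H¹(D)` it exists and is unique up to equality a.e. on `e`; where there is none it is set to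
`0`. -/
def trace {d : ℕ} (D : Set (Pt d)) (e : Finset (Pt d)) (v : Pt d → ℝ) : Pt d → ℝ :=
  if h : ∃ g, IsTrace D e v g then h.choose else 0

/-! ### Simplicial subdivisions -/

/-- A conforming subdivision of `Ω` into finitely many `d`-simplices. -/
structure Mesh {d : ℕ} (Ω : Set (Pt d)) extends Geometry.SimplicialComplex ℝ (Pt d) where
  finite_faces : faces.Finite
  pure_dim : ∀ s ∈ faces, ∃ K ∈ faces, s ⊆ K ∧ K.card = d + 1
  space_eq : toSimplicialComplex.space = closure Ω

namespace Mesh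

variable {d : ℕ} {Ω : Set (Pt d)}

/-- The elements `K` of the subdivision (given by their vertex sets). -/
def cells (T : Mesh Ω) : Finset (Finset (Pt d)) :=
  {s ∈ T.finite_faces.toFinset | s.card = d + 1}

open Classical in
/-- The elements that have `e` as a face. -/
def cellsAt (T : Mesh Ω) (e : Finset (Pt d)) : Finset (Finset (Pt d)) :=
  {K ∈ T.cells | e ⊆ K}

open Classical in
/-- The interior faces: the `(d-1)`-dimensional faces shared by two elements. -/
def interiorFaces (T : Mesh Ω) : Finset (Finset (Pt d)) :=
  {e ∈ T.finite_faces.toFinset | e.card = d ∧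
    ∃ K₁ ∈ T.cellsAt e, ∃ K₂ ∈ T.cellsAt e, K₁ ≠ K₂}

open Classical in
/-- The boundary faces: the `(d-1)`-dimensional faces lying on `∂Ω`. -/
def boundaryFaces (T : Mesh Ω) : Finset (Finset (Pt d)) :=
  {e ∈ T.finite_faces.toFinset | e.card = d ∧ hull e ⊆ frontier Ω}

/-- Shape regularity with parameter `σ`: the diameter `h_K` of every element is at most `σ` times
the diameter `2r` of a ball contained in it. -/
def ShapeRegular (T : Mesh Ω) (σ : ℝ) : Prop :=
  ∀ K ∈ T.cells, ∃ (x : Pt d) (r : ℝ), 0 < r ∧ Metric.closedBall x r ⊆ hull K ∧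
    Metric.diam (hull K) ≤ σ * (2 * r)

end Mesh

/-- The diameter `h_e` of the face `e`. -/
def hFace {d : ℕ} (e : Finset (Pt d)) : ℝ := Metric.diam (hull e)

/-- `n` is the unit normal of the face `e` of the simplex `K` that points out of `K`. -/
def IsOutwardNormal {d : ℕ} (K e : Finset (Pt d)) (n : Pt d) : Prop :=
  ‖n‖ = 1 ∧ (∀ x ∈ e, ∀ y ∈ e, inner ℝ n (y - x) = 0) ∧
    ∀ x ∈ e, ∀ y ∈ K, y ∉ e → inner ℝ n (y - x) < 0

open Classical in
/-- The unit outward normal of the face `e` of the `d`-simplex `K`. -/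
def outwardNormal {d : ℕ} (K e : Finset (Pt d)) : Pt d :=
  if h : ∃ n, IsOutwardNormal K e n then h.choose else 0

/-! ### Products -/

/-- The components `v_i n_j - v_j n_i` of the cross product `v × n`; those with `i < j` are, up to
sign and order, the components of the usual cross product (one of them if `d = 2`, three if
`d = 3`). -/
def cross {d : ℕ} (v n : Fin d → ℝ) (i j : Fin d) : ℝ := v i * n j - v j * n i

/-- The inner product of two cross products: the sum runs over the components with `i < j`. -/
def crossDot {d : ℕ} (X Y : Fin d → Fin d → ℝ) : ℝ := ∑ i, ∑ j ∈ Finset.Ioi i, X i j * Y i j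

/-- The Frobenius inner product `X : Y`. -/
def frob {d : ℕ} (X Y : Fin d → Fin d → ℝ) : ℝ := ∑ i, ∑ j, X i j * Y i j

/-! ### Broken spaces -/

/-- The gradient `(∇q)_{ij} = ∂_j q_i` on the element `K`. -/
def grad {d : ℕ} (K : Finset (Pt d)) (q : Pt d → Pt d) (x : Pt d) (i j : Fin d) : ℝ :=
  weakPd (cell K) j (fun y => q y i) x

/-- The trace on the face `e` of the restriction `q|_K`. -/
def vtrace {d : ℕ} (K e : Finset (Pt d)) (q : Pt d → Pt d) (x : Pt d) (i : Fin d) : ℝ :=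
  trace (cell K) e (fun y => q y i) x

/-- The broken Sobolev space `H¹(T)^d`. -/
def brokenH1 {d : ℕ} {Ω : Set (Pt d)} (T : Mesh Ω) : Set (L2Vec Ω) :=
  {q | ∀ K ∈ T.cells, ∀ i, MemH1 (cell K) (fun x => q x i)}

/-- The space of piecewise irrotational polynomial vector fields of degree at most `m`. -/
def irrotSpace {d : ℕ} {Ω : Set (Pt d)} (T : Mesh Ω) (m : ℕ) : Set (L2Vec Ω) :=
  {q | ∀ K ∈ T.cells, ∃ P : Fin d → MvPolynomial (Fin d) ℝ,
    (∀ i, (P i).totalDegree ≤ m) ∧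
    (∀ i j, MvPolynomial.pderiv i (P j) = MvPolynomial.pderiv j (P i)) ∧
    ∀ᵐ x ∂volume.restrict (cell K), ∀ i, q x i = MvPolynomial.eval (fun k => x k) (P i)}

/-- The jump `⟦q ⊗ n⟧ = q⁺ ⊗ n⁺ + q⁻ ⊗ n⁻` on an interior face `e` (the sum over the two elements
that share `e`). -/
def jump {d : ℕ} {Ω : Set (Pt d)} (T : Mesh Ω) (e : Finset (Pt d)) (q : Pt d → Pt d)
    (x : Pt d) (i j : Fin d) : ℝ :=
  ∑ K ∈ T.cellsAt e, vtrace K e q x i * outwardNormal K e j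

/-- The tangential trace `q × n` on a boundary face `e` (the sum has a single term, for the element
that has `e` as a face). -/
def tang {d : ℕ} {Ω : Set (Pt d)} (T : Mesh Ω) (e : Finset (Pt d)) (q : Pt d → Pt d)
    (x : Pt d) (i j : Fin d) : ℝ :=
  ∑ K ∈ T.cellsAt e, cross (vtrace K e q x) (outwardNormal K e) i j

/-! ### Boundary data -/

/-- `t = ∇g × n ∈ L²(e)` for a function `g ∈ H¹(e)` on the face `e` with unit normal `n`: the limit
of `∇φ_k × n` for smooth functions `φ_k` that converge to `g` in `L²(e)`. -/
def IsTangGrad {d : ℕ} (e : Finset (Pt d)) (n : Pt d) (g : Pt d → ℝ)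
    (t : Pt d → Fin d → Fin d → ℝ) : Prop :=
  (∀ i j, MemLp (fun x => t x i j) 2 (faceMeasure e)) ∧
    ∃ φ : ℕ → Pt d → ℝ, (∀ k, ContDiff ℝ ∞ (φ k)) ∧
      Tendsto (fun k => eLpNorm (g - φ k) 2 (faceMeasure e)) atTop (𝓝 0) ∧
      ∀ i j, Tendsto (fun k => eLpNorm
        (fun x => t x i j - cross (fun l => pd l (φ k) x) n i j) 2 (faceMeasure e)) atTop (𝓝 0)

open Classical in
/-- The tangential gradient `∇g × n` on the face `e`, set to `0` if there is none. -/
def tangGrad {d : ℕ} (e : Finset (Pt d)) (n : Pt d) (g : Pt d → ℝ) :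
    Pt d → Fin d → Fin d → ℝ :=
  if h : ∃ t, IsTangGrad e n g t then h.choose else 0

/-- `g` is of class `H¹` on every boundary face. -/
def BoundaryH1 {d : ℕ} {Ω : Set (Pt d)} (T : Mesh Ω) (g : Pt d → ℝ) : Prop :=
  ∀ e ∈ T.boundaryFaces, MemLp g 2 (faceMeasure e) ∧
    ∀ K ∈ T.cellsAt e, ∃ t, IsTangGrad e (outwardNormal K e) g t

/-- The tangential gradient `∇g × n` of the boundary datum on the boundary face `e`. -/
def dataTang {d : ℕ} {Ω : Set (Pt d)} (T : Mesh Ω) (e : Finset (Pt d)) (g : Pt d → ℝ)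
    (x : Pt d) (i j : Fin d) : ℝ :=
  ∑ K ∈ T.cellsAt e, tangGrad e (outwardNormal K e) g x i j

/-! ### The coefficient -/

/-- `A ∈ L^∞(Ω)^{d × d}`. -/
def EssBounded {d : ℕ} (Ω : Set (Pt d)) (A : Pt d → Matrix (Fin d) (Fin d) ℝ) : Prop :=
  ∀ i j, MemLp (fun x => A x i j) ∞ (volume.restrict Ω)

/-- `A` is uniformly elliptic in `Ω`. -/
def UniformlyElliptic {d : ℕ} (Ω : Set (Pt d)) (A : Pt d → Matrix (Fin d) (Fin d) ℝ) : Prop :=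
  ∃ ν₁ ν₂ : ℝ, 0 < ν₁ ∧ 0 < ν₂ ∧ ∀ᵐ x ∂volume.restrict Ω, ∀ ξ : Fin d → ℝ,
    ν₁ * (ξ ⬝ᵥ ξ) ≤ ξ ⬝ᵥ (A x).mulVec ξ ∧ ξ ⬝ᵥ (A x).mulVec ξ ≤ ν₂ * (ξ ⬝ᵥ ξ)

/-- The Cordes condition. -/
def Cordes {d : ℕ} (Ω : Set (Pt d)) (A : Pt d → Matrix (Fin d) (Fin d) ℝ) : Prop :=
  ∃ ε : ℝ, 0 < ε ∧ ε ≤ 1 ∧ ∀ᵐ x ∂volume.restrict Ω,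
    frob (A x) (A x) / (A x).trace ^ 2 ≤ 1 / ((d : ℝ) - 1 + ε)

/-! ### The least squares method -/

/-- The bilinear form `a_h(p, q)`. -/
def bilin {d : ℕ} {Ω : Set (Pt d)} (T : Mesh Ω) (A : Pt d → Matrix (Fin d) (Fin d) ℝ) (μ : ℝ)
    (p q : Pt d → Pt d) : ℝ :=
  (∑ K ∈ T.cells, ∫ x in cell K, frob (A x) (grad K p x) * frob (A x) (grad K q x)) +
  (∑ e ∈ T.interiorFaces,
    ∫ x, μ / hFace e * frob (jump T e p x) (jump T e q x) ∂faceMeasure e) +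
  ∑ e ∈ T.boundaryFaces,
    ∫ x, μ / hFace e * crossDot (tang T e p x) (tang T e q x) ∂faceMeasure e

/-- The linear form `l_h(q)`. -/
def linForm {d : ℕ} {Ω : Set (Pt d)} (T : Mesh Ω) (A : Pt d → Matrix (Fin d) (Fin d) ℝ) (μ : ℝ)
    (f g : Pt d → ℝ) (q : Pt d → Pt d) : ℝ :=
  (∑ K ∈ T.cells, ∫ x in cell K, f x * frob (A x) (grad K q x)) +
  ∑ e ∈ T.boundaryFaces,
    ∫ x, μ / hFace e * crossDot (tang T e q x) (dataTang T e g x) ∂faceMeasure e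

/-- The least squares functional `J_h(q)`. -/
def lsFunctional {d : ℕ} {Ω : Set (Pt d)} (T : Mesh Ω) (A : Pt d → Matrix (Fin d) (Fin d) ℝ)
    (μ : ℝ) (f g : Pt d → ℝ) (q : Pt d → Pt d) : ℝ :=
  (∑ K ∈ T.cells, ∫ x in cell K, (frob (A x) (grad K q x) - f x) ^ 2) +
  (∑ e ∈ T.interiorFaces,
    μ / hFace e * ∫ x, frob (jump T e q x) (jump T e q x) ∂faceMeasure e) +
  ∑ e ∈ T.boundaryFaces,
    μ / hFace e * ∫ x, crossDot (tang T e q x - dataTang T e g x)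
      (tang T e q x - dataTang T e g x) ∂faceMeasure e

/-- The DG energy norm `|||q|||_p`. -/
def energyNorm {d : ℕ} {Ω : Set (Pt d)} (T : Mesh Ω) (q : Pt d → Pt d) : ℝ :=
  Real.sqrt ((∑ K ∈ T.cells, ∫ x in cell K, frob (grad K q x) (grad K q x)) +
    (∑ e ∈ T.interiorFaces,
      1 / hFace e * ∫ x, frob (jump T e q x) (jump T e q x) ∂faceMeasure e) +
    ∑ e ∈ T.boundaryFaces,
      1 / hFace e * ∫ x, crossDot (tang T e q x) (tang T e q x) ∂faceMeasure e)

/-- `p` is a discrete gradient: it lies in the space of piecewise irrotational polynomials and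
satisfies the variational equation there. -/
def IsDiscreteGradient {d : ℕ} {Ω : Set (Pt d)} (T : Mesh Ω)
    (A : Pt d → Matrix (Fin d) (Fin d) ℝ) (μ : ℝ) (m : ℕ) (f g : Pt d → ℝ) (p : L2Vec Ω) : Prop :=
  p ∈ irrotSpace T m ∧ ∀ q ∈ irrotSpace T m, bilin T A μ p q = linForm T A μ f g q

end CordesLS

end

/-! Boundedness is the Cauchy-Schwarz inequality. The form is a sum of weighted L² pairings of
scalar residuals, so |a(p,q)|² ≤ a(p,p) a(q,q), and a(q,q) is at most a multiple of the squared
energy norm because A is essentially bounded (`Mesh.exists_abs_bilin_le`).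

Coercivity (`Mesh.exists_coercive`) has two sources. By the Cordes condition a multiple γA is close
to the identity, whence (div q)² ≤ C (A:∇q)² + (1 - ε/2)|∇q|² (`sq_trace_le_of_cordes`). By a
discrete Miranda-Talenti estimate (`Mesh.exists_miranda_le`) the broken integral of |∇q|² exceeds
that of (div q)² by at most η times itself plus C(η) times the jump part of the energy. With η = ε/4
the gradient is absorbed.

That estimate comes from an exact identity (`Mesh.sum_miranda`), without a conforming comparison
function. For a curl-free field |∇q|² - (div q)² is a divergence, so its integral over an element is
a sum over faces of forms F(q,q) that contain only tangential derivatives (`faceForm`). Let m be the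
average of the two traces on an interior face and the normal part of the trace on a boundary face.
Then F(q,q) = F(q-m, q+m) + F(m,m) + (F(m,q) - F(q,m)). The terms F(m,m) cancel between the two
elements or vanish on the boundary. The last difference is, by integration by parts in the face, a
sum over ridges (codimension two) of forms R(m,q), antisymmetric under exchange of the arguments
(`ridgeForm`). If c is a value on the ridge that is normal to every boundary face through it, R(m,q)
may be replaced by R(m-c, q-c): R(c,c) = 0, R(c,q) cancels between the two faces of one element at
the ridge, and R(m,c) cancels across interior faces and vanishes on boundary faces.

Now F(q-m, q+m) is bounded by Young's inequality and an inverse trace inequality, and R(m-c, q-c) is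
quadratic in the jumps once c is well chosen (`Mesh.exists_ridge_value`). The elements around a
ridge are connected through common faces because Ω is convex (`Mesh.starGraph_preconnected`), and
their number is bounded by shape regularity. Away from the boundary c may be the value of any of
them, at a flat part of the boundary its normal part, and at a true edge c = 0, because two distinct
boundary normals there are uniformly independent: all subdivisions of the polytope Ω together have
finitely many boundary normals (`Mesh.finite_normals`).

Constants are uniform since integrals are normalized to a reference simplex. The geometry sits in
the factors `simConst` and in the gradients ∇λ of the barycentric coordinates, with 1 ≤ ‖∇λ‖ h_K ≤
σ.

Existence and uniqueness: the discrete space is finite-dimensional and the form is definite on it,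
since a discrete field of energy zero is constant on elements, has no jumps and is normal on the
boundary, hence vanishes by Gauss' theorem for x|u|² - (x·u)u (`Mesh.fieldAt_eq_zero`). Minimality
is read off from the quadratic expansion of the functional. -/

noncomputable section

namespace CordesLS

/-! ### Integrals over simplices -/

/-- The corner simplex `{t ≥ 0, ∑ t ≤ 1}` in `ℝ^k`. -/
def stdSim (k : ℕ) : Set (Fin k → ℝ) := {t | (∀ i, 0 ≤ t i) ∧ ∑ i, t i ≤ 1}

/-- The affine parametrization of the simplex with vertices `b, r 0, r 1, …`. -/
def simMap {d k : ℕ} (b : Pt d) (r : Fin k → Pt d) (t : Fin k → ℝ) : Pt d :=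
  b + ∑ i, t i • (r i - b)

theorem convex_stdSim (k : ℕ) : Convex ℝ (stdSim k) := by
  intro x hx y hy a b ha hb hab
  refine ⟨fun i => ?_, ?_⟩
  · have := hx.1 i
    have := hy.1 i
    simp only [Pi.add_apply, Pi.smul_apply, smul_eq_mul]
    positivity
  · simp only [Pi.add_apply, Pi.smul_apply, smul_eq_mul, Finset.sum_add_distrib,
      ← Finset.mul_sum]
    nlinarith [hx.2, hy.2]

theorem isClosed_stdSim (k : ℕ) : IsClosed (stdSim k) := by
  have : stdSim k = {t | ∀ i, 0 ≤ t i} ∩ {t | ∑ i, t i ≤ 1} := rfl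
  rw [this]
  refine IsClosed.inter ?_ (isClosed_le (by fun_prop) continuous_const)
  simp only [Set.ofPred_forall]
  exact isClosed_iInter fun i => isClosed_le continuous_const (continuous_apply i)

theorem stdSim_subset_Icc (k : ℕ) : stdSim k ⊆ Set.Icc 0 1 := by
  intro t ht
  refine ⟨ht.1, fun i => ?_⟩
  exact (Finset.single_le_sum (fun j _ => ht.1 j) (Finset.mem_univ i)).trans ht.2

theorem isCompact_stdSim (k : ℕ) : IsCompact (stdSim k) :=
  isCompact_Icc.of_isClosed_subset (isClosed_stdSim k) (stdSim_subset_Icc k)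

theorem zero_mem_stdSim (k : ℕ) : (0 : Fin k → ℝ) ∈ stdSim k := by
  simp [stdSim]

theorem single_mem_stdSim {k : ℕ} (i : Fin k) : (Pi.single i 1 : Fin k → ℝ) ∈ stdSim k := by
  refine ⟨fun j => ?_, by simp⟩
  by_cases h : j = i
  · subst h; simp
  · simp [h]

theorem interior_stdSim_nonempty (k : ℕ) : (interior (stdSim k)).Nonempty := by
  have hsub : {t : Fin k → ℝ | (∀ i, 0 < t i) ∧ ∑ i, t i < 1} ⊆ interior (stdSim k) := by
    apply interior_maximal
    · exact fun t ht => ⟨fun i => (ht.1 i).le, ht.2.le⟩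
    · have : {t : Fin k → ℝ | (∀ i, 0 < t i) ∧ ∑ i, t i < 1} =
          {t | ∀ i, 0 < t i} ∩ {t | ∑ i, t i < 1} := rfl
      rw [this]
      refine IsOpen.inter ?_ (isOpen_lt (by fun_prop) continuous_const)
      simp only [Set.ofPred_forall]
      exact isOpen_iInter_of_finite fun i => isOpen_lt continuous_const (continuous_apply i)
  refine ⟨fun _ => 1 / (k + 1), hsub ⟨fun i => by positivity, ?_⟩⟩
  simp only [Finset.sum_const, Finset.card_univ, Fintype.card_fin, nsmul_eq_mul]
  rw [mul_one_div, div_lt_one (by positivity)]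
  linarith

/-- The volume of the corner simplex. -/
def simVol (k : ℕ) : ℝ := (volume (stdSim k)).toReal

theorem volume_stdSim_ne_top (k : ℕ) : volume (stdSim k) ≠ ⊤ :=
  (isCompact_stdSim k).measure_lt_top.ne

theorem volume_stdSim_ne_zero (k : ℕ) : volume (stdSim k) ≠ 0 := by
  have h : 0 < volume (interior (stdSim k)) :=
    isOpen_interior.measure_pos _ (interior_stdSim_nonempty k)
  exact (h.trans_le (measure_mono interior_subset)).ne'

theorem simVol_pos (k : ℕ) : 0 < simVol k :=
  ENNReal.toReal_pos (volume_stdSim_ne_zero k) (volume_stdSim_ne_top k)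

theorem continuous_simMap {d k : ℕ} (b : Pt d) (r : Fin k → Pt d) : Continuous (simMap b r) := by
  unfold simMap; fun_prop

theorem simMap_image {d k : ℕ} (b : Pt d) (r : Fin k → Pt d) :
    simMap b r '' stdSim k = convexHull ℝ (Set.insert b (Set.range r)) := by
  apply Set.Subset.antisymm
  · rintro _ ⟨t, ht, rfl⟩
    have hb : b ∈ convexHull ℝ (Set.insert b (Set.range r)) :=
      subset_convexHull ℝ _ (Set.mem_insert _ _)
    have hr : ∀ i, r i ∈ convexHull ℝ (Set.insert b (Set.range r)) := fun i =>
      subset_convexHull ℝ _ (Set.mem_insert_of_mem _ ⟨i, rfl⟩)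
    have key := (convex_convexHull ℝ (Set.insert b (Set.range r))).sum_mem
      (t := Finset.univ) (w := (Fin.cons (1 - ∑ i, t i) t : Fin (k + 1) → ℝ))
      (z := (Fin.cons b r : Fin (k + 1) → Pt d)) ?_ ?_ ?_
    · convert! key using 1
      simp only [simMap, Fin.sum_univ_succ, Fin.cons_zero, Fin.cons_succ, sub_smul, one_smul,
        smul_sub, Finset.sum_sub_distrib, ← Finset.sum_smul]
      abel
    · intro i _
      refine Fin.cases ?_ (fun j => ?_) i
      · simpa using ht.2
      · simpa using ht.1 j
    · simp [Fin.sum_univ_succ]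
    · intro i _
      refine Fin.cases ?_ (fun j => ?_) i
      · simpa using hb
      · simpa using hr j
  · apply convexHull_min
    · rintro x (rfl | ⟨i, rfl⟩)
      · exact ⟨0, zero_mem_stdSim k, by simp [simMap]⟩
      · refine ⟨Pi.single i 1, single_mem_stdSim i, ?_⟩
        simp [simMap, Pi.single_apply, ite_smul]
    · have : simMap b r = fun t => b + (∑ i, (LinearMap.proj i : (Fin k → ℝ) →ₗ[ℝ] ℝ).smulRight
          (r i - b)) t := by
        ext t; simp [simMap]
      rw [this]
      have h1 := ((convex_stdSim k).linear_image (∑ i, (LinearMap.proj i : (Fin k → ℝ) →ₗ[ℝ]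
        ℝ).smulRight (r i - b))).translate b
      rwa [Set.image_image] at h1

/-- `b, r 0, r 1, …` enumerates the affinely independent set `s`. -/
structure IsEnum {d k : ℕ} (s : Finset (Pt d)) (b : Pt d) (r : Fin k → Pt d) : Prop where
  coe_eq : (s : Set (Pt d)) = Set.insert b (Set.range r)
  card_eq : s.card = k + 1
  linInd : LinearIndependent ℝ (fun i => r i - b)

theorem IsEnum.hull_eq {d k : ℕ} {s : Finset (Pt d)} {b : Pt d} {r : Fin k → Pt d}
    (h : IsEnum s b r) : hull s = simMap b r '' stdSim k := by
  rw [simMap_image, hull, h.coe_eq]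

/-- The linear part of `simMap`. -/
def simLin {d k : ℕ} (b : Pt d) (r : Fin k → Pt d) : (Fin k → ℝ) →ₗ[ℝ] Pt d :=
  Fintype.linearCombination ℝ (fun i => r i - b)

theorem simMap_eq {d k : ℕ} (b : Pt d) (r : Fin k → Pt d) (t : Fin k → ℝ) :
    simMap b r t = b + simLin b r t := by
  simp [simMap, simLin, Fintype.linearCombination_apply]

theorem IsEnum.injective {d k : ℕ} {s : Finset (Pt d)} {b : Pt d} {r : Fin k → Pt d}
    (h : IsEnum s b r) : Function.Injective (simLin b r) :=
  (linearIndependent_iff_injective_fintypeLinearCombination).1 h.linInd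

theorem injective_simMap {d k : ℕ} {s : Finset (Pt d)} {b : Pt d} {r : Fin k → Pt d}
    (h : IsEnum s b r) : Function.Injective (simMap b r) := by
  intro x y hxy
  rw [simMap_eq, simMap_eq] at hxy
  exact h.injective (add_left_cancel hxy)

theorem measurableEmbedding_simMap {d k : ℕ} {s : Finset (Pt d)} {b : Pt d} {r : Fin k → Pt d}
    (h : IsEnum s b r) : MeasurableEmbedding (simMap b r) :=
  (continuous_simMap b r).measurableEmbedding (injective_simMap h)

/-- The pushforward of Lebesgue measure under an injective linear map is a multiple of the
Hausdorff measure on the range. -/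
theorem exists_smul_map_volume {d k : ℕ} (f : (Fin k → ℝ) →ₗ[ℝ] Pt d)
    (hf : Function.Injective f) :
    ∃ c : ℝ≥0∞, c ≠ 0 ∧ c ≠ ⊤ ∧
      (Measure.euclideanHausdorffMeasure k : Measure (Pt d)).restrict (Set.range f) =
        c • (volume : Measure (Fin k → ℝ)).map f := by
  have hfin : Module.finrank ℝ (LinearMap.range f) = k := by
    rw [LinearMap.finrank_range_of_inj hf]; simp
  -- An orthonormal basis of the range factors `f` as `ψ ∘ M`, with `ψ` an isometric embedding and
  -- `M` invertible. The first turns Lebesgue into Hausdorff measure, the second Lebesgue into some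
  -- Haar measure, which is unique up to a factor.
  let e : LinearMap.range f ≃ₗᵢ[ℝ] EuclideanSpace ℝ (Fin k) :=
    ((stdOrthonormalBasis ℝ (LinearMap.range f)).reindex (finCongr hfin)).repr
  let ψ : EuclideanSpace ℝ (Fin k) →ₗᵢ[ℝ] Pt d :=
    (LinearMap.range f).subtypeₗᵢ.comp e.symm.toLinearIsometry
  let M : (Fin k → ℝ) ≃ₗ[ℝ] EuclideanSpace ℝ (Fin k) :=
    (LinearEquiv.ofInjective f hf).trans e.toLinearEquiv
  have hψM : ∀ x, ψ (M x) = f x := by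
    intro x
    simp [ψ, M]
  have hrange : Set.range ψ = Set.range f := by
    have : (f : (Fin k → ℝ) → Pt d) = ψ ∘ M := funext fun x => (hψM x).symm
    rw [this, Set.range_comp, M.surjective.range_eq, Set.image_univ]
  let M' : (Fin k → ℝ) ≃L[ℝ] EuclideanSpace ℝ (Fin k) := M.toContinuousLinearEquiv
  have hhaar : ((volume : Measure (Fin k → ℝ)).map M').IsAddHaarMeasure :=
    M'.isAddHaarMeasure_map _
  have hsm := Measure.isAddLeftInvariant_eq_smul (volume : Measure (EuclideanSpace ℝ (Fin k)))
    ((volume : Measure (Fin k → ℝ)).map M')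
  set c := Measure.addHaarScalarFactor (volume : Measure (EuclideanSpace ℝ (Fin k)))
    ((volume : Measure (Fin k → ℝ)).map M') with hc
  have hc0 : c ≠ 0 := (Measure.addHaarScalarFactor_pos_of_isAddHaarMeasure _ _).ne'
  refine ⟨c, by simpa using hc0, ENNReal.coe_ne_top, ?_⟩
  have h1 := ψ.isometry.map_euclideanHausdorffMeasure (d := k)
  rw [EuclideanSpace.euclideanHausdorffMeasure_eq_volume, hrange] at h1
  rw [← h1, hsm, Measure.map_smul, Measure.map_map ψ.continuous.measurable M'.continuous.measurable]
  have : (ψ ∘ M' : (Fin k → ℝ) → Pt d) = f := funext fun x => hψM x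
  rw [this]
  rfl

/-- The `(card s - 1)`-dimensional measure on the simplex with vertex set `s`. -/
def simMeasure {d : ℕ} (s : Finset (Pt d)) : Measure (Pt d) :=
  (Measure.euclideanHausdorffMeasure (s.card - 1)).restrict (hull s)

/-- The ratio of the measure of the simplex to the volume of the corner simplex. -/
def simConst {d : ℕ} (s : Finset (Pt d)) : ℝ :=
  (simMeasure s Set.univ).toReal / simVol (s.card - 1)

/-- The normalized integral over the simplex with vertex set `s`. -/
def simInt {d : ℕ} (s : Finset (Pt d)) (f : Pt d → ℝ) : ℝ :=
  (simConst s)⁻¹ * ∫ x, f x ∂simMeasure s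

/-- The unspecified factor of `exists_smul_map_volume` is identified by comparing the total masses
of the two measures. -/
theorem IsEnum.simMeasure_eq {d k : ℕ} {s : Finset (Pt d)} {b : Pt d} {r : Fin k → Pt d}
    (h : IsEnum s b r) :
    0 < simConst s ∧ simMeasure s =
      ENNReal.ofReal (simConst s) • (volume.restrict (stdSim k)).map (simMap b r) := by
  obtain ⟨c, hc0, hct, hc⟩ := exists_smul_map_volume (simLin b r) h.injective
  have hk : s.card - 1 = k := by rw [h.card_eq]; rfl
  have hme := measurableEmbedding_simMap h
  have hcomp : simMap b r = (fun x => b + x) ∘ simLin b r := funext fun t => simMap_eq b r t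
  have htr : Isometry (fun x : Pt d => b + x) := isometry_add_left b
  have hfull : (Measure.euclideanHausdorffMeasure k : Measure (Pt d)).restrict
      (Set.range (simMap b r)) = c • (volume : Measure (Fin k → ℝ)).map (simMap b r) := by
    have hlm : Measurable (simLin b r) := (simLin b r).continuous_of_finiteDimensional.measurable
    rw [hcomp, ← Measure.map_map (by fun_prop) hlm, ← Measure.map_smul, ← hc, Set.range_comp]
    have hmp := (IsometryEquiv.addLeft b).measurePreserving_euclideanHausdorffMeasure k
    have := hmp.restrict_image_emb (IsometryEquiv.addLeft b).toHomeomorph.measurableEmbedding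
      (Set.range (simLin b r))
    exact this.map_eq.symm
  have hms : MeasurableSet (stdSim k) := (isClosed_stdSim k).measurableSet
  have key : simMeasure s = c • (volume.restrict (stdSim k)).map (simMap b r) := by
    have hhm : MeasurableSet (hull s) := by
      rw [h.hull_eq]; exact hme.measurableSet_image.2 hms
    rw [simMeasure, hk]
    have hsub : hull s ⊆ Set.range (simMap b r) := by
      rw [h.hull_eq]; exact Set.image_subset_range _ _
    rw [← Set.inter_eq_self_of_subset_left hsub, ← Measure.restrict_restrict hhm, hfull,
      Measure.restrict_smul, hme.restrict_map, h.hull_eq,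
      Set.preimage_image_eq _ (injective_simMap h)]
  have hconst : simConst s = c.toReal := by
    rw [simConst, key, hk, Measure.smul_apply, hme.map_apply]
    simp only [Set.preimage_univ, Measure.restrict_apply MeasurableSet.univ, Set.univ_inter,
      smul_eq_mul, ENNReal.toReal_mul]
    rw [← simVol, mul_div_cancel_right₀ _ (simVol_pos k).ne']
  rw [hconst, ENNReal.ofReal_toReal hct]
  exact ⟨ENNReal.toReal_pos hc0 hct, key⟩

/-- The point of the normalization: after pull-back the integral no longer sees the shape of the
simplex, so an estimate on the corner simplex holds with one constant for all simplices of that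
dimension. -/
theorem IsEnum.simInt_eq {d k : ℕ} {s : Finset (Pt d)} {b : Pt d} {r : Fin k → Pt d}
    (h : IsEnum s b r) (f : Pt d → ℝ) :
    simInt s f = ∫ t in stdSim k, f (simMap b r t) := by
  obtain ⟨h0, h1⟩ := h.simMeasure_eq
  rw [simInt, h1, integral_smul_measure, (measurableEmbedding_simMap h).integral_map,
    ENNReal.toReal_ofReal h0.le, smul_eq_mul, inv_mul_cancel_left₀ h0.ne']

end CordesLS

/-! ### Enumerations of vertices, slicing, and Stokes' theorem along an edge -/

namespace CordesLS
open scoped Classical in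
section

/-- Counting suffices: with k + 1 points in all, `b` cannot be among the `r i` and `r` cannot repeat
a value. -/
theorem isEnum_of {d k : ℕ} {s : Finset (Pt d)} {b : Pt d} {r : Fin k → Pt d}
    (hs : AffineIndependent ℝ ((↑) : s → Pt d))
    (h : (s : Set (Pt d)) = Set.insert b (Set.range r)) (hc : s.card = k + 1) : IsEnum s b r := by
  refine ⟨h, hc, ?_⟩
  have hb : b ∈ s := by rw [← Finset.mem_coe, h]; exact Set.mem_insert _ _
  have hr : ∀ i, r i ∈ s := fun i => by
    rw [← Finset.mem_coe, h]; exact Set.mem_insert_of_mem _ ⟨i, rfl⟩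
  have him : s = insert b (Finset.univ.image r) := by
    apply Finset.coe_injective
    rw [h]
    simp only [Finset.coe_insert, Finset.coe_image, Finset.coe_univ, Set.image_univ]
    rfl
  have hbr : b ∉ Finset.univ.image r := by
    intro hmem
    rw [Finset.insert_eq_of_mem hmem] at him
    have := Finset.card_image_le (s := Finset.univ) (f := r)
    rw [← him, hc] at this
    simp at this
  have hinj : Function.Injective r := by
    have h2 : (Finset.univ.image r).card = (Finset.univ : Finset (Fin k)).card := by
      have := congrArg Finset.card him
      rw [Finset.card_insert_of_notMem hbr, hc] at this
      simpa using this.symm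
    simpa using Finset.card_image_iff.1 h2
  have h3 := (affineIndependent_iff_linearIndependent_vsub ℝ _ (⟨b, hb⟩ : s)).1 hs
  have hne : ∀ i, (⟨r i, hr i⟩ : s) ≠ ⟨b, hb⟩ := fun i hi => by
    simp only [Subtype.mk.injEq] at hi
    exact hbr (Finset.mem_image.2 ⟨i, Finset.mem_univ _, hi⟩)
  exact h3.comp (fun i => ⟨⟨r i, hr i⟩, hne i⟩) fun i j hij => by
    simp only [Subtype.mk.injEq] at hij
    exact hinj hij

theorem AffineIndependent.subset {d : ℕ} {s t : Finset (Pt d)}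
    (hs : AffineIndependent ℝ ((↑) : s → Pt d)) (h : t ⊆ s) :
    AffineIndependent ℝ ((↑) : t → Pt d) :=
  AffineIndependent.mono (k := ℝ) (s := (t : Set (Pt d))) (t := (s : Set (Pt d))) hs
    (Finset.coe_subset.2 h)

theorem exists_range_eq {α : Type*} {k : ℕ} (s : Finset α) (h : s.card = k) :
    ∃ r : Fin k → α, Set.range r = s :=
  ⟨fun i => (s.equivFinOfCardEq h).symm i, by
    ext x
    simp only [Set.mem_range, Finset.mem_coe]
    constructor
    · rintro ⟨i, rfl⟩
      exact Subtype.coe_prop _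
    · intro hx
      exact ⟨s.equivFinOfCardEq h ⟨x, hx⟩, by simp⟩⟩

theorem exists_isEnum {d k : ℕ} {s : Finset (Pt d)} {b : Pt d}
    (hs : AffineIndependent ℝ ((↑) : s → Pt d)) (hc : s.card = k + 1) (hb : b ∈ s) :
    ∃ r : Fin k → Pt d, IsEnum s b r := by
  obtain ⟨r, hr⟩ := exists_range_eq (k := k) (s.erase b) (by
    rw [Finset.card_erase_of_mem hb, hc]; rfl)
  refine ⟨r, isEnum_of hs ?_ hc⟩
  rw [hr, Finset.coe_erase]
  exact (Set.insert_sdiff_self_of_mem (Finset.mem_coe.2 hb)).symm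

/-- One list of the remaining vertices parametrizes the simplex and its faces opposite `a` and `b`
compatibly, as Stokes' theorem along the edge from `b` to `a` requires. -/
theorem exists_isEnum_cons {d k : ℕ} {s : Finset (Pt d)} {a b : Pt d}
    (hs : AffineIndependent ℝ ((↑) : s → Pt d)) (hc : s.card = k + 2) (ha : a ∈ s) (hb : b ∈ s)
    (hab : a ≠ b) :
    ∃ r : Fin k → Pt d, IsEnum s b (Fin.cons a r : Fin (k + 1) → Pt d) ∧
      IsEnum (s.erase a) b r ∧ IsEnum (s.erase b) a r := by
  obtain ⟨r, hr⟩ := exists_range_eq (k := k) ((s.erase a).erase b) (by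
    rw [Finset.card_erase_of_mem (by simp [hb, hab.symm]), Finset.card_erase_of_mem ha, hc]; rfl)
  refine ⟨r, isEnum_of hs ?_ hc, isEnum_of (AffineIndependent.subset hs (Finset.erase_subset _ _)) ?_ ?_,
    isEnum_of (AffineIndependent.subset hs (Finset.erase_subset _ _)) ?_ ?_⟩
  · rw [Fin.range_cons, hr]
    ext x
    simp only [Finset.mem_coe, Finset.coe_erase, Set.insert, Set.mem_ofPred_eq, Set.mem_sdiff,
      Set.mem_singleton_iff]
    by_cases h1 : x = b
    · simp [h1, hb]
    · by_cases h2 : x = a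
      · simp [h2, ha]
      · simp [h1, h2]
  · rw [hr]
    ext x
    simp only [Finset.mem_coe, Finset.coe_erase, Set.insert, Set.mem_ofPred_eq, Set.mem_sdiff,
      Set.mem_singleton_iff]
    by_cases h1 : x = b
    · simp [h1, hb, hab.symm]
    · simp [h1]
  · rw [Finset.card_erase_of_mem ha, hc]; rfl
  · rw [hr]
    ext x
    simp only [Finset.mem_coe, Finset.coe_erase, Set.insert, Set.mem_ofPred_eq, Set.mem_sdiff,
      Set.mem_singleton_iff]
    by_cases h1 : x = a
    · simp [h1, ha, hab]
    · simp [h1]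
  · rw [Finset.card_erase_of_mem hb, hc]; rfl

theorem cons_mem_stdSim {k : ℕ} (s : ℝ) (t : Fin k → ℝ) :
    (Fin.cons s t : Fin (k + 1) → ℝ) ∈ stdSim (k + 1) ↔
      t ∈ stdSim k ∧ s ∈ Set.Icc 0 (1 - ∑ i, t i) := by
  simp only [stdSim, Set.mem_ofPred_eq, Fin.forall_fin_succ, Fin.cons_zero, Fin.cons_succ,
    Fin.sum_univ_succ, Set.mem_Icc]
  constructor
  · rintro ⟨⟨h1, h2⟩, h3⟩
    exact ⟨⟨h2, by linarith⟩, h1, by linarith⟩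
  · rintro ⟨⟨h1, h2⟩, h3, h4⟩
    exact ⟨⟨h3, h1⟩, by linarith⟩

theorem setIntegral_stdSim_succ {k : ℕ} {F : (Fin (k + 1) → ℝ) → ℝ} (hF : Continuous F) :
    ∫ x in stdSim (k + 1), F x =
      ∫ t in stdSim k, ∫ s in (0 : ℝ)..(1 - ∑ i, t i), F (Fin.cons s t) := by
  let e := MeasurableEquiv.piFinSuccAbove (fun _ : Fin (k + 1) => ℝ) 0
  have he : MeasurePreserving e := volume_preserving_piFinSuccAbove (fun _ : Fin (k + 1) => ℝ) 0
  have hes : ∀ x : ℝ × (Fin k → ℝ), e.symm x = Fin.cons x.1 x.2 := fun x => by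
    simp [e, MeasurableEquiv.piFinSuccAbove]
    rfl
  have hm : MeasurableSet (stdSim (k + 1)) := (isClosed_stdSim _).measurableSet
  have hint : IntegrableOn F (stdSim (k + 1)) := hF.continuousOn.integrableOn_compact (isCompact_stdSim _)
  have hs : MeasurePreserving e.symm := he.symm
  rw [← hs.setIntegral_preimage_emb e.symm.measurableEmbedding,
    ← integral_indicator (e.symm.measurable hm), Measure.volume_eq_prod, integral_prod_symm]
  · rw [← integral_indicator (isClosed_stdSim k).measurableSet]
    congr 1
    ext t
    by_cases ht : t ∈ stdSim k
    · rw [Set.indicator_of_mem ht, intervalIntegral.integral_of_le (by linarith [ht.2]),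
        ← integral_Icc_eq_integral_Ioc, ← integral_indicator measurableSet_Icc]
      congr 1
      ext s
      simp only [Set.indicator, Set.mem_preimage, hes, cons_mem_stdSim, ht, true_and]
    · rw [Set.indicator_of_notMem ht]
      have : ∀ s, (e.symm ⁻¹' stdSim (k + 1)).indicator (fun x => F (e.symm x)) (s, t) = 0 := by
        intro s
        simp only [Set.indicator, Set.mem_preimage, hes, cons_mem_stdSim, ht, false_and, if_false]
      simp [this]
  · rw [← Measure.volume_eq_prod, integrable_indicator_iff (e.symm.measurable hm)]
    exact (hs.integrableOn_comp_preimage e.symm.measurableEmbedding).2 hint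

-- The slice at height s is the corner simplex of one dimension less, shrunk by 1 - s, and the
-- integral of (1 - s)^k over [0, 1] is 1 / (k + 1).
open scoped Pointwise in
theorem simVol_succ (k : ℕ) : simVol (k + 1) = simVol k / (k + 1) := by
  let e := MeasurableEquiv.piFinSuccAbove (fun _ : Fin (k + 1) => ℝ) 0
  have he : MeasurePreserving e := volume_preserving_piFinSuccAbove (fun _ : Fin (k + 1) => ℝ) 0
  have hes : ∀ x : ℝ × (Fin k → ℝ), e.symm x = Fin.cons x.1 x.2 := fun x => by
    simp [e, MeasurableEquiv.piFinSuccAbove]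
    rfl
  have hm : MeasurableSet (stdSim (k + 1)) := (isClosed_stdSim _).measurableSet
  have hs : MeasurePreserving e.symm := he.symm
  have h1 : volume (stdSim (k + 1)) =
      ∫⁻ s in Set.Ico (0 : ℝ) 1, ENNReal.ofReal ((1 - s) ^ k) * volume (stdSim k) := by
    rw [← hs.measure_preimage_equiv, Measure.volume_eq_prod,
      Measure.prod_apply (e.symm.measurable hm), ← lintegral_indicator measurableSet_Ico]
    apply lintegral_congr_ae
    -- At s = 1 the slice is a single point, which has positive measure when k = 0; this height is
    -- discarded as a null set.
    have : ∀ᵐ s : ℝ, s ≠ 1 := by simp [ae_iff]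
    filter_upwards [this] with s hs1
    have hpre : Prod.mk s ⁻¹' (e.symm ⁻¹' stdSim (k + 1)) =
        {t | t ∈ stdSim k ∧ s ∈ Set.Icc 0 (1 - ∑ i, t i)} := by
      ext t
      simp only [Set.mem_preimage, hes, cons_mem_stdSim]; rfl
    rw [hpre]
    by_cases hs01 : s ∈ Set.Ico (0 : ℝ) 1
    · rw [Set.indicator_of_mem hs01]
      have hpos : 0 < 1 - s := by linarith [hs01.2]
      have : {t | t ∈ stdSim k ∧ s ∈ Set.Icc 0 (1 - ∑ i, t i)} = (1 - s) • stdSim k := by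
        ext t
        rw [Set.mem_smul_set_iff_inv_smul_mem₀ hpos.ne']
        simp only [stdSim, Set.mem_ofPred_eq, Set.mem_Icc, Pi.smul_apply, smul_eq_mul,
          ← Finset.mul_sum]
        rw [inv_mul_le_iff₀ hpos, mul_one]
        have : ∀ i, 0 ≤ (1 - s)⁻¹ * t i ↔ 0 ≤ t i := fun i =>
          mul_nonneg_iff_of_pos_left (inv_pos.2 hpos)
        simp only [this]
        constructor
        · rintro ⟨⟨h1, h2⟩, h3, h4⟩
          exact ⟨h1, by linarith⟩
        · rintro ⟨h1, h2⟩
          exact ⟨⟨h1, by linarith [hs01.1]⟩, hs01.1, by linarith⟩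
      rw [this, Measure.addHaar_smul]
      simp [abs_of_pos (pow_pos hpos k)]
    · rw [Set.indicator_of_notMem hs01]
      convert! measure_empty (μ := (volume : Measure (Fin k → ℝ)))
      ext t
      simp only [Set.mem_ofPred_eq, Set.mem_empty_iff_false, iff_false, not_and]
      intro ht hst
      apply hs01
      refine ⟨hst.1, lt_of_le_of_ne ?_ hs1⟩
      have := Finset.sum_nonneg (s := Finset.univ) fun i _ => ht.1 i
      linarith [hst.2]
  rw [simVol, h1, lintegral_mul_const _ (by fun_prop), ENNReal.toReal_mul, ← simVol,
    ← ofReal_integral_eq_lintegral_ofReal, ENNReal.toReal_ofReal]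
  · rw [integral_Ico_eq_integral_Ioc, ← intervalIntegral.integral_of_le zero_le_one,
      intervalIntegral.integral_comp_sub_left (fun x => x ^ k) 1]
    simp only [sub_self, sub_zero, integral_pow]
    field_simp
    simp
  · exact setIntegral_nonneg measurableSet_Ico fun s hs => pow_nonneg (by linarith [hs.2]) _
  · have hc : Continuous fun s : ℝ => (1 - s) ^ k := by fun_prop
    exact (hc.continuousOn.integrableOn_compact isCompact_Icc).mono_set Set.Ico_subset_Icc_self
  · refine (ae_restrict_iff' measurableSet_Ico).2 (Eventually.of_forall fun s hs => ?_)
    exact pow_nonneg (by linarith [hs.2]) _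

/-- Stokes' theorem on a simplex, in the direction of an edge. -/
theorem simInt_fderiv_edge {d : ℕ} {s : Finset (Pt d)} {a b : Pt d}
    (hs : AffineIndependent ℝ ((↑) : s → Pt d)) (ha : a ∈ s) (hb : b ∈ s) (hab : a ≠ b)
    {f : Pt d → ℝ} (hf : ContDiff ℝ 1 f) :
    simInt s (fun x => fderiv ℝ f x (a - b)) = simInt (s.erase b) f - simInt (s.erase a) f := by
  have h2 : 2 ≤ s.card := by
    have : ({a, b} : Finset (Pt d)).card ≤ s.card := by
      apply Finset.card_le_card
      intro x; simp only [Finset.mem_insert, Finset.mem_singleton]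
      rintro (rfl | rfl) <;> assumption
    rwa [Finset.card_pair hab] at this
  obtain ⟨k, hk⟩ : ∃ k, s.card = k + 2 := ⟨s.card - 2, by omega⟩
  obtain ⟨r, hr1, hr2, hr3⟩ := exists_isEnum_cons hs hk ha hb hab
  rw [hr1.simInt_eq, hr2.simInt_eq, hr3.simInt_eq]
  have hfd : Continuous fun x => fderiv ℝ f x (a - b) :=
    (hf.continuous_fderiv (by norm_num)).clm_apply continuous_const
  have key := setIntegral_stdSim_succ (hfd.comp (continuous_simMap b
    (Fin.cons a r : Fin (k + 1) → Pt d)))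
  simp only [Function.comp_def] at key
  rw [key, ← integral_sub]
  · apply setIntegral_congr_fun (isClosed_stdSim k).measurableSet
    intro t _
    -- The first coordinate moves the point in direction a - b, so the inner integral is evaluated
    -- by the fundamental theorem of calculus. Its end points u = 0 and u = 1 - ∑ t parametrize the
    -- faces opposite `a` and opposite `b`.
    have hcons : ∀ u : ℝ, simMap b (Fin.cons a r : Fin (k + 1) → Pt d) (Fin.cons u t) =
        simMap b r t + u • (a - b) := by
      intro u
      simp only [simMap, Fin.sum_univ_succ, Fin.cons_zero, Fin.cons_succ]
      abel
    simp only [hcons, Function.comp]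
    have hder : ∀ u : ℝ, HasDerivAt (fun u : ℝ => f (simMap b r t + u • (a - b)))
        (fderiv ℝ f (simMap b r t + u • (a - b)) (a - b)) u := by
      intro u
      have h1 : HasDerivAt (fun u : ℝ => simMap b r t + u • (a - b)) (a - b) u := by
        simpa using ((hasDerivAt_id u).smul_const (a - b)).const_add (simMap b r t)
      exact ((hf.differentiable (by norm_num) _).hasFDerivAt.comp_hasDerivAt u h1)
    rw [intervalIntegral.integral_eq_sub_of_hasDerivAt (fun u _ => hder u)]
    · simp only [zero_smul, add_zero]
      congr 2
      have : (1 - ∑ i, t i) • (a - b) = (a - b) - ∑ i, t i • (a - b) := by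
        rw [sub_smul, one_smul, Finset.sum_smul]
      rw [this, simMap, simMap]
      have h5 : ∑ i, t i • (r i - a) = ∑ i, t i • (r i - b) - ∑ i, t i • (a - b) := by
        rw [← Finset.sum_sub_distrib]
        refine Finset.sum_congr rfl fun i _ => ?_
        rw [← smul_sub]; congr 1; abel
      rw [h5]; abel
    · apply Continuous.intervalIntegrable
      exact hfd.comp (by fun_prop)
  · exact (hf.continuous.comp (continuous_simMap _ _)).continuousOn.integrableOn_compact
      (isCompact_stdSim _)
  · exact (hf.continuous.comp (continuous_simMap _ _)).continuousOn.integrableOn_compact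
      (isCompact_stdSim _)

end
end CordesLS

/-! ### Normalized integrals over nondegenerate simplices -/

namespace CordesLS
open scoped Classical in
section

/-- `s` is the vertex set of a nondegenerate simplex. -/
def IsSim {d : ℕ} (s : Finset (Pt d)) : Prop :=
  s.Nonempty ∧ AffineIndependent ℝ ((↑) : s → Pt d)

variable {d : ℕ} {s : Finset (Pt d)}

theorem IsSim.subset {t : Finset (Pt d)} (hs : IsSim s) (h : t ⊆ s) (ht : t.Nonempty) : IsSim t :=
  ⟨ht, AffineIndependent.subset hs.2 h⟩

theorem IsSim.exists_enum (hs : IsSim s) :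
    ∃ (k : ℕ) (b : Pt d) (r : Fin k → Pt d), IsEnum s b r := by
  obtain ⟨b, hb⟩ := hs.1
  have := Finset.card_pos.2 hs.1
  obtain ⟨r, hr⟩ := exists_isEnum (k := s.card - 1) hs.2 (by omega) hb
  exact ⟨_, b, r, hr⟩

theorem isCompact_hull (s : Finset (Pt d)) : IsCompact (hull s) :=
  s.finite_toSet.isCompact_convexHull ℝ

theorem measurableSet_hull (s : Finset (Pt d)) : MeasurableSet (hull s) :=
  (isCompact_hull s).isClosed.measurableSet

theorem IsSim.simConst_pos (hs : IsSim s) : 0 < simConst s := by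
  obtain ⟨k, b, r, h⟩ := hs.exists_enum
  exact h.simMeasure_eq.1

theorem IsSim.isFiniteMeasure (hs : IsSim s) : IsFiniteMeasure (simMeasure s) := by
  obtain ⟨k, b, r, h⟩ := hs.exists_enum
  rw [h.simMeasure_eq.2]
  have : IsFiniteMeasure (volume.restrict (stdSim k)) :=
    ⟨by simpa using (volume_stdSim_ne_top k).lt_top⟩
  have h2 : IsFiniteMeasure ((volume.restrict (stdSim k)).map (simMap b r)) := inferInstance
  exact ⟨by
    rw [Measure.smul_apply, smul_eq_mul]
    exact ENNReal.mul_lt_top ENNReal.ofReal_lt_top (measure_lt_top _ _)⟩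

theorem IsSim.integrable (hs : IsSim s) {f : Pt d → ℝ} (hf : Continuous f) :
    Integrable f (simMeasure s) := by
  have := hs.isFiniteMeasure
  obtain ⟨C, hC⟩ := (isCompact_hull s).exists_bound_of_continuousOn hf.continuousOn
  refine Integrable.of_bound hf.aestronglyMeasurable C ?_
  exact (ae_restrict_iff' (measurableSet_hull s)).2 (Eventually.of_forall hC)

theorem IsSim.memLp (hs : IsSim s) {f : Pt d → ℝ} (hf : Continuous f) :
    MemLp f 2 (simMeasure s) := by
  have := hs.isFiniteMeasure
  obtain ⟨C, hC⟩ := (isCompact_hull s).exists_bound_of_continuousOn hf.continuousOn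
  refine MemLp.of_bound hf.aestronglyMeasurable C ?_
  exact (ae_restrict_iff' (measurableSet_hull s)).2 (Eventually.of_forall hC)

theorem IsSim.integral_eq (hs : IsSim s) (f : Pt d → ℝ) :
    ∫ x, f x ∂simMeasure s = simConst s * simInt s f := by
  rw [simInt, mul_inv_cancel_left₀ hs.simConst_pos.ne']

theorem simInt_congr {f g : Pt d → ℝ} (h : ∀ x ∈ hull s, f x = g x) :
    simInt s f = simInt s g := by
  unfold simInt simMeasure
  rw [setIntegral_congr_fun (measurableSet_hull s) h]

theorem IsSim.simInt_mono (hs : IsSim s) {f g : Pt d → ℝ} (hf : Continuous f) (hg : Continuous g)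
    (h : ∀ x ∈ hull s, f x ≤ g x) : simInt s f ≤ simInt s g := by
  unfold simInt
  have := hs.simConst_pos
  refine mul_le_mul_of_nonneg_left ?_ (inv_nonneg.2 this.le)
  exact setIntegral_mono_on (hs.integrable hf) (hs.integrable hg) (measurableSet_hull s) h

theorem IsSim.simInt_nonneg (hs : IsSim s) {f : Pt d → ℝ} (h : ∀ x ∈ hull s, 0 ≤ f x) :
    0 ≤ simInt s f := by
  unfold simInt
  have := hs.simConst_pos
  have := setIntegral_nonneg (μ := (Measure.euclideanHausdorffMeasure (s.card - 1)))
    (measurableSet_hull s) h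
  unfold simMeasure
  positivity

theorem IsSim.simInt_add (hs : IsSim s) {f g : Pt d → ℝ} (hf : Continuous f) (hg : Continuous g) :
    simInt s (fun x => f x + g x) = simInt s f + simInt s g := by
  unfold simInt
  rw [integral_add (hs.integrable hf) (hs.integrable hg), mul_add]

theorem simInt_const_mul (c : ℝ) (f : Pt d → ℝ) :
    simInt s (fun x => c * f x) = c * simInt s f := by
  unfold simInt
  rw [integral_const_mul]; ring

theorem simInt_zero : simInt s (fun _ => (0 : ℝ)) = 0 := by
  simp [simInt]

theorem IsSim.simInt_sum (hs : IsSim s) {ι : Type*} (t : Finset ι) {f : ι → Pt d → ℝ}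
    (hf : ∀ i ∈ t, Continuous (f i)) :
    simInt s (fun x => ∑ i ∈ t, f i x) = ∑ i ∈ t, simInt s (f i) := by
  unfold simInt
  rw [integral_finsetSum _ fun i hi => hs.integrable (hf i hi), Finset.mul_sum]

theorem IsSim.simInt_const (hs : IsSim s) (c : ℝ) :
    simInt s (fun _ => c) = simVol (s.card - 1) * c := by
  obtain ⟨k, b, r, h⟩ := hs.exists_enum
  have hk : s.card - 1 = k := by rw [h.card_eq]; rfl
  rw [h.simInt_eq, hk]
  simp [simVol, Measure.real]

/-- The Cauchy-Schwarz inequality for square integrable functions. -/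
theorem sq_integral_mul_le {α : Type*} [MeasurableSpace α] {μ : Measure α} {f g : α → ℝ}
    (hf : MemLp f 2 μ) (hg : MemLp g 2 μ) :
    (∫ x, f x * g x ∂μ) ^ 2 ≤ (∫ x, f x ^ 2 ∂μ) * ∫ x, g x ^ 2 ∂μ := by
  have h1 := hf.integrable_sq
  have h2 := hg.integrable_sq
  have h3 := hf.integrable_mul hg
  have key : ∀ t : ℝ, 0 ≤ (∫ x, f x ^ 2 ∂μ) * (t * t) + (2 * ∫ x, f x * g x ∂μ) * t +
      ∫ x, g x ^ 2 ∂μ := by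
    intro t
    have h : 0 ≤ ∫ x, (t * f x + g x) ^ 2 ∂μ := integral_nonneg fun x => sq_nonneg _
    have h4 : ∫ x, (t * f x + g x) ^ 2 ∂μ =
        ∫ x, (t ^ 2 * f x ^ 2 + 2 * t * (f x * g x) + g x ^ 2) ∂μ := by
      congr 1; ext x; ring
    have h3' : Integrable (fun x => f x * g x) μ := h3
    have e1 : Integrable (fun x => t ^ 2 * f x ^ 2) μ := h1.const_mul _
    have e2 : Integrable (fun x => 2 * t * (f x * g x)) μ := h3'.const_mul _
    have e3 : Integrable (fun x => t ^ 2 * f x ^ 2 + 2 * t * (f x * g x)) μ := e1.add e2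
    rw [h4, integral_add e3 h2, integral_add e1 e2, integral_const_mul, integral_const_mul] at h
    linarith
  have := discrim_le_zero key
  unfold discrim at this
  nlinarith

/-! ### Barycentric coordinates -/

/-- `K` is the vertex set of a nondegenerate simplex of full dimension. -/
def FullSim (K : Finset (Pt d)) : Prop :=
  AffineIndependent ℝ ((↑) : K → Pt d) ∧ K.card = d + 1

variable {K : Finset (Pt d)}

theorem FullSim.isSim (h : FullSim K) : IsSim K :=
  ⟨Finset.card_pos.1 (by rw [h.2]; omega), h.1⟩

/-- The vertices as an affine basis. -/
def FullSim.basis (h : FullSim K) : AffineBasis K ℝ (Pt d) :=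
  ⟨(↑), h.1, (h.1.affineSpan_eq_top_iff_card_eq_finrank_add_one).2 (by simp [h.2])⟩

/-- The barycentric coordinate of the vertex `a`. -/
def bary (K : Finset (Pt d)) (a : Pt d) : Pt d →ᵃ[ℝ] ℝ :=
  if h : FullSim K ∧ a ∈ K then h.1.basis.coord ⟨a, h.2⟩ else 0

/-- The gradient of the barycentric coordinate of the vertex `a`. -/
def baryGrad (K : Finset (Pt d)) (a : Pt d) : Pt d :=
  (InnerProductSpace.toDual ℝ (Pt d)).symm (bary K a).linear.toContinuousLinearMap

theorem inner_baryGrad (K : Finset (Pt d)) (a x y : Pt d) :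
    inner ℝ (baryGrad K a) (x - y) = bary K a x - bary K a y := by
  rw [baryGrad, InnerProductSpace.toDual_symm_apply]
  exact (bary K a).linearMap_vsub x y

theorem FullSim.bary_apply (h : FullSim K) {a b : Pt d} (ha : a ∈ K) (hb : b ∈ K) :
    bary K a b = if a = b then 1 else 0 := by
  rw [bary, dif_pos ⟨h, ha⟩]
  have := h.basis.coord_apply (⟨a, ha⟩ : K) ⟨b, hb⟩
  simp only [Subtype.mk.injEq] at this
  exact this

theorem FullSim.sum_bary (h : FullSim K) (x : Pt d) : ∑ a ∈ K, bary K a x = 1 := by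
  have := h.basis.sum_coord_apply_eq_one x
  rw [← Finset.sum_attach, ← this]
  refine Finset.sum_congr rfl fun a _ => ?_
  rw [bary, dif_pos ⟨h, a.2⟩]

theorem FullSim.sum_bary_smul (h : FullSim K) (x : Pt d) : ∑ a ∈ K, bary K a x • a = x := by
  have := h.basis.linear_combination_coord_eq_self x
  conv_rhs => rw [← this]
  rw [← Finset.sum_attach]
  refine Finset.sum_congr rfl fun a _ => ?_
  rw [bary, dif_pos ⟨h, a.2⟩]
  rfl

theorem FullSim.mem_hull (h : FullSim K) {x : Pt d} : x ∈ hull K ↔ ∀ a ∈ K, 0 ≤ bary K a x := by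
  have := h.basis.convexHull_eq_nonneg_coord
  have h2 : Set.range h.basis = (K : Set (Pt d)) := by
    exact Subtype.range_coe
  rw [h2] at this
  rw [hull, this]
  simp only [Set.mem_ofPred_eq, Subtype.forall]
  refine forall₂_congr fun a ha => ?_
  rw [bary, dif_pos ⟨h, ha⟩]

theorem FullSim.mem_cell (h : FullSim K) {x : Pt d} : x ∈ cell K ↔ ∀ a ∈ K, 0 < bary K a x := by
  have := h.basis.interior_convexHull
  have h2 : Set.range h.basis = (K : Set (Pt d)) := by
    exact Subtype.range_coe
  rw [h2] at this
  rw [cell, hull, this]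
  simp only [Set.mem_ofPred_eq, Subtype.forall]
  refine forall₂_congr fun a ha => ?_
  rw [bary, dif_pos ⟨h, ha⟩]

theorem FullSim.bary_le_one (h : FullSim K) {x : Pt d} (hx : x ∈ hull K) {a : Pt d} (ha : a ∈ K) :
    bary K a x ≤ 1 := by
  rw [← h.sum_bary x]
  exact Finset.single_le_sum (fun b hb => h.mem_hull.1 hx b hb) ha

theorem FullSim.inner_baryGrad (h : FullSim K) {a b c : Pt d} (ha : a ∈ K) (hb : b ∈ K)
    (hc : c ∈ K) :
    inner ℝ (baryGrad K a) (b - c) = (if a = b then 1 else 0) - (if a = c then 1 else 0) := by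
  rw [CordesLS.inner_baryGrad, h.bary_apply ha hb, h.bary_apply ha hc]

theorem FullSim.sum_baryGrad (h : FullSim K) : ∑ a ∈ K, baryGrad K a = 0 := by
  refine ext_inner_right ℝ fun v => ?_
  rw [sum_inner, inner_zero_left]
  have : ∀ a, inner ℝ (baryGrad K a) v = bary K a v - bary K a 0 := fun a => by
    rw [← CordesLS.inner_baryGrad, sub_zero]
  simp only [this, Finset.sum_sub_distrib, h.sum_bary, sub_self]

theorem FullSim.sum_inner_smul (h : FullSim K) (v : Pt d) :
    ∑ a ∈ K, inner ℝ (baryGrad K a) v • a = v := by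
  have : ∀ a, inner ℝ (baryGrad K a) v = bary K a v - bary K a 0 := fun a => by
    rw [← CordesLS.inner_baryGrad, sub_zero]
  simp only [this, sub_smul, Finset.sum_sub_distrib, h.sum_bary_smul, sub_zero]

/-- The coefficients ⟨∇λ_a, v⟩ sum to zero, so the base point `b` may be chosen freely. -/
theorem FullSim.sum_inner_smul_sub (h : FullSim K) (v b : Pt d) :
    ∑ a ∈ K, inner ℝ (baryGrad K a) v • (a - b) = v := by
  have h0 : ∑ a ∈ K, inner ℝ (baryGrad K a) v = 0 := by
    rw [← sum_inner, h.sum_baryGrad, inner_zero_left]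
  simp only [smul_sub, Finset.sum_sub_distrib, h.sum_inner_smul, ← Finset.sum_smul, h0, zero_smul,
    sub_zero]

theorem bary_eq_zero_of_mem_hull_erase (h : FullSim K) {a : Pt d} (ha : a ∈ K) {x : Pt d}
    (hx : x ∈ hull (K.erase a)) : bary K a x = 0 := by
  have hconv : Convex ℝ {x | bary K a x = 0} :=
    (convex_singleton (0 : ℝ)).affine_preimage (bary K a)
  refine convexHull_min (t := {x | bary K a x = 0}) ?_ hconv hx
  intro b hb
  have hb' := Finset.mem_erase.1 (Finset.mem_coe.1 hb)
  have := h.bary_apply ha hb'.2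
  rw [if_neg hb'.1.symm] at this
  exact this

theorem hull_mono {s t : Finset (Pt d)} (h : s ⊆ t) : hull s ⊆ hull t :=
  convexHull_mono (Finset.coe_subset.2 h)

theorem FullSim.isSim_erase (hd : 1 ≤ d) (h : FullSim K) {a : Pt d} (ha : a ∈ K) : IsSim (K.erase a) :=
  h.isSim.subset (Finset.erase_subset _ _) (Finset.card_pos.1 (by
    rw [Finset.card_erase_of_mem ha, h.2]; omega))

theorem FullSim.baryGrad_ne_zero (hd : 1 ≤ d) (h : FullSim K) {a : Pt d} (ha : a ∈ K) :
    baryGrad K a ≠ 0 := by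
  intro h0
  obtain ⟨b, hb⟩ := (h.isSim_erase hd ha).1
  have := h.inner_baryGrad ha ha (Finset.mem_of_mem_erase hb)
  rw [h0, inner_zero_left, if_pos rfl, if_neg (Finset.ne_of_mem_erase hb).symm] at this
  norm_num at this

/-- The differences a - b of the vertices from any point b span the space. Identities between
normals and gradients of barycentric coordinates are thereby checked at vertices. -/
theorem FullSim.ext_inner (h : FullSim K) {v w : Pt d} {b : Pt d} 
    (hvw : ∀ a ∈ K, inner ℝ v (a - b) = inner ℝ w (a - b)) : v = w := by
  refine ext_inner_right ℝ fun u => ?_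
  rw [← h.sum_inner_smul_sub u b]
  simp only [inner_sum, inner_smul_right]
  exact Finset.sum_congr rfl fun a ha => by rw [hvw a ha]

/-- The outward normal is the normalized negative gradient of the barycentric coordinate. -/
theorem FullSim.outwardNormal_eq (hd : 1 ≤ d) (h : FullSim K) {a : Pt d} (ha : a ∈ K) :
    outwardNormal K (K.erase a) = -(‖baryGrad K a‖⁻¹ • baryGrad K a) := by
  have hg := h.baryGrad_ne_zero hd ha
  have hgn : 0 < ‖baryGrad K a‖ := norm_pos_iff.2 hg
  have hex : IsOutwardNormal K (K.erase a) (-(‖baryGrad K a‖⁻¹ • baryGrad K a)) := by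
    refine ⟨?_, ?_, ?_⟩
    · rw [norm_neg, norm_smul, norm_inv, norm_norm, inv_mul_cancel₀ hgn.ne']
    · intro x hx y hy
      rw [inner_neg_left, real_inner_smul_left, h.inner_baryGrad ha (Finset.mem_of_mem_erase hy)
        (Finset.mem_of_mem_erase hx), if_neg (Finset.ne_of_mem_erase hy).symm,
        if_neg (Finset.ne_of_mem_erase hx).symm]
      simp
    · intro x hx y hy hye
      have : y = a := by
        by_contra hne
        exact hye (Finset.mem_erase.2 ⟨hne, hy⟩)
      subst this
      rw [inner_neg_left, real_inner_smul_left, h.inner_baryGrad ha hy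
        (Finset.mem_of_mem_erase hx), if_pos rfl, if_neg (Finset.ne_of_mem_erase hx).symm]
      have := inv_pos.2 hgn
      linarith
  have huniq : ∀ n, IsOutwardNormal K (K.erase a) n →
      n = -(‖baryGrad K a‖⁻¹ • baryGrad K a) := by
    intro n hn
    obtain ⟨b, hb⟩ := (h.isSim_erase hd ha).1
    have hb' := Finset.mem_erase.1 hb
    have hc := hn.2.2 b hb a ha (Finset.notMem_erase a K)
    -- A normal annihilates the edges of the face, so it is a multiple of ∇λ_a; unit length and the
    -- sign condition then fix the factor.
    have hn2 : n = inner ℝ n (a - b) • baryGrad K a := by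
      refine h.ext_inner (b := b) fun c hcK => ?_
      rw [real_inner_smul_left, h.inner_baryGrad ha hcK hb'.2, if_neg hb'.1.symm]
      by_cases hca : a = c
      · subst hca; simp
      · rw [hn.2.1 b hb c (Finset.mem_erase.2 ⟨Ne.symm hca, hcK⟩), if_neg hca]; simp
    set t := inner ℝ n (a - b)
    have hnorm := hn.1
    rw [hn2, norm_smul, Real.norm_eq_abs, abs_of_neg hc] at hnorm
    rw [hn2]
    have : t = -‖baryGrad K a‖⁻¹ := by
      field_simp; linarith
    rw [this, neg_smul]
  have hexi : ∃ n, IsOutwardNormal K (K.erase a) n := ⟨_, hex⟩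
  rw [outwardNormal, dif_pos hexi]
  exact huniq _ hexi.choose_spec

end
end CordesLS

/-! ### Divergence theorem, trace inequality and altitude formula on a simplex -/

namespace CordesLS
open scoped Classical in
section

variable {d : ℕ} {s K : Finset (Pt d)}

/-- Stokes' theorem on a simplex, in the direction of a combination of edges. -/
theorem IsSim.simInt_fderiv (hs : IsSim s) {b : Pt d} (hb : b ∈ s) {w : Pt d → ℝ}
    (hw : ∑ a ∈ s, w a = 0) {f : Pt d → ℝ} (hf : ContDiff ℝ 1 f) :
    simInt s (fun x => fderiv ℝ f x (∑ a ∈ s, w a • (a - b))) =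
      -∑ a ∈ s, w a * simInt (s.erase a) f := by
  have hfd : ∀ v, Continuous fun x => fderiv ℝ f x v := fun v =>
    (hf.continuous_fderiv (by norm_num)).clm_apply continuous_const
  simp only [map_sum, map_smul, smul_eq_mul]
  rw [hs.simInt_sum s (f := fun a x => w a * fderiv ℝ f x (a - b))
    fun a _ => continuous_const.mul (hfd _)]
  have h1 : ∀ a ∈ s, simInt s (fun x => w a * fderiv ℝ f x (a - b)) =
      w a * (simInt (s.erase b) f - simInt (s.erase a) f) := by
    intro a ha
    rw [simInt_const_mul]
    by_cases hab : a = b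
    · subst hab; simp [simInt_zero]
    · rw [simInt_fderiv_edge hs.2 ha hb hab hf]
  rw [Finset.sum_congr rfl h1]
  simp only [mul_sub, Finset.sum_sub_distrib, ← Finset.sum_mul, hw]
  ring

/-- The divergence theorem: in normalized integrals -∇λ_a takes the place of the outward normal
weighted with the size of the face. -/
theorem FullSim.simInt_fderiv (h : FullSim K) (v : Pt d) {f : Pt d → ℝ} (hf : ContDiff ℝ 1 f) :
    simInt K (fun x => fderiv ℝ f x v) =
      -∑ a ∈ K, inner ℝ (baryGrad K a) v * simInt (K.erase a) f := by
  obtain ⟨b, hb⟩ := h.isSim.1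
  have h0 : ∑ a ∈ K, inner ℝ (baryGrad K a) v = 0 := by
    rw [← sum_inner, h.sum_baryGrad, inner_zero_left]
  rw [← h.isSim.simInt_fderiv hb h0 hf, h.sum_inner_smul_sub v b]

/-- A vector tangential to the face has coefficient zero at `a`, so its expansion in edges uses
edges of the face only, and the gradients λ_b of the full simplex serve on the face as well. -/
theorem FullSim.simInt_erase_fderiv (hd : 1 ≤ d) (h : FullSim K) {a : Pt d} (ha : a ∈ K) {v : Pt d}
    (hv : inner ℝ (baryGrad K a) v = 0) {f : Pt d → ℝ} (hf : ContDiff ℝ 1 f) :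
    simInt (K.erase a) (fun x => fderiv ℝ f x v) =
      -∑ b ∈ K.erase a, inner ℝ (baryGrad K b) v * simInt ((K.erase a).erase b) f := by
  obtain ⟨b, hb⟩ := (h.isSim_erase hd ha).1
  have h0 : ∑ a ∈ K, inner ℝ (baryGrad K a) v = 0 := by
    rw [← sum_inner, h.sum_baryGrad, inner_zero_left]
  rw [← Finset.add_sum_erase _ _ ha, hv, zero_add] at h0
  rw [← (h.isSim_erase hd ha).simInt_fderiv hb h0 hf]
  have h1 := h.sum_inner_smul_sub v b
  rw [← Finset.add_sum_erase _ _ ha, hv, zero_smul, zero_add] at h1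
  rw [h1]

theorem contDiff_bary (K : Finset (Pt d)) (a : Pt d) {n : WithTop ℕ∞} :
    ContDiff ℝ n (fun x => bary K a x) := by
  have : ∀ x, bary K a x = inner ℝ (baryGrad K a) x + bary K a 0 := fun x => by
    have := inner_baryGrad K a x 0
    rw [sub_zero] at this
    linarith
  rw [funext this]
  exact (contDiff_const.inner ℝ contDiff_id).add contDiff_const

theorem fderiv_bary (K : Finset (Pt d)) (a x v : Pt d) :
    fderiv ℝ (fun x => bary K a x) x v = inner ℝ (baryGrad K a) v := by
  have : ∀ x, bary K a x = innerSL ℝ (baryGrad K a) x + bary K a 0 := fun x => by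
    have := inner_baryGrad K a x 0
    rw [sub_zero] at this
    rw [innerSL_apply_apply]
    linarith
  rw [funext this, fderiv_add_const, ContinuousLinearMap.fderiv]
  simp

/-- A trace inequality for smooth functions on a simplex. -/
theorem FullSim.exists_trace_le (hd : 1 ≤ d) (h : FullSim K) {a : Pt d} (ha : a ∈ K) :
    ∃ C : ℝ, 0 < C ∧ ∀ φ : Pt d → ℝ, ContDiff ℝ 1 φ →
      simInt (K.erase a) (fun x => φ x ^ 2) ≤
        C * simInt K (fun x => φ x ^ 2 + ‖fderiv ℝ φ x‖ ^ 2) := by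
  refine ⟨∑ b ∈ K.erase a, (2 + ‖b - a‖ ^ 2),
    Finset.sum_pos (fun b _ => by positivity) (h.isSim_erase hd ha).1, fun φ hφ => ?_⟩
  have hfd : Continuous fun x => fderiv ℝ φ x := hφ.continuous_fderiv (by norm_num)
  have hφc := hφ.continuous
  have hbc : ∀ b, Continuous fun x => bary K b x := fun b =>
    (contDiff_bary K b (n := 1)).continuous
  have he := h.isSim_erase hd ha
  -- On the face the λ_b with b ≠ a sum to one. Each λ_b φ² vanishes on the face opposite b, so
  -- Stokes' theorem along the edge from `a` to b leaves only the face opposite `a`.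
  have h1 : simInt (K.erase a) (fun x => φ x ^ 2) =
      ∑ b ∈ K.erase a, simInt (K.erase a) (fun x => bary K b x * φ x ^ 2) := by
    rw [← he.simInt_sum (K.erase a) (f := fun b x => bary K b x * φ x ^ 2)
      fun b _ => (hbc b).mul (hφc.pow 2)]
    refine simInt_congr fun x hx => ?_
    rw [← Finset.sum_mul]
    have := h.sum_bary x
    rw [← Finset.add_sum_erase _ _ ha, bary_eq_zero_of_mem_hull_erase h ha hx, zero_add] at this
    rw [this, one_mul]
  rw [h1, Finset.sum_mul]
  refine Finset.sum_le_sum fun b hb => ?_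
  have hb' := Finset.mem_erase.1 hb
  have hsm : ContDiff ℝ 1 (fun x => bary K b x * φ x ^ 2) := (contDiff_bary K b).mul (hφ.pow 2)
  have h2 := simInt_fderiv_edge h.1 hb'.2 ha hb'.1 hsm
  have h3 : simInt (K.erase b) (fun x => bary K b x * φ x ^ 2) = 0 := by
    rw [← simInt_zero (s := K.erase b)]
    refine simInt_congr fun x hx => ?_
    rw [bary_eq_zero_of_mem_hull_erase h hb'.2 hx, zero_mul]
  rw [h3, sub_zero] at h2
  rw [← h2, ← simInt_const_mul]
  refine h.isSim.simInt_mono ((hsm.continuous_fderiv (by norm_num)).clm_apply continuous_const)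
    (by fun_prop) fun x hx => ?_
  have hd1 : DifferentiableAt ℝ (fun x => bary K b x) x :=
    (contDiff_bary K b (n := 1)).differentiable (by norm_num) x
  have hd2 : DifferentiableAt ℝ φ x := hφ.differentiable (by norm_num) x
  have h4 : fderiv ℝ (fun x => bary K b x * φ x ^ 2) x (b - a) =
      bary K b x * (2 * φ x * fderiv ℝ φ x (b - a)) + φ x ^ 2 := by
    have hd3 : DifferentiableAt ℝ (fun x => φ x ^ 2) x := hd2.pow 2
    rw [fderiv_fun_mul hd1 hd3, fderiv_fun_pow 2 hd2]
    simp only [add_apply, smul_apply, smul_eq_mul,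
      fderiv_bary]
    rw [h.inner_baryGrad hb'.2 hb'.2 ha, if_pos rfl, if_neg hb'.1]
    simp
  rw [h4]
  have h5 : |fderiv ℝ φ x (b - a)| ≤ ‖fderiv ℝ φ x‖ * ‖b - a‖ :=
    (fderiv ℝ φ x).le_opNorm (b - a)
  have h6 := h.mem_hull.1 hx b hb'.2
  have h7 := h.bary_le_one hx hb'.2
  set D := fderiv ℝ φ x (b - a)
  have h8 : D ^ 2 ≤ ‖fderiv ℝ φ x‖ ^ 2 * ‖b - a‖ ^ 2 := by
    rw [← mul_pow, ← sq_abs]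
    exact pow_le_pow_left₀ (abs_nonneg _) h5 2
  have h9 : bary K b x * (2 * φ x * D) ≤ φ x ^ 2 + D ^ 2 := by
    have e1 : 2 * φ x * D ≤ φ x ^ 2 + D ^ 2 := by nlinarith [sq_nonneg (φ x - D)]
    calc bary K b x * (2 * φ x * D) ≤ bary K b x * (φ x ^ 2 + D ^ 2) := by gcongr
      _ ≤ 1 * (φ x ^ 2 + D ^ 2) := by gcongr
      _ = _ := one_mul _
  nlinarith [mul_nonneg (sq_nonneg (φ x)) (sq_nonneg ‖b - a‖), sq_nonneg ‖fderiv ℝ φ x‖]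

theorem lintegral_Ico_one_sub_pow (k : ℕ) :
    ∫⁻ s in Set.Ico (0 : ℝ) 1, ENNReal.ofReal ((1 - s) ^ k) = ENNReal.ofReal (1 / (k + 1)) := by
  rw [← ofReal_integral_eq_lintegral_ofReal]
  · rw [integral_Ico_eq_integral_Ioc, ← intervalIntegral.integral_of_le zero_le_one,
      intervalIntegral.integral_comp_sub_left (fun x => x ^ k) 1]
    simp
  · have hc : Continuous fun s : ℝ => (1 - s) ^ k := by fun_prop
    exact (hc.continuousOn.integrableOn_compact isCompact_Icc).mono_set Set.Ico_subset_Icc_self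
  · refine (ae_restrict_iff' measurableSet_Ico).2 (Eventually.of_forall fun s hs => ?_)
    exact pow_nonneg (by linarith [hs.2]) _

theorem bary_lineMap (K : Finset (Pt d)) (c a y : Pt d) (t : ℝ) :
    bary K c (AffineMap.lineMap a y t) = (1 - t) * bary K c a + t * bary K c y := by
  rw [AffineMap.apply_lineMap, AffineMap.lineMap_apply_module]; simp

/-- A face is the zero set of the corresponding barycentric coordinate. -/
theorem FullSim.mem_hull_erase (h : FullSim K) {a : Pt d} (ha : a ∈ K) {x : Pt d} :
    x ∈ hull (K.erase a) ↔ x ∈ hull K ∧ bary K a x = 0 := by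
  refine ⟨fun hx => ⟨hull_mono (Finset.erase_subset _ _) hx, bary_eq_zero_of_mem_hull_erase h ha hx⟩,
    fun ⟨hx, h0⟩ => ?_⟩
  have h1 := h.sum_bary x
  have h2 := h.sum_bary_smul x
  rw [← Finset.add_sum_erase _ _ ha, h0] at h1 h2
  rw [zero_add] at h1
  rw [zero_smul, zero_add] at h2
  rw [← h2]
  exact (convex_convexHull ℝ _).sum_mem
    (fun c hc => h.mem_hull.1 hx c (Finset.mem_of_mem_erase hc)) h1
    fun c hc => subset_convexHull ℝ _ (Finset.mem_coe.2 hc)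

/-- The measure of a simplex is the altitude times the measure of the base over the dimension. -/
theorem FullSim.simConst_erase (hd : 1 ≤ d) (h : FullSim K) {a : Pt d} (ha : a ∈ K) :
    simConst (K.erase a) = simConst K * ‖baryGrad K a‖ := by
  obtain ⟨n, rfl⟩ : ∃ n, d = n + 1 := ⟨d - 1, by omega⟩
  obtain ⟨b, hb⟩ := (h.isSim_erase hd ha).1
  have hb' := Finset.mem_erase.1 hb
  set g := baryGrad K a with hg
  have hg0 : g ≠ 0 := h.baryGrad_ne_zero hd ha
  have hgn : 0 < ‖g‖ := norm_pos_iff.2 hg0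
  -- Scaled so that ⟨∇λ_a, v⟩ = 1: the slices orthogonal to `v` are the level sets of λ_a. The one
  -- at height x is the opposite face contracted towards `a` by 1 - x, and the slicing formula
  -- contributes the factor ‖v‖ = 1/‖∇λ_a‖.
  set v : Pt (n + 1) := (‖g‖ ^ 2)⁻¹ • g with hv
  have hv0 : v ≠ 0 := smul_ne_zero (by positivity) hg0
  have hcK : K.card - 1 = n + 1 := by rw [h.2]; rfl
  have hce : (K.erase a).card - 1 = n := by rw [Finset.card_erase_of_mem ha, h.2]; rfl
  have hfin := (h.isSim_erase hd ha).isFiniteMeasure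
  have hslice := EuclideanGeometry.euclideanHausdorffMeasure_eq_lintegral b hv0
    (measurableSet_hull K)
  rw [finrank_euclideanSpace_fin] at hslice
  simp only [Nat.add_sub_cancel] at hslice
  have hbb : bary K a b = 0 := by rw [h.bary_apply ha hb'.2, if_neg hb'.1.symm]
  have haa : bary K a a = 1 := by rw [h.bary_apply ha ha, if_pos rfl]
  have hsl : ∀ x : ℝ, hull K ∩ AffineSubspace.mk' (x • v +ᵥ b) (ℝ ∙ v)ᗮ =
      {y | y ∈ hull K ∧ bary K a y = x} := by
    intro x
    ext y
    simp only [Set.mem_inter_iff, SetLike.mem_coe, AffineSubspace.mem_mk', Set.mem_ofPred_eq,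
      Submodule.mem_orthogonal_singleton_iff_inner_right]
    refine and_congr_right fun _ => ?_
    have e1 : inner ℝ v (y -ᵥ (x • v +ᵥ b)) = (‖g‖ ^ 2)⁻¹ * (bary K a y - x) := by
      have : y -ᵥ (x • v +ᵥ b) = (y - b) - x • v := by
        simp only [vsub_eq_sub, vadd_eq_add]; abel
      rw [this, inner_sub_right, hv, real_inner_smul_left, CordesLS.inner_baryGrad, hbb,
        real_inner_smul_left, real_inner_smul_right, real_inner_smul_right,
        real_inner_self_eq_norm_sq]
      field_simp
      ring
    rw [e1]
    have : (‖g‖ ^ 2)⁻¹ ≠ 0 := by positivity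
    simp [this, sub_eq_zero]
  have hmeas : ∀ᵐ x : ℝ, Measure.euclideanHausdorffMeasure n
      (hull K ∩ AffineSubspace.mk' (x • v +ᵥ b) (ℝ ∙ v)ᗮ) =
      (Set.Ico (0 : ℝ) 1).indicator (fun x => ENNReal.ofReal ((1 - x) ^ n) *
        Measure.euclideanHausdorffMeasure n (hull (K.erase a))) x := by
    have : ∀ᵐ s : ℝ, s ≠ 1 := by simp [ae_iff]
    filter_upwards [this] with x hx1
    rw [hsl]
    by_cases hx : x ∈ Set.Ico (0 : ℝ) 1
    · rw [Set.indicator_of_mem hx]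
      have hpos : 0 < 1 - x := by linarith [hx.2]
      have himg : {y | y ∈ hull K ∧ bary K a y = x} =
          AffineMap.homothety a (1 - x) '' hull (K.erase a) := by
        ext y
        simp only [Set.mem_ofPred_eq, Set.mem_image, AffineMap.homothety_eq_lineMap]
        constructor
        · rintro ⟨hyK, hyx⟩
          refine ⟨AffineMap.lineMap a y (1 - x)⁻¹, ?_, ?_⟩
          · rw [h.mem_hull_erase ha, h.mem_hull]
            refine ⟨fun c hc => ?_, ?_⟩
            · rw [bary_lineMap, h.bary_apply hc ha]
              by_cases hca : c = a
              · subst hca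
                rw [hyx]; simp; field_simp; linarith
              · rw [if_neg hca, mul_zero, zero_add]
                exact mul_nonneg (inv_nonneg.2 hpos.le) (h.mem_hull.1 hyK c hc)
            · rw [bary_lineMap, haa, hyx]
              field_simp
              ring
          · rw [AffineMap.lineMap_lineMap_right, mul_inv_cancel₀ hpos.ne', AffineMap.lineMap_apply_one]
        · rintro ⟨z, hz, rfl⟩
          rw [h.mem_hull_erase ha, h.mem_hull] at hz
          refine ⟨h.mem_hull.2 fun c hc => ?_, ?_⟩
          · rw [bary_lineMap, h.bary_apply hc ha]
            have := mul_nonneg hpos.le (hz.1 c hc)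
            split_ifs
            · nlinarith [hx.1]
            · linarith
          · rw [bary_lineMap, haa, hz.2]; ring
      rw [himg, euclideanHausdorffMeasure_homothety_image _ _ hpos.ne']
      have : ENNReal.ofReal ((1 - x) ^ n) = ((‖1 - x‖₊ ^ n : NNReal) : ℝ≥0∞) := by
        rw [ENNReal.ofReal_pow hpos.le, ENNReal.coe_pow]
        congr 1
        rw [← enorm_eq_nnnorm, Real.enorm_of_nonneg hpos.le]
      rw [this]; rfl
    · rw [Set.indicator_of_notMem hx]
      convert! measure_empty (μ := (Measure.euclideanHausdorffMeasure n : Measure (Pt (n + 1))))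
      ext y
      simp only [Set.mem_ofPred_eq, Set.mem_empty_iff_false, iff_false, not_and]
      intro hy hyx
      apply hx
      rw [← hyx]
      refine ⟨h.mem_hull.1 hy a ha, lt_of_le_of_ne (h.bary_le_one hy ha) ?_⟩
      rwa [hyx]
  rw [lintegral_congr_ae hmeas, lintegral_indicator measurableSet_Ico,
    lintegral_mul_const _ (by fun_prop), lintegral_Ico_one_sub_pow] at hslice
  have hm1 : simMeasure K Set.univ = Measure.euclideanHausdorffMeasure (n + 1) (hull K) := by
    rw [simMeasure, hcK, Measure.restrict_apply_univ]
  have hm2 : simMeasure (K.erase a) Set.univ =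
      Measure.euclideanHausdorffMeasure n (hull (K.erase a)) := by
    rw [simMeasure, hce, Measure.restrict_apply_univ]
  have hvn : ‖v‖ = ‖g‖⁻¹ := by
    rw [hv, norm_smul, norm_inv, norm_pow, norm_norm]; field_simp
  rw [simConst, simConst, hm1, hm2, hslice, hcK, hce, simVol_succ, ENNReal.toReal_mul,
    ENNReal.toReal_mul, toReal_enorm, hvn, ENNReal.toReal_ofReal (by positivity)]
  have := simVol_pos n
  field_simp

end
end CordesLS

namespace CordesLS
open scoped Classical in
section

variable {d : ℕ} {K : Finset (Pt d)}

/-! ### Weak derivatives and traces of smooth functions -/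

theorem cell_ae_eq_hull (K : Finset (Pt d)) : cell K =ᵐ[volume] hull K :=
  interior_ae_eq_of_null_frontier ((convex_convexHull ℝ _).addHaar_frontier volume)

theorem FullSim.simMeasure_eq (h : FullSim K) : simMeasure K = volume.restrict (cell K) := by
  have : K.card - 1 = d := by rw [h.2]; rfl
  have h2 := EuclideanSpace.euclideanHausdorffMeasure_eq_volume d
  rw [simMeasure, this, h2, Measure.restrict_congr_set (cell_ae_eq_hull K)]

theorem FullSim.faceMeasure_eq (h : FullSim K) {a : Pt d} (ha : a ∈ K) :
    faceMeasure (K.erase a) = simMeasure (K.erase a) := by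
  rw [faceMeasure, simMeasure, Finset.card_erase_of_mem ha, h.2]; rfl

theorem isOpen_cell (K : Finset (Pt d)) : IsOpen (cell K) := isOpen_interior

theorem isFiniteMeasure_cell (K : Finset (Pt d)) : IsFiniteMeasure (volume.restrict (cell K)) :=
  ⟨by
    rw [Measure.restrict_apply_univ]
    exact (measure_mono interior_subset).trans_lt (isCompact_hull K).measure_lt_top⟩

theorem memLp_cell {f : Pt d → ℝ} (hf : Continuous f) (K : Finset (Pt d)) :
    MemLp f 2 (volume.restrict (cell K)) := by
  have := isFiniteMeasure_cell K
  obtain ⟨C, hC⟩ := (isCompact_hull K).exists_bound_of_continuousOn hf.continuousOn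
  refine MemLp.of_bound hf.aestronglyMeasurable C ?_
  exact (ae_restrict_iff' (isOpen_cell K).measurableSet).2
    (Eventually.of_forall fun x hx => hC x (interior_subset hx))

theorem continuous_pd {f : Pt d → ℝ} (hf : ContDiff ℝ 1 f) (j : Fin d) : Continuous (pd j f) :=
  (hf.continuous_fderiv (by norm_num)).clm_apply continuous_const

theorem IsWeakPd.ae_eq {j : Fin d} {v w w' : Pt d → ℝ}
    (h : IsWeakPd (cell K) j v w) (h' : IsWeakPd (cell K) j v w') :
    w =ᵐ[volume.restrict (cell K)] w' := by
  have := isFiniteMeasure_cell K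
  have hi : IntegrableOn (fun x => w x - w' x) (cell K) :=
    (h.1.sub h'.1).integrable (by norm_num)
  have key := (isOpen_cell K).ae_eq_zero_of_integral_contDiff_smul_eq_zero (μ := volume)
    hi.locallyIntegrableOn (fun φ hφ hc hs => ?_)
  · refine (ae_restrict_iff' (isOpen_cell K).measurableSet).2 ?_
    filter_upwards [key] with x hx hxK
    exact sub_eq_zero.1 (hx hxK)
  · have h1 := h.2 φ hφ hc hs
    have h2 := h'.2 φ hφ hc hs
    rw [h1] at h2
    have hφ2 := memLp_cell hφ.continuous K
    have i1 : Integrable (fun x => w x * φ x) (volume.restrict (cell K)) := h.1.integrable_mul hφ2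
    have i2 : Integrable (fun x => w' x * φ x) (volume.restrict (cell K)) := h'.1.integrable_mul hφ2
    have h3 : ∫ x in cell K, φ x • (w x - w' x) = 0 := by
      have : ∀ x, φ x • (w x - w' x) = w x * φ x - w' x * φ x := fun x => by
        rw [smul_eq_mul]; ring
      simp only [this]
      rw [integral_sub i1 i2]
      linarith
    rw [← h3, setIntegral_eq_integral_of_forall_compl_eq_zero]
    intro x hx
    have : φ x = 0 := by
      by_contra hne
      exact hx (hs (subset_tsupport φ hne))
    rw [this, zero_smul]

/-- The support of a test function lies inside the element, so both integrals extend to the whole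
space and integration by parts has no boundary term. -/
theorem isWeakPd_of_contDiff {j : Fin d} {v P : Pt d → ℝ} (hP : ContDiff ℝ 1 P)
    (hv : v =ᵐ[volume.restrict (cell K)] P) : IsWeakPd (cell K) j v (pd j P) := by
  refine ⟨memLp_cell (continuous_pd hP j) K, fun φ hφ hc hs => ?_⟩
  have h1 : ∫ x in cell K, v x * pd j φ x = ∫ x in cell K, P x * pd j φ x := by
    refine integral_congr_ae ?_
    filter_upwards [hv] with x hx
    rw [hx]
  have hφ1 : ContDiff ℝ 1 φ := hφ.of_le (by exact_mod_cast le_top)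
  have hz : ∀ x ∉ cell K, φ x = 0 := fun x hx => by
    by_contra hne
    exact hx (hs (subset_tsupport φ hne))
  have hz' : ∀ x ∉ cell K, pd j φ x = 0 := fun x hx => by
    have : fderiv ℝ φ x = 0 := by
      by_contra hne
      exact hx (hs (support_fderiv_subset ℝ hne))
    rw [pd, this]; rfl
  rw [h1, setIntegral_eq_integral_of_forall_compl_eq_zero fun x hx => by rw [hz' x hx, mul_zero],
    setIntegral_eq_integral_of_forall_compl_eq_zero fun x hx => by rw [hz x hx, mul_zero]]
  have hcs : HasCompactSupport (pd j φ) := (hc.fderiv_apply (𝕜 := ℝ) (EuclideanSpace.single j 1))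
  refine integral_mul_fderiv_eq_neg_fderiv_mul_of_integrable
    (((continuous_pd hP j).mul hφ.continuous).integrable_of_hasCompactSupport hc.mul_left)
    ((hP.continuous.mul (continuous_pd hφ1 j)).integrable_of_hasCompactSupport hcs.mul_left)
    ((hP.continuous.mul hφ.continuous).integrable_of_hasCompactSupport hc.mul_left)
    (fun x _ => hP.differentiable (by norm_num) x)
    fun x _ => hφ1.differentiable (by norm_num) x

theorem weakPd_ae_eq {j : Fin d} {v P : Pt d → ℝ} (hP : ContDiff ℝ 1 P)
    (hv : v =ᵐ[volume.restrict (cell K)] P) :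
    weakPd (cell K) j v =ᵐ[volume.restrict (cell K)] pd j P := by
  have h : ∃ w, IsWeakPd (cell K) j v w := ⟨_, isWeakPd_of_contDiff hP hv⟩
  rw [weakPd, dif_pos h]
  exact h.choose_spec.ae_eq (isWeakPd_of_contDiff hP hv)

/-- True for every `v`, as the default value 0 is square integrable. With `memLp_trace` it makes all
integrands of the method integrable without reference to H¹. -/
theorem memLp_weakPd (D : Set (Pt d)) (j : Fin d) (v : Pt d → ℝ) :
    MemLp (weakPd D j v) 2 (volume.restrict D) := by
  unfold weakPd
  split_ifs with h
  · exact h.choose_spec.1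
  · exact MemLp.zero

theorem memLp_trace (D : Set (Pt d)) (e : Finset (Pt d)) (v : Pt d → ℝ) :
    MemLp (trace D e v) 2 (faceMeasure e) := by
  unfold trace
  split_ifs with h
  · exact h.choose_spec.1
  · exact MemLp.zero

theorem eLpNorm_two_sq {α : Type*} [MeasurableSpace α] {μ : Measure α} {f : α → ℝ}
    (hf : MemLp f 2 μ) : eLpNorm f 2 μ ^ 2 = ENNReal.ofReal (∫ x, f x ^ 2 ∂μ) := by
  have h := eLpNorm_nnreal_pow_eq_lintegral (f := f) (μ := μ) (p := 2) (by norm_num)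
  rw [ofReal_integral_eq_lintegral_ofReal hf.integrable_sq
    (Eventually.of_forall fun x => sq_nonneg _)]
  have h2 : eLpNorm f 2 μ ^ 2 = eLpNorm f ((2 : NNReal) : ℝ≥0∞) μ ^ ((2 : NNReal) : ℝ) := by
    simp
  rw [h2, h]
  refine lintegral_congr fun x => ?_
  rw [← sq_abs, ENNReal.ofReal_pow (abs_nonneg _), ← Real.norm_eq_abs, ofReal_norm]
  simp

theorem norm_fderiv_sq_le (φ : Pt d → ℝ) (x : Pt d) :
    ‖fderiv ℝ φ x‖ ^ 2 ≤ ∑ j, pd j φ x ^ 2 := by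
  set L := fderiv ℝ φ x
  have h1 : ‖L‖ ≤ Real.sqrt (∑ j, pd j φ x ^ 2) := by
    refine L.opNorm_le_bound (Real.sqrt_nonneg _) fun v => ?_
    have hv : L v = ∑ j, v j * pd j φ x := by
      have hv2 : v = ∑ j, v j • (EuclideanSpace.single j 1 : Pt d) := by
        ext i
        simp [Finset.sum_apply, Pi.single_apply]
      conv_lhs => rw [hv2, map_sum]
      refine Finset.sum_congr rfl fun j _ => ?_
      rw [map_smul, smul_eq_mul]; rfl
    rw [hv, EuclideanSpace.norm_eq, Real.norm_eq_abs]
    rw [← Real.sqrt_mul (Finset.sum_nonneg fun _ _ => sq_nonneg _)]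
    refine Real.abs_le_sqrt ?_
    have := Finset.sum_mul_sq_le_sq_mul_sq Finset.univ (fun j => v j) (fun j => pd j φ x)
    simp only [Real.norm_eq_abs, sq_abs]
    linarith
  calc ‖L‖ ^ 2 ≤ Real.sqrt (∑ j, pd j φ x ^ 2) ^ 2 := by gcongr
    _ = _ := Real.sq_sqrt (Finset.sum_nonneg fun _ _ => sq_nonneg _)

theorem FullSim.exists_eLpNorm_face_le (hd : 1 ≤ d) (h : FullSim K) {a : Pt d} (ha : a ∈ K) :
    ∃ C : ℝ, ∀ φ : Pt d → ℝ, ContDiff ℝ 1 φ →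
      eLpNorm φ 2 (faceMeasure (K.erase a)) ^ 2 ≤
        ENNReal.ofReal C * (eLpNorm φ 2 (volume.restrict (cell K)) ^ 2 +
          ∑ j, eLpNorm (pd j φ) 2 (volume.restrict (cell K)) ^ 2) := by
  obtain ⟨C, hC, hle⟩ := h.exists_trace_le hd ha
  have he := h.isSim_erase hd ha
  have hcK := h.isSim.simConst_pos
  have hce := he.simConst_pos
  refine ⟨simConst (K.erase a) * C * (simConst K)⁻¹, fun φ hφ => ?_⟩
  have i1 := (memLp_cell hφ.continuous K)
  have i2 := fun j => memLp_cell (continuous_pd hφ j) K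
  rw [h.faceMeasure_eq ha, eLpNorm_two_sq (he.memLp hφ.continuous), eLpNorm_two_sq i1]
  simp only [eLpNorm_two_sq (i2 _)]
  rw [← ENNReal.ofReal_sum_of_nonneg fun j _ => integral_nonneg fun x => sq_nonneg _,
    ← ENNReal.ofReal_add (integral_nonneg fun x => sq_nonneg _)
      (Finset.sum_nonneg fun j _ => integral_nonneg fun x => sq_nonneg _),
    ← ENNReal.ofReal_mul (by positivity)]
  apply ENNReal.ofReal_le_ofReal
  rw [← integral_finsetSum _ fun j _ => (i2 j).integrable_sq,
    ← integral_add i1.integrable_sq (integrable_finsetSum _ fun j _ => (i2 j).integrable_sq),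
    ← h.simMeasure_eq, h.isSim.integral_eq, he.integral_eq]
  have hfd : Continuous fun x => fderiv ℝ φ x := hφ.continuous_fderiv (by norm_num)
  have h2 : simInt K (fun x => φ x ^ 2 + ‖fderiv ℝ φ x‖ ^ 2) ≤
      simInt K (fun x => φ x ^ 2 + ∑ j, pd j φ x ^ 2) := by
    refine h.isSim.simInt_mono ((hφ.continuous.pow 2).add (hfd.norm.pow 2))
      ((hφ.continuous.pow 2).add (continuous_finsetSum _ fun j _ => (continuous_pd hφ j).pow 2))
      fun x _ => ?_
    have := norm_fderiv_sq_le φ x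
    linarith
  calc simConst (K.erase a) * simInt (K.erase a) (fun x => φ x ^ 2)
      ≤ simConst (K.erase a) * (C * simInt K (fun x => φ x ^ 2 + ∑ j, pd j φ x ^ 2)) := by
        gcongr
        exact (hle φ hφ).trans (by gcongr)
    _ = _ := by field_simp

/-- Every smooth sequence admitted in the definition converges to `P` in H¹ of the element, hence by
the trace inequality in L² of the face. So every trace of `v`, in particular the chosen one, equals
`P` almost everywhere. -/
theorem trace_ae_eq (hd : 1 ≤ d) (h : FullSim K) {a : Pt d} (ha : a ∈ K) {v P : Pt d → ℝ}
    (hP : ContDiff ℝ ∞ P) (hv : v =ᵐ[volume.restrict (cell K)] P) :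
    trace (cell K) (K.erase a) v =ᵐ[faceMeasure (K.erase a)] P := by
  have hP1 : ContDiff ℝ 1 P := hP.of_le (by exact_mod_cast le_top)
  have he := h.isSim_erase hd ha
  have hPe : MemLp P 2 (faceMeasure (K.erase a)) := by
    rw [h.faceMeasure_eq ha]; exact he.memLp hP.continuous
  have hw : ∀ j, weakPd (cell K) j v =ᵐ[volume.restrict (cell K)] pd j P := fun j =>
    weakPd_ae_eq hP1 hv
  have hex : ∃ g, IsTrace (cell K) (K.erase a) v g := by
    refine ⟨P, hPe, fun _ => P, fun _ => hP, ?_, fun j => ?_, ?_⟩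
    · have : eLpNorm (v - P) 2 (volume.restrict (cell K)) = 0 := by
        rw [eLpNorm_congr_ae (g := 0)]
        · simp
        · filter_upwards [hv] with x hx
          simp [hx]
      simp [this]
    · have : eLpNorm (weakPd (cell K) j v - pd j P) 2 (volume.restrict (cell K)) = 0 := by
        rw [eLpNorm_congr_ae (g := 0)]
        · simp
        · filter_upwards [hw j] with x hx
          simp [hx]
      simp [this]
    · simp
  rw [trace, dif_pos hex]
  obtain ⟨hgm, φ, hφ, h1, h2, h3⟩ := hex.choose_spec
  set g := hex.choose
  obtain ⟨C, hC⟩ := h.exists_eLpNorm_face_le hd ha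
  have hφ1 : ∀ k, ContDiff ℝ 1 (φ k) := fun k => (hφ k).of_le (by exact_mod_cast le_top)
  have h4 : Tendsto (fun k => eLpNorm (φ k - P) 2 (volume.restrict (cell K))) atTop (𝓝 0) := by
    refine h1.congr fun k => ?_
    rw [← eLpNorm_neg]
    refine eLpNorm_congr_ae ?_
    filter_upwards [hv] with x hx
    simp [hx]
  have h5 : ∀ j, Tendsto (fun k => eLpNorm (pd j (φ k - P)) 2 (volume.restrict (cell K)))
      atTop (𝓝 0) := by
    intro j
    refine (h2 j).congr fun k => ?_
    rw [← eLpNorm_neg]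
    refine eLpNorm_congr_ae ?_
    filter_upwards [hw j] with x hx
    have : pd j (φ k - P) x = pd j (φ k) x - pd j P x := by
      simp only [pd]
      rw [fderiv_sub ((hφ1 k).differentiable (by norm_num) x) (hP1.differentiable (by norm_num) x)]
      rfl
    simp [hx, this]
  have h6 : Tendsto (fun k => ENNReal.ofReal C *
      (eLpNorm (φ k - P) 2 (volume.restrict (cell K)) ^ 2 +
          ∑ j, eLpNorm (pd j (φ k - P)) 2 (volume.restrict (cell K)) ^ 2)) atTop (𝓝 0) := by
    have e1 : ∀ {u : ℕ → ℝ≥0∞}, Tendsto u atTop (𝓝 0) → Tendsto (fun k => u k ^ 2) atTop (𝓝 0) := by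
      intro u hu
      simpa using ENNReal.Tendsto.pow (n := 2) hu
    have e2 := (e1 h4).add (tendsto_finsetSum (Finset.univ : Finset (Fin d)) fun j _ => e1 (h5 j))
    have e3 := ENNReal.Tendsto.const_mul (a := ENNReal.ofReal C) e2 (Or.inr ENNReal.ofReal_ne_top)
    simpa using e3
  have h7 : Tendsto (fun k => eLpNorm (φ k - P) 2 (faceMeasure (K.erase a)) ^ 2) atTop (𝓝 0) :=
    tendsto_of_tendsto_of_tendsto_of_le_of_le tendsto_const_nhds h6 (fun _ => zero_le)
      fun k => hC _ ((hφ1 k).sub hP1)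
  have h8 : Tendsto (fun k => eLpNorm (φ k - P) 2 (faceMeasure (K.erase a))) atTop (𝓝 0) := by
    have := (ENNReal.continuous_rpow_const (y := (1 / 2 : ℝ))).tendsto 0 |>.comp h7
    rw [ENNReal.zero_rpow_of_pos (by norm_num)] at this
    refine this.congr fun k => ?_
    rw [Function.comp, ← ENNReal.rpow_natCast, ← ENNReal.rpow_mul]
    norm_num
  have h9 : eLpNorm (g - P) 2 (faceMeasure (K.erase a)) = 0 := by
    have hsum := h3.add h8
    rw [add_zero] at hsum
    refine le_antisymm (ge_of_tendsto' hsum fun k => ?_) zero_le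
    have : g - P = (g - φ k) + (φ k - P) := by abel
    have hφe : MemLp (φ k) 2 (faceMeasure (K.erase a)) := by
      rw [h.faceMeasure_eq ha]; exact he.memLp (hφ k).continuous
    rw [this]
    exact eLpNorm_add_le (hgm.sub hφe).1 (hφe.sub hPe).1 (by norm_num)
  have h10 := (eLpNorm_eq_zero_iff (hgm.sub hPe).1 (by norm_num)).1 h9
  filter_upwards [h10] with x hx
  exact sub_eq_zero.1 hx

end
end CordesLS

namespace CordesLS
open scoped Classical in
section

/-! ### Combinatorics of the subdivision -/

variable {d : ℕ} {Ω : Set (Pt d)} {T : Mesh Ω} {K K' K'' E e : Finset (Pt d)} {a a' : Pt d}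

theorem bary_eq_inner_add (K : Finset (Pt d)) (a x : Pt d) :
    bary K a x = inner ℝ (baryGrad K a) x + bary K a 0 := by
  have := inner_baryGrad K a x 0
  rw [sub_zero] at this
  linarith

theorem bary_sum_smul (K : Finset (Pt d)) (c : Pt d) {ι : Type*} (t : Finset ι) (w : ι → ℝ)
    (x : ι → Pt d) (hw : ∑ i ∈ t, w i = 1) :
    bary K c (∑ i ∈ t, w i • x i) = ∑ i ∈ t, w i * bary K c (x i) := by
  have h1 : ∀ i, w i * bary K c (x i) =
      w i * inner ℝ (baryGrad K c) (x i) + w i * bary K c 0 := fun i => by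
    rw [bary_eq_inner_add K c (x i)]; ring
  rw [bary_eq_inner_add, inner_sum]
  simp only [h1, Finset.sum_add_distrib, ← Finset.sum_mul, hw, real_inner_smul_right, one_mul]

/-- The barycenter of a finite set of points. -/
def barycenter (E : Finset (Pt d)) : Pt d := ∑ a ∈ E, (E.card : ℝ)⁻¹ • a

theorem sum_inv_card (hE : E.Nonempty) : ∑ _a ∈ E, (E.card : ℝ)⁻¹ = 1 := by
  have : (E.card : ℝ) ≠ 0 := by exact_mod_cast (Finset.card_pos.2 hE).ne'
  simp [this]

theorem barycenter_mem_hull (hE : E.Nonempty) : barycenter E ∈ hull E :=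
  (convex_convexHull ℝ _).sum_mem (fun _ _ => by positivity) (sum_inv_card hE)
    fun _ hc => subset_convexHull ℝ _ (Finset.mem_coe.2 hc)

theorem FullSim.bary_barycenter (h : FullSim K) (hE : E.Nonempty) (hEK : E ⊆ K) {c : Pt d}
    (hc : c ∈ K) : bary K c (barycenter E) = if c ∈ E then (E.card : ℝ)⁻¹ else 0 := by
  rw [barycenter, bary_sum_smul _ _ _ _ _ (sum_inv_card hE)]
  have : ∀ a ∈ E, (E.card : ℝ)⁻¹ * bary K c a = if c = a then (E.card : ℝ)⁻¹ else 0 := by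
    intro a ha
    rw [h.bary_apply hc (hEK ha)]; simp
  rw [Finset.sum_congr rfl this, Finset.sum_ite_eq]

namespace Mesh

theorem mem_cells : K ∈ T.cells ↔ K ∈ T.faces ∧ K.card = d + 1 := by
  simp [cells]

theorem mem_cellsAt : K ∈ T.cellsAt e ↔ K ∈ T.cells ∧ e ⊆ K := by
  simp [cellsAt]

theorem fullSim (h : K ∈ T.cells) : FullSim K :=
  ⟨T.indep (mem_cells.1 h).1, (mem_cells.1 h).2⟩

theorem mem_faces_of_subset (h : K ∈ T.cells) (hE : E ⊆ K) (hne : E.Nonempty) : E ∈ T.faces :=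
  T.down_closed (mem_cells.1 h).1 hE hne

theorem exists_cellsAt (h : E ∈ T.faces) : ∃ K, K ∈ T.cellsAt E := by
  obtain ⟨K, hK, hEK, hc⟩ := T.pure_dim E h
  exact ⟨K, mem_cellsAt.2 ⟨mem_cells.2 ⟨hK, hc⟩, hEK⟩⟩

theorem hull_subset_closure (h : E ∈ T.faces) : hull E ⊆ closure Ω := by
  rw [← T.space_eq]
  exact T.convexHull_subset_space h

theorem exists_cell_of_mem_closure {x : Pt d} (hx : x ∈ closure Ω) : ∃ K ∈ T.cells, x ∈ hull K := by
  rw [← T.space_eq] at hx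
  obtain ⟨s, hs, hxs⟩ := Geometry.SimplicialComplex.mem_space_iff.1 hx
  obtain ⟨K, hK⟩ := exists_cellsAt hs
  exact ⟨K, (mem_cellsAt.1 hK).1, hull_mono (mem_cellsAt.1 hK).2 hxs⟩

theorem cell_subset (hO : IsOpen Ω) (hC : Convex ℝ Ω) (h : K ∈ T.cells) : cell K ⊆ Ω := by
  rcases Ω.eq_empty_or_nonempty with rfl | hne
  · have := hull_subset_closure (mem_cells.1 h).1
    rw [closure_empty] at this
    exact interior_subset.trans this
  · have h1 := interior_mono (hull_subset_closure (mem_cells.1 h).1)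
    rwa [hC.interior_closure_eq_interior_of_nonempty_interior (by rwa [hO.interior_eq]),
      hO.interior_eq] at h1

theorem hull_inter_subset (h : E ∈ T.faces) (h' : K ∈ T.faces) :
    hull E ∩ hull K ⊆ hull (E ∩ K) := by
  have := T.inter_subset_convexHull h h'
  rw [← Finset.coe_inter] at this
  exact this

/-- Conformity puts the barycenter into the hull of E ∩ K. If a vertex c of E were missing from K,
its coordinate λ_c would vanish there, whereas at the barycenter it is 1 / card E. -/
theorem subset_of_barycenter_mem (hE : E ∈ T.faces) (hK : K ∈ T.faces)
    (h : barycenter E ∈ hull K) : E ⊆ K := by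
  have hne : E.Nonempty := T.nonempty_of_mem_faces hE
  obtain ⟨L, hL⟩ := exists_cellsAt hE
  obtain ⟨hL, hEL⟩ := mem_cellsAt.1 hL
  have hm := hull_inter_subset hE hK ⟨barycenter_mem_hull hne, h⟩
  intro c hc
  by_contra hcK
  have h1 := (fullSim hL).bary_barycenter hne hEL (hEL hc)
  rw [if_pos hc] at h1
  have hsub : E ∩ K ⊆ L.erase c := by
    intro x hx
    obtain ⟨hxE, hxK⟩ := Finset.mem_inter.1 hx
    refine Finset.mem_erase.2 ⟨?_, hEL hxE⟩
    rintro rfl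
    exact hcK hxK
  rw [bary_eq_zero_of_mem_hull_erase (fullSim hL) (hEL hc) (hull_mono hsub hm)] at h1
  have : (0 : ℝ) < (E.card : ℝ)⁻¹ := inv_pos.2 (by exact_mod_cast Finset.card_pos.2 hne)
  linarith

/-- Near the barycenter of a face, the domain is covered by the elements that have that face. -/
theorem exists_ball_cover (hE : E ∈ T.faces) : ∃ δ > 0, ∀ y ∈ closure Ω,
    dist y (barycenter E) < δ → ∃ K ∈ T.cellsAt E, y ∈ hull K := by
  -- The elements that do not have `E` as a face form a finite union of closed sets missing the
  -- barycenter, hence missing a ball around it.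
  have hcl : IsClosed (⋃ K ∈ T.cells.filter (fun K => ¬ E ⊆ K), hull K) :=
    isClosed_biUnion_finset fun K _ => (isCompact_hull K).isClosed
  have hz : barycenter E ∈ (⋃ K ∈ T.cells.filter (fun K => ¬ E ⊆ K), hull K)ᶜ := by
    simp only [Set.mem_compl_iff, Set.mem_iUnion, not_exists, Finset.mem_filter]
    rintro K ⟨hK, hEK⟩ hm
    exact hEK (subset_of_barycenter_mem hE (mem_cells.1 hK).1 hm)
  obtain ⟨δ, hδ, hb⟩ := Metric.isOpen_iff.1 hcl.isOpen_compl _ hz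
  refine ⟨δ, hδ, fun y hy hyd => ?_⟩
  obtain ⟨K, hK, hyK⟩ := exists_cell_of_mem_closure (T := T) hy
  refine ⟨K, mem_cellsAt.2 ⟨hK, ?_⟩, hyK⟩
  by_contra hEK
  exact hb (Metric.mem_ball.2 hyd) (Set.mem_biUnion (Finset.mem_filter.2 ⟨hK, hEK⟩) hyK)

theorem notMem_of_erase_subset (hK : K ∈ T.cells) (ha : a ∈ K) (hK' : K' ∈ T.cells)
    (hne : K' ≠ K) (hs : K.erase a ⊆ K') : a ∉ K' := by
  intro ha'
  have : K ⊆ K' := by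
    intro x hx
    by_cases hxa : x = a
    · rwa [hxa]
    · exact hs (Finset.mem_erase.2 ⟨hxa, hx⟩)
  exact hne (Finset.eq_of_subset_of_card_le this
    (by rw [(mem_cells.1 hK).2, (mem_cells.1 hK').2])).symm

theorem exists_opposite (hK : K ∈ T.cells) (ha : a ∈ K) (hK' : K' ∈ T.cells)
    (hs : K.erase a ⊆ K') : ∃ a' ∈ K', K'.erase a' = K.erase a := by
  have hc : (K.erase a).card = d := by
    rw [Finset.card_erase_of_mem ha, (mem_cells.1 hK).2]; rfl
  have h1 : (K' \ K.erase a).card = 1 := by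
    rw [Finset.card_sdiff_of_subset hs, hc, (mem_cells.1 hK').2]; omega
  obtain ⟨a', ha'⟩ := Finset.card_eq_one.1 h1
  have ha2 : a' ∈ K' \ K.erase a := by rw [ha']; exact Finset.mem_singleton_self _
  obtain ⟨h2, h3⟩ := Finset.mem_sdiff.1 ha2
  refine ⟨a', h2, (Finset.eq_of_subset_of_card_le ?_ ?_).symm⟩
  · intro x hx
    refine Finset.mem_erase.2 ⟨?_, hs hx⟩
    rintro rfl
    exact h3 hx
  · rw [hc, Finset.card_erase_of_mem h2, (mem_cells.1 hK').2]; rfl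

/-- Two elements that share a face lie on opposite sides of it. -/
theorem bary_opposite_neg (hd : 1 ≤ d) (hK : K ∈ T.cells) (ha : a ∈ K) (hK' : K' ∈ T.cells)
    (hne : K' ≠ K) (ha' : a' ∈ K') (he : K'.erase a' = K.erase a) : bary K a a' < 0 := by
  have hF := fullSim hK
  have hF' := fullSim hK'
  have hs : K.erase a ⊆ K' := by rw [← he]; exact Finset.erase_subset _ _
  have haK' := notMem_of_erase_subset hK ha hK' hne hs
  have hene := (hF.isSim_erase hd ha).1
  obtain ⟨b, hb⟩ := hene
  have hb' := Finset.mem_erase.1 hb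
  have hzero : ∀ c ∈ K.erase a, bary K a c = 0 := fun c hc => by
    rw [hF.bary_apply ha (Finset.mem_of_mem_erase hc), if_neg (Finset.ne_of_mem_erase hc).symm]
  by_contra hnn
  rcases (not_lt.1 hnn).eq_or_lt with h0 | hpos
  · apply hF.baryGrad_ne_zero hd ha
    refine hF'.ext_inner (b := b) fun c hc => ?_
    rw [inner_baryGrad, inner_zero_left, hzero b hb, sub_zero]
    by_cases hca : c = a'
    · rw [hca, ← h0]
    · exact hzero c (he ▸ Finset.mem_erase.2 ⟨hca, hc⟩)
  -- If λ_a(a') were positive, the segment from the barycenter of the common face towards a' would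
  -- first run inside both elements with λ_a > 0, but by conformity they meet only where λ_a = 0.
  · have hz := barycenter_mem_hull (E := K.erase a) ⟨b, hb⟩
    have hev : ∀ᶠ t : ℝ in 𝓝[>] 0, ∀ c ∈ K.erase a,
        0 < bary K c (AffineMap.lineMap (barycenter (K.erase a)) a' t) := by
      rw [Filter.eventually_all_finset]
      intro c hc
      have hcont : Continuous fun t : ℝ =>
          bary K c (AffineMap.lineMap (barycenter (K.erase a)) a' t) := by
        simp only [bary_lineMap]; fun_prop
      have h0 : 0 < bary K c (AffineMap.lineMap (barycenter (K.erase a)) a' (0 : ℝ)) := by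
        rw [AffineMap.lineMap_apply_zero, hF.bary_barycenter ⟨b, hb⟩ (Finset.erase_subset _ _)
          (Finset.mem_of_mem_erase hc), if_pos hc]
        exact inv_pos.2 (by exact_mod_cast Finset.card_pos.2 ⟨b, hb⟩)
      exact (hcont.tendsto 0).mono_left nhdsWithin_le_nhds |>.eventually (lt_mem_nhds h0)
    have hev2 : ∀ᶠ t : ℝ in 𝓝[>] 0, t ∈ Set.Ioo (0 : ℝ) 1 := Ioo_mem_nhdsGT one_pos
    obtain ⟨t, ht, ht1⟩ := (hev.and hev2).exists
    have hza : bary K a (barycenter (K.erase a)) = 0 :=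
      bary_eq_zero_of_mem_hull_erase hF ha hz
    have hxa : bary K a (AffineMap.lineMap (barycenter (K.erase a)) a' t) = t * bary K a a' := by
      rw [bary_lineMap, hza]; ring
    have hxK : AffineMap.lineMap (barycenter (K.erase a)) a' t ∈ hull K := by
      rw [hF.mem_hull]
      intro c hc
      by_cases hca : c = a
      · rw [hca, hxa]; exact (mul_pos ht1.1 hpos).le
      · exact (ht c (Finset.mem_erase.2 ⟨hca, hc⟩)).le
    have hxK' : AffineMap.lineMap (barycenter (K.erase a)) a' t ∈ hull K' :=
      (convex_convexHull ℝ _).lineMap_mem (hull_mono hs hz)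
        (subset_convexHull ℝ _ (Finset.mem_coe.2 ha')) ⟨ht1.1.le, ht1.2.le⟩
    have hm := hull_inter_subset (mem_cells.1 hK).1 (mem_cells.1 hK').1 ⟨hxK, hxK'⟩
    have hsub : K ∩ K' ⊆ K.erase a := by
      intro x hx
      obtain ⟨hx1, hx2⟩ := Finset.mem_inter.1 hx
      refine Finset.mem_erase.2 ⟨?_, hx1⟩
      rintro rfl
      exact haK' hx2
    have := bary_eq_zero_of_mem_hull_erase hF ha (hull_mono hsub hm)
    rw [hxa] at this
    have := mul_pos ht1.1 hpos
    linarith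

/-- Both gradients annihilate the edges of the common face, so they are parallel; the factor is read
off at a'. -/
theorem baryGrad_opposite (hd : 1 ≤ d) (hK : K ∈ T.cells) (ha : a ∈ K) (hK' : K' ∈ T.cells)
    (hne : K' ≠ K) (ha' : a' ∈ K') (he : K'.erase a' = K.erase a) :
    baryGrad K a = bary K a a' • baryGrad K' a' := by
  have hF := fullSim hK
  have hF' := fullSim hK'
  obtain ⟨b, hb⟩ := (hF.isSim_erase hd ha).1
  have hb' : b ∈ K'.erase a' := by rwa [he]
  refine hF'.ext_inner (b := b) fun c hc => ?_
  rw [real_inner_smul_left, inner_baryGrad, hF'.inner_baryGrad ha' hc (Finset.mem_of_mem_erase hb'),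
    if_neg (Finset.ne_of_mem_erase hb').symm, hF.bary_apply ha (Finset.mem_of_mem_erase hb),
    if_neg (Finset.ne_of_mem_erase hb).symm, sub_zero, sub_zero]
  by_cases hca : a' = c
  · rw [if_pos hca, hca, mul_one]
  · have : c ∈ K.erase a := he ▸ Finset.mem_erase.2 ⟨Ne.symm hca, hc⟩
    rw [if_neg hca, hF.bary_apply ha (Finset.mem_of_mem_erase this),
      if_neg (Finset.ne_of_mem_erase this).symm, mul_zero]

theorem outwardNormal_opposite (hd : 1 ≤ d) (hK : K ∈ T.cells) (ha : a ∈ K) (hK' : K' ∈ T.cells)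
    (hne : K' ≠ K) (hs : K.erase a ⊆ K') :
    outwardNormal K' (K.erase a) = -outwardNormal K (K.erase a) := by
  obtain ⟨a', ha', he⟩ := exists_opposite hK ha hK' hs
  have h1 := (fullSim hK').outwardNormal_eq hd ha'
  rw [he] at h1
  rw [h1, (fullSim hK).outwardNormal_eq hd ha, baryGrad_opposite hd hK ha hK' hne ha' he]
  have hneg := bary_opposite_neg hd hK ha hK' hne ha' he
  have hg := norm_pos_iff.2 ((fullSim hK').baryGrad_ne_zero hd ha')
  rw [norm_smul, Real.norm_eq_abs, abs_of_neg hneg, smul_smul, neg_neg, ← neg_smul]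
  have := hneg.ne
  congr 1
  field_simp

theorem norm_outwardNormal (hd : 1 ≤ d) (hK : FullSim K) (ha : a ∈ K) :
    ‖outwardNormal K (K.erase a)‖ = 1 := by
  have hg := norm_pos_iff.2 (hK.baryGrad_ne_zero hd ha)
  rw [hK.outwardNormal_eq hd ha, norm_neg, norm_smul, norm_inv, norm_norm,
    inv_mul_cancel₀ hg.ne']

/-- A face is shared by at most two elements. -/
theorem eq_or_eq_of_mem_cellsAt (hd : 1 ≤ d) (hK : K ∈ T.cells) (ha : a ∈ K)
    (hK' : K' ∈ T.cellsAt (K.erase a)) (hne : K' ≠ K) (hK'' : K'' ∈ T.cellsAt (K.erase a)) :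
    K'' = K ∨ K'' = K' := by
  obtain ⟨hK', hs⟩ := mem_cellsAt.1 hK'
  obtain ⟨hK'', hs'⟩ := mem_cellsAt.1 hK''
  by_contra! hcon
  obtain ⟨a', ha', he⟩ := exists_opposite hK ha hK' hs
  -- Three elements at one face would have pairwise opposite unit normals.
  have h1 := outwardNormal_opposite hd hK ha hK' hne hs
  have h2 := outwardNormal_opposite hd hK ha hK'' hcon.1 hs'
  have h3 := outwardNormal_opposite hd hK' ha' hK'' hcon.2 (he ▸ hs')
  rw [he, h1, h2, neg_neg] at h3
  have h4 := norm_outwardNormal hd (fullSim hK) ha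
  have : outwardNormal K (K.erase a) = 0 := by
    have h5 : (2 : ℝ) • outwardNormal K (K.erase a) = 0 := by
      rw [two_smul]; nth_rewrite 1 [← h3]; simp
    simpa using h5
  rw [this] at h4
  simp at h4

theorem exists_erase_eq (hK : K ∈ T.cells) (he : e ⊆ K) (hc : e.card = d) :
    ∃ a ∈ K, K.erase a = e := by
  have h1 : (K \ e).card = 1 := by
    rw [Finset.card_sdiff_of_subset he, hc, (mem_cells.1 hK).2]; omega
  obtain ⟨a, ha⟩ := Finset.card_eq_one.1 h1
  have ha2 : a ∈ K \ e := by rw [ha]; exact Finset.mem_singleton_self _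
  obtain ⟨h2, h3⟩ := Finset.mem_sdiff.1 ha2
  refine ⟨a, h2, (Finset.eq_of_subset_of_card_le ?_ ?_).symm⟩
  · intro x hx
    refine Finset.mem_erase.2 ⟨?_, he hx⟩
    rintro rfl
    exact h3 hx
  · rw [hc, Finset.card_erase_of_mem h2, (mem_cells.1 hK).2]; rfl

theorem mem_interiorFaces : e ∈ T.interiorFaces ↔ e ∈ T.faces ∧ e.card = d ∧
    ∃ K₁ ∈ T.cellsAt e, ∃ K₂ ∈ T.cellsAt e, K₁ ≠ K₂ := by
  simp [interiorFaces]

theorem mem_boundaryFaces : e ∈ T.boundaryFaces ↔ e ∈ T.faces ∧ e.card = d ∧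
    hull e ⊆ frontier Ω := by
  simp [boundaryFaces]

/-- A supporting functional of the domain at a face whose barycenter is not in the domain. -/
theorem exists_support (hO : IsOpen Ω) (hC : Convex ℝ Ω) (hE : E.Nonempty)
    (hcl : hull E ⊆ closure Ω) (hz : barycenter E ∉ Ω) :
    ∃ f : Pt d →L[ℝ] ℝ, (∀ x ∈ Ω, f x < f (barycenter E)) ∧
      (∀ x ∈ closure Ω, f x ≤ f (barycenter E)) ∧ ∀ x ∈ hull E, f x = f (barycenter E) := by
  obtain ⟨f, hf⟩ := geometric_hahn_banach_open_point hC hO hz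
  have hfc : ∀ y ∈ closure Ω, f y ≤ f (barycenter E) := by
    intro y hy
    have : closure Ω ⊆ {y | f y ≤ f (barycenter E)} :=
      closure_minimal (fun y hy => (hf y hy).le) (isClosed_le f.continuous continuous_const)
    exact this hy
  have hcard : (0 : ℝ) < (E.card : ℝ)⁻¹ := inv_pos.2 (by exact_mod_cast Finset.card_pos.2 hE)
  -- The value at the barycenter is the average of the values at the vertices, none of which exceeds
  -- it; hence all of them are equal.
  have hsum : ∑ c ∈ E, ((E.card : ℝ)⁻¹ * f c) = ∑ c ∈ E, ((E.card : ℝ)⁻¹ * f (barycenter E)) := by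
    rw [← Finset.sum_mul, sum_inv_card hE, one_mul]
    conv_rhs => rw [barycenter, map_sum]
    simp
  have hfe : ∀ c ∈ E, f c = f (barycenter E) := by
    intro c hc
    have := (Finset.sum_eq_sum_iff_of_le fun c hc => by
      have := hfc c (hcl (subset_convexHull ℝ _ (Finset.mem_coe.2 hc)))
      gcongr).1 hsum c hc
    exact mul_left_cancel₀ hcard.ne' this
  refine ⟨f, hf, hfc, fun x hx => ?_⟩
  have hconv : Convex ℝ {x | f x = f (barycenter E)} :=
    (convex_singleton _).linear_preimage f.toLinearMap
  exact convexHull_min (t := {x | f x = f (barycenter E)})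
    (fun c hc => hfe c (Finset.mem_coe.1 hc)) hconv hx

/-- At a boundary face the domain lies on one side. -/
theorem inner_outwardNormal_neg (hd : 1 ≤ d) (hO : IsOpen Ω) (hC : Convex ℝ Ω) (hne : Ω.Nonempty)
    (he : e ∈ T.boundaryFaces) (hK : K ∈ T.cellsAt e) {x z : Pt d} (hx : x ∈ Ω) (hz : z ∈ e) :
    inner ℝ (outwardNormal K e) (x - z) < 0 := by
  obtain ⟨hef, hec, hefr⟩ := mem_boundaryFaces.1 he
  obtain ⟨hKc, heK⟩ := mem_cellsAt.1 hK
  obtain ⟨a, ha, rfl⟩ := exists_erase_eq hKc heK hec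
  have hF := fullSim hKc
  have hene := (hF.isSim_erase hd ha).1
  have hzΩ : barycenter (K.erase a) ∉ Ω := by
    have := hefr (barycenter_mem_hull hene)
    rw [hO.frontier_eq] at this
    exact this.2
  obtain ⟨f, hf, hfc, hfe'⟩ := exists_support hO hC hene (hull_subset_closure hef) hzΩ
  have hvert : ∀ c ∈ K, c ∈ closure Ω := fun c hc =>
    hull_subset_closure (mem_cells.1 hKc).1 (subset_convexHull ℝ _ (Finset.mem_coe.2 hc))
  have hfe : ∀ c ∈ K.erase a, f c = f (barycenter (K.erase a)) := fun c hc =>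
    hfe' c (subset_convexHull ℝ _ (Finset.mem_coe.2 hc))
  set w := (InnerProductSpace.toDual ℝ (Pt d)).symm f
  have hw : ∀ y, inner ℝ w y = f y := fun y => InnerProductSpace.toDual_symm_apply
  -- The supporting functional is constant on the face and therefore a multiple of ∇λ_a; evaluation
  -- at `a` shows on which side the domain lies.
  have hwg : w = f (a - z) • baryGrad K a := by
    refine hF.ext_inner (b := z) fun c hc => ?_
    rw [hw, real_inner_smul_left, hF.inner_baryGrad ha hc (Finset.mem_of_mem_erase hz),
      if_neg (Finset.ne_of_mem_erase hz).symm, sub_zero]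
    by_cases hca : a = c
    · rw [if_pos hca, hca, mul_one]
    · rw [if_neg hca, map_sub, hfe c (Finset.mem_erase.2 ⟨Ne.symm hca, hc⟩), hfe z hz]; ring
  have h1 : f (x - z) < 0 := by rw [map_sub, hfe z hz]; linarith [hf x hx]
  have h2 : f (a - z) ≤ 0 := by rw [map_sub, hfe z hz]; linarith [hfc a (hvert a ha)]
  have h3 : f (x - z) = f (a - z) * inner ℝ (baryGrad K a) (x - z) := by
    rw [← hw, hwg, real_inner_smul_left]
  rw [h3] at h1
  have h4 : 0 < inner ℝ (baryGrad K a) (x - z) := by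
    by_contra hcon
    have := mul_nonneg_of_nonpos_of_nonpos h2 (not_lt.1 hcon)
    linarith
  rw [hF.outwardNormal_eq hd ha, inner_neg_left, real_inner_smul_left]
  have hg := inv_pos.2 (norm_pos_iff.2 (hF.baryGrad_ne_zero hd ha))
  have := mul_pos hg h4
  linarith

theorem inner_outwardNormal_nonpos (hd : 1 ≤ d) (hO : IsOpen Ω) (hC : Convex ℝ Ω) (hne : Ω.Nonempty)
    (he : e ∈ T.boundaryFaces) (hK : K ∈ T.cellsAt e) {x z : Pt d} (hx : x ∈ closure Ω)
    (hz : z ∈ e) : inner ℝ (outwardNormal K e) (x - z) ≤ 0 := by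
  have : closure Ω ⊆ {x | inner ℝ (outwardNormal K e) (x - z) ≤ 0} :=
    closure_minimal (fun x hx => (inner_outwardNormal_neg hd hO hC hne he hK hx hz).le)
      (isClosed_le (by fun_prop) continuous_const)
  exact this hx

/-- A boundary face belongs to a single element. -/
theorem eq_of_mem_cellsAt_boundary (hd : 1 ≤ d) (hO : IsOpen Ω) (hC : Convex ℝ Ω)
    (hne : Ω.Nonempty) (he : e ∈ T.boundaryFaces) (hK : K ∈ T.cellsAt e) (hK' : K' ∈ T.cellsAt e) :
    K' = K := by
  by_contra hKK
  have hn := fun x z => inner_outwardNormal_nonpos hd hO hC hne he hK (x := x) (z := z)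
  obtain ⟨hef, hec, hefr⟩ := mem_boundaryFaces.1 he
  obtain ⟨hKc, heK⟩ := mem_cellsAt.1 hK
  obtain ⟨hKc', heK'⟩ := mem_cellsAt.1 hK'
  obtain ⟨a, ha, rfl⟩ := exists_erase_eq hKc heK hec
  obtain ⟨a', ha', he'⟩ := exists_opposite hKc ha hKc' heK'
  -- A second element would have its opposite vertex strictly beyond the supporting hyperplane of
  -- the face.
  have hneg := bary_opposite_neg hd hKc ha hKc' hKK ha' he'
  have hF := fullSim hKc
  obtain ⟨z, hz⟩ := (hF.isSim_erase hd ha).1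
  have := hn a' z (hull_subset_closure (mem_cells.1 hKc').1
    (subset_convexHull ℝ _ (Finset.mem_coe.2 ha'))) hz
  rw [hF.outwardNormal_eq hd ha, inner_neg_left, real_inner_smul_left, inner_baryGrad,
    hF.bary_apply ha (Finset.mem_of_mem_erase hz), if_neg (Finset.ne_of_mem_erase hz).symm,
    sub_zero] at this
  have hg := inv_pos.2 (norm_pos_iff.2 (hF.baryGrad_ne_zero hd ha))
  have := mul_neg_of_pos_of_neg hg hneg
  linarith

/-- A face of a single element lies on the boundary. -/
theorem mem_boundaryFaces_of_unique (hd : 1 ≤ d) (hO : IsOpen Ω) (hC : Convex ℝ Ω)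
    (hK : K ∈ T.cells) (ha : a ∈ K)
    (huniq : ∀ K' ∈ T.cellsAt (K.erase a), K' = K) : K.erase a ∈ T.boundaryFaces := by
  have hF := fullSim hK
  have hene := (hF.isSim_erase hd ha).1
  have hef : K.erase a ∈ T.faces := mem_faces_of_subset hK (Finset.erase_subset _ _) hene
  have hec : (K.erase a).card = d := by rw [Finset.card_erase_of_mem ha, hF.2]; rfl
  refine mem_boundaryFaces.2 ⟨hef, hec, ?_⟩
  have hz := barycenter_mem_hull hene
  have hza : bary K a (barycenter (K.erase a)) = 0 := bary_eq_zero_of_mem_hull_erase hF ha hz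
  have hcl := hull_subset_closure hef
  -- Otherwise points slightly beyond the face, as seen from `a`, lie in Ω and close to the
  -- barycenter, where only `K` covers the domain; but λ_a is negative at them.
  have hzΩ : barycenter (K.erase a) ∉ Ω := by
    intro hzΩ
    obtain ⟨δ, hδ, hcov⟩ := exists_ball_cover hef
    obtain ⟨y, hy⟩ : ∃ y : ℝ → Pt d, ∀ t, y t =
        AffineMap.lineMap (barycenter (K.erase a)) a (-t) := ⟨_, fun _ => rfl⟩
    have hyc : Continuous y := by
      rw [funext hy]
      exact AffineMap.lineMap_continuous.comp continuous_neg
    have hy0 : y 0 = barycenter (K.erase a) := by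
      rw [hy, neg_zero, AffineMap.lineMap_apply_zero]
    have h1 : ∀ᶠ t in 𝓝[>] (0 : ℝ), y t ∈ Ω := by
      refine (hyc.tendsto 0).mono_left nhdsWithin_le_nhds |>.eventually (hO.mem_nhds ?_)
      rwa [hy0]
    have h2 : ∀ᶠ t in 𝓝[>] (0 : ℝ), y t ∈ Metric.ball (barycenter (K.erase a)) δ := by
      refine (hyc.tendsto 0).mono_left nhdsWithin_le_nhds |>.eventually
        (Metric.isOpen_ball.mem_nhds ?_)
      rw [hy0]; exact Metric.mem_ball_self hδ
    obtain ⟨t, ⟨ht1, ht2⟩, ht0⟩ := ((h1.and h2).and self_mem_nhdsWithin).exists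
    obtain ⟨L, hL, hyL⟩ := hcov (y t) (subset_closure ht1) (Metric.mem_ball.1 ht2)
    rw [huniq L hL] at hyL
    have h3 := hF.mem_hull.1 hyL a ha
    rw [hy, bary_lineMap, hza, hF.bary_apply ha ha, if_pos rfl] at h3
    have : (0 : ℝ) < t := ht0
    linarith
  -- The supporting functional takes its maximum on the entire face, so no point of the face is in
  -- the open set Ω.
  obtain ⟨f, hf, hfc, hfe'⟩ := exists_support hO hC hene hcl hzΩ
  intro y hy
  rw [hO.frontier_eq]
  refine ⟨hcl hy, fun hyΩ => ?_⟩
  have hye := hfe' y hy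
  have := hf y hyΩ
  linarith

end Mesh
end
end CordesLS

/-! ### Sums over elements and faces, and the star of a ridge -/

namespace CordesLS
open scoped Classical in
section

variable {d : ℕ} {Ω : Set (Pt d)} {T : Mesh Ω} {K K' K'' E e : Finset (Pt d)} {a a' : Pt d}

namespace Mesh

theorem erase_mem (hd : 1 ≤ d) (hO : IsOpen Ω) (hC : Convex ℝ Ω)
    (hK : K ∈ T.cells) (ha : a ∈ K) :
    K.erase a ∈ T.interiorFaces ∨ K.erase a ∈ T.boundaryFaces := by
  by_cases h : ∀ K' ∈ T.cellsAt (K.erase a), K' = K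
  · exact Or.inr (mem_boundaryFaces_of_unique hd hO hC hK ha h)
  · push Not at h
    obtain ⟨K', hK', hne⟩ := h
    have hF := fullSim hK
    refine Or.inl (mem_interiorFaces.2 ⟨mem_faces_of_subset hK (Finset.erase_subset _ _)
      (hF.isSim_erase hd ha).1, ?_, K', hK', K, ?_, hne⟩)
    · rw [Finset.card_erase_of_mem ha, hF.2]; rfl
    · exact mem_cellsAt.2 ⟨hK, Finset.erase_subset _ _⟩

theorem disjoint_faces (hd : 1 ≤ d) (hO : IsOpen Ω) (hC : Convex ℝ Ω) (hne : Ω.Nonempty) :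
    Disjoint T.interiorFaces T.boundaryFaces := by
  rw [Finset.disjoint_left]
  intro e h1 h2
  obtain ⟨_, _, K₁, h3, K₂, h4, h5⟩ := mem_interiorFaces.1 h1
  exact h5 (eq_of_mem_cellsAt_boundary hd hO hC hne h2 h4 h3)

/-- The faces of codimension one. -/
def sides (T : Mesh Ω) : Finset (Finset (Pt d)) := T.interiorFaces ∪ T.boundaryFaces

theorem card_of_mem_sides (he : e ∈ T.sides) : e.card = d := by
  rcases Finset.mem_union.1 he with h | h
  · exact (mem_interiorFaces.1 h).2.1
  · exact (mem_boundaryFaces.1 h).2.1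

theorem mem_faces_of_mem_sides (he : e ∈ T.sides) : e ∈ T.faces := by
  rcases Finset.mem_union.1 he with h | h
  · exact (mem_interiorFaces.1 h).1
  · exact (mem_boundaryFaces.1 h).1

/-- Pairs of an element and a vertex correspond to pairs of a face and an element containing it,
since a face determines the opposite vertex. This is how boundary terms of elements are regrouped
face by face. -/
theorem sum_cells_erase (hd : 1 ≤ d) (hO : IsOpen Ω) (hC : Convex ℝ Ω)
    (F : Finset (Pt d) → Finset (Pt d) → ℝ) :
    ∑ K ∈ T.cells, ∑ a ∈ K, F K (K.erase a) = ∑ e ∈ T.sides, ∑ K ∈ T.cellsAt e, F K e := by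
  have h1 : ∀ K ∈ T.cells, ∑ a ∈ K, F K (K.erase a) = ∑ e ∈ T.sides with e ⊆ K, F K e := by
    intro K hK
    refine Finset.sum_bij (fun a _ => K.erase a) ?_ ?_ ?_ fun _ _ => rfl
    · intro a ha
      exact Finset.mem_filter.2 ⟨Finset.mem_union.2 (erase_mem hd hO hC hK ha),
        Finset.erase_subset _ _⟩
    · intro a ha b hb hab
      by_contra hne
      have : b ∈ K.erase a := Finset.mem_erase.2 ⟨Ne.symm hne, hb⟩
      rw [hab] at this
      exact Finset.notMem_erase b K this
    · intro e he
      obtain ⟨he1, he2⟩ := Finset.mem_filter.1 he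
      obtain ⟨a, ha, hae⟩ := exists_erase_eq hK he2 (card_of_mem_sides he1)
      exact ⟨a, ha, hae⟩
  rw [Finset.sum_congr rfl h1]
  refine Finset.sum_comm' fun K e => ?_
  simp only [Finset.mem_filter, mem_cellsAt]
  tauto

theorem sum_sides (hd : 1 ≤ d) (hO : IsOpen Ω) (hC : Convex ℝ Ω) (hne : Ω.Nonempty)
    (F : Finset (Pt d) → ℝ) :
    ∑ e ∈ T.sides, F e = ∑ e ∈ T.interiorFaces, F e + ∑ e ∈ T.boundaryFaces, F e :=
  Finset.sum_union (disjoint_faces hd hO hC hne)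

/-! ### Connectedness of the elements around a face of codimension two -/

/-- Two elements that contain `E` are adjacent if they share a face. -/
def starGraph (T : Mesh Ω) (E : Finset (Pt d)) : SimpleGraph {K // K ∈ T.cellsAt E} where
  Adj A B := A ≠ B ∧ (A.1 ∩ B.1).card = d
  symm := ⟨fun A B h => ⟨h.1.symm, by rw [Finset.inter_comm]; exact h.2⟩⟩
  loopless := ⟨fun A h => h.1 rfl⟩

/-- Convexity of the domain is the reason. Near the barycenter of `E` a point of one element is
joined to a point of the other by a segment that misses the simplex `E`, and the elements around `E`
cover this segment. If the elements fell into two groups without adjacency, connectedness of the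
segment would give a point common to an element of each group. It lies in a common face larger than
`E`, which has codimension one, so these two elements are adjacent after all. -/
theorem starGraph_preconnected (hd : 2 ≤ d) (hC : Convex ℝ Ω)
    (hE : E ∈ T.faces) (hc : E.card + 1 = d) : (T.starGraph E).Preconnected := by
  intro A B
  by_contra hAB
  have hEne : E.Nonempty := T.nonempty_of_mem_faces hE
  obtain ⟨hA, hEA⟩ := mem_cellsAt.1 A.2
  obtain ⟨hB, hEB⟩ := mem_cellsAt.1 B.2
  have hF := fullSim hA
  have hF' := fullSim hB
  have h2 : (A.1 \ E).card = 2 := by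
    rw [Finset.card_sdiff_of_subset hEA, hF.2]; omega
  obtain ⟨u, v, huv, huvE⟩ := Finset.card_eq_two.1 h2
  have hu : u ∈ A.1 \ E := by rw [huvE]; simp
  have hv : v ∈ A.1 \ E := by rw [huvE]; simp
  obtain ⟨huA, huE⟩ := Finset.mem_sdiff.1 hu
  obtain ⟨hvA, hvE⟩ := Finset.mem_sdiff.1 hv
  have hEu : E ⊆ A.1.erase u := fun x hx => Finset.mem_erase.2
    ⟨fun h => huE (h ▸ hx), hEA hx⟩
  have hEv : E ⊆ A.1.erase v := fun x hx => Finset.mem_erase.2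
    ⟨fun h => hvE (h ▸ hx), hEA hx⟩
  obtain ⟨b, hb⟩ := hEne
  have hbu : bary A.1 u b = 0 := by
    rw [hF.bary_apply huA (hEA hb), if_neg (fun h : u = b => huE (h ▸ hb))]
  -- The segment will run from a point towards `v`, where λ_u = 0, to a point towards `c`. As λ_u(c)
  -- ≠ 0, λ_u vanishes only at its start, where λ_v > 0; on `E` both vanish, so the segment avoids
  -- `E`.
  obtain ⟨c, hcB, hcu⟩ : ∃ c ∈ B.1, bary A.1 u c ≠ 0 := by
    by_contra! hcon
    apply hF.baryGrad_ne_zero (by omega) huA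
    refine hF'.ext_inner (b := b) fun c hc => ?_
    rw [inner_baryGrad, hcon c hc, hbu, inner_zero_left, sub_zero]
  set z := barycenter E with hz
  have hzE : z ∈ hull E := barycenter_mem_hull ⟨b, hb⟩
  obtain ⟨δ, hδ, hcov⟩ := exists_ball_cover hE
  obtain ⟨t, ht0, ht1, htv, htc⟩ : ∃ t : ℝ, 0 < t ∧ t ≤ 1 ∧
      AffineMap.lineMap z v t ∈ Metric.ball z δ ∧ AffineMap.lineMap z c t ∈ Metric.ball z δ := by
    have hlim : ∀ w : Pt d, ∀ᶠ t in 𝓝[>] (0 : ℝ), AffineMap.lineMap z w t ∈ Metric.ball z δ := by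
      intro w
      have hcont : Continuous fun t : ℝ => AffineMap.lineMap z w t :=
        AffineMap.lineMap_continuous
      refine (hcont.tendsto 0).mono_left nhdsWithin_le_nhds |>.eventually
        (Metric.isOpen_ball.mem_nhds ?_)
      rw [AffineMap.lineMap_apply_zero]; exact Metric.mem_ball_self hδ
    have h01 : ∀ᶠ t : ℝ in 𝓝[>] 0, t ∈ Set.Ioc (0 : ℝ) 1 := Ioc_mem_nhdsGT one_pos
    obtain ⟨t, ⟨h1, h2⟩, h3⟩ := (((hlim v).and (hlim c)).and h01).exists
    exact ⟨t, h3.1, h3.2, h1, h2⟩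
  set x := AffineMap.lineMap z v t with hx
  set y := AffineMap.lineMap z c t with hy
  have hxA : x ∈ hull A.1 := (convex_convexHull ℝ _).lineMap_mem (hull_mono hEA hzE)
    (subset_convexHull ℝ _ (Finset.mem_coe.2 hvA)) ⟨ht0.le, ht1⟩
  have hyB : y ∈ hull B.1 := (convex_convexHull ℝ _).lineMap_mem (hull_mono hEB hzE)
    (subset_convexHull ℝ _ (Finset.mem_coe.2 hcB)) ⟨ht0.le, ht1⟩
  have hclA := hull_subset_closure (mem_cells.1 hA).1
  have hclB := hull_subset_closure (mem_cells.1 hB).1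
  have hseg : ∀ w ∈ segment ℝ x y, ∃ L : {K // K ∈ T.cellsAt E}, w ∈ hull L.1 := by
    intro w hw
    obtain ⟨L, hL, hwL⟩ := hcov w (hC.closure.segment_subset (hclA hxA) (hclB hyB) hw)
      (Metric.mem_ball.1 ((convex_ball z δ).segment_subset htv htc hw))
    exact ⟨⟨L, hL⟩, hwL⟩
  have hzero : ∀ w ∈ segment ℝ x y, w ∉ hull E := by
    intro w hw hwE
    rw [segment_eq_image_lineMap] at hw
    obtain ⟨s, hs, rfl⟩ := hw
    have e1 := bary_eq_zero_of_mem_hull_erase hF huA (hull_mono hEu hwE)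
    have e2 := bary_eq_zero_of_mem_hull_erase hF hvA (hull_mono hEv hwE)
    have hzu := bary_eq_zero_of_mem_hull_erase hF huA (hull_mono hEu hzE)
    have hzv := bary_eq_zero_of_mem_hull_erase hF hvA (hull_mono hEv hzE)
    rw [bary_lineMap, hx, hy, bary_lineMap, bary_lineMap, hzu,
      hF.bary_apply huA hvA, if_neg huv] at e1
    rw [bary_lineMap, hx, hy, bary_lineMap, bary_lineMap, hzv,
      hF.bary_apply hvA hvA, if_pos rfl] at e2
    have hs0 : s = 0 := by
      have : s * (t * bary A.1 u c) = 0 := by linarith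
      rcases mul_eq_zero.1 this with h | h
      · exact h
      · exact absurd h (mul_ne_zero ht0.ne' hcu)
    rw [hs0] at e2
    apply ht0.ne'
    linarith
  let U : Finset {K // K ∈ T.cellsAt E} := Finset.univ.filter fun L => (T.starGraph E).Reachable A L
  have hclosed : ∀ S : Finset {K // K ∈ T.cellsAt E}, IsClosed (⋃ L ∈ S, hull L.1) := fun S =>
    isClosed_biUnion_finset fun L _ => (isCompact_hull L.1).isClosed
  have hpre := isPreconnected_closed_iff.1 (convex_segment x y).isPreconnected _ _ (hclosed U)
    (hclosed Uᶜ) ?_ ⟨x, left_mem_segment ℝ x y, ?_⟩ ⟨y, right_mem_segment ℝ x y, ?_⟩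
  · obtain ⟨w, hw, hwU, hwV⟩ := hpre
    simp only [Set.mem_iUnion] at hwU hwV
    obtain ⟨L, hLU, hwL⟩ := hwU
    obtain ⟨M, hMV, hwM⟩ := hwV
    have hLr := (Finset.mem_filter.1 hLU).2
    have hMr : ¬ (T.starGraph E).Reachable A M := fun h =>
      (Finset.mem_compl.1 hMV) (Finset.mem_filter.2 ⟨Finset.mem_univ _, h⟩)
    obtain ⟨hL, hEL⟩ := mem_cellsAt.1 L.2
    obtain ⟨hM, hEM⟩ := mem_cellsAt.1 M.2
    have hwLM := hull_inter_subset (mem_cells.1 hL).1 (mem_cells.1 hM).1 ⟨hwL, hwM⟩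
    have hsub : E ⊆ L.1 ∩ M.1 := Finset.subset_inter hEL hEM
    have hneE : E ≠ L.1 ∩ M.1 := by
      intro h
      rw [← h] at hwLM
      exact hzero w hw hwLM
    have hcard1 := Finset.card_lt_card (Finset.ssubset_iff_subset_ne.2 ⟨hsub, hneE⟩)
    have hLM : L ≠ M := by
      rintro rfl
      exact hMr hLr
    have hcard2 : (L.1 ∩ M.1).card ≤ d := by
      by_contra hgt
      have h1 : L.1 ∩ M.1 = L.1 := Finset.eq_of_subset_of_card_le Finset.inter_subset_left (by
        rw [(fullSim hL).2]; omega)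
      have h2 : L.1 ∩ M.1 = M.1 := Finset.eq_of_subset_of_card_le Finset.inter_subset_right (by
        rw [(fullSim hM).2]; omega)
      exact hLM (Subtype.ext (h1.symm.trans h2))
    have hadj : (T.starGraph E).Adj L M := ⟨hLM, by omega⟩
    exact hMr (hLr.trans hadj.reachable)
  · intro w hw
    obtain ⟨L, hL⟩ := hseg w hw
    by_cases h : L ∈ U
    · exact Or.inl (Set.mem_biUnion h hL)
    · exact Or.inr (Set.mem_biUnion (Finset.mem_compl.2 h) hL)
  · exact Set.mem_biUnion (Finset.mem_filter.2 ⟨Finset.mem_univ _, SimpleGraph.Reachable.refl A⟩) hxA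
  · exact Set.mem_biUnion (Finset.mem_compl.2 fun h => hAB (Finset.mem_filter.1 h).2) hyB

end Mesh

theorem _root_.SimpleGraph.Walk.le_pow_mul {V : Type*} {G : SimpleGraph V} {ψ : V → ℝ}
    {κ : ℝ} (hκ : 0 ≤ κ) (h : ∀ u v, G.Adj u v → ψ u ≤ κ * ψ v) {u v : V} (p : G.Walk u v) :
    ψ u ≤ κ ^ p.length * ψ v := by
  induction p with
  | nil => simp
  | cons hadj p ih =>
    rw [SimpleGraph.Walk.length_cons, pow_succ']
    calc _ ≤ κ * ψ _ := h _ _ hadj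
      _ ≤ κ * (κ ^ p.length * ψ _) := by gcongr
      _ = _ := by ring

theorem _root_.SimpleGraph.Walk.norm_sub_le {V F : Type*} [NormedAddCommGroup F]
    {G : SimpleGraph V} {f : V → F} {R : ℝ} (h : ∀ u v, G.Adj u v → ‖f u - f v‖ ≤ R) {u v : V}
    (p : G.Walk u v) : ‖f u - f v‖ ≤ p.length * R := by
  induction p with
  | nil => simp
  | @cons a b c hadj p ih =>
    rw [SimpleGraph.Walk.length_cons]
    have : f a - f c = (f a - f b) + (f b - f c) := by abel
    rw [this]
    have h1 := h _ _ hadj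
    push_cast
    calc _ ≤ ‖f a - f b‖ + ‖f b - f c‖ := norm_add_le _ _
      _ ≤ R + p.length * R := by gcongr
      _ = _ := by ring

theorem _root_.SimpleGraph.Preconnected.exists_walk_length_le {V : Type*} [Fintype V]
    {G : SimpleGraph V} (h : G.Preconnected) (u v : V) : ∃ p : G.Walk u v, p.length ≤ Fintype.card V := by
  obtain ⟨p⟩ := h u v
  exact ⟨p.toPath.1, p.toPath.2.length_lt.le⟩

end
end CordesLS

namespace CordesLS
open scoped Classical in
section

variable {d : ℕ} {Ω : Set (Pt d)} {T : Mesh Ω} {K K' K'' E e : Finset (Pt d)} {a a' : Pt d}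
  {σ : ℝ}

/-! ### Shape regularity -/

theorem dist_le_diam_hull {x y : Pt d} (hx : x ∈ hull K) (hy : y ∈ hull K) :
    dist x y ≤ Metric.diam (hull K) :=
  Metric.dist_le_diam_of_mem (isCompact_hull K).isBounded hx hy

theorem mem_hull_of_mem {x : Pt d} (hx : x ∈ K) : x ∈ hull K :=
  subset_convexHull ℝ _ (Finset.mem_coe.2 hx)

theorem FullSim.one_le_norm_mul_dist (h : FullSim K) {b : Pt d} (ha : a ∈ K) (hb : b ∈ K)
    (hab : a ≠ b) : 1 ≤ ‖baryGrad K a‖ * dist a b := by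
  have h1 := h.inner_baryGrad ha ha hb
  rw [if_pos rfl, if_neg hab, sub_zero] at h1
  rw [← h1, dist_eq_norm]
  exact real_inner_le_norm _ _

theorem FullSim.diam_pos (hd : 1 ≤ d) (h : FullSim K) : 0 < Metric.diam (hull K) := by
  obtain ⟨a, ha⟩ := h.isSim.1
  obtain ⟨b, hb⟩ := (h.isSim_erase hd ha).1
  obtain ⟨hba, hb⟩ := Finset.mem_erase.1 hb
  exact (dist_pos.2 hba).trans_le (dist_le_diam_hull (mem_hull_of_mem hb) (mem_hull_of_mem ha))

theorem FullSim.one_le_norm_mul_diam (hd : 1 ≤ d) (h : FullSim K) (ha : a ∈ K) :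
    1 ≤ ‖baryGrad K a‖ * Metric.diam (hull K) := by
  obtain ⟨b, hb⟩ := (h.isSim_erase hd ha).1
  obtain ⟨hba, hb⟩ := Finset.mem_erase.1 hb
  refine (h.one_le_norm_mul_dist ha hb hba.symm).trans ?_
  have := dist_le_diam_hull (mem_hull_of_mem ha) (mem_hull_of_mem hb)
  gcongr

/-- Along the diameter of the ball in direction ∇λ_a the coordinate λ_a grows by ‖∇λ_a‖ · 2r, while
its values stay in [0, 1]. -/
theorem FullSim.norm_baryGrad_mul_le (hd : 1 ≤ d) (h : FullSim K) (ha : a ∈ K) {x : Pt d} {r : ℝ}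
    (hr : 0 < r) (hball : Metric.closedBall x r ⊆ hull K) : ‖baryGrad K a‖ * (2 * r) ≤ 1 := by
  have hg := norm_pos_iff.2 (h.baryGrad_ne_zero hd ha)
  set g := baryGrad K a
  have hmem : ∀ s : ℝ, |s| ≤ r → x + (s * ‖g‖⁻¹) • g ∈ hull K := fun s hs => hball (by
    rw [Metric.mem_closedBall, dist_eq_norm, add_sub_cancel_left, norm_smul, norm_mul, norm_inv,
      norm_norm, mul_assoc, inv_mul_cancel₀ hg.ne', mul_one]
    exact hs)
  have h1 := hmem r (by rw [abs_of_pos hr])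
  have h2 := hmem (-r) (by rw [abs_neg, abs_of_pos hr])
  have h3 := CordesLS.inner_baryGrad K a (x + (r * ‖g‖⁻¹) • g) (x + (-r * ‖g‖⁻¹) • g)
  have h4 := h.bary_le_one h1 ha
  have h5 := h.mem_hull.1 h2 a ha
  have h6 : x + (r * ‖g‖⁻¹) • g - (x + (-r * ‖g‖⁻¹) • g) = (2 * r * ‖g‖⁻¹) • g := by
    rw [add_sub_add_left_eq_sub, ← sub_smul]; congr 1; ring
  rw [h6, real_inner_smul_right, real_inner_self_eq_norm_sq] at h3
  have h7 : 2 * r * ‖g‖⁻¹ * ‖g‖ ^ 2 = ‖g‖ * (2 * r) := by field_simp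
  rw [h7] at h3
  linarith

namespace Mesh

/-- With `one_le_norm_mul_diam` this makes ‖∇λ_a‖ comparable to 1/h_K. All uses of shape regularity
pass through it, except the count of elements around a face. -/
theorem ShapeRegular.norm_baryGrad_mul_diam_le (hd : 1 ≤ d) (hT : T.ShapeRegular σ)
    (hK : K ∈ T.cells) (ha : a ∈ K) : ‖baryGrad K a‖ * Metric.diam (hull K) ≤ σ := by
  obtain ⟨x, r, hr, hball, hdiam⟩ := hT K hK
  have hF := fullSim hK
  have h1 := hF.norm_baryGrad_mul_le hd ha hr hball
  have h2 := hF.diam_pos hd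
  have hσ : 0 ≤ σ := by
    by_contra hneg
    have : σ * (2 * r) < 0 := mul_neg_of_neg_of_pos (not_le.1 hneg) (by linarith)
    linarith
  calc ‖baryGrad K a‖ * Metric.diam (hull K) ≤ ‖baryGrad K a‖ * (σ * (2 * r)) := by gcongr
    _ = σ * (‖baryGrad K a‖ * (2 * r)) := by ring
    _ ≤ σ * 1 := by gcongr
    _ = σ := mul_one σ

theorem ShapeRegular.one_le (hd : 1 ≤ d) (hT : T.ShapeRegular σ) (hK : K ∈ T.cells) : 1 ≤ σ := by
  obtain ⟨a, ha⟩ := (fullSim hK).isSim.1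
  exact ((fullSim hK).one_le_norm_mul_diam hd ha).trans (hT.norm_baryGrad_mul_diam_le hd hK ha)

/-- A face has at least two vertices b, c, and their distance is at least 1/‖∇λ_b‖ ≥ h_K/σ. -/
theorem ShapeRegular.diam_le_hFace (hd : 2 ≤ d) (hT : T.ShapeRegular σ)
    (hK : K ∈ T.cells) (heK : e ⊆ K) (hec : e.card = d) :
    Metric.diam (hull K) ≤ σ * hFace e := by
  have hF := fullSim hK
  obtain ⟨b, hb, c, hc, hbc⟩ := Finset.one_lt_card.1 (show 1 < e.card by omega)
  have h1 := hF.one_le_norm_mul_dist (heK hb) (heK hc) hbc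
  have h2 : dist b c ≤ hFace e := dist_le_diam_hull (mem_hull_of_mem hb) (mem_hull_of_mem hc)
  have h3 := hT.norm_baryGrad_mul_diam_le (by omega) hK (heK hb)
  have h4 := hF.diam_pos (by omega)
  have h5 : (0 : ℝ) ≤ dist b c := dist_nonneg
  calc Metric.diam (hull K) = 1 * Metric.diam (hull K) := (one_mul _).symm
    _ ≤ (‖baryGrad K b‖ * dist b c) * Metric.diam (hull K) := by gcongr
    _ = (‖baryGrad K b‖ * Metric.diam (hull K)) * dist b c := by ring
    _ ≤ σ * dist b c := by gcongr
    _ ≤ σ * hFace e := by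
      have := hT.one_le (by omega) hK
      gcongr

theorem hFace_le_diam (he : e ⊆ K) : hFace e ≤ Metric.diam (hull K) :=
  Metric.diam_mono (hull_mono he) (isCompact_hull K).isBounded

theorem hFace_pos (hd : 2 ≤ d) (hec : e.card = d) : 0 < hFace e := by
  obtain ⟨b, hb, c, hc, hbc⟩ := Finset.one_lt_card.1 (show 1 < e.card by omega)
  exact (dist_pos.2 hbc).trans_le (dist_le_diam_hull (mem_hull_of_mem hb) (mem_hull_of_mem hc))

theorem disjoint_cell (hK : K ∈ T.cells) (hK' : K' ∈ T.cells) (hne : K ≠ K') :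
    Disjoint (cell K) (cell K') := by
  rw [Set.disjoint_left]
  intro x hx hx'
  have hm := hull_inter_subset (mem_cells.1 hK).1 (mem_cells.1 hK').1
    ⟨interior_subset hx, interior_subset hx'⟩
  obtain ⟨c, hc, hc'⟩ : ∃ c ∈ K, c ∉ K' := by
    by_contra! hcon
    exact hne (Finset.eq_of_subset_of_card_le hcon
      (by rw [(mem_cells.1 hK).2, (mem_cells.1 hK').2]))
  have hsub : K ∩ K' ⊆ K.erase c := by
    intro y hy
    obtain ⟨hy1, hy2⟩ := Finset.mem_inter.1 hy
    exact Finset.mem_erase.2 ⟨fun h => hc' (h ▸ hy2), hy1⟩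
  have h0 := bary_eq_zero_of_mem_hull_erase (fullSim hK) hc (hull_mono hsub hm)
  have := (fullSim hK).mem_cell.1 hx c hc
  linarith

/-- The number of elements around a face is bounded in terms of the shape regularity. -/
theorem ShapeRegular.card_cellsAt_le (hd : 1 ≤ d) (hT : T.ShapeRegular σ) (hE : E.Nonempty)
    (hne : (T.cellsAt E).Nonempty) :
    ((T.cellsAt E).card : ℝ) ≤ (2 * σ) ^ d := by
  obtain ⟨z, hz⟩ := hE
  obtain ⟨K₀, hK₀, hmin⟩ := Finset.exists_min_image (T.cellsAt E)
    (fun K => Metric.diam (hull K)) hne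
  set ρ := Metric.diam (hull K₀) with hρ
  have hρ0 : 0 < ρ := (fullSim (mem_cellsAt.1 hK₀).1).diam_pos hd
  have hσ : 1 ≤ σ := hT.one_le hd (mem_cellsAt.1 hK₀).1
  -- Let ρ be the smallest diameter in the star. Contracting an element by ρ/h_K towards the common
  -- vertex `z` keeps it inside itself, moves it to within ρ of `z`, and leaves a ball of radius
  -- ρ/(2σ). These balls are disjoint, and comparing volumes gives the bound.
  have hball : ∀ K ∈ T.cellsAt E, ∃ c : Pt d, Metric.ball c (ρ / (2 * σ)) ⊆ cell K ∧
      Metric.ball c (ρ / (2 * σ)) ⊆ Metric.closedBall z ρ := by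
    intro K hK
    obtain ⟨hKc, hEK⟩ := mem_cellsAt.1 hK
    obtain ⟨x, r, hr, hb, hdiam⟩ := hT K hKc
    have hF := fullSim hKc
    have hh := hF.diam_pos hd
    set h := Metric.diam (hull K) with hh'
    have hρh : ρ ≤ h := hmin K hK
    set t := ρ / h with ht
    have ht0 : 0 < t := div_pos hρ0 hh
    have ht1 : t ≤ 1 := (div_le_one hh).2 hρh
    have hrad : ρ / (2 * σ) ≤ t * r := by
      rw [div_le_iff₀ (by linarith), ht, div_mul_eq_mul_div, div_mul_eq_mul_div, le_div_iff₀ hh]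
      nlinarith
    have hzK : z ∈ hull K := mem_hull_of_mem (hEK hz)
    have key : ∀ y ∈ Metric.ball (AffineMap.lineMap z x t) (ρ / (2 * σ)),
        ∃ w ∈ hull K, y = AffineMap.lineMap z w t := by
      intro y hy
      refine ⟨AffineMap.lineMap z y t⁻¹, hb ?_, ?_⟩
      · rw [Metric.mem_closedBall]
        have e1 : AffineMap.lineMap z y t⁻¹ - x = t⁻¹ • (y - AffineMap.lineMap z x t) := by
          simp only [AffineMap.lineMap_apply_module', smul_sub, smul_add, smul_smul,
            inv_mul_cancel₀ ht0.ne', one_smul]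
          abel
        rw [dist_eq_norm, e1, norm_smul, ← dist_eq_norm, Real.norm_eq_abs,
          abs_of_pos (inv_pos.2 ht0), inv_mul_le_iff₀ ht0]
        exact (Metric.mem_ball.1 hy).le.trans hrad
      · rw [AffineMap.lineMap_lineMap_right, mul_inv_cancel₀ ht0.ne', AffineMap.lineMap_apply_one]
    refine ⟨AffineMap.lineMap z x t, interior_maximal (fun y hy => ?_) Metric.isOpen_ball,
      fun y hy => ?_⟩
    · obtain ⟨w, hw, rfl⟩ := key y hy
      exact (convex_convexHull ℝ _).lineMap_mem hzK hw ⟨ht0.le, ht1⟩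
    · obtain ⟨w, hw, rfl⟩ := key y hy
      rw [Metric.mem_closedBall, dist_comm, dist_left_lineMap, Real.norm_eq_abs, abs_of_pos ht0]
      have := dist_le_diam_hull hzK hw
      rw [← hh'] at this
      calc t * dist z w ≤ t * h := by gcongr
        _ = ρ := by rw [ht]; field_simp
  choose! c hc1 hc2 using hball
  have hdisj : (T.cellsAt E : Set (Finset (Pt d))).PairwiseDisjoint
      (fun K => Metric.ball (c K) (ρ / (2 * σ))) := by
    intro K hK K' hK' hKK
    exact (disjoint_cell (mem_cellsAt.1 hK).1 (mem_cellsAt.1 hK').1 hKK).mono (hc1 K hK) (hc1 K' hK')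
  have hmeas := measure_biUnion_finset (μ := (volume : Measure (Pt d))) hdisj
    fun K _ => Metric.isOpen_ball.measurableSet
  have hle : volume (⋃ K ∈ T.cellsAt E, Metric.ball (c K) (ρ / (2 * σ))) ≤
      volume (Metric.closedBall z ρ) := measure_mono (Set.iUnion₂_subset fun K hK => hc2 K hK)
  have hrad0 : 0 ≤ ρ / (2 * σ) := by positivity
  have : Nonempty (Fin d) := ⟨⟨0, hd⟩⟩
  rw [hmeas] at hle
  simp only [Measure.addHaar_ball _ _ hrad0] at hle
  rw [Measure.addHaar_closedBall _ _ hρ0.le, finrank_euclideanSpace_fin, Finset.sum_const,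
    nsmul_eq_mul, ← mul_assoc] at hle
  have hv0 : volume (Metric.ball (0 : Pt d) 1) ≠ 0 := (Metric.measure_ball_pos _ _ one_pos).ne'
  have hvt : volume (Metric.ball (0 : Pt d) 1) ≠ ⊤ := measure_ball_lt_top.ne
  rw [ENNReal.mul_le_mul_iff_left hv0 hvt] at hle
  have h3 : ((T.cellsAt E).card : ℝ≥0∞) = ENNReal.ofReal ((T.cellsAt E).card : ℝ) := by simp
  rw [h3, ← ENNReal.ofReal_mul (by positivity), ENNReal.ofReal_le_ofReal_iff (by positivity),
    div_pow, mul_div_assoc', div_le_iff₀ (by positivity), mul_comm] at hle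
  exact le_of_mul_le_mul_left hle (by positivity)

/-! ### The normals of the boundary -/

theorem exists_closure_eq_convexHull (hC : Convex ℝ Ω) (T : Mesh Ω) :
    ∃ V : Finset (Pt d), closure Ω = convexHull ℝ (V : Set (Pt d)) := by
  refine ⟨T.cells.biUnion id, Set.Subset.antisymm ?_ ?_⟩
  · intro x hx
    obtain ⟨K, hK, hxK⟩ := exists_cell_of_mem_closure (T := T) hx
    exact convexHull_mono (Finset.coe_subset.2 (Finset.subset_biUnion_of_mem id hK)) hxK
  · refine convexHull_min (fun x hx => ?_) hC.closure
    obtain ⟨K, hK, hxK⟩ := Finset.mem_biUnion.1 (Finset.mem_coe.1 hx)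
    exact hull_subset_closure (mem_cells.1 hK).1 (mem_hull_of_mem hxK)

/-- All subdivisions of the domain together have finitely many boundary normals. -/
theorem finite_normals (hd : 1 ≤ d) (hO : IsOpen Ω) (hC : Convex ℝ Ω) (hne : Ω.Nonempty) :
    {n : Pt d | ∃ (T : Mesh Ω) (e : Finset (Pt d)) (K : Finset (Pt d)), e ∈ T.boundaryFaces ∧
      K ∈ T.cellsAt e ∧ n = outwardNormal K e}.Finite := by
  by_cases hT : Nonempty (Mesh Ω)
  swap
  · refine Set.Finite.subset Set.finite_empty ?_
    rintro n ⟨T, -⟩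
    exact hT ⟨T⟩
  obtain ⟨T₀⟩ := hT
  obtain ⟨V, hV⟩ := exists_closure_eq_convexHull hC T₀
  -- The points of `V` at which ⟨n, ·⟩ is largest. As `V` comes from the fixed `T₀`, there are
  -- finitely many such sets; the normal is recovered from its set.
  let M : Pt d → Finset (Pt d) := fun n => V.filter fun v => ∀ w ∈ V, inner ℝ n w ≤ inner ℝ n v
  have hVcl : ∀ v ∈ V, v ∈ closure Ω := fun v hv => by
    rw [hV]; exact subset_convexHull ℝ _ (Finset.mem_coe.2 hv)
  refine Set.Finite.of_finite_image (f := M) ((V.powerset.finite_toSet).subset ?_) ?_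
  · rintro _ ⟨n, _, rfl⟩
    exact Finset.mem_coe.2 (Finset.mem_powerset.2 (Finset.filter_subset _ _))
  rintro n ⟨T, e, K, he, hK, rfl⟩ n' ⟨T', e', K', he', hK', rfl⟩ hM
  -- A vertex of a boundary face maximizes ⟨n, ·⟩ over the closed domain, so only maximizing points
  -- carry weight when it is written as a convex combination of `V`.
  have hin : ∀ z ∈ e, z ∈ convexHull ℝ (M (outwardNormal K e) : Set (Pt d)) := by
    intro z hz
    have hzcl : z ∈ convexHull ℝ (V : Set (Pt d)) := by
      rw [← hV]
      exact hull_subset_closure (mem_boundaryFaces.1 he).1 (mem_hull_of_mem hz)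
    rw [Finset.mem_convexHull'] at hzcl
    obtain ⟨w, hw0, hw1, hwz⟩ := hzcl
    set n := outwardNormal K e
    have hle : ∀ v ∈ V, inner ℝ n v ≤ inner ℝ n z := fun v hv => by
      have := inner_outwardNormal_nonpos hd hO hC hne he hK (hVcl v hv) hz
      rw [inner_sub_right] at this
      linarith
    have hsum : ∑ v ∈ V, w v * inner ℝ n v = ∑ v ∈ V, w v * inner ℝ n z := by
      rw [← Finset.sum_mul, hw1, one_mul]
      conv_rhs => rw [← hwz, inner_sum]
      simp only [real_inner_smul_right]
    have heq := (Finset.sum_eq_sum_iff_of_le fun v hv =>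
      mul_le_mul_of_nonneg_left (hle v hv) (hw0 v hv)).1 hsum
    have hmem : ∀ v ∈ V, w v ≠ 0 → v ∈ M n := fun v hv hwv => by
      have h1 := mul_left_cancel₀ hwv (heq v hv)
      exact Finset.mem_filter.2 ⟨hv, fun u hu => by rw [h1]; exact hle u hu⟩
    rw [← hwz, ← Finset.sum_filter_of_ne (p := fun v => w v ≠ 0) (by
      intro v _ hne h0; exact hne (by rw [h0, zero_smul]))]
    refine (convex_convexHull ℝ _).sum_mem (fun v hv => hw0 v (Finset.mem_filter.1 hv).1) ?_
      fun v hv => subset_convexHull ℝ _ (Finset.mem_coe.2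
        (hmem v (Finset.mem_filter.1 hv).1 (Finset.mem_filter.1 hv).2))
    rw [Finset.sum_filter_ne_zero]; exact hw1
  have hMmem : ∀ n u, u ∈ M n → ∀ w ∈ V, inner ℝ n w ≤ inner ℝ n u :=
    fun n u hu => (Finset.mem_filter.1 hu).2
  have hM' : M (outwardNormal K e) = M (outwardNormal K' e') := hM
  rw [hM'] at hin
  obtain ⟨hef, hec, hefr⟩ := mem_boundaryFaces.1 he
  obtain ⟨hKc, heK⟩ := mem_cellsAt.1 hK
  obtain ⟨a, ha, rfl⟩ := exists_erase_eq hKc heK hec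
  have hF := fullSim hKc
  obtain ⟨b, hb⟩ := (hF.isSim_erase hd ha).1
  set n' := outwardNormal K' e'
  have hconst : ∀ z ∈ K.erase a, ∀ y ∈ closure Ω, inner ℝ n' y ≤ inner ℝ n' z := by
    intro z hz
    have h1 : ∀ v ∈ V, inner ℝ n' v ≤ inner ℝ n' z := by
      intro v hv
      have hconv : Convex ℝ {x | inner ℝ n' v ≤ inner ℝ n' x} :=
        (convex_Ici (inner ℝ n' v)).linear_preimage (innerSL ℝ n').toLinearMap
      exact convexHull_min (t := {x | inner ℝ n' v ≤ inner ℝ n' x})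
        (fun u hu => hMmem n' u (Finset.mem_coe.1 hu) v hv) hconv (hin z hz)
    intro y hy
    rw [hV] at hy
    have hconv : Convex ℝ {x | inner ℝ n' x ≤ inner ℝ n' z} :=
      (convex_Iic (inner ℝ n' z)).linear_preimage (innerSL ℝ n').toLinearMap
    exact convexHull_min (t := {x | inner ℝ n' x ≤ inner ℝ n' z})
      (fun u hu => h1 u (Finset.mem_coe.1 hu)) hconv hy
  have hvert : ∀ c ∈ K, c ∈ closure Ω := fun c hc =>
    hull_subset_closure (mem_cells.1 hKc).1 (mem_hull_of_mem hc)
  -- Every vertex of the first face also maximizes ⟨n', ·⟩, so n' is constant along that face and is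
  -- a nonpositive multiple of ∇λ_a, like the first normal.
  have hn' : n' = inner ℝ n' (a - b) • baryGrad K a := by
    refine hF.ext_inner (b := b) fun c hc => ?_
    rw [real_inner_smul_left, hF.inner_baryGrad ha hc (Finset.mem_of_mem_erase hb),
      if_neg (Finset.ne_of_mem_erase hb).symm, sub_zero]
    by_cases hca : a = c
    · rw [if_pos hca, hca, mul_one]
    · have hce : c ∈ K.erase a := Finset.mem_erase.2 ⟨Ne.symm hca, hc⟩
      have e1 := hconst c hce b (hvert b (Finset.mem_of_mem_erase hb))
      have e2 := hconst b hb c (hvert c hc)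
      rw [if_neg hca, inner_sub_right]
      linarith
  have hneg : inner ℝ n' (a - b) ≤ 0 := by
    have := hconst b hb a (hvert a ha)
    rw [inner_sub_right]; linarith
  have hnorm : ‖n'‖ = 1 := by
    obtain ⟨hKc', heK'⟩ := mem_cellsAt.1 hK'
    obtain ⟨a', ha', hae⟩ := exists_erase_eq hKc' heK' (mem_boundaryFaces.1 he').2.1
    have := norm_outwardNormal hd (fullSim hKc') ha'
    rwa [hae] at this
  have hg := norm_pos_iff.2 (hF.baryGrad_ne_zero hd ha)
  rw [hF.outwardNormal_eq hd ha, hn', ← neg_smul]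
  rw [hn', norm_smul, Real.norm_eq_abs, abs_of_nonpos hneg] at hnorm
  congr 1
  field_simp
  linarith

/-- Distinct boundary normals at a common vertex are uniformly linearly independent. -/
theorem exists_inner_normals_le (hd : 1 ≤ d) (hO : IsOpen Ω) (hC : Convex ℝ Ω) (hne : Ω.Nonempty) :
    ∃ κ > 0, ∀ (T : Mesh Ω) (e e' K K' : Finset (Pt d)), e ∈ T.boundaryFaces →
      e' ∈ T.boundaryFaces → K ∈ T.cellsAt e → K' ∈ T.cellsAt e' → (e ∩ e').Nonempty →
      outwardNormal K e ≠ outwardNormal K' e' →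
      κ ≤ 1 - inner ℝ (outwardNormal K e) (outwardNormal K' e') ^ 2 := by
  obtain ⟨N, hN⟩ := (finite_normals (Ω := Ω) hd hO hC hne).exists_finset_coe
  obtain ⟨S, hSdef⟩ : ∃ S, S = (N ×ˢ N).filter fun p => 0 < 1 - inner ℝ p.1 p.2 ^ 2 := ⟨_, rfl⟩
  have hunit : ∀ (T : Mesh Ω) (e K : Finset (Pt d)), e ∈ T.boundaryFaces → K ∈ T.cellsAt e →
      ‖outwardNormal K e‖ = 1 := by
    intro T e K he hK
    obtain ⟨hKc', heK'⟩ := mem_cellsAt.1 hK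
    obtain ⟨a', ha', hae⟩ := exists_erase_eq hKc' heK' (mem_boundaryFaces.1 he).2.1
    have := norm_outwardNormal hd (fullSim hKc') ha'
    rwa [hae] at this
  have hS : ∀ (T : Mesh Ω) (e e' K K' : Finset (Pt d)), e ∈ T.boundaryFaces →
      e' ∈ T.boundaryFaces → K ∈ T.cellsAt e → K' ∈ T.cellsAt e' → (e ∩ e').Nonempty →
      outwardNormal K e ≠ outwardNormal K' e' → (outwardNormal K e, outwardNormal K' e') ∈ S := by
    intro T e e' K K' he he' hK hK' hz hnn
    rw [hSdef]
    refine Finset.mem_filter.2 ⟨Finset.mem_product.2 ⟨?_, ?_⟩, ?_⟩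
    · rw [← Finset.mem_coe, hN]; exact ⟨T, e, K, he, hK, rfl⟩
    · rw [← Finset.mem_coe, hN]; exact ⟨T, e', K', he', hK', rfl⟩
    obtain ⟨z, hz⟩ := hz
    obtain ⟨hz1, hz2⟩ := Finset.mem_inter.1 hz
    obtain ⟨x, hx⟩ := hne
    have h1 := inner_outwardNormal_neg hd hO hC ⟨x, hx⟩ he hK hx hz1
    have h2 := inner_outwardNormal_neg hd hO hC ⟨x, hx⟩ he' hK' hx hz2
    have u1 := hunit T e K he hK
    have u2 := hunit T e' K' he' hK'
    have h3 : inner ℝ (outwardNormal K e) (outwardNormal K' e') < 1 :=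
      inner_lt_one_iff_real_of_norm_eq_one u1 u2 |>.2 hnn
    -- Opposite normals are excluded because both have negative product with x - z. Hence |⟨n, n'⟩|
    -- < 1, and finiteness of the set of normals makes this uniform.
    have h4 : inner ℝ (outwardNormal K e) (-outwardNormal K' e') < 1 := by
      refine (inner_lt_one_iff_real_of_norm_eq_one u1 (by rwa [norm_neg])).2 fun h => ?_
      rw [h, inner_neg_left] at h1
      linarith
    rw [inner_neg_right] at h4
    simp only
    nlinarith
  by_cases hSne : S.Nonempty
  · obtain ⟨p, hp, hmin⟩ := Finset.exists_min_image S (fun p => 1 - inner ℝ p.1 p.2 ^ 2) hSne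
    rw [hSdef] at hp
    refine ⟨1 - inner ℝ p.1 p.2 ^ 2, (Finset.mem_filter.1 hp).2, fun T e e' K K' he he' hK hK' hz hnn => ?_⟩
    exact hmin (outwardNormal K e, outwardNormal K' e') (hS T e e' K K' he he' hK hK' hz hnn)
  · refine ⟨1, one_pos, fun T e e' K K' he he' hK hK' hz hnn => ?_⟩
    exact absurd ⟨_, hS T e e' K K' he he' hK hK' hz hnn⟩ hSne

end Mesh
end
end CordesLS

/-! ### Polynomials on simplices and inverse inequalities -/

namespace CordesLS
open scoped Classical in
section

variable {d : ℕ}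

/-- The polynomial function on `ℝ^d` given by `P`. -/
def pev (P : MvPolynomial (Fin d) ℝ) (x : Pt d) : ℝ := MvPolynomial.eval (fun k => x k) P

theorem hasFDerivAt_pev (P : MvPolynomial (Fin d) ℝ) (x : Pt d) :
    HasFDerivAt (pev P) (∑ j, pev (MvPolynomial.pderiv j P) x •
      (EuclideanSpace.proj j : Pt d →L[ℝ] ℝ)) x := by
  induction P using MvPolynomial.induction_on with
  | C c =>
    have : pev (MvPolynomial.C c : MvPolynomial (Fin d) ℝ) = fun _ => c := by
      funext y; simp [pev]
    rw [this]
    refine (hasFDerivAt_const c x).congr_fderiv ?_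
    simp [pev]
  | add p q hp hq =>
    have : pev (p + q) = pev p + pev q := by funext y; simp [pev]
    rw [this]
    refine (hp.add hq).congr_fderiv ?_
    rw [← Finset.sum_add_distrib]
    refine Finset.sum_congr rfl fun j _ => ?_
    rw [← add_smul]; simp [pev]
  | mul_X p i hp =>
    have : pev (p * MvPolynomial.X i) = fun y => pev p y * (EuclideanSpace.proj i : Pt d →L[ℝ] ℝ) y := by
      funext y; simp [pev]
    rw [this]
    refine (hp.mul (EuclideanSpace.proj i : Pt d →L[ℝ] ℝ).hasFDerivAt).congr_fderiv ?_
    rw [Finset.smul_sum]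
    have : ∀ j, pev (MvPolynomial.pderiv j (p * MvPolynomial.X i)) x =
        pev p x * (if i = j then 1 else 0) + x i * pev (MvPolynomial.pderiv j p) x := by
      intro j
      rw [MvPolynomial.pderiv_mul, MvPolynomial.pderiv_X]
      by_cases h : i = j
      · subst h; simp [pev]; ring
      · simp [pev, h]; ring
    simp only [this, add_smul, Finset.sum_add_distrib]
    congr 1
    · simp
    · refine Finset.sum_congr rfl fun j _ => ?_
      rw [smul_smul]; rfl

theorem contDiff_pev (P : MvPolynomial (Fin d) ℝ) {n : WithTop ℕ∞} : ContDiff ℝ n (pev P) := by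
  induction P using MvPolynomial.induction_on with
  | C c =>
    have : pev (MvPolynomial.C c : MvPolynomial (Fin d) ℝ) = fun _ => c := by
      funext y; simp [pev]
    rw [this]; exact contDiff_const
  | add p q hp hq =>
    have : pev (p + q) = pev p + pev q := by funext y; simp [pev]
    rw [this]; exact hp.add hq
  | mul_X p i hp =>
    have : pev (p * MvPolynomial.X i) = fun y => pev p y * (EuclideanSpace.proj i : Pt d →L[ℝ] ℝ) y := by
      funext y; simp [pev]
    rw [this]; exact hp.mul (ContinuousLinearMap.contDiff _)

theorem pd_pev (j : Fin d) (P : MvPolynomial (Fin d) ℝ) :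
    pd j (pev P) = pev (MvPolynomial.pderiv j P) := by
  funext x
  rw [pd, (hasFDerivAt_pev P x).fderiv, _root_.sum_apply]
  simp [Pi.single_apply]

theorem totalDegree_pderiv_le (j : Fin d) (P : MvPolynomial (Fin d) ℝ) :
    (MvPolynomial.pderiv j P).totalDegree ≤ P.totalDegree := by
  conv_lhs => rw [P.as_sum, map_sum]
  refine MvPolynomial.totalDegree_finsetSum_le fun s hs => ?_
  rw [MvPolynomial.pderiv_monomial]
  refine (MvPolynomial.totalDegree_monomial_le _ _).trans
    (le_trans ?_ (MvPolynomial.le_totalDegree hs))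
  exact Finsupp.sum_le_sum_index tsub_le_self (fun _ _ => monotone_id) (by simp)

/-- Pull-back of a polynomial along the parametrization of a simplex. -/
theorem exists_pev_simMap {k m : ℕ} (b : Pt d) (r : Fin k → Pt d) (P : MvPolynomial (Fin d) ℝ)
    (hP : P.totalDegree ≤ m) :
    ∃ Q : MvPolynomial (Fin k) ℝ, Q.totalDegree ≤ m ∧
      ∀ t, pev P (simMap b r t) = MvPolynomial.eval t Q := by
  let A : Fin d → MvPolynomial (Fin k) ℝ := fun i =>
    MvPolynomial.C (b i) + ∑ j, MvPolynomial.C ((r j - b) i) * MvPolynomial.X j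
  have hA : ∀ i, (A i).totalDegree ≤ 1 := by
    intro i
    refine (MvPolynomial.totalDegree_add _ _).trans (max_le (by simp) ?_)
    refine MvPolynomial.totalDegree_finsetSum_le fun j _ => ?_
    refine (MvPolynomial.totalDegree_mul _ _).trans ?_
    rw [MvPolynomial.totalDegree_C, zero_add, MvPolynomial.totalDegree_X]
  refine ⟨MvPolynomial.bind₁ A P, ?_, fun t => ?_⟩
  · rw [MvPolynomial.bind₁, MvPolynomial.aeval_def, MvPolynomial.eval₂_eq]
    refine MvPolynomial.totalDegree_finsetSum_le fun s hs => ?_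
    refine (MvPolynomial.totalDegree_mul _ _).trans ?_
    rw [MvPolynomial.algebraMap_eq, MvPolynomial.totalDegree_C, zero_add]
    refine (MvPolynomial.totalDegree_finsetProd _ _).trans ?_
    refine (Finset.sum_le_sum (g := fun i => s i) fun i _ =>
      (MvPolynomial.totalDegree_pow _ _).trans ?_).trans ?_
    · calc s i * (A i).totalDegree ≤ s i * 1 := Nat.mul_le_mul_left _ (hA i)
        _ = s i := mul_one _
    · exact (MvPolynomial.le_totalDegree hs).trans hP
  · rw [pev, MvPolynomial.eval, MvPolynomial.eval, MvPolynomial.eval₂Hom_bind₁]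
    congr 2
    funext i
    simp [A, simMap, mul_comm]

/-- Norms on a finite-dimensional space are equivalent: on polynomials of bounded degree the L²
seminorm is a norm because the corner simplex has interior points, so it controls the supremum norm.
-/
theorem exists_sq_eval_le (k m : ℕ) : ∃ C : ℝ, 0 < C ∧ ∀ Q : MvPolynomial (Fin k) ℝ,
    Q.totalDegree ≤ m → ∀ t ∈ stdSim k,
      MvPolynomial.eval t Q ^ 2 ≤ C * ∫ t in stdSim k, MvPolynomial.eval t Q ^ 2 := by
  let μ : Measure (Fin k → ℝ) := volume.restrict (stdSim k)
  have hc : ∀ Q : MvPolynomial (Fin k) ℝ, Continuous fun t => MvPolynomial.eval t Q :=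
    fun Q => MvPolynomial.continuous_eval Q
  haveI : CompactSpace (stdSim k) := isCompact_iff_compactSpace.1 (isCompact_stdSim k)
  have hL : ∀ Q : MvPolynomial (Fin k) ℝ, MemLp (fun t => MvPolynomial.eval t Q) 2 μ := fun Q =>
    by
      haveI : IsFiniteMeasure μ := ⟨by simpa [μ] using (volume_stdSim_ne_top k).lt_top⟩
      obtain ⟨M, hM⟩ := (isCompact_stdSim k).exists_bound_of_continuousOn (hc Q).continuousOn
      exact MemLp.of_bound (hc Q).aestronglyMeasurable M
        ((ae_restrict_iff' (isClosed_stdSim k).measurableSet).2 (Eventually.of_forall hM))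
  let W := MvPolynomial.restrictTotalDegree (Fin k) ℝ m
  let Φ : W →ₗ[ℝ] Lp ℝ 2 μ :=
    { toFun := fun Q => (hL Q.1).toLp _
      map_add' := fun P Q => by
        rw [← MemLp.toLp_add]; congr 1; funext t; simp
      map_smul' := fun c Q => by
        rw [RingHom.id_apply, ← MemLp.toLp_const_smul]; congr 1; funext t; simp }
  let Ψ : W →ₗ[ℝ] C(stdSim k, ℝ) :=
    { toFun := fun Q => ⟨fun t => MvPolynomial.eval t.1 Q.1, (hc Q.1).comp continuous_subtype_val⟩
      map_add' := fun P Q => by ext t; simp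
      map_smul' := fun c Q => by ext t; simp }
  have hinj : Function.Injective Φ := by
    rw [injective_iff_map_eq_zero]
    intro Q hQ
    have h0 : (fun t => MvPolynomial.eval t Q.1) =ᵐ[μ] 0 := by
      have h := (hL Q.1).coeFn_toLp
      have hQ' : (hL Q.1).toLp _ = 0 := hQ
      rw [hQ'] at h
      exact h.symm.trans (Lp.coeFn_zero _ _ _)
    have h1 : (fun t => MvPolynomial.eval t Q.1) =ᵐ[volume.restrict (interior (stdSim k))]
        fun _ => (0 : ℝ) := ae_restrict_of_ae_restrict_of_subset interior_subset h0
    have h2 := Measure.eqOn_open_of_ae_eq h1 isOpen_interior (hc Q.1).continuousOn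
      continuousOn_const
    obtain ⟨x, hx⟩ := interior_stdSim_nonempty k
    obtain ⟨δ, hδ, hball⟩ := Metric.isOpen_iff.1 isOpen_interior x hx
    refine Subtype.ext (MvPolynomial.funext_set (fun i => Metric.ball (x i) δ)
      (fun i => ?_) fun y hy => ?_)
    · rw [Real.ball_eq_Ioo]
      exact Set.Ioo_infinite (by linarith)
    · refine (h2 (hball ((ball_pi x hδ).symm ▸ hy))).trans ?_
      simp
  let e := LinearEquiv.ofInjective Φ hinj
  let G : LinearMap.range Φ →L[ℝ] C(stdSim k, ℝ) :=
    LinearMap.toContinuousLinearMap (Ψ ∘ₗ e.symm.toLinearMap)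
  refine ⟨‖G‖ ^ 2 + 1, by positivity, fun Q hQ t ht => ?_⟩
  let Q' : W := ⟨Q, (MvPolynomial.mem_restrictTotalDegree _ _ _).2 hQ⟩
  have h1 : ‖Ψ Q'‖ ≤ ‖G‖ * ‖Φ Q'‖ := by
    have := G.le_opNorm (e Q')
    have h2 : G (e Q') = Ψ Q' := by simp [G]
    rw [h2] at this
    exact this
  have h2 : |MvPolynomial.eval t Q| ≤ ‖Ψ Q'‖ := (Ψ Q').norm_coe_le_norm ⟨t, ht⟩
  have h3 : ‖Φ Q'‖ ^ 2 = ∫ t in stdSim k, MvPolynomial.eval t Q ^ 2 := by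
    rw [← real_inner_self_eq_norm_sq, L2.inner_def]
    refine integral_congr_ae ?_
    filter_upwards [(hL Q).coeFn_toLp] with s hs
    have : (Φ Q' : (Fin k → ℝ) → ℝ) s = MvPolynomial.eval s Q := hs
    rw [this]; simp [sq]
  rw [← h3, ← sq_abs]
  nlinarith [norm_nonneg (Φ Q'), norm_nonneg G, abs_nonneg (MvPolynomial.eval t Q),
    mul_nonneg (norm_nonneg G) (norm_nonneg (Φ Q')), sq_nonneg ‖Φ Q'‖,
    pow_le_pow_left₀ (abs_nonneg (MvPolynomial.eval t Q)) (h2.trans h1) 2]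

theorem IsSim.card_le {s : Finset (Pt d)} (hs : IsSim s) : s.card ≤ d + 1 := by
  obtain ⟨k, b, r, h⟩ := hs.exists_enum
  have := h.linInd.fintype_card_le_finrank
  rw [h.card_eq]
  simpa using this

/-- Inverse inequality: a polynomial on a simplex is bounded by its mean square. -/
theorem exists_sq_pev_le (d m : ℕ) : ∃ C : ℝ, 0 < C ∧ ∀ s : Finset (Pt d), IsSim s →
    ∀ P : MvPolynomial (Fin d) ℝ, P.totalDegree ≤ m → ∀ x ∈ hull s,
      pev P x ^ 2 ≤ C * simInt s (fun y => pev P y ^ 2) := by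
  choose C hC0 hC using fun k => exists_sq_eval_le k m
  -- Summation makes one constant serve simplices of every dimension up to d.
  refine ⟨∑ k ∈ Finset.range (d + 1), C k, Finset.sum_pos (fun k _ => hC0 k) (by simp),
    fun s hs P hP x hx => ?_⟩
  obtain ⟨k, b, r, h⟩ := hs.exists_enum
  obtain ⟨Q, hQ, hPQ⟩ := exists_pev_simMap b r P hP
  have hk : k ∈ Finset.range (d + 1) := by
    have := hs.card_le
    rw [h.card_eq] at this
    exact Finset.mem_range.2 (by omega)
  rw [h.hull_eq] at hx
  obtain ⟨t, ht, rfl⟩ := hx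
  have h1 := hC k Q hQ t ht
  rw [hPQ]
  refine h1.trans (le_trans (mul_le_mul_of_nonneg_right
    (Finset.single_le_sum (fun k _ => (hC0 k).le) hk) ?_) (le_of_eq ?_))
  · exact integral_nonneg fun _ => sq_nonneg _
  · rw [h.simInt_eq]; simp only [hPQ]

/-- The pointwise bound on `s` is integrated over its face `t`. Both integrals are normalized, so no
power of the diameter appears. -/
theorem exists_simInt_sq_pev_le (d m : ℕ) : ∃ C : ℝ, 0 < C ∧ ∀ s t : Finset (Pt d), IsSim s →
    t ⊆ s → t.Nonempty → ∀ P : MvPolynomial (Fin d) ℝ, P.totalDegree ≤ m →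
      simInt t (fun y => pev P y ^ 2) ≤ C * simInt s (fun y => pev P y ^ 2) := by
  obtain ⟨C, hC0, hC⟩ := exists_sq_pev_le d m
  refine ⟨C * ∑ k ∈ Finset.range (d + 1), simVol k, mul_pos hC0
    (Finset.sum_pos (fun k _ => simVol_pos k) (by simp)), fun s t hs hts ht P hP => ?_⟩
  have hsim := hs.subset hts ht
  have hI : 0 ≤ simInt s (fun y => pev P y ^ 2) := hs.simInt_nonneg fun _ _ => sq_nonneg _
  have hk : t.card - 1 ∈ Finset.range (d + 1) := by
    have := hsim.card_le
    exact Finset.mem_range.2 (by omega)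
  calc simInt t (fun y => pev P y ^ 2)
      ≤ simInt t (fun _ => C * simInt s (fun y => pev P y ^ 2)) :=
        hsim.simInt_mono ((contDiff_pev P (n := 0)).continuous.pow 2) continuous_const
          fun x hx => hC s hs P hP x (hull_mono hts hx)
    _ = simVol (t.card - 1) * (C * simInt s (fun y => pev P y ^ 2)) := hsim.simInt_const _
    _ ≤ (∑ k ∈ Finset.range (d + 1), simVol k) * (C * simInt s (fun y => pev P y ^ 2)) :=
        mul_le_mul_of_nonneg_right (Finset.single_le_sum (fun k _ => (simVol_pos k).le) hk)
          (mul_nonneg hC0.le hI)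
    _ = _ := by ring

end
end CordesLS

/-! ### The discrete Miranda-Talenti identity -/

namespace CordesLS
open scoped Classical in
section

variable {d : ℕ} {Ω : Set (Pt d)} {T : Mesh Ω} {K K' E e s : Finset (Pt d)} {a b : Pt d}

theorem continuous_pev (P : MvPolynomial (Fin d) ℝ) : Continuous (pev P) :=
  (contDiff_pev P (n := 0)).continuous

theorem pev_add (P Q : MvPolynomial (Fin d) ℝ) (x : Pt d) : pev (P + Q) x = pev P x + pev Q x :=
  map_add _ _ _

theorem pev_sub (P Q : MvPolynomial (Fin d) ℝ) (x : Pt d) : pev (P - Q) x = pev P x - pev Q x :=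
  map_sub _ _ _

theorem pev_mul (P Q : MvPolynomial (Fin d) ℝ) (x : Pt d) : pev (P * Q) x = pev P x * pev Q x :=
  map_mul _ _ _

theorem pev_smul (c : ℝ) (P : MvPolynomial (Fin d) ℝ) (x : Pt d) : pev (c • P) x = c * pev P x := by
  simp [pev]

theorem pev_sum {ι : Type*} (t : Finset ι) (P : ι → MvPolynomial (Fin d) ℝ) (x : Pt d) :
    pev (∑ i ∈ t, P i) x = ∑ i ∈ t, pev (P i) x :=
  map_sum (MvPolynomial.eval fun k => x k) _ _

theorem pderiv_comm (i j : Fin d) (P : MvPolynomial (Fin d) ℝ) :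
    MvPolynomial.pderiv i (MvPolynomial.pderiv j P) =
      MvPolynomial.pderiv j (MvPolynomial.pderiv i P) := by
  have h : ⁅(MvPolynomial.pderiv i : Derivation ℝ (MvPolynomial (Fin d) ℝ) (MvPolynomial (Fin d) ℝ)),
      (MvPolynomial.pderiv j : Derivation ℝ (MvPolynomial (Fin d) ℝ) (MvPolynomial (Fin d) ℝ))⁆ =
        0 := by
    refine MvPolynomial.derivation_ext fun k => ?_
    rw [Derivation.commutator_apply, MvPolynomial.pderiv_X, MvPolynomial.pderiv_X]
    by_cases h1 : j = k <;> by_cases h2 : i = k <;> simp [Pi.single_apply, h1, h2]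
  have h2 := congrArg (fun D => D P) h
  simp only [Derivation.commutator_apply, Derivation.coe_zero, Pi.zero_apply] at h2
  exact sub_eq_zero.1 h2

/-- The normalized integral of a polynomial over a simplex. -/
def polyInt (s : Finset (Pt d)) : MvPolynomial (Fin d) ℝ →ₗ[ℝ] ℝ :=
  if hs : IsSim s then
    { toFun := fun P => simInt s (pev P)
      map_add' := fun P Q => by
        rw [← hs.simInt_add (continuous_pev P) (continuous_pev Q)]
        simp only [← pev_add]
      map_smul' := fun c P => by
        rw [RingHom.id_apply, smul_eq_mul, ← simInt_const_mul]
        simp only [← pev_smul] }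
  else 0

theorem IsSim.polyInt_apply (hs : IsSim s) (P : MvPolynomial (Fin d) ℝ) :
    polyInt s P = simInt s (pev P) := by
  rw [polyInt, dif_pos hs]; rfl

theorem FullSim.polyInt_pderiv (hd : 1 ≤ d) (h : FullSim K) (i : Fin d)
    (P : MvPolynomial (Fin d) ℝ) :
    polyInt K (MvPolynomial.pderiv i P) = -∑ a ∈ K, baryGrad K a i * polyInt (K.erase a) P := by
  have h1 := h.simInt_fderiv (EuclideanSpace.single i 1) (contDiff_pev P)
  rw [h.isSim.polyInt_apply, ← pd_pev]
  refine h1.trans (congrArg _ (Finset.sum_congr rfl fun a ha => ?_))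
  rw [(h.isSim_erase hd ha).polyInt_apply]
  simp [EuclideanSpace.inner_single_right]

/-- For N parallel to ∇λ_a, the operator N_i ∂_j - N_j ∂_i differentiates along a vector tangential
to the face, so integration by parts leaves ridge terms only. -/
theorem FullSim.polyInt_erase_pderiv (hd : 2 ≤ d) (h : FullSim K) (ha : a ∈ K) (c : ℝ) (i j : Fin d)
    (P : MvPolynomial (Fin d) ℝ) :
    polyInt (K.erase a) ((c * baryGrad K a i) • MvPolynomial.pderiv j P -
        (c * baryGrad K a j) • MvPolynomial.pderiv i P) =
      -∑ b ∈ K.erase a, ((c * baryGrad K a i) * baryGrad K b j -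
        (c * baryGrad K a j) * baryGrad K b i) * polyInt ((K.erase a).erase b) P := by
  let v : Pt d := (c * baryGrad K a i) • EuclideanSpace.single j 1 -
    (c * baryGrad K a j) • EuclideanSpace.single i 1
  have hin : ∀ g : Pt d, inner ℝ g v = (c * baryGrad K a i) * g j - (c * baryGrad K a j) * g i := by
    intro g
    simp [v, inner_sub_right, real_inner_smul_right, EuclideanSpace.inner_single_right]
  have hs := h.isSim_erase (by omega) ha
  have h1 := h.simInt_erase_fderiv (by omega) ha (v := v) (by rw [hin]; ring) (contDiff_pev P)
  rw [hs.polyInt_apply]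
  have h2 : (fun x => fderiv ℝ (pev P) x v) = pev ((c * baryGrad K a i) • MvPolynomial.pderiv j P -
      (c * baryGrad K a j) • MvPolynomial.pderiv i P) := by
    funext x
    simp only [v, map_sub, map_smul, pev_sub, pev_smul, ← pd_pev, smul_eq_mul]
    rfl
  rw [← h2, h1]
  refine congrArg _ (Finset.sum_congr rfl fun b hb => ?_)
  rw [hin]
  congr 1
  refine (IsSim.polyInt_apply (hs.subset (Finset.erase_subset _ _) ?_) P).symm
  rw [← Finset.card_pos, Finset.card_erase_of_mem hb, Finset.card_erase_of_mem ha, h.2]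
  omega

/-- `∑ᵢⱼ ∫ uⱼ (Nᵢ ∂ⱼ - Nⱼ ∂ᵢ) wᵢ` over a face. -/
def faceForm (e : Finset (Pt d)) (N : Pt d) (u w : Fin d → MvPolynomial (Fin d) ℝ) : ℝ :=
  ∑ i, ∑ j, (N i * polyInt e (u j * MvPolynomial.pderiv j (w i)) -
    N j * polyInt e (u j * MvPolynomial.pderiv i (w i)))

/-- `-∑ᵢⱼ (N ∧ g)ᵢⱼ ∫ uⱼ wᵢ` over a ridge. -/
def ridgeForm (E : Finset (Pt d)) (N g : Pt d) (u w : Fin d → MvPolynomial (Fin d) ℝ) : ℝ :=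
  -∑ i, ∑ j, (N i * g j - N j * g i) * polyInt E (u j * w i)

theorem faceForm_add_right (N : Pt d) (u w w' : Fin d → MvPolynomial (Fin d) ℝ) :
    faceForm e N u (w + w') = faceForm e N u w + faceForm e N u w' := by
  simp only [faceForm, Pi.add_apply, map_add, mul_add, ← Finset.sum_add_distrib]
  refine Finset.sum_congr rfl fun i _ => Finset.sum_congr rfl fun j _ => ?_
  ring

theorem faceForm_sub_left (N : Pt d) (u u' w : Fin d → MvPolynomial (Fin d) ℝ) :
    faceForm e N (u - u') w = faceForm e N u w - faceForm e N u' w := by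
  simp only [faceForm, Pi.sub_apply, map_sub, sub_mul, ← Finset.sum_sub_distrib]
  refine Finset.sum_congr rfl fun i _ => Finset.sum_congr rfl fun j _ => ?_
  ring

theorem faceForm_neg (N : Pt d) (u w : Fin d → MvPolynomial (Fin d) ℝ) :
    faceForm e (-N) u w = -faceForm e N u w := by
  simp only [faceForm, PiLp.neg_apply, ← Finset.sum_neg_distrib]
  refine Finset.sum_congr rfl fun i _ => Finset.sum_congr rfl fun j _ => ?_
  ring

/-- For u = w = nφ the two halves of the form coincide after exchanging i and j. This removes the
boundary faces, where the mean is normal. -/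
theorem faceForm_normal (c : ℝ) (n : Pt d) (φ : MvPolynomial (Fin d) ℝ) :
    faceForm e (c • n) (fun i => n i • φ) (fun i => n i • φ) = 0 := by
  simp only [faceForm, Derivation.map_smul, smul_mul_smul_comm, PiLp.smul_apply, smul_eq_mul,
    map_smul, Finset.sum_sub_distrib]
  rw [sub_eq_zero]
  conv_rhs => rw [Finset.sum_comm]
  refine Finset.sum_congr rfl fun i _ => Finset.sum_congr rfl fun j _ => ?_
  ring

theorem ridgeForm_sub_left (N g : Pt d) (u u' w : Fin d → MvPolynomial (Fin d) ℝ) :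
    ridgeForm E N g (u - u') w = ridgeForm E N g u w - ridgeForm E N g u' w := by
  simp only [ridgeForm, Pi.sub_apply, map_sub, sub_mul, mul_sub, Finset.sum_sub_distrib]
  ring

theorem ridgeForm_sub_right (N g : Pt d) (u w w' : Fin d → MvPolynomial (Fin d) ℝ) :
    ridgeForm E N g u (w - w') = ridgeForm E N g u w - ridgeForm E N g u w' := by
  simp only [ridgeForm, Pi.sub_apply, map_sub, sub_mul, mul_sub, Finset.sum_sub_distrib]
  ring

/-- The coefficients are antisymmetric in i, j while the integrals of u_j u_i are symmetric. -/
theorem ridgeForm_self (N g : Pt d) (u : Fin d → MvPolynomial (Fin d) ℝ) :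
    ridgeForm E N g u u = 0 := by
  have : ridgeForm E N g u u = -ridgeForm E N g u u := by
    rw [ridgeForm, neg_neg, ← Finset.sum_neg_distrib]
    conv_rhs => rw [Finset.sum_comm]
    refine Finset.sum_congr rfl fun i _ => ?_
    rw [← Finset.sum_neg_distrib]
    refine Finset.sum_congr rfl fun j _ => ?_
    rw [mul_comm (u j)]; ring
  linarith

/-- Describes one ridge as seen from the two faces of an element that contain it. -/
theorem ridgeForm_swap (N g : Pt d) (c : ℝ) (u w : Fin d → MvPolynomial (Fin d) ℝ) :
    ridgeForm E (c • g) N u w = -ridgeForm E (c • N) g u w := by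
  simp only [ridgeForm, neg_neg, ← Finset.sum_neg_distrib, PiLp.smul_apply, smul_eq_mul]
  refine Finset.sum_congr rfl fun i _ => Finset.sum_congr rfl fun j _ => ?_
  ring

/-- Describes one ridge as seen from the two elements at an interior face: the normal flips, and a
multiple of it added to `g` drops out of the exterior product. -/
theorem ridgeForm_neg_add (N g : Pt d) (t : ℝ) (u w : Fin d → MvPolynomial (Fin d) ℝ) :
    ridgeForm E (-N) (g + t • N) u w = -ridgeForm E N g u w := by
  simp only [ridgeForm, neg_neg, ← Finset.sum_neg_distrib, PiLp.smul_apply, PiLp.neg_apply,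
    PiLp.add_apply, smul_eq_mul]
  refine Finset.sum_congr rfl fun i _ => Finset.sum_congr rfl fun j _ => ?_
  ring

theorem ridgeForm_normal (c : ℝ) (n g : Pt d) (φ ψ : MvPolynomial (Fin d) ℝ) :
    ridgeForm E (c • n) g (fun i => n i • φ) (fun i => n i • ψ) = 0 := by
  simp only [ridgeForm, neg_eq_zero, smul_mul_smul_comm, map_smul, smul_eq_mul, PiLp.smul_apply,
    sub_mul, Finset.sum_sub_distrib]
  rw [sub_eq_zero]
  conv_rhs => rw [Finset.sum_comm]
  refine Finset.sum_congr rfl fun i _ => Finset.sum_congr rfl fun j _ => ?_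
  ring

/-- With i and j renamed in the second form, the product rule turns the difference into the
tangential derivative (N_i ∂_j - N_j ∂_i)(u_j w_i). -/
theorem FullSim.faceForm_sub_swap (hd : 2 ≤ d) (h : FullSim K) (ha : a ∈ K) (c : ℝ)
    (u w : Fin d → MvPolynomial (Fin d) ℝ) :
    faceForm (K.erase a) (c • baryGrad K a) u w - faceForm (K.erase a) (c • baryGrad K a) w u =
      ∑ b ∈ K.erase a, ridgeForm ((K.erase a).erase b) (c • baryGrad K a) (baryGrad K b) u w := by
  have h1 : ∀ i j, polyInt (K.erase a) ((c * baryGrad K a i) • MvPolynomial.pderiv j (u j * w i) -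
        (c * baryGrad K a j) • MvPolynomial.pderiv i (u j * w i)) = _ :=
    fun i j => h.polyInt_erase_pderiv hd ha c i j (u j * w i)
  have h2 : faceForm (K.erase a) (c • baryGrad K a) u w -
      faceForm (K.erase a) (c • baryGrad K a) w u = ∑ i, ∑ j, polyInt (K.erase a)
        ((c * baryGrad K a i) • MvPolynomial.pderiv j (u j * w i) -
        (c * baryGrad K a j) • MvPolynomial.pderiv i (u j * w i)) := by
    rw [faceForm, faceForm]
    conv_lhs => rw [Finset.sum_comm (f := fun i j =>
      ((c • baryGrad K a) i * polyInt (K.erase a) (w j * MvPolynomial.pderiv j (u i)) -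
    (c • baryGrad K a) j * polyInt (K.erase a) (w j * MvPolynomial.pderiv i (u i))))]
    simp only [← Finset.sum_sub_distrib]
    refine Finset.sum_congr rfl fun i _ => Finset.sum_congr rfl fun j _ => ?_
    simp only [MvPolynomial.pderiv_mul, map_sub, map_smul, map_add, smul_eq_mul,
      PiLp.smul_apply, mul_comm (w i)]
    ring
  rw [h2]
  simp only [h1, ridgeForm, Finset.sum_neg_distrib, PiLp.smul_apply, smul_eq_mul]
  congr 1
  simp only [Finset.sum_comm (s := K.erase a)]

/-- For curl-free q the integrand |∇q|² - (div q)² is the sum over i, j of ∂_i(q_j ∂_j q_i) -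
∂_j(q_j ∂_i q_i), in which the second derivatives cancel; the divergence theorem applies. -/
theorem FullSim.sum_faceForm_self (hd : 1 ≤ d) (h : FullSim K) (c : ℝ)
    {q : Fin d → MvPolynomial (Fin d) ℝ}
    (hq : ∀ i j, MvPolynomial.pderiv i (q j) = MvPolynomial.pderiv j (q i)) :
    ∑ a ∈ K, faceForm (K.erase a) (-c • baryGrad K a) q q =
      c * polyInt K (∑ i, ∑ j, MvPolynomial.pderiv j (q i) ^ 2 -
        (∑ i, MvPolynomial.pderiv i (q i)) ^ 2) := by
  have h1 : ∑ a ∈ K, faceForm (K.erase a) (-c • baryGrad K a) q q =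
      c * ∑ i, ∑ j, (polyInt K (MvPolynomial.pderiv i (q j * MvPolynomial.pderiv j (q i))) -
        polyInt K (MvPolynomial.pderiv j (q j * MvPolynomial.pderiv i (q i)))) := by
    simp only [faceForm, h.polyInt_pderiv hd, ← Finset.sum_neg_distrib, ← Finset.sum_sub_distrib,
      Finset.mul_sum]
    rw [Finset.sum_comm]
    refine Finset.sum_congr rfl fun i _ => ?_
    rw [Finset.sum_comm]
    refine Finset.sum_congr rfl fun j _ => Finset.sum_congr rfl fun a _ => ?_
    simp only [PiLp.smul_apply, smul_eq_mul]
    ring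
  rw [h1]
  congr 1
  simp only [← map_sub, ← map_sum]
  congr 1
  rw [sq (∑ i, _), Finset.sum_mul_sum, ← Finset.sum_sub_distrib]
  refine Finset.sum_congr rfl fun i _ => ?_
  rw [← Finset.sum_sub_distrib]
  refine Finset.sum_congr rfl fun j _ => ?_
  rw [MvPolynomial.pderiv_mul, MvPolynomial.pderiv_mul, hq i j]
  have : MvPolynomial.pderiv i (MvPolynomial.pderiv j (q i)) =
      MvPolynomial.pderiv j (MvPolynomial.pderiv i (q i)) := pderiv_comm _ _ _
  rw [this]
  ring

namespace Mesh

theorem cellsAt_eq_pair (hd : 1 ≤ d) (he : e ∈ T.interiorFaces) (hK : K ∈ T.cellsAt e) :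
    ∃ K' ∈ T.cellsAt e, K ≠ K' ∧ T.cellsAt e = {K, K'} := by
  obtain ⟨-, hc, K₁, h₁, K₂, h₂, h12⟩ := mem_interiorFaces.1 he
  obtain ⟨hKc, heK⟩ := mem_cellsAt.1 hK
  obtain ⟨a, ha, rfl⟩ := exists_erase_eq hKc heK hc
  obtain ⟨K', hK', hne⟩ : ∃ K' ∈ T.cellsAt (K.erase a), K' ≠ K := by
    by_cases h : K₁ = K
    · exact ⟨K₂, h₂, fun h' => h12 (h.trans h'.symm)⟩
    · exact ⟨K₁, h₁, h⟩
  refine ⟨K', hK', hne.symm, ?_⟩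
  ext K''
  rw [Finset.mem_insert, Finset.mem_singleton]
  refine ⟨fun h => eq_or_eq_of_mem_cellsAt hd hKc ha hK' hne h, ?_⟩
  rintro (rfl | rfl)
  exacts [hK, hK']

theorem cellsAt_eq_singleton (hd : 1 ≤ d) (hO : IsOpen Ω) (hC : Convex ℝ Ω) (hne : Ω.Nonempty)
    (he : e ∈ T.boundaryFaces) (hK : K ∈ T.cellsAt e) : T.cellsAt e = {K} := by
  ext K'
  rw [Finset.mem_singleton]
  exact ⟨fun h => eq_of_mem_cellsAt_boundary hd hO hC hne he hK h, fun h => h ▸ hK⟩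

end Mesh

/-- The outward normal weighted with the size of the face. -/
def wNormal (K e : Finset (Pt d)) : Pt d := simConst e • outwardNormal K e

/-- The size of the face cancels the normalization of the normal by the altitude formula, so all
weighted normals of an element share one factor. -/
theorem FullSim.wNormal_erase (hd : 1 ≤ d) (h : FullSim K) (ha : a ∈ K) :
    wNormal K (K.erase a) = (-simConst K) • baryGrad K a := by
  rw [wNormal, h.outwardNormal_eq hd ha, h.simConst_erase hd ha, smul_neg, smul_smul, neg_smul]
  congr 2
  have := norm_pos_iff.2 (h.baryGrad_ne_zero hd ha)
  field_simp

theorem Mesh.wNormal_opposite (hd : 1 ≤ d) (hK : K ∈ T.cellsAt e) (hK' : K' ∈ T.cellsAt e)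
    (hc : e.card = d) (hne : K ≠ K') : wNormal K' e = -wNormal K e := by
  obtain ⟨hKc, heK⟩ := mem_cellsAt.1 hK
  obtain ⟨a, ha, rfl⟩ := exists_erase_eq hKc heK hc
  obtain ⟨hKc', heK'⟩ := mem_cellsAt.1 hK'
  rw [wNormal, wNormal, outwardNormal_opposite hd hKc ha hKc' hne.symm heK', smul_neg]

/-- Across a face, the gradients of the barycentric coordinates only differ in normal direction. -/
theorem Mesh.exists_baryGrad_eq_add (hd : 1 ≤ d) (hK : K ∈ T.cellsAt e) (hK' : K' ∈ T.cellsAt e)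
    (hc : e.card = d) (hb : b ∈ e) :
    ∃ t : ℝ, baryGrad K' b = baryGrad K b + t • wNormal K e := by
  obtain ⟨hKc, heK⟩ := mem_cellsAt.1 hK
  obtain ⟨a, ha, rfl⟩ := exists_erase_eq hKc heK hc
  obtain ⟨hKc', heK'⟩ := mem_cellsAt.1 hK'
  have hF := fullSim hKc
  have hF' := fullSim hKc'
  have hbK := Finset.mem_of_mem_erase hb
  have hab := Finset.ne_of_mem_erase hb
  set s := inner ℝ (baryGrad K' b) (a - b) - inner ℝ (baryGrad K b) (a - b) with hs
  refine ⟨s * (-simConst K)⁻¹, ?_⟩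
  rw [hF.wNormal_erase hd ha, smul_smul, inv_mul_cancel_right₀ (neg_ne_zero.2 hF.isSim.simConst_pos.ne')]
  refine hF.ext_inner (b := b) fun c hcK => ?_
  rw [inner_add_left, real_inner_smul_left, hF.inner_baryGrad ha hcK hbK, if_neg hab.symm]
  by_cases hca : a = c
  · subst hca
    rw [if_pos rfl, hs]; ring
  · have hce : c ∈ K.erase a := Finset.mem_erase.2 ⟨Ne.symm hca, hcK⟩
    rw [if_neg hca, hF.inner_baryGrad hbK hcK hbK,
      hF'.inner_baryGrad (heK' hb) (heK' hce) (heK' hb)]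
    ring

/-- Discrete Miranda-Talenti identity: the defect of a piecewise curl-free field is expressed
through differences across the faces and ridges. -/
theorem Mesh.sum_miranda (hd : 2 ≤ d) (hO : IsOpen Ω) (hC : Convex ℝ Ω) (hne : Ω.Nonempty)
    (q mf c : Finset (Pt d) → Fin d → MvPolynomial (Fin d) ℝ)
    (hq : ∀ K ∈ T.cells, ∀ i j, MvPolynomial.pderiv i (q K j) = MvPolynomial.pderiv j (q K i))
    (hm : ∀ e ∈ T.boundaryFaces, ∀ K ∈ T.cellsAt e, ∃ φ, mf e = fun i => outwardNormal K e i • φ)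
    (hc : ∀ e ∈ T.boundaryFaces, ∀ K ∈ T.cellsAt e, ∀ b ∈ e,
      ∃ ψ, c (e.erase b) = fun i => outwardNormal K e i • ψ) :
    ∑ K ∈ T.cells, simConst K * polyInt K (∑ i, ∑ j, MvPolynomial.pderiv j (q K i) ^ 2 -
        (∑ i, MvPolynomial.pderiv i (q K i)) ^ 2) =
      ∑ K ∈ T.cells, ∑ a ∈ K, (faceForm (K.erase a) (wNormal K (K.erase a))
        (q K - mf (K.erase a)) (q K + mf (K.erase a)) +
        ∑ b ∈ K.erase a, ridgeForm ((K.erase a).erase b) (wNormal K (K.erase a)) (baryGrad K b)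
          (mf (K.erase a) - c ((K.erase a).erase b)) (q K - c ((K.erase a).erase b))) := by
  have hd1 : 1 ≤ d := by omega
  -- The mean is single-valued on an interior face, where the two normals cancel, and normal on a
  -- boundary face.
  have hm0 : ∑ K ∈ T.cells, ∑ a ∈ K, faceForm (K.erase a) (wNormal K (K.erase a))
      (mf (K.erase a)) (mf (K.erase a)) = 0 := by
    rw [sum_cells_erase hd1 hO hC (fun K e => faceForm e (wNormal K e) (mf e) (mf e)),
      sum_sides hd1 hO hC hne]
    rw [Finset.sum_eq_zero, Finset.sum_eq_zero, add_zero]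
    · intro e he
      refine Finset.sum_eq_zero fun K hK => ?_
      obtain ⟨φ, hφ⟩ := hm e he K hK
      rw [hφ]; exact faceForm_normal _ _ _
    · intro e he
      obtain ⟨-, hcard, K, hK, -⟩ := mem_interiorFaces.1 he
      obtain ⟨K', hK', hKK, heq⟩ := cellsAt_eq_pair hd1 he hK
      rw [heq, Finset.sum_pair hKK, wNormal_opposite hd1 hK hK' hcard hKK, faceForm_neg]
      ring
  -- Across an interior face only the sign of the normal matters, as ∇λ_b changes by a multiple of
  -- it; on a boundary face both arguments are parallel to the normal.
  have hmc : ∑ K ∈ T.cells, ∑ a ∈ K, ∑ b ∈ K.erase a, ridgeForm ((K.erase a).erase b)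
      (wNormal K (K.erase a)) (baryGrad K b) (mf (K.erase a)) (c ((K.erase a).erase b)) = 0 := by
    rw [sum_cells_erase hd1 hO hC (fun K e => ∑ b ∈ e, ridgeForm (e.erase b)
      (wNormal K e) (baryGrad K b) (mf e) (c (e.erase b))), sum_sides hd1 hO hC hne]
    rw [Finset.sum_eq_zero, Finset.sum_eq_zero, add_zero]
    · intro e he
      refine Finset.sum_eq_zero fun K hK => Finset.sum_eq_zero fun b hb => ?_
      obtain ⟨φ, hφ⟩ := hm e he K hK
      obtain ⟨ψ, hψ⟩ := hc e he K hK b hb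
      rw [hφ, hψ]; exact ridgeForm_normal _ _ _ _ _
    · intro e he
      obtain ⟨-, hcard, K, hK, -⟩ := mem_interiorFaces.1 he
      obtain ⟨K', hK', hKK, heq⟩ := cellsAt_eq_pair hd1 he hK
      rw [heq, Finset.sum_pair hKK, ← Finset.sum_add_distrib]
      refine Finset.sum_eq_zero fun b hb => ?_
      obtain ⟨t, ht⟩ := exists_baryGrad_eq_add hd1 hK hK' hcard hb
      rw [wNormal_opposite hd1 hK hK' hcard hKK, ht, ridgeForm_neg_add]
      ring
  -- Within one element the ridge opposite `a` and `b` is met from two faces, with the exterior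
  -- product of ∇λ_a and ∇λ_b in opposite orders.
  have hcq : ∀ K ∈ T.cells, ∑ a ∈ K, ∑ b ∈ K.erase a, ridgeForm ((K.erase a).erase b)
      (wNormal K (K.erase a)) (baryGrad K b) (c ((K.erase a).erase b)) (q K) = 0 := by
    intro K hK
    set S := ∑ a ∈ K, ∑ b ∈ K.erase a, ridgeForm ((K.erase a).erase b)
      (wNormal K (K.erase a)) (baryGrad K b) (c ((K.erase a).erase b)) (q K) with hS
    have : S = -S := by
      conv_lhs => rw [hS]
      rw [Finset.sum_comm' (t' := K) (s' := fun b => K.erase b) (by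
        intro x y; simp only [Finset.mem_erase]; tauto), hS, ← Finset.sum_neg_distrib]
      refine Finset.sum_congr rfl fun a ha => ?_
      rw [← Finset.sum_neg_distrib]
      refine Finset.sum_congr rfl fun b hb => ?_
      have hbK := Finset.mem_of_mem_erase hb
      rw [(fullSim hK).wNormal_erase hd1 ha, (fullSim hK).wNormal_erase hd1 hbK, ridgeForm_swap,
        Finset.erase_right_comm]
    linarith
  have hcq' := Finset.sum_eq_zero hcq
  -- With F and R the face and ridge forms: F(q,q) = F(q-m, q+m) + F(m,m) + (F(m,q) - F(q,m)), the
  -- bracket is a sum of R(m,q), and R(m,q) = R(m-c, q-c) + R(m,c) + R(c,q) because R(c,c) = 0.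
  have key : ∀ K ∈ T.cells, simConst K * polyInt K (∑ i, ∑ j, MvPolynomial.pderiv j (q K i) ^ 2 -
        (∑ i, MvPolynomial.pderiv i (q K i)) ^ 2) = ∑ a ∈ K,
      ((faceForm (K.erase a) (wNormal K (K.erase a))
        (q K - mf (K.erase a)) (q K + mf (K.erase a)) +
        ∑ b ∈ K.erase a, ridgeForm ((K.erase a).erase b) (wNormal K (K.erase a)) (baryGrad K b)
          (mf (K.erase a) - c ((K.erase a).erase b)) (q K - c ((K.erase a).erase b))) +
       (faceForm (K.erase a) (wNormal K (K.erase a)) (mf (K.erase a)) (mf (K.erase a)) +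
        ∑ b ∈ K.erase a, ridgeForm ((K.erase a).erase b)
          (wNormal K (K.erase a)) (baryGrad K b) (mf (K.erase a)) (c ((K.erase a).erase b)) +
        ∑ b ∈ K.erase a, ridgeForm ((K.erase a).erase b)
          (wNormal K (K.erase a)) (baryGrad K b) (c ((K.erase a).erase b)) (q K))) := by
    intro K hK
    rw [← (fullSim hK).sum_faceForm_self hd1 _ (hq K hK)]
    refine Finset.sum_congr rfl fun a ha => ?_
    rw [(fullSim hK).wNormal_erase hd1 ha]
    have h1 := (fullSim hK).faceForm_sub_swap hd ha (-simConst K) (mf (K.erase a)) (q K)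
    simp only [ridgeForm_sub_left, ridgeForm_sub_right, ridgeForm_self, faceForm_add_right,
      faceForm_sub_left, Finset.sum_sub_distrib, Finset.sum_const_zero]
    linarith
  rw [Finset.sum_congr rfl key]
  simp only [Finset.sum_add_distrib] at hm0 hmc hcq' ⊢
  rw [hm0, hmc, hcq']
  ring

end
end CordesLS

/-! ### Means and jumps on faces, values on ridges -/

namespace CordesLS
open scoped Classical in
section

variable {d : ℕ} {Ω : Set (Pt d)} {T : Mesh Ω} {K K' E e s : Finset (Pt d)} {a b : Pt d} {σ : ℝ}

/-- The value at `x` of a polynomial vector field. -/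
def fieldAt (u : Fin d → MvPolynomial (Fin d) ℝ) (x : Pt d) : Pt d :=
  WithLp.toLp 2 fun i => pev (u i) x

@[simp] theorem fieldAt_apply (u : Fin d → MvPolynomial (Fin d) ℝ) (x : Pt d) (i : Fin d) :
    fieldAt u x i = pev (u i) x := rfl

theorem fieldAt_sub (u w : Fin d → MvPolynomial (Fin d) ℝ) (x : Pt d) :
    fieldAt (u - w) x = fieldAt u x - fieldAt w x := by
  ext i; simp [pev_sub]

theorem fieldAt_add (u w : Fin d → MvPolynomial (Fin d) ℝ) (x : Pt d) :
    fieldAt (u + w) x = fieldAt u x + fieldAt w x := by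
  ext i; simp [pev_add]

theorem fieldAt_smul (c : ℝ) (u : Fin d → MvPolynomial (Fin d) ℝ) (x : Pt d) :
    fieldAt (c • u) x = c • fieldAt u x := by
  ext i; simp [pev_smul]

/-- The squared length of a polynomial vector field. -/
def nsq (u : Fin d → MvPolynomial (Fin d) ℝ) : MvPolynomial (Fin d) ℝ := ∑ i, u i ^ 2

/-- The squared Frobenius norm of the gradient of a polynomial vector field. -/
def gsq (u : Fin d → MvPolynomial (Fin d) ℝ) : MvPolynomial (Fin d) ℝ :=
  ∑ i, ∑ j, MvPolynomial.pderiv j (u i) ^ 2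

theorem pev_sq (P : MvPolynomial (Fin d) ℝ) (x : Pt d) : pev (P ^ 2) x = pev P x ^ 2 :=
  map_pow _ _ _

theorem pev_nsq (u : Fin d → MvPolynomial (Fin d) ℝ) (x : Pt d) :
    pev (nsq u) x = ‖fieldAt u x‖ ^ 2 := by
  rw [nsq, pev_sum, EuclideanSpace.norm_sq_eq]
  simp [pev_sq]

theorem pev_gsq (u : Fin d → MvPolynomial (Fin d) ℝ) (x : Pt d) :
    pev (gsq u) x = ∑ i, ∑ j, pev (MvPolynomial.pderiv j (u i)) x ^ 2 := by
  simp [gsq, pev_sum, pev_sq]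

/-- Grouped by the direction of differentiation, so that bounds for fields apply to each derivative
∂_j u. -/
theorem pev_gsq' (u : Fin d → MvPolynomial (Fin d) ℝ) (x : Pt d) :
    pev (gsq u) x = ∑ j, ‖fieldAt (fun i => MvPolynomial.pderiv j (u i)) x‖ ^ 2 := by
  rw [pev_gsq, Finset.sum_comm]
  refine Finset.sum_congr rfl fun j _ => ?_
  rw [EuclideanSpace.norm_sq_eq]
  simp

namespace Mesh

/-- On an interior face the average of the two traces, on a boundary face the normal part. -/
def meanField (T : Mesh Ω) (q : Finset (Pt d) → Fin d → MvPolynomial (Fin d) ℝ)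
    (e : Finset (Pt d)) : Fin d → MvPolynomial (Fin d) ℝ :=
  if e ∈ T.boundaryFaces then
    ∑ K ∈ T.cellsAt e, fun i => outwardNormal K e i • ∑ j, outwardNormal K e j • q K j
  else (2⁻¹ : ℝ) • ∑ K ∈ T.cellsAt e, q K

/-- The squared deviation of the traces from their mean. -/
def jumpSq (T : Mesh Ω) (q : Finset (Pt d) → Fin d → MvPolynomial (Fin d) ℝ)
    (e : Finset (Pt d)) : MvPolynomial (Fin d) ℝ :=
  ∑ K ∈ T.cellsAt e, nsq (q K - T.meanField q e)

variable {q : Finset (Pt d) → Fin d → MvPolynomial (Fin d) ℝ}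

theorem meanField_interior (hd : 1 ≤ d) (hO : IsOpen Ω) (hC : Convex ℝ Ω) (hne : Ω.Nonempty)
    (he : e ∈ T.interiorFaces) (hK : K ∈ T.cellsAt e) (hK' : K' ∈ T.cellsAt e) (hKK : K ≠ K') :
    T.cellsAt e = {K, K'} ∧ T.meanField q e = (2⁻¹ : ℝ) • (q K + q K') := by
  have hb : e ∉ T.boundaryFaces := fun h =>
    Finset.disjoint_left.1 (disjoint_faces hd hO hC hne) he h
  obtain ⟨K'', hK'', hne'', heq⟩ := cellsAt_eq_pair hd he hK
  have : K' = K'' := by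
    rw [heq, Finset.mem_insert, Finset.mem_singleton] at hK'
    exact hK'.resolve_left hKK.symm
  subst this
  refine ⟨heq, ?_⟩
  rw [meanField, if_neg hb, heq, Finset.sum_pair hKK]

theorem pev_jumpSq_interior (hd : 1 ≤ d) (hO : IsOpen Ω) (hC : Convex ℝ Ω) (hne : Ω.Nonempty)
    (he : e ∈ T.interiorFaces) (hK : K ∈ T.cellsAt e) (hK' : K' ∈ T.cellsAt e) (hKK : K ≠ K')
    (x : Pt d) :
    pev (T.jumpSq q e) x = 2⁻¹ * ‖fieldAt (q K) x - fieldAt (q K') x‖ ^ 2 := by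
  obtain ⟨heq, hm⟩ := meanField_interior (q := q) hd hO hC hne he hK hK' hKK
  have e1 : fieldAt (q K) x - (2⁻¹ : ℝ) • (fieldAt (q K) x + fieldAt (q K') x) =
    (2⁻¹ : ℝ) • (fieldAt (q K) x - fieldAt (q K') x) := by module
  have e2 : fieldAt (q K') x - (2⁻¹ : ℝ) • (fieldAt (q K) x + fieldAt (q K') x) =
    -((2⁻¹ : ℝ) • (fieldAt (q K) x - fieldAt (q K') x)) := by module
  rw [jumpSq, heq, Finset.sum_pair hKK, pev_add, pev_nsq, pev_nsq, hm, fieldAt_sub, fieldAt_sub,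
    fieldAt_smul, fieldAt_add, e1, e2, norm_neg, norm_smul, mul_pow]
  norm_num
  ring

theorem meanField_boundary (hd : 1 ≤ d) (hO : IsOpen Ω) (hC : Convex ℝ Ω) (hne : Ω.Nonempty)
    (he : e ∈ T.boundaryFaces) (hK : K ∈ T.cellsAt e) :
    T.meanField q e = fun i => outwardNormal K e i • ∑ j, outwardNormal K e j • q K j := by
  rw [meanField, if_pos he, cellsAt_eq_singleton hd hO hC hne he hK, Finset.sum_singleton]

theorem fieldAt_normal (n : Pt d) (u : Fin d → MvPolynomial (Fin d) ℝ) (x : Pt d) :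
    fieldAt (fun i => n i • ∑ j, n j • u j) x = inner ℝ n (fieldAt u x) • n := by
  ext i
  simp only [fieldAt_apply, pev_smul, pev_sum, PiLp.smul_apply, smul_eq_mul, PiLp.inner_apply,
    RCLike.inner_apply, conj_trivial]
  rw [mul_comm]
  congr 1
  exact Finset.sum_congr rfl fun j _ => mul_comm _ _

theorem pev_jumpSq_boundary (hd : 1 ≤ d) (hO : IsOpen Ω) (hC : Convex ℝ Ω) (hne : Ω.Nonempty)
    (he : e ∈ T.boundaryFaces) (hK : K ∈ T.cellsAt e) (x : Pt d) :
    pev (T.jumpSq q e) x = ‖fieldAt (q K) x -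
      inner ℝ (outwardNormal K e) (fieldAt (q K) x) • outwardNormal K e‖ ^ 2 := by
  rw [jumpSq, cellsAt_eq_singleton hd hO hC hne he hK, Finset.sum_singleton, pev_nsq, fieldAt_sub,
    meanField_boundary hd hO hC hne he hK, fieldAt_normal]

theorem pev_jumpSq_nonneg (x : Pt d) : 0 ≤ pev (T.jumpSq q e) x := by
  rw [jumpSq, pev_sum]
  exact Finset.sum_nonneg fun K _ => by rw [pev_nsq]; positivity

theorem norm_sub_meanField_sq_le (hK : K ∈ T.cellsAt e) (x : Pt d) :
    ‖fieldAt (q K - T.meanField q e) x‖ ^ 2 ≤ pev (T.jumpSq q e) x := by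
  rw [jumpSq, pev_sum, ← pev_nsq]
  exact Finset.single_le_sum (f := fun K => pev (nsq (q K - T.meanField q e)) x)
    (fun K _ => by rw [pev_nsq]; positivity) hK

theorem norm_normal (hd : 1 ≤ d) (hK : K ∈ T.cellsAt e) (hc : e.card = d) :
    ‖outwardNormal K e‖ = 1 := by
  obtain ⟨hKc, heK⟩ := mem_cellsAt.1 hK
  obtain ⟨a, ha, rfl⟩ := exists_erase_eq hKc heK hc
  exact norm_outwardNormal hd (fullSim hKc) ha

/-- Existence of a corner value: a vector field at the ridge `E` which is normal on all boundary
faces through `E` and is controlled by the jumps across the faces through `E`. -/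
theorem exists_ridge_value (hd : 2 ≤ d) (hO : IsOpen Ω) (hC : Convex ℝ Ω) (hne : Ω.Nonempty)
    {κ : ℝ} (hκ : 0 < κ) (hκT : ∀ (T : Mesh Ω) (e e' K K' : Finset (Pt d)), e ∈ T.boundaryFaces →
      e' ∈ T.boundaryFaces → K ∈ T.cellsAt e → K' ∈ T.cellsAt e' → (e ∩ e').Nonempty →
      outwardNormal K e ≠ outwardNormal K' e' →
      κ ≤ 1 - inner ℝ (outwardNormal K e) (outwardNormal K' e') ^ 2)
    {N : ℝ} (hE : E ∈ T.faces) (hEc : E.card + 1 = d) (hN : ((T.cellsAt E).card : ℝ) ≤ N)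
    (q : Finset (Pt d) → Fin d → MvPolynomial (Fin d) ℝ) :
    ∃ c : Fin d → MvPolynomial (Fin d) ℝ,
      (∀ e ∈ T.boundaryFaces, E ⊆ e → ∀ K ∈ T.cellsAt e,
        ∃ ψ, c = fun i => outwardNormal K e i • ψ) ∧
      ∀ K ∈ T.cellsAt E, ∀ x, ‖fieldAt (q K - c) x‖ ^ 2 ≤
        ((2 * N + 1) + (2 * N + 2) / κ + 2 * N) ^ 2 *
          ∑ e ∈ T.sides with E ⊆ e, pev (T.jumpSq q e) x := by
  have hd1 : 1 ≤ d := by omega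
  have hN0 : 0 ≤ N := le_trans (Nat.cast_nonneg _) hN
  set R : Pt d → ℝ := fun x => Real.sqrt (∑ e ∈ T.sides with E ⊆ e, pev (T.jumpSq q e) x) with hR
  have hR0 : ∀ x, 0 ≤ R x := fun x => Real.sqrt_nonneg _
  have hRsq : ∀ x, R x ^ 2 = ∑ e ∈ T.sides with E ⊆ e, pev (T.jumpSq q e) x := fun x =>
    Real.sq_sqrt (Finset.sum_nonneg fun e _ => pev_jumpSq_nonneg x)
  have hle : ∀ e ∈ T.sides, E ⊆ e → ∀ x, pev (T.jumpSq q e) x ≤ R x ^ 2 := by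
    intro e he hEe x
    rw [hRsq]
    exact Finset.single_le_sum (f := fun e => pev (T.jumpSq q e) x)
      (fun e _ => pev_jumpSq_nonneg x) (Finset.mem_filter.2 ⟨he, hEe⟩)
  have hbd : ∀ e ∈ T.boundaryFaces, E ⊆ e → ∀ K ∈ T.cellsAt e, ∀ x, ‖fieldAt (q K) x -
      inner ℝ (outwardNormal K e) (fieldAt (q K) x) • outwardNormal K e‖ ≤ R x := by
    intro e he hEe K hK x
    refine abs_le_of_sq_le_sq' ?_ (hR0 x) |>.2
    rw [← pev_jumpSq_boundary hd1 hO hC hne he hK]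
    exact hle e (Finset.mem_union_right _ he) hEe x
  -- Each step of a walk around `E` crosses an interior face and changes the value by at most √2 R ≤
  -- 2R, since the squared jump is half the squared difference; a path has at most N steps.
  have hpath : ∀ K ∈ T.cellsAt E, ∀ K' ∈ T.cellsAt E, ∀ x,
      ‖fieldAt (q K) x - fieldAt (q K') x‖ ≤ 2 * N * R x := by
    intro K hK K' hK' x
    obtain ⟨p, hp⟩ := (T.starGraph_preconnected hd hC hE hEc).exists_walk_length_le ⟨K, hK⟩ ⟨K', hK'⟩
    have h := SimpleGraph.Walk.norm_sub_le (f := fun A : {K // K ∈ T.cellsAt E} =>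
      fieldAt (q A.1) x) (R := 2 * R x) (G := T.starGraph E) (by
      rintro ⟨A, hA⟩ ⟨B, hB⟩ ⟨hAB, hcard⟩
      have hABne : A ≠ B := fun h => hAB (Subtype.ext h)
      obtain ⟨hA1, hA2⟩ := mem_cellsAt.1 hA
      obtain ⟨hB1, hB2⟩ := mem_cellsAt.1 hB
      have hcard : (A ∩ B).card = d := hcard
      have hAe : A ∈ T.cellsAt (A ∩ B) := mem_cellsAt.2 ⟨hA1, Finset.inter_subset_left⟩
      have hBe : B ∈ T.cellsAt (A ∩ B) := mem_cellsAt.2 ⟨hB1, Finset.inter_subset_right⟩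
      have hint : A ∩ B ∈ T.interiorFaces := mem_interiorFaces.2
        ⟨mem_faces_of_subset hA1 Finset.inter_subset_left (Finset.card_pos.1 (by omega)), hcard,
          A, hAe, B, hBe, hABne⟩
      have h1 := hle _ (Finset.mem_union_left _ hint) (Finset.subset_inter hA2 hB2) x
      rw [pev_jumpSq_interior hd1 hO hC hne hint hAe hBe hABne] at h1
      refine abs_le_of_sq_le_sq' ?_ (by have := hR0 x; positivity) |>.2
      nlinarith [sq_nonneg (R x)]) p
    refine h.trans ?_
    have h2 : (p.length : ℝ) ≤ N := by
      refine le_trans ?_ hN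
      rw [Fintype.card_coe] at hp
      exact_mod_cast hp
    have := mul_le_mul_of_nonneg_right h2 (mul_nonneg zero_le_two (hR0 x))
    linarith
  have hfin : ∀ c : Fin d → MvPolynomial (Fin d) ℝ, (∀ K ∈ T.cellsAt E, ∀ x,
      ‖fieldAt (q K) x - fieldAt c x‖ ≤ ((2 * N + 1) + (2 * N + 2) / κ + 2 * N) * R x) →
      ∀ K ∈ T.cellsAt E, ∀ x, ‖fieldAt (q K - c) x‖ ^ 2 ≤
        ((2 * N + 1) + (2 * N + 2) / κ + 2 * N) ^ 2 *
          ∑ e ∈ T.sides with E ⊆ e, pev (T.jumpSq q e) x := by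
    intro c hc K hK x
    rw [← hRsq, ← mul_pow, fieldAt_sub]
    exact pow_le_pow_left₀ (norm_nonneg _) (hc K hK x) 2
  have hκN : 0 ≤ (2 * N + 2) / κ := by positivity
  by_cases hB : ∃ e ∈ T.boundaryFaces, E ⊆ e
  swap
  -- No boundary face at the ridge: the value in any element around it will do.
  · obtain ⟨K₀, hK₀⟩ := exists_cellsAt hE
    refine ⟨q K₀, fun e he hEe => absurd ⟨e, he, hEe⟩ hB, hfin _ fun K hK x => ?_⟩
    refine (hpath K hK K₀ hK₀ x).trans (mul_le_mul_of_nonneg_right ?_ (hR0 x))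
    linarith
  obtain ⟨e₀, he₀, hEe₀⟩ := hB
  obtain ⟨K₀, hK₀⟩ := exists_cellsAt (mem_boundaryFaces.1 he₀).1
  have hcE : ∀ e, E ⊆ e → ∀ K ∈ T.cellsAt e, K ∈ T.cellsAt E := fun e hEe K hK =>
    mem_cellsAt.2 ⟨(mem_cellsAt.1 hK).1, hEe.trans (mem_cellsAt.1 hK).2⟩
  by_cases hflat : ∀ e ∈ T.boundaryFaces, E ⊆ e → ∀ K ∈ T.cellsAt e,
      outwardNormal K e = outwardNormal K₀ e₀
  -- The boundary is flat at the ridge: the normal part of one boundary trace is normal to all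
  -- boundary faces there.
  · refine ⟨fun i => outwardNormal K₀ e₀ i • ∑ j, outwardNormal K₀ e₀ j • q K₀ j,
      fun e he hEe K hK => ⟨∑ j, outwardNormal K₀ e₀ j • q K₀ j, ?_⟩, hfin _ fun K hK x => ?_⟩
    · rw [hflat e he hEe K hK]
    · rw [fieldAt_normal]
      have h1 := hpath K hK K₀ (hcE e₀ hEe₀ K₀ hK₀) x
      have h2 := hbd e₀ he₀ hEe₀ K₀ hK₀ x
      have h3 := norm_sub_le_norm_sub_add_norm_sub (fieldAt (q K) x) (fieldAt (q K₀) x)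
        (inner ℝ (outwardNormal K₀ e₀) (fieldAt (q K₀) x) • outwardNormal K₀ e₀)
      have h4 := mul_nonneg hκN (hR0 x)
      have h5 := mul_nonneg hN0 (hR0 x)
      linarith
  -- Two different boundary normals meet at the ridge. The value is zero, and the field itself must
  -- be small because it is nearly parallel to both normals.
  · push Not at hflat
    obtain ⟨e₁, he₁, hEe₁, K₁, hK₁, hnn⟩ := hflat
    refine ⟨0, fun e he hEe K hK => ⟨0, by funext i; simp⟩, hfin _ fun K hK x => ?_⟩
    obtain ⟨z, hz⟩ := Finset.card_pos.1 (show 0 < E.card by omega)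
    have hκ1 := hκT T e₁ e₀ K₁ K₀ he₁ he₀ hK₁ hK₀
      ⟨z, Finset.mem_inter.2 ⟨hEe₁ hz, hEe₀ hz⟩⟩ hnn
    have u1 := norm_normal hd1 hK₁ (mem_boundaryFaces.1 he₁).2.1
    have u0 := norm_normal hd1 hK₀ (mem_boundaryFaces.1 he₀).2.1
    set n₁ := outwardNormal K₁ e₁
    set n₀ := outwardNormal K₀ e₀
    set v := fieldAt (q K₁) x
    set v₀ := fieldAt (q K₀) x
    have h1 : ‖v - inner ℝ n₁ v • n₁‖ ≤ R x := hbd e₁ he₁ hEe₁ K₁ hK₁ x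
    have h0 : ‖v₀ - inner ℝ n₀ v₀ • n₀‖ ≤ R x := hbd e₀ he₀ hEe₀ K₀ hK₀ x
    have h10 : ‖v - v₀‖ ≤ 2 * N * R x := hpath K₁ (hcE _ hEe₁ _ hK₁) K₀ (hcE _ hEe₀ _ hK₀) x
    have hK1 : ‖fieldAt (q K) x - v‖ ≤ 2 * N * R x := hpath K hK K₁ (hcE _ hEe₁ _ hK₁) x
    have hzero : fieldAt (0 : Fin d → MvPolynomial (Fin d) ℝ) x = 0 := by
      ext i; simp [pev]
    rw [hzero, sub_zero]
    -- the tangential part of `v` with respect to `n₀`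
    have ht : ‖v - inner ℝ n₀ v • n₀‖ ≤ (2 * N + 1) * R x := by
      have e1 : v - inner ℝ n₀ v • n₀ = (v₀ - inner ℝ n₀ v₀ • n₀) +
          ((v - v₀) - inner ℝ n₀ (v - v₀) • n₀) := by
        rw [inner_sub_right]; module
      have e2 : ‖(v - v₀) - inner ℝ n₀ (v - v₀) • n₀‖ ≤ ‖v - v₀‖ := by
        refine abs_le_of_sq_le_sq' ?_ (norm_nonneg _) |>.2
        rw [norm_sub_sq_real, norm_smul, real_inner_smul_right, u0, Real.norm_eq_abs, mul_one, sq_abs,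
          real_inner_comm]
        nlinarith [sq_nonneg (inner ℝ n₀ (v - v₀))]
      rw [e1]
      refine (norm_add_le _ _).trans ?_
      linarith
    -- Expresses the normal component of `v` through its tangential parts with respect to both
    -- normals; `κ` bounds the factor on the left from below.
    have hin : (1 - inner ℝ n₁ n₀ ^ 2) * inner ℝ n₁ v = inner ℝ n₁ (v - inner ℝ n₀ v • n₀) +
        inner ℝ n₁ n₀ * inner ℝ n₀ (v - inner ℝ n₁ v • n₁) := by
      simp only [inner_sub_right, real_inner_smul_right]
      rw [real_inner_comm n₁ n₀]; ring
    have b1 : |inner ℝ n₁ (v - inner ℝ n₀ v • n₀)| ≤ (2 * N + 1) * R x := by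
      refine (abs_real_inner_le_norm _ _).trans ?_
      rw [u1, one_mul]; exact ht
    have b2 : |inner ℝ n₁ n₀ * inner ℝ n₀ (v - inner ℝ n₁ v • n₁)| ≤ R x := by
      rw [abs_mul]
      have c1 : |inner ℝ n₁ n₀| ≤ 1 := by
        refine (abs_real_inner_le_norm _ _).trans ?_
        rw [u1, u0, one_mul]
      have c2 : |inner ℝ n₀ (v - inner ℝ n₁ v • n₁)| ≤ R x := by
        refine (abs_real_inner_le_norm _ _).trans ?_
        rw [u0, one_mul]; exact h1
      calc _ ≤ 1 * R x := mul_le_mul c1 c2 (abs_nonneg _) zero_le_one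
        _ = R x := one_mul _
    have b3 : |inner ℝ n₁ v| ≤ (2 * N + 2) / κ * R x := by
      have : κ * |inner ℝ n₁ v| ≤ (2 * N + 2) * R x := by
        calc κ * |inner ℝ n₁ v| ≤ (1 - inner ℝ n₁ n₀ ^ 2) * |inner ℝ n₁ v| :=
              mul_le_mul_of_nonneg_right hκ1 (abs_nonneg _)
          _ = |(1 - inner ℝ n₁ n₀ ^ 2) * inner ℝ n₁ v| := by
              rw [abs_mul, abs_of_nonneg (hκ.le.trans hκ1)]
          _ ≤ (2 * N + 1) * R x + R x := by
              rw [hin]; exact (abs_add_le _ _).trans (add_le_add b1 b2)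
          _ = _ := by ring
      rw [div_mul_eq_mul_div, le_div_iff₀ hκ]
      linarith
    have hv : ‖v‖ ≤ R x + (2 * N + 2) / κ * R x := by
      have : v = (v - inner ℝ n₁ v • n₁) + inner ℝ n₁ v • n₁ := by abel
      rw [this]
      refine (norm_add_le _ _).trans (add_le_add h1 ?_)
      rwa [norm_smul, u1, mul_one, Real.norm_eq_abs]
    have h6 : ‖fieldAt (q K) x‖ ≤ ‖fieldAt (q K) x - v‖ + ‖v‖ := norm_le_norm_sub_add _ _
    have h5 := mul_nonneg hN0 (hR0 x)
    linarith

end Mesh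
end
end CordesLS

/-! ### Bounds for the face terms -/

namespace CordesLS
open scoped Classical in
section

variable {d m : ℕ} {Ω : Set (Pt d)} {T : Mesh Ω} {K K' E e s : Finset (Pt d)} {a b : Pt d} {σ : ℝ}

theorem polyInt_nonneg {P : MvPolynomial (Fin d) ℝ} (h : ∀ x, 0 ≤ pev P x) : 0 ≤ polyInt s P := by
  by_cases hs : IsSim s
  · rw [hs.polyInt_apply]
    exact hs.simInt_nonneg fun x _ => h x
  · rw [polyInt, dif_neg hs]; rfl

theorem polyInt_mono {P Q : MvPolynomial (Fin d) ℝ} (h : ∀ x, pev P x ≤ pev Q x) :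
    polyInt s P ≤ polyInt s Q := by
  have := polyInt_nonneg (s := s) (P := Q - P) fun x => by rw [pev_sub]; linarith [h x]
  rw [map_sub] at this
  linarith

theorem polyInt_sq_nonneg (P : MvPolynomial (Fin d) ℝ) : 0 ≤ polyInt s (P ^ 2) :=
  polyInt_nonneg fun x => by rw [pev_sq]; positivity

/-- Young's inequality; the parameter stays free so that gradient terms can be made small later. -/
theorem abs_polyInt_mul_le (P Q : MvPolynomial (Fin d) ℝ) {t : ℝ} (ht : 0 < t) :
    |polyInt s (P * Q)| ≤ 2⁻¹ * (t * polyInt s (P ^ 2) + t⁻¹ * polyInt s (Q ^ 2)) := by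
  have key : ∀ ε : ℝ, ε ^ 2 = 1 → 0 ≤ t * polyInt s (P ^ 2) + t⁻¹ * polyInt s (Q ^ 2) -
      2 * ε * polyInt s (P * Q) := by
    intro ε hε
    have := polyInt_nonneg (s := s) (P := t • P ^ 2 + t⁻¹ • Q ^ 2 - (2 * ε) • (P * Q)) fun x => by
      simp only [pev_sub, pev_add, pev_smul, pev_sq, pev_mul]
      have : t * pev P x ^ 2 + t⁻¹ * pev Q x ^ 2 - 2 * ε * (pev P x * pev Q x) =
          t⁻¹ * (t * pev P x - ε * pev Q x) ^ 2 := by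
        field_simp
        linear_combination (-pev Q x ^ 2) * hε
      rw [this]; positivity
    simpa only [map_sub, map_add, map_smul, smul_eq_mul] using this
  have h1 := key 1 (by norm_num)
  have h2 := key (-1) (by norm_num)
  rw [abs_le]
  constructor <;> linarith

theorem polyInt_nsq (u : Fin d → MvPolynomial (Fin d) ℝ) :
    polyInt s (nsq u) = ∑ i, polyInt s (u i ^ 2) := by
  rw [nsq, map_sum]

theorem polyInt_gsq (u : Fin d → MvPolynomial (Fin d) ℝ) :
    polyInt s (gsq u) = ∑ i, ∑ j, polyInt s (MvPolynomial.pderiv j (u i) ^ 2) := by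
  simp only [gsq, map_sum]

theorem abs_faceForm_le (hd : 1 ≤ d) {N : Pt d} {c t : ℝ} (hN : ∀ i, |N i| ≤ c) (ht : 0 < t)
    (u w : Fin d → MvPolynomial (Fin d) ℝ) :
    |faceForm e N u w| ≤ d * c * (t * polyInt e (nsq u) + t⁻¹ * polyInt e (gsq w)) := by
  have hc : 0 ≤ c := (abs_nonneg _).trans (hN ⟨0, hd⟩)
  have h1 : |faceForm e N u w| ≤ ∑ i, ∑ j,
      c * (t * polyInt e (u j ^ 2) + t⁻¹ * (2⁻¹ * polyInt e (MvPolynomial.pderiv j (w i) ^ 2) +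
        2⁻¹ * polyInt e (MvPolynomial.pderiv i (w i) ^ 2))) := by
    refine (Finset.abs_sum_le_sum_abs _ _).trans (Finset.sum_le_sum fun i _ =>
      (Finset.abs_sum_le_sum_abs _ _).trans (Finset.sum_le_sum fun j _ => ?_))
    refine (abs_sub _ _).trans ?_
    rw [abs_mul, abs_mul]
    have e1 := mul_le_mul (hN i) (abs_polyInt_mul_le (s := e) (u j) (MvPolynomial.pderiv j (w i)) ht)
      (abs_nonneg _) hc
    have e2 := mul_le_mul (hN j) (abs_polyInt_mul_le (s := e) (u j) (MvPolynomial.pderiv i (w i)) ht)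
      (abs_nonneg _) hc
    refine (add_le_add e1 e2).trans (le_of_eq ?_)
    ring
  refine h1.trans ?_
  have e3 : ∑ i, polyInt e (MvPolynomial.pderiv i (w i) ^ 2) ≤ polyInt e (gsq w) := by
    rw [polyInt_gsq]
    exact Finset.sum_le_sum fun i _ => Finset.single_le_sum
      (f := fun j => polyInt e (MvPolynomial.pderiv j (w i) ^ 2))
      (fun j _ => polyInt_sq_nonneg _) (Finset.mem_univ i)
  have e4 : 0 ≤ polyInt e (gsq w) := by
    rw [polyInt_gsq]
    exact Finset.sum_nonneg fun i _ => Finset.sum_nonneg fun j _ => polyInt_sq_nonneg _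
  simp only [← Finset.mul_sum, Finset.sum_add_distrib, Finset.sum_const, Finset.card_univ,
    Fintype.card_fin, nsmul_eq_mul]
  rw [← polyInt_nsq, ← polyInt_gsq]
  have hd' : (1 : ℝ) ≤ d := by exact_mod_cast hd
  have e5 : 2⁻¹ * polyInt e (gsq w) + d * (2⁻¹ * ∑ i, polyInt e (MvPolynomial.pderiv i (w i) ^ 2)) ≤
      d * polyInt e (gsq w) := by nlinarith
  have e6 := mul_le_mul_of_nonneg_left e5 (inv_nonneg.2 ht.le)
  have e7 := mul_le_mul_of_nonneg_left e6 hc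
  linarith

theorem abs_ridgeForm_le {N g : Pt d} {c : ℝ} (hN : ∀ i j, |N i * g j - N j * g i| ≤ c)
    (hc : 0 ≤ c) (u w : Fin d → MvPolynomial (Fin d) ℝ) :
    |ridgeForm E N g u w| ≤ d * c * (polyInt E (nsq u) + polyInt E (nsq w)) := by
  have h1 : |ridgeForm E N g u w| ≤ ∑ i, ∑ j,
      c * (polyInt E (u j ^ 2) + polyInt E (w i ^ 2)) := by
    rw [ridgeForm, abs_neg]
    refine (Finset.abs_sum_le_sum_abs _ _).trans (Finset.sum_le_sum fun i _ =>
      (Finset.abs_sum_le_sum_abs _ _).trans (Finset.sum_le_sum fun j _ => ?_))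
    rw [abs_mul]
    refine mul_le_mul (hN i j) ?_ (abs_nonneg _) hc
    have := abs_polyInt_mul_le (s := E) (u j) (w i) one_pos
    have h2 := polyInt_sq_nonneg (s := E) (u j)
    have h3 := polyInt_sq_nonneg (s := E) (w i)
    rw [inv_one] at this
    linarith
  refine h1.trans (le_of_eq ?_)
  simp only [← Finset.mul_sum, Finset.sum_add_distrib, Finset.sum_const, Finset.card_univ,
    Fintype.card_fin, nsmul_eq_mul, ← polyInt_nsq]
  ring

namespace Mesh

variable {q : Finset (Pt d) → Fin d → MvPolynomial (Fin d) ℝ}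

/-- The mean is formed with constant coefficients, so its derivatives are the means of the
derivatives and inherit every bound for means. -/
theorem meanField_pderiv (j : Fin d) :
    (fun i => MvPolynomial.pderiv j (T.meanField q e i)) =
      T.meanField (fun K i => MvPolynomial.pderiv j (q K i)) e := by
  funext i
  rw [meanField, meanField]
  split_ifs
  · simp only [Finset.sum_apply, map_sum, Derivation.map_smul]
  · simp only [Pi.smul_apply, Finset.sum_apply, map_sum, Derivation.map_smul]

theorem norm_meanField_sq_le (hd : 1 ≤ d) (hO : IsOpen Ω) (hC : Convex ℝ Ω) (hne : Ω.Nonempty)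
    (he : e ∈ T.sides) (x : Pt d) :
    ‖fieldAt (T.meanField q e) x‖ ^ 2 ≤ ∑ K ∈ T.cellsAt e, ‖fieldAt (q K) x‖ ^ 2 := by
  rcases Finset.mem_union.1 he with hi | hb
  · obtain ⟨-, -, K, hK, -⟩ := mem_interiorFaces.1 hi
    obtain ⟨K', hK', hKK, heq⟩ := cellsAt_eq_pair hd hi hK
    rw [heq, Finset.sum_pair hKK, (meanField_interior hd hO hC hne hi hK hK' hKK).2, fieldAt_smul,
      fieldAt_add, norm_smul, mul_pow]
    have h1 := norm_add_le (fieldAt (q K) x) (fieldAt (q K') x)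
    have h2 := pow_le_pow_left₀ (norm_nonneg _) h1 2
    norm_num
    nlinarith [sq_nonneg (‖fieldAt (q K) x‖ - ‖fieldAt (q K') x‖), sq_nonneg ‖fieldAt (q K) x‖,
      sq_nonneg ‖fieldAt (q K') x‖]
  · obtain ⟨K, hK⟩ := exists_cellsAt (mem_boundaryFaces.1 hb).1
    rw [meanField_boundary hd hO hC hne hb hK, fieldAt_normal,
      cellsAt_eq_singleton hd hO hC hne hb hK, Finset.sum_singleton, norm_smul,
      norm_normal hd hK (mem_boundaryFaces.1 hb).2.1, mul_one]
    refine pow_le_pow_left₀ (norm_nonneg _) ?_ 2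
    refine (norm_inner_le_norm _ _).trans ?_
    rw [norm_normal hd hK (mem_boundaryFaces.1 hb).2.1, one_mul]

theorem polyInt_gsq_add_meanField_le (hd : 1 ≤ d) (hO : IsOpen Ω) (hC : Convex ℝ Ω)
    (hne : Ω.Nonempty) (he : e ∈ T.sides) (hK : K ∈ T.cellsAt e) :
    polyInt s (gsq (q K + T.meanField q e)) ≤ 4 * ∑ K' ∈ T.cellsAt e, polyInt s (gsq (q K')) := by
  have h : ∀ x, pev (gsq (q K + T.meanField q e)) x ≤
      pev ((4 : ℝ) • ∑ K' ∈ T.cellsAt e, gsq (q K')) x := by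
    intro x
    rw [pev_smul, pev_sum]
    simp only [pev_gsq']
    rw [Finset.sum_comm, Finset.mul_sum]
    refine Finset.sum_le_sum fun j _ => ?_
    have h1 : (fun i => MvPolynomial.pderiv j ((q K + T.meanField q e) i)) =
        (fun i => MvPolynomial.pderiv j (q K i)) +
          T.meanField (fun K i => MvPolynomial.pderiv j (q K i)) e := by
      rw [← meanField_pderiv]; funext i; simp
    simp only [h1, fieldAt_add]
    have h2 := norm_meanField_sq_le (q := fun K i => MvPolynomial.pderiv j (q K i)) hd hO hC hne he x
    have h3 := Finset.single_le_sum
      (f := fun K => ‖fieldAt (fun i => MvPolynomial.pderiv j (q K i)) x‖ ^ 2)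
      (fun K _ => sq_nonneg _) hK
    have h4 := pow_le_pow_left₀ (norm_nonneg _)
      (norm_add_le (fieldAt (fun i => MvPolynomial.pderiv j (q K i)) x)
        (fieldAt (T.meanField (fun K i => MvPolynomial.pderiv j (q K i)) e) x)) 2
    nlinarith [sq_nonneg (‖fieldAt (fun i => MvPolynomial.pderiv j (q K i)) x‖ -
      ‖fieldAt (T.meanField (fun K i => MvPolynomial.pderiv j (q K i)) e) x‖)]
  have := polyInt_mono (s := s) h
  rwa [map_smul, map_sum, smul_eq_mul] at this

/-- The mean square of the jump over a face, scaled as in the energy norm. -/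
def jumpTerm (T : Mesh Ω) (q : Finset (Pt d) → Fin d → MvPolynomial (Fin d) ℝ)
    (e : Finset (Pt d)) : ℝ :=
  simConst e / hFace e * polyInt e (T.jumpSq q e)

/-- The Dirichlet energy on an element. -/
def gradTerm (q : Finset (Pt d) → Fin d → MvPolynomial (Fin d) ℝ) (K : Finset (Pt d)) : ℝ :=
  simConst K * polyInt K (gsq (q K))

theorem isSim_of_card (hd : 1 ≤ d) (hK : K ∈ T.cellsAt e) (hc : e.card = d) : IsSim e := by
  obtain ⟨hKc, heK⟩ := mem_cellsAt.1 hK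
  obtain ⟨a, ha, rfl⟩ := exists_erase_eq hKc heK hc
  exact (fullSim hKc).isSim_erase hd ha

theorem jumpTerm_nonneg (hd : 2 ≤ d) (he : e ∈ T.sides) : 0 ≤ T.jumpTerm q e := by
  obtain ⟨K, hK⟩ := exists_cellsAt (mem_faces_of_mem_sides he)
  have h1 := (isSim_of_card (by omega) hK (card_of_mem_sides he)).simConst_pos
  have h2 := hFace_pos hd (card_of_mem_sides he)
  have h3 := polyInt_nonneg (s := e) (P := T.jumpSq q e) pev_jumpSq_nonneg
  rw [jumpTerm]; positivity

theorem polyInt_gsq_nonneg (u : Fin d → MvPolynomial (Fin d) ℝ) : 0 ≤ polyInt s (gsq u) :=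
  polyInt_nonneg fun x => by rw [pev_gsq']; positivity

theorem gradTerm_nonneg (hK : K ∈ T.cells) : 0 ≤ gradTerm q K :=
  mul_nonneg (fullSim hK).isSim.simConst_pos.le (polyInt_gsq_nonneg _)

/-- Inverse trace inequality for the gradient. -/
theorem ShapeRegular.face_grad_le (hd : 2 ≤ d) (hT : T.ShapeRegular σ) {C : ℝ} (hC0 : 0 < C)
    (hC : ∀ s t : Finset (Pt d), IsSim s → t ⊆ s → t.Nonempty → ∀ P : MvPolynomial (Fin d) ℝ,
      P.totalDegree ≤ m → simInt t (fun y => pev P y ^ 2) ≤ C * simInt s (fun y => pev P y ^ 2))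
    (hq : ∀ i, (q K i).totalDegree ≤ m) (hK : K ∈ T.cellsAt e) (hc : e.card = d) :
    hFace e * (simConst e * polyInt e (gsq (q K))) ≤ C * σ * gradTerm q K := by
  have hs := isSim_of_card (by omega) hK hc
  obtain ⟨hKc, heK⟩ := mem_cellsAt.1 hK
  have hF := fullSim hKc
  have h1 : polyInt e (gsq (q K)) ≤ C * polyInt K (gsq (q K)) := by
    simp only [polyInt_gsq, Finset.mul_sum]
    refine Finset.sum_le_sum fun i _ => Finset.sum_le_sum fun j _ => ?_
    rw [hs.polyInt_apply, hF.isSim.polyInt_apply]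
    simp only [funext (pev_sq (MvPolynomial.pderiv j (q K i)))]
    exact hC K e hF.isSim heK (Finset.card_pos.1 (by omega)) _
      ((totalDegree_pderiv_le j _).trans (hq i))
  -- By the altitude formula the face has size |K| ‖∇λ_a‖, and ‖∇λ_a‖ h_e ≤ ‖∇λ_a‖ h_K ≤ σ.
  have h2 : hFace e * simConst e ≤ σ * simConst K := by
    have h3 := hFace_le_diam heK
    obtain ⟨a, ha, rfl⟩ := exists_erase_eq hKc heK hc
    rw [hF.simConst_erase (by omega) ha]
    have h4 := hT.norm_baryGrad_mul_diam_le (by omega) hKc ha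
    have h5 := hF.isSim.simConst_pos
    calc hFace (K.erase a) * (simConst K * ‖baryGrad K a‖)
        ≤ Metric.diam (hull K) * (simConst K * ‖baryGrad K a‖) :=
          mul_le_mul_of_nonneg_right h3 (by positivity)
      _ = (‖baryGrad K a‖ * Metric.diam (hull K)) * simConst K := by ring
      _ ≤ σ * simConst K := mul_le_mul_of_nonneg_right h4 h5.le
  have h6 : 0 ≤ hFace e * simConst e := mul_nonneg (hFace_pos hd hc).le hs.simConst_pos.le
  calc hFace e * (simConst e * polyInt e (gsq (q K)))
      = (hFace e * simConst e) * polyInt e (gsq (q K)) := by ring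
    _ ≤ (hFace e * simConst e) * (C * polyInt K (gsq (q K))) := mul_le_mul_of_nonneg_left h1 h6
    _ ≤ (σ * simConst K) * (C * polyInt K (gsq (q K))) :=
        mul_le_mul_of_nonneg_right h2 (mul_nonneg hC0.le (polyInt_gsq_nonneg _))
    _ = _ := by rw [gradTerm]; ring

theorem ShapeRegular.abs_faceForm_le (hd : 2 ≤ d) (hO : IsOpen Ω) (hcv : Convex ℝ Ω)
    (hne : Ω.Nonempty) (hT : T.ShapeRegular σ) {C : ℝ} (hC0 : 0 < C)
    (hC : ∀ s t : Finset (Pt d), IsSim s → t ⊆ s → t.Nonempty → ∀ P : MvPolynomial (Fin d) ℝ,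
      P.totalDegree ≤ m → simInt t (fun y => pev P y ^ 2) ≤ C * simInt s (fun y => pev P y ^ 2))
    (hq : ∀ K ∈ T.cells, ∀ i, (q K i).totalDegree ≤ m) {t : ℝ} (ht : 0 < t)
    (he : e ∈ T.sides) (hK : K ∈ T.cellsAt e) :
    |faceForm e (wNormal K e) (q K - T.meanField q e) (q K + T.meanField q e)| ≤
      d * (t * T.jumpTerm q e + t⁻¹ * (4 * C * σ) * ∑ K' ∈ T.cellsAt e, gradTerm q K') := by
  have hd1 : 1 ≤ d := by omega
  have hc := card_of_mem_sides he
  have hs := isSim_of_card hd1 hK hc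
  have hV := hs.simConst_pos
  have hh := hFace_pos hd hc
  have hN : ∀ i, |wNormal K e i| ≤ simConst e := by
    intro i
    have h1 := PiLp.norm_apply_le (wNormal K e) i
    rwa [wNormal, norm_smul, norm_normal hd1 hK hc, mul_one, Real.norm_eq_abs, Real.norm_eq_abs,
      abs_of_pos hV] at h1
  -- Young's parameter is t/h_e: it produces the weight 1/h_e of the jumps and the weight h_e that
  -- the inverse trace inequality compensates.
  refine (CordesLS.abs_faceForm_le hd1 hN (div_pos ht hh) _ _).trans ?_
  have h2 : polyInt e (nsq (q K - T.meanField q e)) ≤ polyInt e (T.jumpSq q e) :=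
    polyInt_mono fun x => by rw [pev_nsq]; exact norm_sub_meanField_sq_le hK x
  have h3 := polyInt_gsq_add_meanField_le (q := q) (s := e) hd1 hO hcv hne he hK
  have h4 : hFace e * (simConst e * ∑ K' ∈ T.cellsAt e, polyInt e (gsq (q K'))) ≤
      C * σ * ∑ K' ∈ T.cellsAt e, gradTerm q K' := by
    rw [Finset.mul_sum, Finset.mul_sum, Finset.mul_sum]
    exact Finset.sum_le_sum fun K' hK' =>
      hT.face_grad_le hd hC0 hC (hq K' (mem_cellsAt.1 hK').1) hK' hc
  rw [mul_assoc]
  refine mul_le_mul_of_nonneg_left ?_ (Nat.cast_nonneg d)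
  rw [mul_add]
  refine add_le_add ?_ ?_
  · rw [jumpTerm]
    calc simConst e * (t / hFace e * polyInt e (nsq (q K - T.meanField q e)))
        = (t * (simConst e / hFace e)) * polyInt e (nsq (q K - T.meanField q e)) := by ring
      _ ≤ (t * (simConst e / hFace e)) * polyInt e (T.jumpSq q e) :=
        mul_le_mul_of_nonneg_left h2 (by positivity)
      _ = _ := by ring
  · calc simConst e * ((t / hFace e)⁻¹ * polyInt e (gsq (q K + T.meanField q e)))
        ≤ simConst e * ((t / hFace e)⁻¹ * (4 * ∑ K' ∈ T.cellsAt e, polyInt e (gsq (q K')))) := by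
          gcongr
      _ = 4 * t⁻¹ * (hFace e * (simConst e * ∑ K' ∈ T.cellsAt e, polyInt e (gsq (q K')))) := by
          rw [inv_div]; field_simp
      _ ≤ 4 * t⁻¹ * (C * σ * ∑ K' ∈ T.cellsAt e, gradTerm q K') := by gcongr
      _ = _ := by ring

end Mesh
end
end CordesLS

/-! ### Bounds for the ridge terms and the Miranda-Talenti estimate -/

namespace CordesLS
open scoped Classical in
section

variable {d m : ℕ} {Ω : Set (Pt d)} {T : Mesh Ω} {K K' E e s : Finset (Pt d)} {a b : Pt d} {σ : ℝ}

namespace Mesh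

variable {q : Finset (Pt d) → Fin d → MvPolynomial (Fin d) ℝ}

/-- The weights `|K| / h_K²` of neighbouring elements are comparable. -/
theorem ShapeRegular.weight_le_of_adj (hd : 2 ≤ d) (hT : T.ShapeRegular σ)
    (hK : K ∈ T.cellsAt e) (hK' : K' ∈ T.cellsAt e) (hc : e.card = d) :
    simConst K / Metric.diam (hull K) ^ 2 ≤
      σ ^ 2 * (simConst K' / Metric.diam (hull K') ^ 2) := by
  have hd1 : 1 ≤ d := by omega
  obtain ⟨hKc, heK⟩ := mem_cellsAt.1 hK
  obtain ⟨hKc', heK'⟩ := mem_cellsAt.1 hK'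
  obtain ⟨a, ha, hae⟩ := exists_erase_eq hKc heK hc
  obtain ⟨a', ha', hae'⟩ := exists_erase_eq hKc' heK' hc
  have hF := fullSim hKc
  have hF' := fullSim hKc'
  have hσ := hT.one_le hd1 hKc
  have v := hF.isSim.simConst_pos
  have v' := hF'.isSim.simConst_pos
  have p := hF.diam_pos hd1
  have p' := hF'.diam_pos hd1
  have g1 := hF.one_le_norm_mul_diam hd1 ha
  have g2 := hT.norm_baryGrad_mul_diam_le hd1 hKc' ha'
  have h3 := hT.diam_le_hFace hd hKc' heK' hc
  have h4 := hFace_le_diam heK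
  have c1 := hF.simConst_erase hd1 ha
  have c2 := hF'.simConst_erase hd1 ha'
  rw [hae] at c1
  rw [hae'] at c2
  have hce := (isSim_of_card hd1 hK hc).simConst_pos
  set D := Metric.diam (hull K)
  set D' := Metric.diam (hull K')
  have e1 : simConst K / D ^ 2 ≤ simConst e / D := by
    rw [div_le_div_iff₀ (by positivity) p, c1]
    nlinarith [mul_le_mul_of_nonneg_left g1 (mul_nonneg v.le p.le)]
  have e2 : simConst e / D' ≤ σ * (simConst K' / D' ^ 2) := by
    rw [c2, ← mul_div_assoc, div_le_div_iff₀ p' (by positivity)]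
    nlinarith [mul_le_mul_of_nonneg_left g2 (mul_nonneg v'.le p'.le)]
  have e3 : simConst e / D ≤ σ * (simConst e / D') := by
    rw [← mul_div_assoc, div_le_div_iff₀ p p']
    have : D' ≤ σ * D := h3.trans (mul_le_mul_of_nonneg_left h4 (by linarith))
    nlinarith [mul_le_mul_of_nonneg_left this hce.le]
  calc _ ≤ simConst e / D := e1
    _ ≤ σ * (simConst e / D') := e3
    _ ≤ σ * (σ * (simConst K' / D' ^ 2)) := mul_le_mul_of_nonneg_left e2 (by linarith)
    _ = _ := by ring

/-- A ridge term carries the weight |K|/h_K², a jump term |e|/h_e. A walk around `E` leads from `K`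
to an element with face `e`, at a cost of at most σ² per step. -/
theorem ShapeRegular.weight_le (hd : 2 ≤ d) (hcv : Convex ℝ Ω) (hT : T.ShapeRegular σ)
    (hE : E ∈ T.faces) (hEc : E.card + 1 = d) {N : ℕ} (hN : (T.cellsAt E).card ≤ N)
    (hK : K ∈ T.cellsAt E) (hEe : E ⊆ e) (he : e ∈ T.sides) :
    simConst K / Metric.diam (hull K) ^ 2 ≤ (σ ^ 2) ^ N * (simConst e / hFace e) := by
  have hd1 : 1 ≤ d := by omega
  obtain ⟨K', hK'⟩ := exists_cellsAt (mem_faces_of_mem_sides he)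
  have hc := card_of_mem_sides he
  obtain ⟨hKc', heK'⟩ := mem_cellsAt.1 hK'
  have hKE' : K' ∈ T.cellsAt E := mem_cellsAt.2 ⟨hKc', hEe.trans heK'⟩
  obtain ⟨p, hp⟩ := (T.starGraph_preconnected hd hcv hE hEc).exists_walk_length_le ⟨K, hK⟩ ⟨K', hKE'⟩
  rw [Fintype.card_coe] at hp
  have hσ := hT.one_le hd1 hKc'
  have h1 := SimpleGraph.Walk.le_pow_mul (G := T.starGraph E)
    (ψ := fun A => simConst A.1 / Metric.diam (hull A.1) ^ 2) (κ := σ ^ 2) (sq_nonneg σ) (by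
      rintro ⟨A, hA⟩ ⟨B, hB⟩ ⟨hAB, hcard⟩
      exact hT.weight_le_of_adj hd (e := A ∩ B)
        (mem_cellsAt.2 ⟨(mem_cellsAt.1 hA).1, Finset.inter_subset_left⟩)
        (mem_cellsAt.2 ⟨(mem_cellsAt.1 hB).1, Finset.inter_subset_right⟩) hcard) p
  have hF' := fullSim hKc'
  have hpow : (σ ^ 2) ^ p.length ≤ (σ ^ 2) ^ N :=
    pow_le_pow_right₀ (one_le_pow₀ hσ) (hp.trans hN)
  have v' := hF'.isSim.simConst_pos
  have p' := hF'.diam_pos hd1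
  have h2 : simConst K' / Metric.diam (hull K') ^ 2 ≤ simConst e / hFace e := by
    obtain ⟨a, ha, rfl⟩ := exists_erase_eq hKc' heK' hc
    have g1 := hF'.one_le_norm_mul_diam hd1 ha
    have h4 := hFace_le_diam heK'
    have hh := hFace_pos hd hc
    rw [hF'.simConst_erase hd1 ha]
    calc simConst K' / Metric.diam (hull K') ^ 2
        = simConst K' / Metric.diam (hull K') * (1 / Metric.diam (hull K')) := by field_simp
      _ ≤ simConst K' / Metric.diam (hull K') * ‖baryGrad K' a‖ := by
          refine mul_le_mul_of_nonneg_left ?_ (by positivity)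
          rwa [div_le_iff₀ p']
      _ = simConst K' * ‖baryGrad K' a‖ / Metric.diam (hull K') := by ring
      _ ≤ _ := div_le_div_of_nonneg_left (by positivity) hh h4
  refine h1.trans (mul_le_mul hpow h2 (by positivity) (by positivity))

theorem totalDegree_sub_le {P Q : MvPolynomial (Fin d) ℝ} (hP : P.totalDegree ≤ m)
    (hQ : Q.totalDegree ≤ m) : (P - Q).totalDegree ≤ m :=
  (MvPolynomial.totalDegree_sub _ _).trans (max_le hP hQ)

theorem totalDegree_meanField_le (hq : ∀ K ∈ T.cells, ∀ i, (q K i).totalDegree ≤ m) (i : Fin d) :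
    (T.meanField q e i).totalDegree ≤ m := by
  have hK : ∀ K ∈ T.cellsAt e, ∀ i, (q K i).totalDegree ≤ m := fun K h => hq K (mem_cellsAt.1 h).1
  rw [meanField]
  split_ifs
  · rw [Finset.sum_apply]
    refine MvPolynomial.totalDegree_finsetSum_le fun K h => ?_
    refine (MvPolynomial.totalDegree_smul_le _ _).trans ?_
    refine MvPolynomial.totalDegree_finsetSum_le fun j _ => ?_
    exact (MvPolynomial.totalDegree_smul_le _ _).trans (hK K h j)
  · rw [Pi.smul_apply, Finset.sum_apply]
    refine (MvPolynomial.totalDegree_smul_le _ _).trans ?_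
    exact MvPolynomial.totalDegree_finsetSum_le fun K h => hK K h i

theorem polyInt_jumpSq_le {C : ℝ}
    (hC : ∀ s t : Finset (Pt d), IsSim s → t ⊆ s → t.Nonempty → ∀ P : MvPolynomial (Fin d) ℝ,
      P.totalDegree ≤ m → simInt t (fun y => pev P y ^ 2) ≤ C * simInt s (fun y => pev P y ^ 2))
    (hq : ∀ K ∈ T.cells, ∀ i, (q K i).totalDegree ≤ m) (hs : IsSim e) (hE : E ⊆ e)
    (hne : E.Nonempty) : polyInt E (T.jumpSq q e) ≤ C * polyInt e (T.jumpSq q e) := by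
  simp only [jumpSq, nsq, map_sum, Finset.mul_sum]
  refine Finset.sum_le_sum fun K hK => Finset.sum_le_sum fun i _ => ?_
  rw [hs.polyInt_apply, (hs.subset hE hne).polyInt_apply]
  simp only [funext (pev_sq _)]
  exact hC e E hs hE hne _ (totalDegree_sub_le (hq K (mem_cellsAt.1 hK).1 i)
    (totalDegree_meanField_le hq i))

/-- The exterior product of the weighted normal and ∇λ_b is of order σ²|K|/h_K². The argument m - c
is (q - c) - (q - m), so both arguments are bounded by jumps at the ridge, and the inverse
inequality passes from the ridge to the faces. -/
theorem ShapeRegular.abs_ridgeForm_le (hd : 2 ≤ d) (hcv : Convex ℝ Ω)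
    (hT : T.ShapeRegular σ) {C : ℝ} (hC0 : 0 < C)
    (hC : ∀ s t : Finset (Pt d), IsSim s → t ⊆ s → t.Nonempty → ∀ P : MvPolynomial (Fin d) ℝ,
      P.totalDegree ≤ m → simInt t (fun y => pev P y ^ 2) ≤ C * simInt s (fun y => pev P y ^ 2))
    (hq : ∀ K ∈ T.cells, ∀ i, (q K i).totalDegree ≤ m) (hK : K ∈ T.cells)
    (ha : a ∈ K) (hb : b ∈ K.erase a) (he : K.erase a ∈ T.sides)
    {N : ℕ} (hN : (T.cellsAt ((K.erase a).erase b)).card ≤ N)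
    {c : Fin d → MvPolynomial (Fin d) ℝ} {D : ℝ} (hD : 0 ≤ D)
    (hc : ∀ x, ‖fieldAt (q K - c) x‖ ^ 2 ≤
      D * ∑ e ∈ T.sides with (K.erase a).erase b ⊆ e, pev (T.jumpSq q e) x) :
    |ridgeForm ((K.erase a).erase b) (wNormal K (K.erase a)) (baryGrad K b)
      (T.meanField q (K.erase a) - c) (q K - c)| ≤
      d * (2 * σ ^ 2) * ((3 * D + 2) * (C * (σ ^ 2) ^ N)) *
        ∑ e ∈ T.sides with (K.erase a).erase b ⊆ e, T.jumpTerm q e := by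
  have hd1 : 1 ≤ d := by omega
  have hF := fullSim hK
  set E := (K.erase a).erase b with hEdef
  have hbK := Finset.mem_of_mem_erase hb
  have hEK : E ⊆ K := (Finset.erase_subset _ _).trans (Finset.erase_subset _ _)
  have hEcard : E.card + 1 = d := by
    rw [hEdef, Finset.card_erase_of_mem hb, Finset.card_erase_of_mem ha, hF.2]; omega
  have hEne : E.Nonempty := Finset.card_pos.1 (by omega)
  have hEf : E ∈ T.faces := mem_faces_of_subset hK hEK hEne
  have hKE : K ∈ T.cellsAt E := mem_cellsAt.2 ⟨hK, hEK⟩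
  have hV := hF.isSim.simConst_pos
  have hp := hF.diam_pos hd1
  set h := Metric.diam (hull K)
  set S := T.sides.filter fun e => E ⊆ e with hS
  have hSe : K.erase a ∈ S := Finset.mem_filter.2 ⟨he, Finset.erase_subset _ _⟩
  have hg : ∀ c ∈ K, ‖baryGrad K c‖ ≤ σ / h := fun c hcK => by
    rw [le_div_iff₀ hp]; exact hT.norm_baryGrad_mul_diam_le hd1 hK hcK
  have hσ := hT.one_le hd1 hK
  have hNg : ∀ i j, |wNormal K (K.erase a) i * baryGrad K b j -
      wNormal K (K.erase a) j * baryGrad K b i| ≤ 2 * σ ^ 2 * (simConst K / h ^ 2) := by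
    intro i j
    have h1 : ∀ i, |wNormal K (K.erase a) i| ≤ simConst K * (σ / h) := fun i => by
      rw [hF.wNormal_erase hd1 ha, PiLp.smul_apply, smul_eq_mul, abs_mul, abs_neg, abs_of_pos hV]
      exact mul_le_mul_of_nonneg_left ((PiLp.norm_apply_le (baryGrad K a) i).trans (hg a ha)) hV.le
    have h2 : ∀ j, |baryGrad K b j| ≤ σ / h := fun j =>
      (PiLp.norm_apply_le (baryGrad K b) j).trans (hg b hbK)
    refine (abs_sub _ _).trans ?_
    rw [abs_mul, abs_mul]
    have e1 := mul_le_mul (h1 i) (h2 j) (abs_nonneg _) (by positivity)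
    have e2 := mul_le_mul (h1 j) (h2 i) (abs_nonneg _) (by positivity)
    refine (add_le_add e1 e2).trans (le_of_eq ?_)
    field_simp
    ring
  refine (CordesLS.abs_ridgeForm_le hNg (by positivity) _ _).trans ?_
  have hJ0 : ∀ x, 0 ≤ ∑ e ∈ S, pev (T.jumpSq q e) x := fun x =>
    Finset.sum_nonneg fun e _ => pev_jumpSq_nonneg x
  have b1 : polyInt E (nsq (q K - c)) ≤ D * ∑ e ∈ S, polyInt E (T.jumpSq q e) := by
    have := polyInt_mono (s := E) (P := nsq (q K - c)) (Q := D • ∑ e ∈ S, T.jumpSq q e) fun x => by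
      rw [pev_nsq, pev_smul, pev_sum]; exact hc x
    rwa [map_smul, map_sum, smul_eq_mul] at this
  have b2 : polyInt E (nsq (T.meanField q (K.erase a) - c)) ≤
      (2 * D + 2) * ∑ e ∈ S, polyInt E (T.jumpSq q e) := by
    have := polyInt_mono (s := E) (P := nsq (T.meanField q (K.erase a) - c))
        (Q := (2 * D + 2) • ∑ e ∈ S, T.jumpSq q e) fun x => by
      rw [pev_nsq, pev_smul, pev_sum]
      have h1 : fieldAt (T.meanField q (K.erase a) - c) x = fieldAt (q K - c) x -
          fieldAt (q K - T.meanField q (K.erase a)) x := by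
        simp only [fieldAt_sub]; abel
      have h2 := norm_sub_meanField_sq_le (q := q) (mem_cellsAt.2 ⟨hK, Finset.erase_subset a K⟩) x
      have h3 := Finset.single_le_sum (f := fun e => pev (T.jumpSq q e) x)
        (fun e _ => pev_jumpSq_nonneg x) hSe
      have h4 := pow_le_pow_left₀ (norm_nonneg _)
        (norm_sub_le (fieldAt (q K - c) x) (fieldAt (q K - T.meanField q (K.erase a)) x)) 2
      rw [h1]
      have h5 := hc x
      nlinarith [sq_nonneg (‖fieldAt (q K - c) x‖ - ‖fieldAt (q K - T.meanField q (K.erase a)) x‖)]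
    rwa [map_smul, map_sum, smul_eq_mul] at this
  have b3 : simConst K / h ^ 2 * ∑ e ∈ S, polyInt E (T.jumpSq q e) ≤
      C * (σ ^ 2) ^ N * ∑ e ∈ S, T.jumpTerm q e := by
    rw [Finset.mul_sum, Finset.mul_sum]
    refine Finset.sum_le_sum fun e heS => ?_
    obtain ⟨hes, hEe⟩ := Finset.mem_filter.1 heS
    have w1 := hT.weight_le hd hcv hEf hEcard hN hKE hEe hes
    obtain ⟨K', hK'⟩ := exists_cellsAt (mem_faces_of_mem_sides hes)
    have hs := isSim_of_card hd1 hK' (card_of_mem_sides hes)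
    have w2 := polyInt_jumpSq_le hC hq hs hEe hEne
    have w3 := polyInt_nonneg (s := E) (P := T.jumpSq q e) pev_jumpSq_nonneg
    have w4 := hs.simConst_pos
    have w5 := hFace_pos hd (card_of_mem_sides hes)
    rw [jumpTerm]
    refine (mul_le_mul w1 w2 w3 (by positivity)).trans (le_of_eq ?_)
    ring
  have hm : 0 ≤ simConst K / h ^ 2 := by positivity
  calc d * (2 * σ ^ 2 * (simConst K / h ^ 2)) * (polyInt E (nsq (T.meanField q (K.erase a) - c)) +
        polyInt E (nsq (q K - c)))
      ≤ d * (2 * σ ^ 2 * (simConst K / h ^ 2)) * ((2 * D + 2) * ∑ e ∈ S, polyInt E (T.jumpSq q e) +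
        D * ∑ e ∈ S, polyInt E (T.jumpSq q e)) :=
        mul_le_mul_of_nonneg_left (add_le_add b2 b1) (by positivity)
    _ = d * (2 * σ ^ 2) * (3 * D + 2) * (simConst K / h ^ 2 * ∑ e ∈ S, polyInt E (T.jumpSq q e)) := by
        ring
    _ ≤ d * (2 * σ ^ 2) * (3 * D + 2) * (C * (σ ^ 2) ^ N * ∑ e ∈ S, T.jumpTerm q e) :=
        mul_le_mul_of_nonneg_left b3 (by positivity)
    _ = _ := by ring

theorem card_cellsAt_le_two (hd : 1 ≤ d) (hO : IsOpen Ω) (hC : Convex ℝ Ω) (hne : Ω.Nonempty)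
    (he : e ∈ T.sides) : (T.cellsAt e).card ≤ 2 := by
  obtain ⟨K, hK⟩ := exists_cellsAt (mem_faces_of_mem_sides he)
  rcases Finset.mem_union.1 he with hi | hb
  · obtain ⟨K', hK', hKK, heq⟩ := cellsAt_eq_pair hd hi hK
    rw [heq]; exact Finset.card_le_two
  · rw [cellsAt_eq_singleton hd hO hC hne hb hK]; simp

/-- Each face only meets a bounded number of elements. -/
theorem ShapeRegular.sum_ridges_le (hd : 2 ≤ d) (hT : T.ShapeRegular σ) {j : Finset (Pt d) → ℝ}
    (hj : ∀ e ∈ T.sides, 0 ≤ j e) :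
    ∑ K ∈ T.cells, ∑ a ∈ K, ∑ b ∈ K.erase a, ∑ e ∈ T.sides with (K.erase a).erase b ⊆ e, j e ≤
      (d + 1) ^ 2 * (d * (2 * σ) ^ d) * ∑ e ∈ T.sides, j e := by
  have h1 : ∀ K ∈ T.cells, ∑ a ∈ K, ∑ b ∈ K.erase a,
      ∑ e ∈ T.sides with (K.erase a).erase b ⊆ e, j e ≤
      (d + 1) ^ 2 * ∑ e ∈ T.sides with (K ∩ e).Nonempty, j e := by
    intro K hK
    have hF := fullSim hK
    have hX : 0 ≤ ∑ e ∈ T.sides with (K ∩ e).Nonempty, j e :=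
      Finset.sum_nonneg fun e he => hj e (Finset.mem_filter.1 he).1
    have h2 : ∀ a ∈ K, ∀ b ∈ K.erase a, ∑ e ∈ T.sides with (K.erase a).erase b ⊆ e, j e ≤
        ∑ e ∈ T.sides with (K ∩ e).Nonempty, j e := by
      intro a ha b hb
      refine Finset.sum_le_sum_of_subset_of_nonneg (fun e he => ?_) fun e he _ =>
        hj e (Finset.mem_filter.1 he).1
      obtain ⟨h3, h4⟩ := Finset.mem_filter.1 he
      obtain ⟨z, hz⟩ := Finset.card_pos.1 (show 0 < ((K.erase a).erase b).card by
        rw [Finset.card_erase_of_mem hb, Finset.card_erase_of_mem ha, hF.2]; omega)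
      exact Finset.mem_filter.2 ⟨h3, z, Finset.mem_inter.2
        ⟨Finset.mem_of_mem_erase (Finset.mem_of_mem_erase hz), h4 hz⟩⟩
    calc _ ≤ ∑ a ∈ K, ∑ b ∈ K.erase a, ∑ e ∈ T.sides with (K ∩ e).Nonempty, j e :=
          Finset.sum_le_sum fun a ha => Finset.sum_le_sum fun b hb => h2 a ha b hb
      _ ≤ ∑ a ∈ K, (d + 1) * ∑ e ∈ T.sides with (K ∩ e).Nonempty, j e := by
          refine Finset.sum_le_sum fun a ha => ?_
          rw [Finset.sum_const, nsmul_eq_mul]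
          refine mul_le_mul_of_nonneg_right ?_ hX
          rw [Finset.card_erase_of_mem ha, hF.2]
          push_cast
          simp
      _ = _ := by
          rw [Finset.sum_const, nsmul_eq_mul, hF.2]; push_cast; ring
  refine (Finset.sum_le_sum h1).trans ?_
  rw [← Finset.mul_sum, mul_assoc]
  refine mul_le_mul_of_nonneg_left ?_ (by positivity)
  simp only [Finset.sum_filter]
  rw [Finset.sum_comm, Finset.mul_sum]
  refine Finset.sum_le_sum fun e he => ?_
  rw [← Finset.sum_filter, Finset.sum_const, nsmul_eq_mul]
  refine mul_le_mul_of_nonneg_right ?_ (hj e he)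
  -- An element charges a face only if they share a vertex. A face has d vertices, each in at most
  -- (2σ)^d elements; (d + 1)² bounds the number of pairs a, b in an element.
  have h5 : T.cells.filter (fun K => (K ∩ e).Nonempty) ⊆ e.biUnion fun v => T.cellsAt {v} := by
    intro K hK
    obtain ⟨hKc, z, hz⟩ := Finset.mem_filter.1 hK
    obtain ⟨hz1, hz2⟩ := Finset.mem_inter.1 hz
    exact Finset.mem_biUnion.2 ⟨z, hz2, mem_cellsAt.2 ⟨hKc, Finset.singleton_subset_iff.2 hz1⟩⟩
  have hσ0 : 0 ≤ σ := by
    obtain ⟨K, hK⟩ := exists_cellsAt (mem_faces_of_mem_sides he)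
    linarith [hT.one_le (by omega) (mem_cellsAt.1 hK).1]
  calc ((T.cells.filter (fun K => (K ∩ e).Nonempty)).card : ℝ)
      ≤ ∑ v ∈ e, ((T.cellsAt {v}).card : ℝ) := by
        exact_mod_cast (Finset.card_le_card h5).trans Finset.card_biUnion_le
    _ ≤ ∑ v ∈ e, (2 * σ) ^ d := by
        refine Finset.sum_le_sum fun v _ => ?_
        by_cases h : (T.cellsAt {v}).Nonempty
        · exact hT.card_cellsAt_le (by omega) (Finset.singleton_nonempty v) h
        · rw [Finset.not_nonempty_iff_eq_empty.1 h]; simp; positivity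
    _ = _ := by rw [Finset.sum_const, nsmul_eq_mul, card_of_mem_sides he]

/-- Discrete Miranda-Talenti estimate for piecewise curl-free polynomial fields. -/
theorem exists_miranda_le (hd : 2 ≤ d) (hO : IsOpen Ω) (hcv : Convex ℝ Ω) (hne : Ω.Nonempty)
    (σ : ℝ) (m : ℕ) {η : ℝ} (hη : 0 < η) :
    ∃ C : ℝ, 0 < C ∧ ∀ T : Mesh Ω, T.ShapeRegular σ →
      ∀ q : Finset (Pt d) → Fin d → MvPolynomial (Fin d) ℝ,
      (∀ K ∈ T.cells, ∀ i, (q K i).totalDegree ≤ m) →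
      (∀ K ∈ T.cells, ∀ i j, MvPolynomial.pderiv i (q K j) = MvPolynomial.pderiv j (q K i)) →
      ∑ K ∈ T.cells, simConst K * polyInt K (gsq (q K) -
        (∑ i, MvPolynomial.pderiv i (q K i)) ^ 2) ≤
      η * ∑ K ∈ T.cells, gradTerm q K + C * ∑ e ∈ T.sides, T.jumpTerm q e := by
  have hd1 : 1 ≤ d := by omega
  obtain ⟨C₀, hC₀, hinv⟩ := exists_simInt_sq_pev_le d m
  obtain ⟨κ, hκ, hκT⟩ := exists_inner_normals_le (Ω := Ω) hd1 hO hcv hne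
  by_cases hσ : 1 ≤ σ
  swap
  -- For σ < 1 no subdivision of a nonempty domain is shape-regular, because 1 ≤ ‖∇λ_a‖ h_K ≤ σ.
  · refine ⟨1, one_pos, fun T hT q _ _ => ?_⟩
    obtain ⟨x, hx⟩ := hne
    obtain ⟨K, hK, -⟩ := exists_cell_of_mem_closure (T := T) (subset_closure hx)
    exact absurd (hT.one_le hd1 hK) hσ
  set M : ℕ := ⌈(2 * σ) ^ d⌉₊ with hM
  set D : ℝ := ((2 * (M : ℝ) + 1) + (2 * M + 2) / κ + 2 * M) ^ 2 with hD
  set B : ℝ := d * (2 * σ ^ 2) * ((3 * D + 2) * (C₀ * (σ ^ 2) ^ M)) with hB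
  -- Chosen so that the gradients receive the total factor η. Summed over all elements and faces
  -- each gradient term is counted at most 2(d + 1) times: d + 1 faces, at most two elements at
  -- each.
  set t : ℝ := 8 * d * (d + 1) * C₀ * σ / η with ht
  have hd0 : (0 : ℝ) < d := by exact_mod_cast hd1
  have ht0 : 0 < t := by positivity
  have hB0 : 0 ≤ B := by positivity
  refine ⟨2 * d * t + B * ((d + 1) ^ 2 * (d * (2 * σ) ^ d)), by positivity,
    fun T hT q hq hcurl => ?_⟩
  have hcard : ∀ E, E.Nonempty → (T.cellsAt E).card ≤ M := by
    intro E hE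
    by_cases h : (T.cellsAt E).Nonempty
    · have := hT.card_cellsAt_le hd1 hE h
      exact_mod_cast this.trans (Nat.le_ceil _)
    · rw [Finset.not_nonempty_iff_eq_empty.1 h]; simp
  have hc : ∀ E : Finset (Pt d), ∃ c : Fin d → MvPolynomial (Fin d) ℝ,
      E ∈ T.faces → E.card + 1 = d → (∀ e ∈ T.boundaryFaces, E ⊆ e → ∀ K ∈ T.cellsAt e,
        ∃ ψ, c = fun i => outwardNormal K e i • ψ) ∧
      ∀ K ∈ T.cellsAt E, ∀ x, ‖fieldAt (q K - c) x‖ ^ 2 ≤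
        D * ∑ e ∈ T.sides with E ⊆ e, pev (T.jumpSq q e) x := by
    intro E
    by_cases h : E ∈ T.faces ∧ E.card + 1 = d
    · obtain ⟨c, hc⟩ := exists_ridge_value hd hO hcv hne hκ hκT h.1 h.2 (N := M)
        (by exact_mod_cast hcard E (Finset.card_pos.1 (by omega))) q
      exact ⟨c, fun _ _ => hc⟩
    · exact ⟨0, fun h1 h2 => absurd ⟨h1, h2⟩ h⟩
  choose c hc using hc
  have hmir := sum_miranda hd hO hcv hne q (T.meanField q) c hcurl
    (fun e he K hK => ⟨_, meanField_boundary hd1 hO hcv hne he hK⟩)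
    (fun e he K hK b hb => by
      obtain ⟨hf, hec, -⟩ := mem_boundaryFaces.1 he
      have hcd := Finset.card_erase_of_mem hb
      have hn : (e.erase b).Nonempty := Finset.card_pos.1 (by omega)
      exact (hc (e.erase b) (mem_faces_of_subset (mem_cellsAt.1 hK).1
        ((Finset.erase_subset _ _).trans (mem_cellsAt.1 hK).2) hn) (by omega)).1 e he
          (Finset.erase_subset _ _) K hK)
  have hside : ∀ K ∈ T.cells, ∀ a ∈ K, K.erase a ∈ T.sides := fun K hK a ha => by
    rcases erase_mem hd1 hO hcv hK ha with h | h
    exacts [Finset.mem_union_left _ h, Finset.mem_union_right _ h]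
  have hj0 : ∀ e ∈ T.sides, 0 ≤ T.jumpTerm q e := fun e he => jumpTerm_nonneg hd he
  have hface : ∀ K ∈ T.cells, ∀ a ∈ K, faceForm (K.erase a) (wNormal K (K.erase a))
      (q K - T.meanField q (K.erase a)) (q K + T.meanField q (K.erase a)) ≤
      d * (t * T.jumpTerm q (K.erase a) + t⁻¹ * (4 * C₀ * σ) *
        ∑ K' ∈ T.cellsAt (K.erase a), gradTerm q K') := fun K hK a ha =>
    (le_abs_self _).trans (hT.abs_faceForm_le hd hO hcv hne hC₀ hinv hq ht0 (hside K hK a ha)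
      (mem_cellsAt.2 ⟨hK, Finset.erase_subset a K⟩))
  have hridge : ∀ K ∈ T.cells, ∀ a ∈ K, ∀ b ∈ K.erase a,
      ridgeForm ((K.erase a).erase b) (wNormal K (K.erase a)) (baryGrad K b)
        (T.meanField q (K.erase a) - c ((K.erase a).erase b))
        (q K - c ((K.erase a).erase b)) ≤
      B * ∑ e ∈ T.sides with (K.erase a).erase b ⊆ e, T.jumpTerm q e := by
    intro K hK a ha b hb
    have hEK : (K.erase a).erase b ⊆ K := (Finset.erase_subset _ _).trans (Finset.erase_subset _ _)
    have hEcard : ((K.erase a).erase b).card + 1 = d := by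
      rw [Finset.card_erase_of_mem hb, Finset.card_erase_of_mem ha, (fullSim hK).2]; omega
    have hEne : ((K.erase a).erase b).Nonempty := Finset.card_pos.1 (by omega)
    exact (le_abs_self _).trans (hT.abs_ridgeForm_le hd hcv hC₀ hinv hq hK ha hb (hside K hK a ha)
      (hcard _ hEne) (sq_nonneg _) ((hc _ (mem_faces_of_subset hK hEK hEne) hEcard).2 K
        (mem_cellsAt.2 ⟨hK, hEK⟩)))
  have s1 : ∑ K ∈ T.cells, ∑ a ∈ K, T.jumpTerm q (K.erase a) ≤
      2 * ∑ e ∈ T.sides, T.jumpTerm q e := by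
    rw [sum_cells_erase hd1 hO hcv fun _ e => T.jumpTerm q e, Finset.mul_sum]
    refine Finset.sum_le_sum fun e he => ?_
    rw [Finset.sum_const, nsmul_eq_mul]
    refine mul_le_mul_of_nonneg_right ?_ (hj0 e he)
    exact_mod_cast card_cellsAt_le_two hd1 hO hcv hne he
  have s2 : ∑ K ∈ T.cells, ∑ a ∈ K, ∑ K' ∈ T.cellsAt (K.erase a), gradTerm q K' ≤
      2 * (d + 1) * ∑ K ∈ T.cells, gradTerm q K := by
    rw [sum_cells_erase hd1 hO hcv fun _ e => ∑ K' ∈ T.cellsAt e, gradTerm q K']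
    have h1 : ∑ e ∈ T.sides, ∑ K ∈ T.cellsAt e, gradTerm q K =
        (d + 1) * ∑ K ∈ T.cells, gradTerm q K := by
      rw [← sum_cells_erase hd1 hO hcv fun K _ => gradTerm q K, Finset.mul_sum]
      refine Finset.sum_congr rfl fun K hK => ?_
      rw [Finset.sum_const, nsmul_eq_mul, (fullSim hK).2]; push_cast; ring
    rw [mul_assoc, ← h1, Finset.mul_sum]
    refine Finset.sum_le_sum fun e he => ?_
    rw [Finset.sum_const, nsmul_eq_mul]
    refine mul_le_mul_of_nonneg_right ?_
      (Finset.sum_nonneg fun K hK => gradTerm_nonneg (mem_cellsAt.1 hK).1)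
    exact_mod_cast card_cellsAt_le_two hd1 hO hcv hne he
  have s3 := hT.sum_ridges_le hd hj0
  have hgoal : ∑ K ∈ T.cells, simConst K * polyInt K (gsq (q K) -
      (∑ i, MvPolynomial.pderiv i (q K i)) ^ 2) ≤ ∑ K ∈ T.cells, ∑ a ∈ K,
      (d * (t * T.jumpTerm q (K.erase a) + t⁻¹ * (4 * C₀ * σ) *
        ∑ K' ∈ T.cellsAt (K.erase a), gradTerm q K') + ∑ b ∈ K.erase a,
          B * ∑ e ∈ T.sides with (K.erase a).erase b ⊆ e, T.jumpTerm q e) := by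
    refine (le_of_eq hmir).trans (Finset.sum_le_sum fun K hK => Finset.sum_le_sum fun a ha => ?_)
    exact add_le_add (hface K hK a ha) (Finset.sum_le_sum fun b hb => hridge K hK a ha b hb)
  refine hgoal.trans ?_
  simp only [Finset.sum_add_distrib, ← Finset.mul_sum, mul_add]
  have e1 := mul_le_mul_of_nonneg_left s1 (mul_nonneg hd0.le ht0.le)
  have e2 := mul_le_mul_of_nonneg_left s2 (show 0 ≤ d * (t⁻¹ * (4 * C₀ * σ)) by positivity)
  have e3 := mul_le_mul_of_nonneg_left s3 hB0
  have e4 : d * (t⁻¹ * (4 * C₀ * σ)) * (2 * (d + 1)) = η := by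
    rw [ht]; field_simp; ring
  have e5 : d * (t⁻¹ * (4 * C₀ * σ)) * (2 * (d + 1) * ∑ K ∈ T.cells, gradTerm q K) =
      η * ∑ K ∈ T.cells, gradTerm q K := by rw [← e4]; ring
  rw [e5] at e2
  linarith

end Mesh
end
end CordesLS

/-! ### Scalar residuals and boundedness -/

namespace CordesLS
open scoped Classical in
section

variable {d m : ℕ} {Ω : Set (Pt d)} {T : Mesh Ω} {K K' E e s : Finset (Pt d)} {a b : Pt d} {σ : ℝ}
  {A : Pt d → Matrix (Fin d) (Fin d) ℝ}

theorem memLp_frob_grad (hK : cell K ⊆ Ω) (hA : EssBounded Ω A) (q : Pt d → Pt d) :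
    MemLp (fun x => frob (A x) (grad K q x)) 2 (volume.restrict (cell K)) := by
  refine memLp_finsetSum _ fun i _ => memLp_finsetSum _ fun j _ => ?_
  exact (memLp_weakPd (cell K) j fun y => q y i).mul
    ((hA i j).mono_measure (Measure.restrict_mono hK le_rfl))

theorem memLp_jump (T : Mesh Ω) (e : Finset (Pt d)) (q : Pt d → Pt d) (i j : Fin d) :
    MemLp (fun x => jump T e q x i j) 2 (faceMeasure e) :=
  memLp_finsetSum _ fun K _ => (memLp_trace (cell K) e fun y => q y i).mul_const _

theorem memLp_tang (T : Mesh Ω) (e : Finset (Pt d)) (q : Pt d → Pt d) (i j : Fin d) :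
    MemLp (fun x => tang T e q x i j) 2 (faceMeasure e) :=
  memLp_finsetSum _ fun K _ => ((memLp_trace (cell K) e fun y => q y i).mul_const _).sub
    ((memLp_trace (cell K) e fun y => q y j).mul_const _)

theorem memLp_tangGrad (e : Finset (Pt d)) (n : Pt d) (g : Pt d → ℝ) (i j : Fin d) :
    MemLp (fun x => tangGrad e n g x i j) 2 (faceMeasure e) := by
  by_cases h : ∃ t, IsTangGrad e n g t
  · simp only [tangGrad, dif_pos h]
    exact h.choose_spec.1 i j
  · simp only [tangGrad, dif_neg h]
    exact MemLp.zero

theorem memLp_dataTang (T : Mesh Ω) (e : Finset (Pt d)) (g : Pt d → ℝ) (i j : Fin d) :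
    MemLp (fun x => dataTang T e g x i j) 2 (faceMeasure e) :=
  memLp_finsetSum _ fun K _ => memLp_tangGrad e (outwardNormal K e) g i j

theorem mul_integral_sum_mul {ν : Measure (Pt d)} {X Y : Pt d → Fin d → Fin d → ℝ}
    (hX : ∀ i j, MemLp (fun x => X x i j) 2 ν) (hY : ∀ i j, MemLp (fun x => Y x i j) 2 ν)
    (c : ℝ) (S : Fin d → Finset (Fin d)) :
    c * ∫ x, ∑ i, ∑ j ∈ S i, X x i j * Y x i j ∂ν =
      ∑ i, ∑ j ∈ S i, c * ∫ x, X x i j * Y x i j ∂ν := by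
  have h : ∀ i j, Integrable (fun x => X x i j * Y x i j) ν := fun i j =>
    (hX i j).integrable_mul (hY i j)
  rw [integral_finsetSum _ fun i _ => integrable_finsetSum _ fun j _ => h i j, Finset.mul_sum]
  refine Finset.sum_congr rfl fun i _ => ?_
  rw [integral_finsetSum _ fun j _ => h i j, Finset.mul_sum]

/-- Indices of the scalar residuals of the least squares method. -/
abbrev ResIdx (d : ℕ) :=
  Finset (Pt d) ⊕ (Finset (Pt d) × Fin d × Fin d) ⊕ (Finset (Pt d) × Fin d × Fin d)

/-- The measure over which a residual is integrated. -/
def resMeasure : ResIdx d → Measure (Pt d)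
  | .inl K => volume.restrict (cell K)
  | .inr (.inl k) => faceMeasure k.1
  | .inr (.inr k) => faceMeasure k.1

/-- The weight of a residual. -/
def resWeight (μ : ℝ) : ResIdx d → ℝ
  | .inl _ => 1
  | .inr (.inl k) => μ / hFace k.1
  | .inr (.inr k) => μ / hFace k.1

namespace Mesh

/-- The residuals that occur in the method. -/
def resIdx (T : Mesh Ω) : Finset (ResIdx d) :=
  T.cells.disjSum ((T.interiorFaces ×ˢ Finset.univ).disjSum
    (T.boundaryFaces ×ˢ Finset.univ.filter fun p : Fin d × Fin d => p.1 < p.2))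

/-- The homogeneous residuals of a vector field. -/
def res (T : Mesh Ω) (A : Pt d → Matrix (Fin d) (Fin d) ℝ) (q : Pt d → Pt d) :
    ResIdx d → Pt d → ℝ
  | .inl K => fun x => frob (A x) (grad K q x)
  | .inr (.inl k) => fun x => jump T k.1 q x k.2.1 k.2.2
  | .inr (.inr k) => fun x => tang T k.1 q x k.2.1 k.2.2

/-- The data of the least squares problem. -/
def resData (T : Mesh Ω) (f g : Pt d → ℝ) : ResIdx d → Pt d → ℝ
  | .inl _ => f
  | .inr (.inl _) => fun _ => 0
  | .inr (.inr k) => fun x => dataTang T k.1 g x k.2.1 k.2.2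

theorem sum_resIdx (G : ResIdx d → ℝ) : ∑ k ∈ T.resIdx, G k =
    ∑ K ∈ T.cells, G (.inl K) +
    (∑ e ∈ T.interiorFaces, ∑ i, ∑ j, G (.inr (.inl (e, i, j)))) +
    ∑ e ∈ T.boundaryFaces, ∑ i, ∑ j ∈ Finset.Ioi i, G (.inr (.inr (e, i, j))) := by
  rw [resIdx, Finset.sum_disjSum, Finset.sum_disjSum, add_assoc]
  congr 2
  · rw [Finset.sum_product]
    refine Finset.sum_congr rfl fun e _ => ?_
    rw [← Finset.univ_product_univ, Finset.sum_product]
  · rw [Finset.sum_product]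
    refine Finset.sum_congr rfl fun e _ => ?_
    rw [Finset.sum_filter, ← Finset.univ_product_univ, Finset.sum_product]
    refine Finset.sum_congr rfl fun i _ => ?_
    rw [← Finset.sum_filter]
    refine Finset.sum_congr ?_ fun _ _ => rfl
    ext j; simp

theorem memLp_res (hO : IsOpen Ω) (hC : Convex ℝ Ω) (hA : EssBounded Ω A) (q : Pt d → Pt d)
    {k : ResIdx d} (hk : k ∈ T.resIdx) : MemLp (T.res A q k) 2 (resMeasure k) := by
  rcases k with K | k | k
  · exact memLp_frob_grad (cell_subset hO hC (Finset.inl_mem_disjSum.1 hk)) hA q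
  · exact memLp_jump T k.1 q k.2.1 k.2.2
  · exact memLp_tang T k.1 q k.2.1 k.2.2

theorem memLp_resData (hO : IsOpen Ω) (hC : Convex ℝ Ω) {f : Pt d → ℝ}
    (hf : MemLp f 2 (volume.restrict Ω)) (g : Pt d → ℝ)
    {k : ResIdx d} (hk : k ∈ T.resIdx) : MemLp (T.resData f g k) 2 (resMeasure k) := by
  rcases k with K | k | k
  · exact hf.mono_measure (Measure.restrict_mono (cell_subset hO hC (Finset.inl_mem_disjSum.1 hk)) le_rfl)
  · exact MemLp.zero
  · exact memLp_dataTang T k.1 g k.2.1 k.2.2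

/-- Written as weighted L² pairings of scalar residuals, the bilinear form, the linear form and the
functional become one kind of sum, so boundedness, linearity and the quadratic expansion are each
proved for a single summand. -/
theorem bilin_eq_sum (T : Mesh Ω) (A : Pt d → Matrix (Fin d) (Fin d) ℝ) (μ : ℝ)
    (p q : Pt d → Pt d) : bilin T A μ p q =
      ∑ k ∈ T.resIdx, resWeight μ k * ∫ x, T.res A p k x * T.res A q k x ∂resMeasure k := by
  rw [sum_resIdx, bilin]
  congr 1
  · congr 1
    · exact Finset.sum_congr rfl fun K _ => (one_mul _).symm
    · refine Finset.sum_congr rfl fun e _ => ?_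
      rw [integral_const_mul]
      exact mul_integral_sum_mul (memLp_jump T e p) (memLp_jump T e q) _ _
  · refine Finset.sum_congr rfl fun e _ => ?_
    rw [integral_const_mul]
    exact mul_integral_sum_mul (memLp_tang T e p) (memLp_tang T e q) _ _

theorem linForm_eq_sum (T : Mesh Ω) (A : Pt d → Matrix (Fin d) (Fin d) ℝ) (μ : ℝ)
    (f g : Pt d → ℝ) (q : Pt d → Pt d) : linForm T A μ f g q =
      ∑ k ∈ T.resIdx, resWeight μ k * ∫ x, T.resData f g k x * T.res A q k x ∂resMeasure k := by
  rw [sum_resIdx, linForm]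
  congr 1
  · rw [eq_comm, add_eq_left.2]
    · exact Finset.sum_congr rfl fun K _ => (one_mul _)
    · simp [resData]
  · refine Finset.sum_congr rfl fun e _ => ?_
    rw [integral_const_mul]
    refine (mul_integral_sum_mul (memLp_tang T e q) (memLp_dataTang T e g) _ _).trans ?_
    refine Finset.sum_congr rfl fun i _ => Finset.sum_congr rfl fun j _ => ?_
    simp only [mul_comm (tang T e q _ i j)]
    rfl

theorem lsFunctional_eq_sum (T : Mesh Ω) (A : Pt d → Matrix (Fin d) (Fin d) ℝ) (μ : ℝ)
    (f g : Pt d → ℝ) (q : Pt d → Pt d) : lsFunctional T A μ f g q =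
      ∑ k ∈ T.resIdx, resWeight μ k *
        ∫ x, (T.res A q k x - T.resData f g k x) ^ 2 ∂resMeasure k := by
  rw [sum_resIdx, lsFunctional]
  congr 1
  · congr 1
    · exact Finset.sum_congr rfl fun K _ => (one_mul _).symm
    · refine Finset.sum_congr rfl fun e _ => ?_
      refine (mul_integral_sum_mul (memLp_jump T e q) (memLp_jump T e q) _ _).trans ?_
      refine Finset.sum_congr rfl fun i _ => Finset.sum_congr rfl fun j _ => ?_
      simp only [res, resData, sub_zero, sq]
      rfl
  · refine Finset.sum_congr rfl fun e _ => ?_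
    have hi : ∀ i j, MemLp (fun x => (tang T e q x - dataTang T e g x) i j) 2 (faceMeasure e) :=
      fun i j => (memLp_tang T e q i j).sub (memLp_dataTang T e g i j)
    refine (mul_integral_sum_mul hi hi _ _).trans ?_
    refine Finset.sum_congr rfl fun i _ => Finset.sum_congr rfl fun j _ => ?_
    simp only [res, resData, sq]
    rfl

theorem resWeight_nonneg {μ : ℝ} (hμ : 0 ≤ μ) (k : ResIdx d) : 0 ≤ resWeight μ k := by
  rcases k with K | k | k
  · exact zero_le_one
  · exact div_nonneg hμ Metric.diam_nonneg
  · exact div_nonneg hμ Metric.diam_nonneg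

theorem bilin_self_nonneg {μ : ℝ} (hμ : 0 ≤ μ) (T : Mesh Ω) (q : Pt d → Pt d) :
    0 ≤ bilin T A μ q q := by
  rw [bilin_eq_sum]
  exact Finset.sum_nonneg fun k _ => mul_nonneg (resWeight_nonneg hμ k)
    (integral_nonneg fun x => mul_self_nonneg _)

/-- Cauchy-Schwarz for each residual integral, then for the finite sum with its nonnegative weights.
-/
theorem abs_bilin_le (hO : IsOpen Ω) (hC : Convex ℝ Ω) (hA : EssBounded Ω A) {μ : ℝ} (hμ : 0 ≤ μ)
    (T : Mesh Ω) (p q : Pt d → Pt d) :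
    |bilin T A μ p q| ≤ Real.sqrt (bilin T A μ p p) * Real.sqrt (bilin T A μ q q) := by
  have hf : ∀ (p : Pt d → Pt d) k, 0 ≤ resWeight μ k *
      ∫ x, T.res A p k x * T.res A p k x ∂resMeasure k := fun p k =>
    mul_nonneg (resWeight_nonneg hμ k) (integral_nonneg fun x => mul_self_nonneg _)
  rw [bilin_eq_sum, bilin_eq_sum T A μ p p, bilin_eq_sum T A μ q q]
  refine le_trans ?_ (Real.sum_sqrt_mul_sqrt_le _ (hf p) (hf q))
  refine (Finset.abs_sum_le_sum_abs _ _).trans (Finset.sum_le_sum fun k hk => ?_)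
  rw [← Real.sqrt_mul (hf p k)]
  refine Real.abs_le_sqrt ?_
  have := sq_integral_mul_le (memLp_res hO hC hA p hk) (memLp_res hO hC hA q hk)
  simp only [sq] at this ⊢
  have hw := mul_self_nonneg (resWeight μ k)
  nlinarith [mul_le_mul_of_nonneg_left this hw]

/-- The squared energy norm. -/
theorem energyNorm_sq (T : Mesh Ω) (q : Pt d → Pt d) : energyNorm T q ^ 2 =
    (∑ K ∈ T.cells, ∫ x in cell K, frob (grad K q x) (grad K q x)) +
    (∑ e ∈ T.interiorFaces,
      1 / hFace e * ∫ x, frob (jump T e q x) (jump T e q x) ∂faceMeasure e) +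
    ∑ e ∈ T.boundaryFaces,
      1 / hFace e * ∫ x, crossDot (tang T e q x) (tang T e q x) ∂faceMeasure e := by
  have h1 : ∀ X : Fin d → Fin d → ℝ, 0 ≤ frob X X := fun X =>
    Finset.sum_nonneg fun i _ => Finset.sum_nonneg fun j _ => mul_self_nonneg _
  have h2 : ∀ X : Fin d → Fin d → ℝ, 0 ≤ crossDot X X := fun X =>
    Finset.sum_nonneg fun i _ => Finset.sum_nonneg fun j _ => mul_self_nonneg _
  have h3 : ∀ e : Finset (Pt d), 0 ≤ 1 / hFace e := fun e => div_nonneg zero_le_one Metric.diam_nonneg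
  rw [energyNorm, Real.sq_sqrt]
  refine add_nonneg (add_nonneg ?_ ?_) ?_
  · exact Finset.sum_nonneg fun K _ => integral_nonneg fun x => h1 _
  · exact Finset.sum_nonneg fun e _ => mul_nonneg (h3 e) (integral_nonneg fun x => h1 _)
  · exact Finset.sum_nonneg fun e _ => mul_nonneg (h3 e) (integral_nonneg fun x => h2 _)

theorem frob_sq_le (X Y : Fin d → Fin d → ℝ) : frob X Y ^ 2 ≤ frob X X * frob Y Y := by
  simp only [frob, ← Finset.univ_product_univ, ← Finset.sum_product', ← sq]
  exact Finset.sum_mul_sq_le_sq_mul_sq _ _ _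

theorem exists_bilin_self_le (hO : IsOpen Ω) (hC : Convex ℝ Ω) (hA : EssBounded Ω A) {μ : ℝ}
    (hμ : 0 < μ) : ∃ C : ℝ, 0 < C ∧ ∀ (T : Mesh Ω) (q : Pt d → Pt d),
      bilin T A μ q q ≤ C * energyNorm T q ^ 2 := by
  have hAb : ∃ B : ℝ, 0 < B ∧ ∀ᵐ x ∂volume.restrict Ω, frob (A x) (A x) ≤ B := by
    have h1 : ∀ i j, ∃ B : ℝ, ∀ᵐ x ∂volume.restrict Ω, ‖A x i j‖ ≤ B := fun i j => by
      refine ⟨(eLpNormEssSup (fun x => A x i j) (volume.restrict Ω)).toReal, ?_⟩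
      have h2 := (hA i j).eLpNorm_lt_top
      rw [eLpNorm_exponent_top] at h2
      filter_upwards [ae_le_eLpNormEssSup (f := fun x => A x i j) (μ := volume.restrict Ω)] with x hx
      have := ENNReal.toReal_mono h2.ne hx
      simpa using this
    choose B hB using h1
    refine ⟨∑ i, ∑ j, B i j ^ 2 + 1, by positivity, ?_⟩
    filter_upwards [ae_all_iff.2 fun i => ae_all_iff.2 (hB i)] with x hx
    refine le_trans ?_ (le_add_of_nonneg_right zero_le_one)
    refine Finset.sum_le_sum fun i _ => Finset.sum_le_sum fun j _ => ?_
    have := pow_le_pow_left₀ (norm_nonneg _) (hx i j) 2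
    rwa [Real.norm_eq_abs, sq_abs, sq] at this
  obtain ⟨B, hB0, hB⟩ := hAb
  refine ⟨B + μ, by positivity, fun T q => ?_⟩
  rw [energyNorm_sq, bilin, mul_add, mul_add]
  have h1 : ∀ X : Fin d → Fin d → ℝ, 0 ≤ frob X X := fun X =>
    Finset.sum_nonneg fun i _ => Finset.sum_nonneg fun j _ => mul_self_nonneg _
  have h2 : ∀ X : Fin d → Fin d → ℝ, 0 ≤ crossDot X X := fun X =>
    Finset.sum_nonneg fun i _ => Finset.sum_nonneg fun j _ => mul_self_nonneg _
  refine add_le_add (add_le_add ?_ ?_) ?_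
  · rw [Finset.mul_sum]
    refine Finset.sum_le_sum fun K hK => ?_
    have hsub := cell_subset hO hC hK
    rw [← integral_const_mul]
    refine integral_mono_ae ((memLp_frob_grad hsub hA q).integrable_mul (memLp_frob_grad hsub hA q))
      (Integrable.const_mul (integrable_finsetSum _ fun i _ => integrable_finsetSum _ fun j _ =>
        (memLp_weakPd (cell K) j fun y => q y i).integrable_mul
          (memLp_weakPd (cell K) j fun y => q y i)) _) ?_
    filter_upwards [ae_restrict_of_ae_restrict_of_subset hsub hB] with x hx
    have h3 := frob_sq_le (A x) (grad K q x)
    have h4 := mul_le_mul_of_nonneg_right hx (h1 (grad K q x))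
    have h5 := mul_nonneg hμ.le (h1 (grad K q x))
    linarith
  · rw [Finset.mul_sum]
    refine Finset.sum_le_sum fun e _ => ?_
    rw [integral_const_mul, ← mul_assoc, mul_one_div]
    exact mul_le_mul_of_nonneg_right (div_le_div_of_nonneg_right (by linarith) Metric.diam_nonneg)
      (integral_nonneg fun x => h1 _)
  · rw [Finset.mul_sum]
    refine Finset.sum_le_sum fun e _ => ?_
    rw [integral_const_mul, ← mul_assoc, mul_one_div]
    exact mul_le_mul_of_nonneg_right (div_le_div_of_nonneg_right (by linarith) Metric.diam_nonneg)
      (integral_nonneg fun x => h2 _)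

theorem exists_abs_bilin_le (hO : IsOpen Ω) (hC : Convex ℝ Ω) (hA : EssBounded Ω A) {μ : ℝ}
    (hμ : 0 < μ) : ∃ C : ℝ, 0 < C ∧ ∀ (T : Mesh Ω) (p q : Pt d → Pt d),
      |bilin T A μ p q| ≤ C * (energyNorm T p * energyNorm T q) := by
  obtain ⟨C, hC0, h⟩ := exists_bilin_self_le hO hC hA hμ
  refine ⟨C, hC0, fun T p q => (abs_bilin_le hO hC hA hμ.le T p q).trans ?_⟩
  have hs : ∀ q : Pt d → Pt d, Real.sqrt (bilin T A μ q q) ≤ Real.sqrt C * energyNorm T q := by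
    intro q
    refine Real.sqrt_le_iff.2 ⟨mul_nonneg (Real.sqrt_nonneg _) (Real.sqrt_nonneg _), ?_⟩
    rw [mul_pow, Real.sq_sqrt hC0.le]
    exact h T q
  refine (mul_le_mul (hs p) (hs q) (Real.sqrt_nonneg _)
    (mul_nonneg (Real.sqrt_nonneg _) (Real.sqrt_nonneg _))).trans (le_of_eq ?_)
  rw [mul_mul_mul_comm, Real.mul_self_sqrt hC0.le]

end Mesh
end
end CordesLS

/-! ### The Cordes condition and coercivity -/

namespace CordesLS
open scoped Classical in
section

variable {d m : ℕ} {Ω : Set (Pt d)} {T : Mesh Ω} {K K' E e s : Finset (Pt d)} {a b : Pt d} {σ : ℝ}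
  {A : Pt d → Matrix (Fin d) (Fin d) ℝ}

/-- The algebraic consequence of the Cordes condition. -/
theorem sq_trace_le_of_cordes (hd : 1 ≤ d) (B : Matrix (Fin d) (Fin d) ℝ) (M : Fin d → Fin d → ℝ)
    {ν ε : ℝ} (hν : 0 < ν) (hε : 0 < ε) (hε1 : ε ≤ 1)
    (hell : ∀ ξ : Fin d → ℝ, ν * (ξ ⬝ᵥ ξ) ≤ ξ ⬝ᵥ B.mulVec ξ)
    (hcor : frob B B / B.trace ^ 2 ≤ 1 / ((d : ℝ) - 1 + ε)) :
    (∑ i, M i i) ^ 2 ≤ (1 + 2 / ε) * (ν⁻¹ ^ 2) * frob B M ^ 2 + (1 - ε / 2) * frob M M := by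
  have hd1 : (1 : ℝ) ≤ d := by exact_mod_cast hd
  have hdiag : ∀ i, ν ≤ B i i := fun i => by
    have := hell (Pi.single i 1)
    simpa using this
  have htr : d * ν ≤ B.trace := by
    rw [Matrix.trace]
    calc (d : ℝ) * ν = ∑ _i : Fin d, ν := by simp
      _ ≤ _ := Finset.sum_le_sum fun i _ => hdiag i
  have htr0 : 0 < B.trace := lt_of_lt_of_le (by positivity) htr
  have hcs : B.trace ^ 2 ≤ d * frob B B := by
    have h1 := Finset.sum_mul_sq_le_sq_mul_sq Finset.univ (fun _ : Fin d => (1 : ℝ)) (fun i => B i i)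
    have h2 : ∑ i, B i i ^ 2 ≤ frob B B := Finset.sum_le_sum fun i _ => by
      rw [sq]
      exact Finset.single_le_sum (f := fun j => B i j * B i j) (fun j _ => mul_self_nonneg _)
        (Finset.mem_univ i)
    simp only [one_mul, one_pow, Finset.sum_const, Finset.card_univ, Fintype.card_fin,
      nsmul_eq_mul, mul_one] at h1
    exact h1.trans (mul_le_mul_of_nonneg_left h2 (by linarith))
  set F := frob B B with hF
  have hF0 : 0 < F := by
    by_contra h
    push Not at h
    have h2 := mul_nonpos_of_nonneg_of_nonpos (show (0 : ℝ) ≤ d by linarith) h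
    linarith [pow_pos htr0 2]
  -- This γ minimizes |γB - I|². The minimum is d - (tr B)²/|B|², which the Cordes condition bounds
  -- by 1 - ε; ellipticity gives γ ≤ 1/ν.
  set γ := B.trace / F with hγ
  have hγ0 : 0 ≤ γ := by positivity
  have hγν : γ ≤ ν⁻¹ := by
    rw [hγ, div_le_iff₀ hF0, inv_mul_eq_div, le_div_iff₀ hν]
    nlinarith
  have hcor' : (d - 1 + ε) * F ≤ B.trace ^ 2 := by
    rw [div_le_div_iff₀ (by positivity) (by linarith)] at hcor
    linarith
  -- the matrix `γ B - 1` is small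
  set R : Fin d → Fin d → ℝ := fun i j => γ * B i j - if i = j then 1 else 0 with hR
  have hRM : frob R M = γ * frob B M - ∑ i, M i i := by
    simp only [frob, hR, sub_mul, Finset.sum_sub_distrib, Finset.mul_sum, mul_assoc, ite_mul, one_mul,
      zero_mul, Finset.sum_ite_eq, Finset.mem_univ, if_true]
  have hRR : frob R R ≤ 1 - ε := by
    have h1 : frob R R = γ ^ 2 * F - 2 * γ * B.trace + d := by
      have : ∀ i j, R i j * R i j = γ ^ 2 * (B i j * B i j) - 2 * γ * (if i = j then B i j else 0) +
          if i = j then 1 else 0 := by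
        intro i j
        by_cases h : i = j
        · simp only [hR, if_pos h]; ring
        · simp only [hR, if_neg h]; ring
      simp only [frob, this, Finset.sum_add_distrib, Finset.sum_sub_distrib, ← Finset.mul_sum, hF,
        Matrix.trace, Finset.sum_ite_eq, Finset.mem_univ, if_true, Matrix.diag]
      simp
    have h2 : γ * F = B.trace := div_mul_cancel₀ _ hF0.ne'
    have h3 : γ ^ 2 * F = γ * B.trace := by rw [sq, mul_assoc, h2]
    have h4 : d - 1 + ε ≤ γ * B.trace := by
      rw [hγ, div_mul_eq_mul_div, le_div_iff₀ hF0]; linarith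
    rw [h1, h3]; linarith
  have hMM : 0 ≤ frob M M := Finset.sum_nonneg fun i _ => Finset.sum_nonneg fun j _ => mul_self_nonneg _
  have hsq : frob R M ^ 2 ≤ (1 - ε) * frob M M :=
    (Mesh.frob_sq_le R M).trans (mul_le_mul_of_nonneg_right hRR hMM)
  have hsplit : ∑ i, M i i = γ * frob B M - frob R M := by rw [hRM]; ring
  -- Here tr M = γ B:M - (γB - I):M. Young's inequality with parameter ε/2 keeps the second part
  -- below (1 + ε/2)(1 - ε) ≤ 1 - ε/2 times |M|².
  have hyoung : (∑ i, M i i) ^ 2 ≤ (1 + 2 / ε) * (γ * frob B M) ^ 2 + (1 + ε / 2) * frob R M ^ 2 := by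
    rw [hsplit]
    have h5 : (1 + 2 / ε) * (γ * frob B M) ^ 2 + (1 + ε / 2) * frob R M ^ 2 -
        (γ * frob B M - frob R M) ^ 2 = (2 / ε) * (γ * frob B M + ε / 2 * frob R M) ^ 2 := by
      field_simp; ring
    have h6 : 0 ≤ (2 / ε) * (γ * frob B M + ε / 2 * frob R M) ^ 2 := by positivity
    linarith
  have h7 : (γ * frob B M) ^ 2 ≤ ν⁻¹ ^ 2 * frob B M ^ 2 := by
    rw [mul_pow]
    exact mul_le_mul_of_nonneg_right (pow_le_pow_left₀ hγ0 hγν 2) (sq_nonneg _)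
  have h8 : (1 + ε / 2) * frob R M ^ 2 ≤ (1 - ε / 2) * frob M M := by
    have := mul_le_mul_of_nonneg_left hsq (show 0 ≤ 1 + ε / 2 by linarith)
    nlinarith [mul_nonneg (sq_nonneg ε) hMM]
  have h9 := mul_le_mul_of_nonneg_left h7 (show 0 ≤ 1 + 2 / ε by positivity)
  linarith

/-- Lagrange's identity |v × n|² = |v|²|n|² - (v·n)², as half the sum over all i, j. It identifies
the tangential boundary term with the deviation from the normal part. -/
theorem crossDot_self_eq (v n : Pt d) (hn : ‖n‖ = 1) :
    crossDot (cross v n) (cross v n) = ‖v - inner ℝ n v • n‖ ^ 2 := by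
  have h1 : crossDot (cross v n) (cross v n) =
      2⁻¹ * ∑ i, ∑ j, (v i * n j - v j * n i) ^ 2 := by
    have h2 : ∀ i j, (v i * n j - v j * n i) ^ 2 = (if i < j then (v i * n j - v j * n i) ^ 2 else 0) +
        (if j < i then (v j * n i - v i * n j) ^ 2 else 0) := by
      intro i j
      rcases lt_trichotomy i j with h | h | h
      · rw [if_pos h, if_neg h.not_gt, add_zero]
      · subst h; simp
      · rw [if_neg h.not_gt, if_pos h, zero_add]; ring
    have h3 : crossDot (cross v n) (cross v n) =
        ∑ i, ∑ j, if i < j then (v i * n j - v j * n i) ^ 2 else 0 := by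
      refine Finset.sum_congr rfl fun i _ => ?_
      rw [← Finset.sum_filter]
      refine Finset.sum_congr (by ext j; simp) fun j _ => by simp only [cross]; ring
    conv_rhs => rw [Finset.sum_congr rfl fun i _ => Finset.sum_congr rfl fun j _ => h2 i j]
    simp only [Finset.sum_add_distrib]
    rw [Finset.sum_comm (f := fun i j => if j < i then (v j * n i - v i * n j) ^ 2 else 0), ← h3]
    ring
  have hn2 : ∑ i, n i ^ 2 = 1 := by
    have := EuclideanSpace.norm_sq_eq n
    rw [hn] at this
    simpa using this.symm
  have hv2 : ∑ i, v i ^ 2 = ‖v‖ ^ 2 := by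
    rw [EuclideanSpace.norm_sq_eq]; simp
  have hin : ∑ i, v i * n i = inner ℝ n v := by
    simp [PiLp.inner_apply]
  have h4 : ∑ i, ∑ j, (v i * n j - v j * n i) ^ 2 = 2 * (‖v‖ ^ 2 - inner ℝ n v ^ 2) := by
    have h5 : ∀ i j, (v i * n j - v j * n i) ^ 2 = v i ^ 2 * n j ^ 2 + n i ^ 2 * v j ^ 2 -
        2 * ((v i * n i) * (v j * n j)) := fun i j => by ring
    simp only [h5, Finset.sum_sub_distrib, Finset.sum_add_distrib, ← Finset.mul_sum, ← Finset.sum_mul,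
      hn2, hv2, hin]
    ring
  rw [h1, h4, norm_sub_sq_real, norm_smul, real_inner_smul_right, hn, Real.norm_eq_abs, mul_one, sq_abs,
    real_inner_comm]
  ring

namespace Mesh

/-- The field `q` coincides on each element with the polynomial field `P`. -/
def Represents (T : Mesh Ω) (q : Pt d → Pt d) (P : Finset (Pt d) → Fin d → MvPolynomial (Fin d) ℝ) :
    Prop :=
  ∀ K ∈ T.cells, ∀ᵐ x ∂volume.restrict (cell K), ∀ i, q x i = pev (P K i) x

variable {q : Pt d → Pt d} {P : Finset (Pt d) → Fin d → MvPolynomial (Fin d) ℝ}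

theorem Represents.grad_ae_eq (h : T.Represents q P) (hK : K ∈ T.cells) :
    ∀ᵐ x ∂volume.restrict (cell K), ∀ i j, grad K q x i j = pev (MvPolynomial.pderiv j (P K i)) x := by
  refine ae_all_iff.2 fun i => ae_all_iff.2 fun j => ?_
  rw [← pd_pev]
  exact weakPd_ae_eq (contDiff_pev _) ((h K hK).mono fun x hx => hx i)

theorem Represents.vtrace_ae_eq (hd : 1 ≤ d) (h : T.Represents q P) (hK : K ∈ T.cellsAt e)
    (hc : e.card = d) :
    ∀ᵐ x ∂faceMeasure e, ∀ i, vtrace K e q x i = pev (P K i) x := by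
  obtain ⟨hKc, heK⟩ := mem_cellsAt.1 hK
  obtain ⟨a, ha, rfl⟩ := exists_erase_eq hKc heK hc
  exact ae_all_iff.2 fun i => trace_ae_eq hd (fullSim hKc) ha (contDiff_pev _)
    ((h K hKc).mono fun x hx => hx i)

theorem Represents.all_vtrace_ae_eq (hd : 1 ≤ d) (h : T.Represents q P) (hc : e.card = d) :
    ∀ᵐ x ∂faceMeasure e, ∀ K ∈ T.cellsAt e, ∀ i, vtrace K e q x i = pev (P K i) x := by
  rw [Filter.eventually_all_finset]
  exact fun K hK => h.vtrace_ae_eq hd hK hc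

theorem integral_cell_pev (hK : K ∈ T.cells) (Q : MvPolynomial (Fin d) ℝ) :
    ∫ x in cell K, pev Q x = simConst K * polyInt K Q := by
  rw [← (fullSim hK).simMeasure_eq, (fullSim hK).isSim.integral_eq, (fullSim hK).isSim.polyInt_apply]

theorem integral_face_pev (hd : 1 ≤ d) (he : e ∈ T.sides) (Q : MvPolynomial (Fin d) ℝ) :
    ∫ x, pev Q x ∂faceMeasure e = simConst e * polyInt e Q := by
  obtain ⟨K, hK⟩ := exists_cellsAt (mem_faces_of_mem_sides he)
  have hs := isSim_of_card hd hK (card_of_mem_sides he)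
  obtain ⟨hKc, heK⟩ := mem_cellsAt.1 hK
  obtain ⟨a, ha, rfl⟩ := exists_erase_eq hKc heK (card_of_mem_sides he)
  rw [(fullSim hKc).faceMeasure_eq ha, hs.integral_eq, hs.polyInt_apply]

theorem Represents.integral_grad (h : T.Represents q P) (hK : K ∈ T.cells) :
    ∫ x in cell K, frob (grad K q x) (grad K q x) = gradTerm P K := by
  rw [gradTerm, ← integral_cell_pev hK]
  refine integral_congr_ae ?_
  filter_upwards [h.grad_ae_eq hK] with x hx
  simp only [frob, hx, pev_gsq, sq]

/-- The jump is (q - q') ⊗ n with |n| = 1; the factor 2 appears because the deviations from the mean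
contribute half of |q - q'|². -/
theorem Represents.integral_jump (hd : 1 ≤ d) (hO : IsOpen Ω) (hC : Convex ℝ Ω) (hne : Ω.Nonempty)
    (h : T.Represents q P) (he : e ∈ T.interiorFaces) :
    1 / hFace e * ∫ x, frob (jump T e q x) (jump T e q x) ∂faceMeasure e = 2 * T.jumpTerm P e := by
  obtain ⟨-, hc, K, hK, -⟩ := mem_interiorFaces.1 he
  obtain ⟨K', hK', hKK, heq⟩ := cellsAt_eq_pair hd he hK
  have h1 : ∫ x, frob (jump T e q x) (jump T e q x) ∂faceMeasure e =
      ∫ x, pev ((2 : ℝ) • T.jumpSq P e) x ∂faceMeasure e := by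
    refine integral_congr_ae ?_
    filter_upwards [h.vtrace_ae_eq hd hK hc, h.vtrace_ae_eq hd hK' hc] with x hx hx'
    have hn : outwardNormal K' e = -outwardNormal K e := by
      obtain ⟨hKc, heK⟩ := mem_cellsAt.1 hK
      obtain ⟨a, ha, rfl⟩ := exists_erase_eq hKc heK hc
      exact outwardNormal_opposite hd hKc ha (mem_cellsAt.1 hK').1 hKK.symm (mem_cellsAt.1 hK').2
    have hj : ∀ i j, jump T e q x i j =
        (fieldAt (P K) x - fieldAt (P K') x) i * outwardNormal K e j := by
      intro i j
      rw [jump, heq, Finset.sum_pair hKK, hx, hx', hn]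
      simp only [PiLp.neg_apply, PiLp.sub_apply, fieldAt_apply]
      ring
    have hn2 : ∑ j, outwardNormal K e j ^ 2 = 1 := by
      have := EuclideanSpace.norm_sq_eq (outwardNormal K e)
      rw [norm_normal hd hK hc] at this
      simpa using this.symm
    rw [pev_smul, pev_jumpSq_interior hd hO hC hne he hK hK' hKK, EuclideanSpace.norm_sq_eq]
    simp only [frob, hj, Real.norm_eq_abs, sq_abs]
    have : ∀ i j, (fieldAt (P K) x - fieldAt (P K') x) i * outwardNormal K e j *
        ((fieldAt (P K) x - fieldAt (P K') x) i * outwardNormal K e j) =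
        (fieldAt (P K) x - fieldAt (P K') x) i ^ 2 * outwardNormal K e j ^ 2 := fun i j => by ring
    simp only [this, ← Finset.mul_sum, hn2, mul_one]
    ring
  rw [h1, integral_face_pev hd (Finset.mem_union_left _ he), jumpTerm, map_smul, smul_eq_mul]
  ring

theorem Represents.integral_tang (hd : 1 ≤ d) (hO : IsOpen Ω) (hC : Convex ℝ Ω) (hne : Ω.Nonempty)
    (h : T.Represents q P) (he : e ∈ T.boundaryFaces) :
    1 / hFace e * ∫ x, crossDot (tang T e q x) (tang T e q x) ∂faceMeasure e = T.jumpTerm P e := by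
  obtain ⟨hf, hc, -⟩ := mem_boundaryFaces.1 he
  obtain ⟨K, hK⟩ := exists_cellsAt hf
  have h1 : ∫ x, crossDot (tang T e q x) (tang T e q x) ∂faceMeasure e =
      ∫ x, pev (T.jumpSq P e) x ∂faceMeasure e := by
    refine integral_congr_ae ?_
    filter_upwards [h.vtrace_ae_eq hd hK hc] with x hx
    have hj : tang T e q x = cross (fieldAt (P K) x) (outwardNormal K e) := by
      funext i j
      rw [tang, cellsAt_eq_singleton hd hO hC hne he hK, Finset.sum_singleton]
      simp only [cross, hx, fieldAt_apply]
    rw [hj, crossDot_self_eq _ _ (norm_normal hd hK hc), pev_jumpSq_boundary hd hO hC hne he hK]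
  rw [h1, integral_face_pev hd (Finset.mem_union_right _ he), jumpTerm]
  ring

theorem Represents.energyNorm_sq (hd : 1 ≤ d) (hO : IsOpen Ω) (hC : Convex ℝ Ω) (hne : Ω.Nonempty)
    (h : T.Represents q P) : energyNorm T q ^ 2 = ∑ K ∈ T.cells, gradTerm P K +
      (2 * ∑ e ∈ T.interiorFaces, T.jumpTerm P e + ∑ e ∈ T.boundaryFaces, T.jumpTerm P e) := by
  rw [Mesh.energyNorm_sq, ← add_assoc, Finset.mul_sum]
  refine congrArg₂ _ (congrArg₂ _ ?_ ?_) ?_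
  · exact Finset.sum_congr rfl fun K hK => h.integral_grad hK
  · exact Finset.sum_congr rfl fun e he => h.integral_jump hd hO hC hne he
  · exact Finset.sum_congr rfl fun e he => h.integral_tang hd hO hC hne he

theorem Represents.bilin_self (hd : 1 ≤ d) (hO : IsOpen Ω) (hC : Convex ℝ Ω) (hne : Ω.Nonempty)
    (h : T.Represents q P) (μ : ℝ) : bilin T A μ q q =
      (∑ K ∈ T.cells, ∫ x in cell K, frob (A x) (grad K q x) ^ 2) +
      μ * (2 * ∑ e ∈ T.interiorFaces, T.jumpTerm P e + ∑ e ∈ T.boundaryFaces, T.jumpTerm P e) := by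
  rw [bilin, mul_add, ← add_assoc, Finset.mul_sum, Finset.mul_sum, Finset.mul_sum]
  refine congrArg₂ _ (congrArg₂ _ ?_ ?_) ?_
  · simp only [sq]
  · refine Finset.sum_congr rfl fun e he => ?_
    rw [← h.integral_jump hd hO hC hne he, integral_const_mul]; ring
  · refine Finset.sum_congr rfl fun e he => ?_
    rw [← h.integral_tang hd hO hC hne he, integral_const_mul]; ring

theorem exists_represents {p : L2Vec Ω} (hp : p ∈ irrotSpace T m) :
    ∃ P : Finset (Pt d) → Fin d → MvPolynomial (Fin d) ℝ, T.Represents p P ∧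
      (∀ K ∈ T.cells, ∀ i, (P K i).totalDegree ≤ m) ∧
      ∀ K ∈ T.cells, ∀ i j, MvPolynomial.pderiv i (P K j) = MvPolynomial.pderiv j (P K i) := by
  choose! P h1 h2 h3 using hp
  exact ⟨P, h3, h1, h2⟩

/-- With G, J, a the gradient, jump and operator parts, Miranda-Talenti gives G ≤ D + (ε/4)G + C₀J
for the squared divergence D, and Cordes gives D ≤ C₁a + (1 - ε/2)G. Hence (ε/4)G ≤ C₁a + C₀J. -/
theorem exists_coercive (hd : 2 ≤ d) (hO : IsOpen Ω) (hC : Convex ℝ Ω) (hne : Ω.Nonempty)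
    (hA : EssBounded Ω A) (hell : UniformlyElliptic Ω A) (hcor : Cordes Ω A) {μ : ℝ} (hμ : 0 < μ)
    (σ : ℝ) (m : ℕ) :
    ∃ C : ℝ, 0 < C ∧ ∀ T : Mesh Ω, T.ShapeRegular σ → ∀ p ∈ irrotSpace T m,
      C * energyNorm T p ^ 2 ≤ bilin T A μ p p := by
  have hd1 : 1 ≤ d := by omega
  obtain ⟨ν, ν₂, hν, -, hell⟩ := hell
  obtain ⟨ε, hε, hε1, hcor⟩ := hcor
  obtain ⟨C₀, hC₀, hmir⟩ := exists_miranda_le hd hO hC hne σ m (show 0 < ε / 4 by positivity)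
  set C₁ := (1 + 2 / ε) * (ν⁻¹ ^ 2) with hC₁
  have hC₁0 : 0 < C₁ := by positivity
  -- Large enough for G + J ≤ M(a + μJ); the cross terms left over in the product are nonnegative.
  set M := 4 / ε * (C₁ + C₀ / μ) + 1 / μ with hM
  have hM0 : 0 < M := by positivity
  refine ⟨M⁻¹, inv_pos.2 hM0, fun T hT p hp => ?_⟩
  obtain ⟨P, hP, hdeg, hcurl⟩ := exists_represents hp
  rw [inv_mul_le_iff₀ hM0, hP.energyNorm_sq hd1 hO hC hne, hP.bilin_self hd1 hO hC hne]
  have hm := hmir T hT P hdeg hcurl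
  set J := 2 * ∑ e ∈ T.interiorFaces, T.jumpTerm P e + ∑ e ∈ T.boundaryFaces, T.jumpTerm P e with hJ
  set G := ∑ K ∈ T.cells, gradTerm P K with hG
  set a := ∑ K ∈ T.cells, ∫ x in cell K, frob (A x) (grad K p x) ^ 2 with ha
  have ha0 : 0 ≤ a := Finset.sum_nonneg fun K _ => integral_nonneg fun x => sq_nonneg _
  have hJi : 0 ≤ ∑ e ∈ T.interiorFaces, T.jumpTerm P e :=
    Finset.sum_nonneg fun e he => jumpTerm_nonneg hd (Finset.mem_union_left _ he)
  have hJb : 0 ≤ ∑ e ∈ T.boundaryFaces, T.jumpTerm P e :=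
    Finset.sum_nonneg fun e he => jumpTerm_nonneg hd (Finset.mem_union_right _ he)
  have hJ0 : 0 ≤ J := by positivity
  have hJs : ∑ e ∈ T.sides, T.jumpTerm P e ≤ J := by
    rw [sum_sides hd1 hO hC hne]; linarith
  have hdiv : ∀ K ∈ T.cells, simConst K * polyInt K ((∑ i, MvPolynomial.pderiv i (P K i)) ^ 2) ≤
      C₁ * (∫ x in cell K, frob (A x) (grad K p x) ^ 2) + (1 - ε / 2) * gradTerm P K := by
    intro K hK
    have hsub := cell_subset hO hC hK
    rw [← integral_cell_pev hK, ← hP.integral_grad hK, ← integral_const_mul, ← integral_const_mul,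
      ← integral_add]
    · refine integral_mono_ae ?_ ?_ ?_
      · rw [← (fullSim hK).simMeasure_eq]
        exact (fullSim hK).isSim.integrable (continuous_pev _)
      · exact ((memLp_frob_grad hsub hA p).integrable_sq.const_mul _).add
          (Integrable.const_mul (integrable_finsetSum _ fun i _ => integrable_finsetSum _ fun j _ =>
            (memLp_weakPd (cell K) j fun y => p y i).integrable_mul
              (memLp_weakPd (cell K) j fun y => p y i)) _)
      · filter_upwards [hP.grad_ae_eq hK, ae_restrict_of_ae_restrict_of_subset hsub hell,
          ae_restrict_of_ae_restrict_of_subset hsub hcor] with x hx hx1 hx2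
        have := sq_trace_le_of_cordes hd1 (A x) (grad K p x) hν hε hε1 (fun ξ => (hx1 ξ).1) hx2
        simp only [pev_sq, pev_sum]
        simpa only [hx] using this
    · exact (memLp_frob_grad hsub hA p).integrable_sq.const_mul _
    · exact Integrable.const_mul (integrable_finsetSum _ fun i _ => integrable_finsetSum _ fun j _ =>
            (memLp_weakPd (cell K) j fun y => p y i).integrable_mul
              (memLp_weakPd (cell K) j fun y => p y i)) _
  have hdivs : ∑ K ∈ T.cells, simConst K * polyInt K ((∑ i, MvPolynomial.pderiv i (P K i)) ^ 2) ≤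
      C₁ * a + (1 - ε / 2) * G := by
    rw [ha, hG, Finset.mul_sum, Finset.mul_sum, ← Finset.sum_add_distrib]
    exact Finset.sum_le_sum hdiv
  simp only [map_sub, mul_sub, Finset.sum_sub_distrib] at hm
  have hGe : ∑ K ∈ T.cells, simConst K * polyInt K (gsq (P K)) = G := rfl
  rw [hGe] at hm
  have h1 := mul_le_mul_of_nonneg_left hJs hC₀.le
  have h2 : ε / 4 * G ≤ C₁ * a + C₀ * J := by linarith
  have h3 : G ≤ 4 / ε * (C₁ * a + C₀ * J) := by
    rw [div_mul_eq_mul_div, le_div_iff₀ hε]; linarith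
  have h4 : M * (a + μ * J) = 4 / ε * (C₁ * a + C₀ * J) + J +
      (4 / ε * (C₀ / μ) * a + 4 / ε * (C₁ * μ) * J + 1 / μ * a) := by
    rw [hM]; field_simp; ring
  rw [h4]
  have h5 : 0 ≤ 4 / ε * (C₀ / μ) * a + 4 / ε * (C₁ * μ) * J + 1 / μ * a := by positivity
  linarith

end Mesh
end
end CordesLS

/-! ### Definiteness of the energy norm on the discrete space -/

namespace CordesLS
open scoped Classical in
section

variable {d m : ℕ} {Ω : Set (Pt d)} {T : Mesh Ω} {K K' E e s : Finset (Pt d)} {a b : Pt d} {σ : ℝ}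
  {A : Pt d → Matrix (Fin d) (Fin d) ℝ}

theorem pev_X (i : Fin d) (x : Pt d) : pev (MvPolynomial.X i) x = x i := by simp [pev]

theorem IsSim.pev_eq_zero (hs : IsSim s) {Q : MvPolynomial (Fin d) ℝ}
    (h : polyInt s (Q ^ 2) = 0) {x : Pt d} (hx : x ∈ hull s) : pev Q x = 0 := by
  obtain ⟨C, -, hC⟩ := exists_sq_pev_le d Q.totalDegree
  have h1 := hC s hs Q le_rfl x hx
  rw [hs.polyInt_apply] at h
  simp only [funext (pev_sq Q)] at h
  rw [h, mul_zero] at h1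
  exact pow_eq_zero_iff two_ne_zero |>.1 (le_antisymm h1 (sq_nonneg _))

theorem IsSim.fieldAt_eq_zero (hs : IsSim s) {u : Fin d → MvPolynomial (Fin d) ℝ}
    (h : polyInt s (nsq u) = 0) {x : Pt d} (hx : x ∈ hull s) : fieldAt u x = 0 := by
  rw [polyInt_nsq] at h
  ext i
  exact hs.pev_eq_zero ((Finset.sum_eq_zero_iff_of_nonneg fun i _ => polyInt_sq_nonneg _).1 h i
    (Finset.mem_univ i)) hx

theorem polyInt_congr {P Q : MvPolynomial (Fin d) ℝ} (h : ∀ x ∈ hull s, pev P x = pev Q x) :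
    polyInt s P = polyInt s Q := by
  by_cases hs : IsSim s
  · rw [hs.polyInt_apply, hs.polyInt_apply, simInt_congr h]
  · rw [polyInt, dif_neg hs]; rfl

/-- The components `xᵢ |u|² - (x · u) uᵢ`. -/
def flux (u : Fin d → MvPolynomial (Fin d) ℝ) (i : Fin d) : MvPolynomial (Fin d) ℝ :=
  MvPolynomial.X i * nsq u - (∑ j, MvPolynomial.X j * u j) * u i

theorem pev_flux (u : Fin d → MvPolynomial (Fin d) ℝ) (i : Fin d) (x : Pt d) :
    pev (flux u i) x = x i * ‖fieldAt u x‖ ^ 2 - inner ℝ x (fieldAt u x) * fieldAt u x i := by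
  rw [flux, pev_sub, pev_mul, pev_mul, pev_X, pev_nsq, pev_sum]
  simp only [pev_mul, pev_X, PiLp.inner_apply, fieldAt_apply, RCLike.inner_apply, conj_trivial]
  simp only [mul_comm]

/-- Where ∇u = 0, the first part x_i |u|² contributes d|u|² to the divergence and the second part
(x·u)u_i contributes |u|². -/
theorem pev_sum_pderiv_flux {u : Fin d → MvPolynomial (Fin d) ℝ} {x : Pt d}
    (h : ∀ i j, pev (MvPolynomial.pderiv j (u i)) x = 0) :
    pev (∑ i, MvPolynomial.pderiv i (flux u i)) x = (d - 1) * pev (nsq u) x := by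
  have h1 : ∀ i, pev (MvPolynomial.pderiv i (nsq u)) x = 0 := by
    intro i
    rw [nsq, map_sum, pev_sum]
    refine Finset.sum_eq_zero fun j _ => ?_
    rw [sq, MvPolynomial.pderiv_mul, pev_add, pev_mul, pev_mul, h]
    ring
  have h2 : ∀ i, pev (MvPolynomial.pderiv i (∑ j, MvPolynomial.X j * u j)) x = pev (u i) x := by
    intro i
    rw [map_sum, pev_sum, Finset.sum_eq_single i]
    · rw [MvPolynomial.pderiv_mul, pev_add, pev_mul, pev_mul, h, MvPolynomial.pderiv_X_self]
      simp [pev]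
    · intro j _ hj
      rw [MvPolynomial.pderiv_mul, pev_add, pev_mul, pev_mul, h, MvPolynomial.pderiv_X_of_ne hj]
      simp [pev]
    · simp
  have h3 : ∀ i, pev (MvPolynomial.pderiv i (flux u i)) x = pev (nsq u) x - pev (u i) x ^ 2 := by
    intro i
    rw [flux, map_sub, pev_sub, MvPolynomial.pderiv_mul, MvPolynomial.pderiv_mul, pev_add, pev_add,
      pev_mul, pev_mul, pev_mul, pev_mul, h1, h2, h, MvPolynomial.pderiv_X_self]
    have : pev (1 : MvPolynomial (Fin d) ℝ) x = 1 := by simp [pev]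
    rw [this]; ring
  rw [pev_sum]
  simp only [h3, Finset.sum_sub_distrib, Finset.sum_const, Finset.card_univ, Fintype.card_fin,
    nsmul_eq_mul]
  have h4 : ∑ i, pev (u i) x ^ 2 = pev (nsq u) x := by
    rw [nsq, pev_sum]; simp only [pev_sq]
  rw [h4]; ring

namespace Mesh

variable {q : Finset (Pt d) → Fin d → MvPolynomial (Fin d) ℝ}

/-- A piecewise constant field without jumps and with normal boundary values vanishes. -/
theorem fieldAt_eq_zero (hd : 2 ≤ d) (hO : IsOpen Ω) (hC : Convex ℝ Ω) (hne : Ω.Nonempty)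
    (hg : ∀ K ∈ T.cells, gradTerm q K = 0) (hj : ∀ e ∈ T.sides, T.jumpTerm q e = 0)
    (hK : K ∈ T.cells) {x : Pt d} (hx : x ∈ hull K) : fieldAt (q K) x = 0 := by
  have hd1 : 1 ≤ d := by omega
  have hgrad : ∀ K ∈ T.cells, ∀ x ∈ hull K, ∀ i j, pev (MvPolynomial.pderiv j (q K i)) x = 0 := by
    intro K hK x hx i j
    have h1 := (mul_eq_zero.1 (hg K hK)).resolve_left (fullSim hK).isSim.simConst_pos.ne'
    rw [polyInt_gsq] at h1
    have h2 := (Finset.sum_eq_zero_iff_of_nonneg fun i _ => Finset.sum_nonneg fun j _ =>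
      polyInt_sq_nonneg _).1 h1 i (Finset.mem_univ i)
    have h3 := (Finset.sum_eq_zero_iff_of_nonneg fun j _ =>
      polyInt_sq_nonneg _).1 h2 j (Finset.mem_univ j)
    exact (fullSim hK).isSim.pev_eq_zero h3 hx
  have hmean : ∀ e ∈ T.sides, ∀ K ∈ T.cellsAt e, ∀ x ∈ hull e,
      fieldAt (q K) x = fieldAt (T.meanField q e) x := by
    intro e he K hK x hx
    have hs := isSim_of_card hd1 hK (card_of_mem_sides he)
    have h0 : simConst e / hFace e ≠ 0 :=
      (div_pos hs.simConst_pos (hFace_pos hd (card_of_mem_sides he))).ne'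
    have h1 := (mul_eq_zero.1 (hj e he)).resolve_left h0
    rw [jumpSq, map_sum] at h1
    have h2 := (Finset.sum_eq_zero_iff_of_nonneg fun K _ => polyInt_nonneg fun x => by
      rw [pev_nsq]; positivity).1 h1 K hK
    have h3 := hs.fieldAt_eq_zero h2 hx
    rwa [fieldAt_sub, sub_eq_zero] at h3
  have hgauss : ∀ K ∈ T.cells, simConst K * ((d - 1) * polyInt K (nsq (q K))) =
      ∑ a ∈ K, ∑ i, wNormal K (K.erase a) i * polyInt (K.erase a) (flux (q K) i) := by
    intro K hK
    have hF := fullSim hK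
    have h1 : polyInt K (∑ i, MvPolynomial.pderiv i (flux (q K) i)) =
        (d - 1) * polyInt K (nsq (q K)) := by
      rw [← smul_eq_mul, ← map_smul]
      refine polyInt_congr fun x hx => ?_
      rw [pev_sum_pderiv_flux (hgrad K hK x hx), pev_smul]
    rw [← h1, map_sum]
    simp only [hF.polyInt_pderiv hd1]
    rw [Finset.sum_neg_distrib, Finset.sum_comm, mul_neg, Finset.mul_sum, ← Finset.sum_neg_distrib]
    refine Finset.sum_congr rfl fun a ha => ?_
    rw [Finset.mul_sum, ← Finset.sum_neg_distrib]
    refine Finset.sum_congr rfl fun i _ => ?_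
    rw [hF.wNormal_erase hd1 ha, PiLp.smul_apply, smul_eq_mul]; ring
  -- Without jumps the flux agrees on both sides of an interior face and cancels. On the boundary u
  -- = φn gives n · flux = φ²(n·x) - φ²(x·n) = 0. So the integral of |u|² is zero, and connectedness
  -- of the subdivision is not needed.
  have hsum : ∑ K ∈ T.cells, simConst K * ((d - 1) * polyInt K (nsq (q K))) = 0 := by
    rw [Finset.sum_congr rfl hgauss, sum_cells_erase hd1 hO hC fun K e =>
      ∑ i, wNormal K e i * polyInt e (flux (q K) i), sum_sides hd1 hO hC hne]
    rw [Finset.sum_eq_zero, Finset.sum_eq_zero, add_zero]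
    · intro e he
      refine Finset.sum_eq_zero fun K hK => ?_
      have hes : e ∈ T.sides := Finset.mem_union_right _ he
      have h1 : ∑ i, wNormal K e i * polyInt e (flux (q K) i) =
          polyInt e (∑ i, wNormal K e i • flux (q K) i) := by
        rw [map_sum]; simp only [map_smul, smul_eq_mul]
      rw [h1, polyInt_congr (Q := 0), map_zero]
      intro x hx
      have h2 := hmean e hes K hK x hx
      rw [meanField_boundary hd1 hO hC hne he hK, fieldAt_normal] at h2
      have hn := norm_normal hd1 hK (card_of_mem_sides hes)
      set φ := inner ℝ (outwardNormal K e) (fieldAt (q K) x)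
      have h3 : pev (0 : MvPolynomial (Fin d) ℝ) x = 0 := by simp [pev]
      have h4 : inner ℝ x (φ • outwardNormal K e) =
          φ * ∑ i, outwardNormal K e i * x i := by
        rw [real_inner_smul_right]; simp [PiLp.inner_apply]
      have h5 : ∑ i, outwardNormal K e i ^ 2 = 1 := by
        have := EuclideanSpace.norm_sq_eq (outwardNormal K e)
        rw [hn] at this
        simpa using this.symm
      rw [pev_sum, h3]
      simp only [pev_smul, pev_flux, h2, norm_smul, hn, mul_one, Real.norm_eq_abs, sq_abs, h4,
        PiLp.smul_apply, smul_eq_mul, wNormal]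
      set S := ∑ i, outwardNormal K e i * x i
      have h6 : ∀ i, simConst e * outwardNormal K e i * (x i * φ ^ 2 -
          φ * S * (φ * outwardNormal K e i)) = simConst e * φ ^ 2 * (outwardNormal K e i * x i) -
          simConst e * φ ^ 2 * S * outwardNormal K e i ^ 2 := fun i => by ring
      simp only [h6, Finset.sum_sub_distrib, ← Finset.mul_sum, h5]
      ring
    · intro e he
      have hes : e ∈ T.sides := Finset.mem_union_left _ he
      obtain ⟨-, hcard, K, hK, -⟩ := mem_interiorFaces.1 he
      obtain ⟨K', hK', hKK, heq⟩ := cellsAt_eq_pair hd1 he hK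
      rw [heq, Finset.sum_pair hKK, ← Finset.sum_add_distrib]
      refine Finset.sum_eq_zero fun i _ => ?_
      rw [wNormal_opposite hd1 hK hK' hcard hKK, polyInt_congr (Q := flux (q K') i) (P := flux (q K) i)]
      · rw [PiLp.neg_apply]; ring
      · intro x hx
        rw [pev_flux, pev_flux, hmean e hes K hK x hx, hmean e hes K' hK' x hx]
  have hd' : (0 : ℝ) < d - 1 := by
    have : (2 : ℝ) ≤ d := by exact_mod_cast hd
    linarith
  have h1 := (Finset.sum_eq_zero_iff_of_nonneg fun K hK => mul_nonneg
    (fullSim hK).isSim.simConst_pos.le (mul_nonneg hd'.le (polyInt_nonneg fun x => by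
      rw [pev_nsq]; positivity))).1 hsum K hK
  have h2 := (mul_eq_zero.1 ((mul_eq_zero.1 h1).resolve_left
    (fullSim hK).isSim.simConst_pos.ne')).resolve_left hd'.ne'
  exact (fullSim hK).isSim.fieldAt_eq_zero h2 hx

theorem ae_of_forall_cells (T : Mesh Ω) {Q : Pt d → Prop}
    (h : ∀ K ∈ T.cells, ∀ᵐ x ∂volume.restrict (cell K), Q x) :
    ∀ᵐ x ∂volume.restrict Ω, Q x := by
  have h1 : ∀ᵐ x ∂volume.restrict (⋃ K ∈ T.cells, hull K), Q x := by
    rw [ae_restrict_biUnion_finset_iff]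
    intro K hK
    rw [← Measure.restrict_congr_set (cell_ae_eq_hull K)]
    exact h K hK
  refine ae_restrict_of_ae_restrict_of_subset (fun x hx => ?_) h1
  obtain ⟨K, hK, hxK⟩ := exists_cell_of_mem_closure (T := T) (subset_closure hx)
  exact Set.mem_biUnion hK hxK

theorem Represents.eq_zero {p : L2Vec Ω} (hp : T.Represents p q)
    (h : ∀ K ∈ T.cells, ∀ x ∈ hull K, fieldAt (q K) x = 0) : p = 0 := by
  rw [Lp.eq_zero_iff_ae_eq_zero]
  refine T.ae_of_forall_cells fun K hK => ?_
  filter_upwards [hp K hK, ae_restrict_mem (isOpen_cell K).measurableSet] with x hx hxK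
  ext i
  have := congrArg (fun v : Pt d => v i) (h K hK x (interior_subset hxK))
  rw [hx i]
  exact this

theorem eq_zero_of_energyNorm_eq_zero (hd : 2 ≤ d) (hO : IsOpen Ω) (hC : Convex ℝ Ω)
    (hne : Ω.Nonempty) {p : L2Vec Ω} (hp : p ∈ irrotSpace T m) (h : energyNorm T p = 0) :
    p = 0 := by
  have hd1 : 1 ≤ d := by omega
  obtain ⟨P, hP, -, -⟩ := exists_represents hp
  have h1 := hP.energyNorm_sq hd1 hO hC hne
  have hi : ∀ e ∈ T.interiorFaces, 0 ≤ T.jumpTerm P e := fun e he =>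
    jumpTerm_nonneg hd (Finset.mem_union_left _ he)
  have hb : ∀ e ∈ T.boundaryFaces, 0 ≤ T.jumpTerm P e := fun e he =>
    jumpTerm_nonneg hd (Finset.mem_union_right _ he)
  have s1 := Finset.sum_nonneg fun K (hK : K ∈ T.cells) => gradTerm_nonneg (q := P) hK
  have s2 := Finset.sum_nonneg hi
  have s3 := Finset.sum_nonneg hb
  rw [h] at h1
  refine hP.eq_zero fun K hK x hx => fieldAt_eq_zero hd hO hC hne ?_ ?_ hK hx
  · exact (Finset.sum_eq_zero_iff_of_nonneg fun K hK => gradTerm_nonneg hK).1 (by linarith)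
  · intro e he
    rcases Finset.mem_union.1 he with he | he
    · exact (Finset.sum_eq_zero_iff_of_nonneg hi).1 (by linarith) e he
    · exact (Finset.sum_eq_zero_iff_of_nonneg hb).1 (by linarith) e he

end Mesh
end
end CordesLS

/-! ### The discrete space, unique solvability and minimality -/

namespace CordesLS
open scoped Classical in
section

variable {d m : ℕ} {Ω : Set (Pt d)} {T : Mesh Ω} {K K' E e s : Finset (Pt d)} {a b : Pt d} {σ : ℝ}
  {A : Pt d → Matrix (Fin d) (Fin d) ℝ}

/-- By continuity the polynomial vanishes on the open element, which contains a product of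
intervals. So the polynomial representing a field on an element is unique and depends linearly on
the field. -/
theorem FullSim.eq_zero_of_ae (hK : FullSim K) {P : MvPolynomial (Fin d) ℝ}
    (h : ∀ᵐ x ∂volume.restrict (cell K), pev P x = 0) : P = 0 := by
  have h1 : Set.EqOn (pev P) (fun _ => 0) (cell K) :=
    Measure.eqOn_open_of_ae_eq h (isOpen_cell K) (continuous_pev P).continuousOn continuousOn_const
  have hne : K.Nonempty := Finset.card_pos.1 (by rw [hK.2]; omega)
  have hb : barycenter K ∈ cell K := hK.mem_cell.2 fun c hc => by
    rw [hK.bary_barycenter hne subset_rfl hc, if_pos hc, hK.2]; positivity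
  have ho : IsOpen {y : Fin d → ℝ | (WithLp.toLp 2 y : Pt d) ∈ cell K} :=
    (isOpen_cell K).preimage (PiLp.continuous_toLp 2 _)
  obtain ⟨δ, hδ, hball⟩ := Metric.isOpen_iff.1 ho (fun i => barycenter K i) hb
  refine MvPolynomial.funext_set (fun i => Metric.ball (barycenter K i) δ) (fun i => ?_)
    fun y hy => ?_
  · rw [Real.ball_eq_Ioo]
    exact Set.Ioo_infinite (by linarith)
  · have hy' : y ∈ Metric.ball (fun i => barycenter K i) δ := by
      rw [ball_pi _ hδ]; exact hy
    have h2 := h1 (hball hy')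
    rw [map_zero]
    exact h2

/-- A definite bilinear form on a finite-dimensional space represents every functional. -/
theorem existsUnique_of_definite {V : Type*} [AddCommGroup V] [Module ℝ V] [FiniteDimensional ℝ V]
    (B : V →ₗ[ℝ] V →ₗ[ℝ] ℝ) (hB : ∀ p, B p p = 0 → p = 0) (l : V →ₗ[ℝ] ℝ) :
    ∃! p, ∀ q, B p q = l q := by
  have hinj : Function.Injective B := (injective_iff_map_eq_zero B).2 fun p hp =>
    hB p (by rw [hp]; rfl)
  have hsur : Function.Surjective B :=
    (LinearMap.injective_iff_surjective_of_finrank_eq_finrank Subspace.dual_finrank_eq.symm).1 hinj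
  obtain ⟨p, hp⟩ := hsur l
  refine ⟨p, fun q => by rw [hp], fun p' hp' => hinj ?_⟩
  rw [hp]
  exact LinearMap.ext hp'

namespace Mesh

section

theorem Represents.add (hO : IsOpen Ω) (hC : Convex ℝ Ω) {p q : L2Vec Ω}
    {P Q : Finset (Pt d) → Fin d → MvPolynomial (Fin d) ℝ}
    (hp : T.Represents p P) (hq : T.Represents q Q) :
    T.Represents (p + q : L2Vec Ω) (P + Q) := by
  intro K hK
  have h := Lp.coeFn_add p q
  filter_upwards [hp K hK, hq K hK,
    ae_restrict_of_ae_restrict_of_subset (cell_subset hO hC hK) h] with x h1 h2 h3 i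
  rw [h3, Pi.add_apply, PiLp.add_apply, h1, h2]
  simp only [Pi.add_apply, pev_add]

theorem Represents.smul (hO : IsOpen Ω) (hC : Convex ℝ Ω) {p : L2Vec Ω} (c : ℝ)
    {P : Finset (Pt d) → Fin d → MvPolynomial (Fin d) ℝ}
    (hp : T.Represents p P) : T.Represents (c • p : L2Vec Ω) (c • P) := by
  intro K hK
  have h := Lp.coeFn_smul c p
  filter_upwards [hp K hK,
    ae_restrict_of_ae_restrict_of_subset (cell_subset hO hC hK) h] with x h1 h3 i
  rw [h3, Pi.smul_apply, PiLp.smul_apply, h1]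
  simp only [Pi.smul_apply, pev_smul, smul_eq_mul]

theorem Represents.mem_irrotSpace {p : L2Vec Ω}
    {P : Finset (Pt d) → Fin d → MvPolynomial (Fin d) ℝ} (hp : T.Represents p P)
    (hdeg : ∀ K ∈ T.cells, ∀ i, (P K i).totalDegree ≤ m)
    (hcurl : ∀ K ∈ T.cells, ∀ i j, MvPolynomial.pderiv i (P K j) = MvPolynomial.pderiv j (P K i)) :
    p ∈ irrotSpace T m :=
  fun K hK => ⟨P K, hdeg K hK, hcurl K hK, hp K hK⟩

theorem Represents.unique {p : L2Vec Ω}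
    {P Q : Finset (Pt d) → Fin d → MvPolynomial (Fin d) ℝ} (hP : T.Represents p P)
    (hQ : T.Represents p Q) (hK : K ∈ T.cells) (i : Fin d) : P K i = Q K i := by
  rw [← sub_eq_zero]
  refine (fullSim hK).eq_zero_of_ae ?_
  filter_upwards [hP K hK, hQ K hK] with x h1 h2
  rw [pev_sub, ← h1, ← h2, sub_self]

/-- The space of piecewise irrotational polynomial fields as a subspace. -/
def irrotSubmodule (T : Mesh Ω) (hO : IsOpen Ω) (hC : Convex ℝ Ω) (m : ℕ) :
    Submodule ℝ (L2Vec Ω) where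
  carrier := irrotSpace T m
  zero_mem' := by
    intro K hK
    refine ⟨0, by simp, by simp, ?_⟩
    have h := Lp.coeFn_zero (Pt d) 2 (volume.restrict Ω)
    filter_upwards [ae_restrict_of_ae_restrict_of_subset (cell_subset hO hC hK) h] with x hx i
    rw [hx]; simp
  add_mem' := by
    intro p q hp hq
    obtain ⟨P, hP, hP1, hP2⟩ := exists_represents hp
    obtain ⟨Q, hQ, hQ1, hQ2⟩ := exists_represents hq
    refine (hP.add hO hC hQ).mem_irrotSpace (fun K hK i => ?_) fun K hK i j => ?_
    · exact (MvPolynomial.totalDegree_add _ _).trans (max_le (hP1 K hK i) (hQ1 K hK i))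
    · simp only [Pi.add_apply, map_add, hP2 K hK i j, hQ2 K hK i j]
  smul_mem' := by
    intro c p hp
    obtain ⟨P, hP, hP1, hP2⟩ := exists_represents hp
    refine (hP.smul hO hC c).mem_irrotSpace (fun K hK i => ?_) fun K hK i j => ?_
    · exact (MvPolynomial.totalDegree_smul_le _ _).trans (hP1 K hK i)
    · simp only [Pi.smul_apply, Derivation.map_smul, hP2 K hK i j]

/-- Uniqueness makes the choice of representing polynomials linear, and it embeds the space into a
finite product of polynomial spaces. -/
theorem finiteDimensional_irrotSubmodule (T : Mesh Ω) (hO : IsOpen Ω) (hC : Convex ℝ Ω) (m : ℕ) :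
    FiniteDimensional ℝ (T.irrotSubmodule hO hC m) := by
  choose P hP hdeg hcurl using fun p : T.irrotSubmodule hO hC m => exists_represents p.2
  let Φ : T.irrotSubmodule hO hC m →ₗ[ℝ]
      ({K // K ∈ T.cells} → Fin d → MvPolynomial.restrictTotalDegree (Fin d) ℝ m) :=
    { toFun := fun p K i => ⟨P p K.1 i,
        (MvPolynomial.mem_restrictTotalDegree _ _ _).2 (hdeg p K.1 K.2 i)⟩
      map_add' := fun p q => by
        funext K i
        refine Subtype.ext ?_
        exact (hP (p + q)).unique ((hP p).add hO hC (hP q)) K.2 i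
      map_smul' := fun c p => by
        funext K i
        refine Subtype.ext ?_
        exact (hP (c • p)).unique ((hP p).smul hO hC c) K.2 i }
  refine FiniteDimensional.of_injective Φ ((injective_iff_map_eq_zero Φ).2 fun p hp => ?_)
  refine Subtype.ext ((hP p).eq_zero fun K hK x _ => ?_)
  ext i
  have h1 : P p K i = 0 := congrArg Subtype.val (congrFun (congrFun hp ⟨K, hK⟩) i)
  rw [fieldAt_apply, h1]
  simp [pev]

end

/-! ### Linearity of the residuals -/

/-- Weak derivatives and traces are arbitrary choices, so additivity holds only almost everywhere;
it is obtained by passing to the representing polynomials. -/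
theorem res_add (hd : 1 ≤ d) (hO : IsOpen Ω) (hC : Convex ℝ Ω) {p q : L2Vec Ω}
    (hp : p ∈ irrotSpace T m) (hq : q ∈ irrotSpace T m) {k : ResIdx d} (hk : k ∈ T.resIdx) :
    T.res A (p + q : L2Vec Ω) k =ᵐ[resMeasure k] fun x => T.res A p k x + T.res A q k x := by
  obtain ⟨P, hP, -⟩ := exists_represents hp
  obtain ⟨Q, hQ, -⟩ := exists_represents hq
  have hPQ := hP.add hO hC hQ
  rcases k with K | k | k
  · have hK := Finset.inl_mem_disjSum.1 hk
    show ∀ᵐ x ∂volume.restrict (cell K), _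
    filter_upwards [hP.grad_ae_eq hK, hQ.grad_ae_eq hK, hPQ.grad_ae_eq hK] with x h1 h2 h3
    simp only [res, frob, h1, h2, h3, Pi.add_apply, map_add, pev_add, mul_add,
      Finset.sum_add_distrib]
  · have hc := (mem_interiorFaces.1 (Finset.mem_product.1 (Finset.inl_mem_disjSum.1
      (Finset.inr_mem_disjSum.1 hk))).1).2.1
    show ∀ᵐ x ∂faceMeasure k.1, _
    filter_upwards [hP.all_vtrace_ae_eq hd hc, hQ.all_vtrace_ae_eq hd hc,
      hPQ.all_vtrace_ae_eq hd hc] with x h1 h2 h3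
    simp only [res, jump, ← Finset.sum_add_distrib]
    refine Finset.sum_congr rfl fun K hK => ?_
    rw [h1 K hK, h2 K hK, h3 K hK, Pi.add_apply, Pi.add_apply, pev_add, add_mul]
  · have hc := (mem_boundaryFaces.1 (Finset.mem_product.1 (Finset.inr_mem_disjSum.1
      (Finset.inr_mem_disjSum.1 hk))).1).2.1
    show ∀ᵐ x ∂faceMeasure k.1, _
    filter_upwards [hP.all_vtrace_ae_eq hd hc, hQ.all_vtrace_ae_eq hd hc,
      hPQ.all_vtrace_ae_eq hd hc] with x h1 h2 h3
    simp only [res, tang, cross, ← Finset.sum_add_distrib]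
    refine Finset.sum_congr rfl fun K hK => ?_
    simp only [h1 K hK, h2 K hK, h3 K hK, Pi.add_apply, pev_add]
    ring

theorem res_smul (hd : 1 ≤ d) (hO : IsOpen Ω) (hC : Convex ℝ Ω) {p : L2Vec Ω} (c : ℝ)
    (hp : p ∈ irrotSpace T m) {k : ResIdx d} (hk : k ∈ T.resIdx) :
    T.res A (c • p : L2Vec Ω) k =ᵐ[resMeasure k] fun x => c * T.res A p k x := by
  obtain ⟨P, hP, -⟩ := exists_represents hp
  have hPQ := hP.smul hO hC c
  rcases k with K | k | k
  · have hK := Finset.inl_mem_disjSum.1 hk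
    show ∀ᵐ x ∂volume.restrict (cell K), _
    filter_upwards [hP.grad_ae_eq hK, hPQ.grad_ae_eq hK] with x h1 h3
    simp only [res, frob, h1, h3, Pi.smul_apply, Derivation.map_smul, pev_smul, Finset.mul_sum,
      mul_left_comm]
  · have hc := (mem_interiorFaces.1 (Finset.mem_product.1 (Finset.inl_mem_disjSum.1
      (Finset.inr_mem_disjSum.1 hk))).1).2.1
    show ∀ᵐ x ∂faceMeasure k.1, _
    filter_upwards [hP.all_vtrace_ae_eq hd hc, hPQ.all_vtrace_ae_eq hd hc] with x h1 h3
    simp only [res, jump, Finset.mul_sum]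
    refine Finset.sum_congr rfl fun K hK => ?_
    rw [h1 K hK, h3 K hK, Pi.smul_apply, Pi.smul_apply, pev_smul, mul_assoc]
  · have hc := (mem_boundaryFaces.1 (Finset.mem_product.1 (Finset.inr_mem_disjSum.1
      (Finset.inr_mem_disjSum.1 hk))).1).2.1
    show ∀ᵐ x ∂faceMeasure k.1, _
    filter_upwards [hP.all_vtrace_ae_eq hd hc, hPQ.all_vtrace_ae_eq hd hc] with x h1 h3
    simp only [res, tang, cross, Finset.mul_sum]
    refine Finset.sum_congr rfl fun K hK => ?_
    simp only [h1 K hK, h3 K hK, Pi.smul_apply, pev_smul]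
    ring

/-- The weighted pairing of data with the residuals of a field. -/
def resPair (T : Mesh Ω) (A : Pt d → Matrix (Fin d) (Fin d) ℝ) (μ : ℝ) (G : ResIdx d → Pt d → ℝ)
    (q : Pt d → Pt d) : ℝ :=
  ∑ k ∈ T.resIdx, resWeight μ k * ∫ x, G k x * T.res A q k x ∂resMeasure k

variable {μ : ℝ} {G : ResIdx d → Pt d → ℝ}

theorem resPair_add (hd : 1 ≤ d) (hO : IsOpen Ω) (hC : Convex ℝ Ω) (hA : EssBounded Ω A)
    (hG : ∀ k ∈ T.resIdx, MemLp (G k) 2 (resMeasure k)) {p q : L2Vec Ω}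
    (hp : p ∈ irrotSpace T m) (hq : q ∈ irrotSpace T m) :
    T.resPair A μ G (p + q : L2Vec Ω) = T.resPair A μ G p + T.resPair A μ G q := by
  simp only [resPair, ← Finset.sum_add_distrib]
  refine Finset.sum_congr rfl fun k hk => ?_
  have i1 : Integrable (fun x => G k x * T.res A p k x) (resMeasure k) :=
    (hG k hk).integrable_mul (memLp_res hO hC hA p hk)
  have i2 : Integrable (fun x => G k x * T.res A q k x) (resMeasure k) :=
    (hG k hk).integrable_mul (memLp_res hO hC hA q hk)
  rw [← mul_add, ← integral_add i1 i2]
  congr 1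
  refine integral_congr_ae ?_
  filter_upwards [res_add (A := A) hd hO hC hp hq hk] with x hx
  rw [hx, mul_add]

theorem resPair_smul (hd : 1 ≤ d) (hO : IsOpen Ω) (hC : Convex ℝ Ω) (c : ℝ) {p : L2Vec Ω}
    (hp : p ∈ irrotSpace T m) :
    T.resPair A μ G (c • p : L2Vec Ω) = c * T.resPair A μ G p := by
  simp only [resPair, Finset.mul_sum]
  refine Finset.sum_congr rfl fun k hk => ?_
  rw [mul_left_comm, ← integral_const_mul c]
  congr 1
  refine integral_congr_ae ?_
  filter_upwards [res_smul (A := A) hd hO hC c hp hk] with x hx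
  rw [hx]; ring

theorem bilin_eq_resPair (p q : Pt d → Pt d) :
    bilin T A μ p q = T.resPair A μ (T.res A p) q := bilin_eq_sum T A μ p q

theorem linForm_eq_resPair (f g : Pt d → ℝ) (q : Pt d → Pt d) :
    linForm T A μ f g q = T.resPair A μ (T.resData f g) q := linForm_eq_sum T A μ f g q

theorem bilin_comm (p q : Pt d → Pt d) : bilin T A μ p q = bilin T A μ q p := by
  rw [bilin_eq_sum, bilin_eq_sum]
  simp only [mul_comm (T.res A p _ _)]

/-- The bilinear form on the discrete space. -/
def bilinMap (hd : 1 ≤ d) (hO : IsOpen Ω) (hC : Convex ℝ Ω) (hA : EssBounded Ω A) (T : Mesh Ω)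
    (μ : ℝ) (m : ℕ) :
    T.irrotSubmodule hO hC m →ₗ[ℝ] T.irrotSubmodule hO hC m →ₗ[ℝ] ℝ :=
  LinearMap.mk₂ ℝ (fun p q => bilin T A μ (p : L2Vec Ω) (q : L2Vec Ω))
    (fun p p' q => by
      rw [bilin_comm, bilin_comm (p : L2Vec Ω), bilin_comm (p' : L2Vec Ω)]
      simp only [bilin_eq_resPair]
      exact resPair_add hd hO hC hA (fun k hk => memLp_res hO hC hA _ hk) p.2 p'.2)
    (fun c p q => by
      rw [bilin_comm, bilin_comm (p : L2Vec Ω)]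
      simp only [bilin_eq_resPair]
      exact resPair_smul hd hO hC c p.2)
    (fun p q q' => by
      simp only [bilin_eq_resPair]
      exact resPair_add hd hO hC hA (fun k hk => memLp_res hO hC hA _ hk) q.2 q'.2)
    (fun c p q => by
      simp only [bilin_eq_resPair]
      exact resPair_smul hd hO hC c q.2)

/-- The linear form on the discrete space. -/
def linMap (hd : 1 ≤ d) (hO : IsOpen Ω) (hC : Convex ℝ Ω) (hA : EssBounded Ω A) (T : Mesh Ω)
    (μ : ℝ) (m : ℕ) {f : Pt d → ℝ} (hf : MemLp f 2 (volume.restrict Ω)) (g : Pt d → ℝ) :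
    T.irrotSubmodule hO hC m →ₗ[ℝ] ℝ where
  toFun q := linForm T A μ f g (q : L2Vec Ω)
  map_add' p q := by
    simp only [linForm_eq_resPair]
    exact resPair_add hd hO hC hA (fun k hk => memLp_resData hO hC hf g hk) p.2 q.2
  map_smul' c p := by
    simp only [linForm_eq_resPair, RingHom.id_apply, smul_eq_mul]
    exact resPair_smul hd hO hC c p.2

/-- Expansion of the least squares functional. -/
theorem lsFunctional_add (hd : 1 ≤ d) (hO : IsOpen Ω) (hC : Convex ℝ Ω) (hA : EssBounded Ω A)
    {f : Pt d → ℝ} (hf : MemLp f 2 (volume.restrict Ω)) (g : Pt d → ℝ) {p r : L2Vec Ω}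
    (hp : p ∈ irrotSpace T m) (hr : r ∈ irrotSpace T m) :
    lsFunctional T A μ f g (p + r : L2Vec Ω) = lsFunctional T A μ f g p +
      (2 * (bilin T A μ p r - linForm T A μ f g r) + bilin T A μ r r) := by
  rw [lsFunctional_eq_sum, lsFunctional_eq_sum, bilin_eq_sum, bilin_eq_sum, linForm_eq_sum,
    ← Finset.sum_sub_distrib, Finset.mul_sum, ← Finset.sum_add_distrib, ← Finset.sum_add_distrib]
  refine Finset.sum_congr rfl fun k hk => ?_
  have mp := memLp_res hO hC hA p hk
  have mr := memLp_res hO hC hA r hk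
  have mb := memLp_resData hO hC hf g hk
  have i1 : Integrable (fun x => (T.res A p k x - T.resData f g k x) ^ 2) (resMeasure k) :=
    (mp.sub mb).integrable_sq
  have i2 : Integrable (fun x => T.res A p k x * T.res A r k x) (resMeasure k) :=
    mp.integrable_mul mr
  have i3 : Integrable (fun x => T.resData f g k x * T.res A r k x) (resMeasure k) :=
    mb.integrable_mul mr
  have i4 : Integrable (fun x => T.res A r k x * T.res A r k x) (resMeasure k) :=
    mr.integrable_mul mr
  have h1 : ∫ x, (T.res A (p + r : L2Vec Ω) k x - T.resData f g k x) ^ 2 ∂resMeasure k =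
      ∫ x, ((T.res A p k x - T.resData f g k x) ^ 2 + (2 * (T.res A p k x * T.res A r k x -
        T.resData f g k x * T.res A r k x) + T.res A r k x * T.res A r k x)) ∂resMeasure k := by
    refine integral_congr_ae ?_
    filter_upwards [res_add (A := A) hd hO hC hp hr hk] with x hx
    rw [hx]; ring
  have i5 : Integrable (fun x => 2 * (T.res A p k x * T.res A r k x -
      T.resData f g k x * T.res A r k x)) (resMeasure k) := (i2.sub i3).const_mul 2
  have i6 : Integrable (fun x => 2 * (T.res A p k x * T.res A r k x -
      T.resData f g k x * T.res A r k x) + T.res A r k x * T.res A r k x) (resMeasure k) :=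
    i5.add i4
  rw [h1, integral_add i1 i6, integral_add i5 i4, integral_const_mul, integral_sub i2 i3]
  ring

/-- In J(p + r) = J(p) + 2(a(p,r) - l(r)) + a(r,r) the last term is nonnegative, so p is a minimizer
exactly if the linear term vanishes for all r. -/
theorem isDiscreteGradient_iff_isMinOn (hd : 1 ≤ d) (hO : IsOpen Ω) (hC : Convex ℝ Ω)
    (hA : EssBounded Ω A) (hμ : 0 ≤ μ) {f : Pt d → ℝ} (hf : MemLp f 2 (volume.restrict Ω))
    (g : Pt d → ℝ) {p : L2Vec Ω} (hp : p ∈ irrotSpace T m) :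
    IsDiscreteGradient T A μ m f g p ↔
      IsMinOn (fun q : L2Vec Ω => lsFunctional T A μ f g q) (irrotSpace T m) p := by
  constructor
  · rintro ⟨-, h⟩ q hq
    have hr : q - p ∈ irrotSpace T m := (T.irrotSubmodule hO hC m).sub_mem hq hp
    have h1 := lsFunctional_add (A := A) (μ := μ) hd hO hC hA hf g hp hr
    rw [add_sub_cancel, h _ hr, sub_self] at h1
    have h2 := bilin_self_nonneg (A := A) hμ T ((q - p : L2Vec Ω) : Pt d → Pt d)
    show lsFunctional T A μ f g p ≤ lsFunctional T A μ f g q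
    linarith
  · intro hmin
    refine ⟨hp, fun r hr => ?_⟩
    set α := bilin T A μ p r - linForm T A μ f g r with hα
    set β := bilin T A μ r r with hβ
    have hβ0 : 0 ≤ β := bilin_self_nonneg hμ T _
    have key : ∀ t : ℝ, 0 ≤ 2 * (t * α) + t ^ 2 * β := by
      intro t
      have htr : t • r ∈ irrotSpace T m := (T.irrotSubmodule hO hC m).smul_mem t hr
      have h1 := lsFunctional_add (A := A) (μ := μ) hd hO hC hA hf g hp htr
      have h2 : lsFunctional T A μ f g p ≤ lsFunctional T A μ f g (p + t • r : L2Vec Ω) :=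
        hmin ((T.irrotSubmodule hO hC m).add_mem hp htr)
      have h3 : bilin T A μ p (t • r : L2Vec Ω) = t * bilin T A μ p r := by
        rw [bilin_eq_resPair, bilin_eq_resPair, resPair_smul hd hO hC t hr]
      have h4 : linForm T A μ f g (t • r : L2Vec Ω) = t * linForm T A μ f g r := by
        rw [linForm_eq_resPair, linForm_eq_resPair, resPair_smul hd hO hC t hr]
      have h5 : bilin T A μ (t • r : L2Vec Ω) (t • r : L2Vec Ω) = t ^ 2 * β := by
        rw [bilin_eq_resPair, resPair_smul hd hO hC t hr, ← bilin_eq_resPair, bilin_comm,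
          bilin_eq_resPair, resPair_smul hd hO hC t hr, ← bilin_eq_resPair]
        ring
      rw [h3, h4, h5] at h1
      have : t * bilin T A μ p r - t * linForm T A μ f g r = t * α := by rw [hα]; ring
      rw [this] at h1
      linarith
    -- Nearly the minimizer -α/β, but defined also for β = 0; the quadratic is then negative unless
    -- α = 0.
    have h6 := key (-α / (β + 1))
    have h7 : 2 * (-α / (β + 1) * α) + (-α / (β + 1)) ^ 2 * β =
        -(α ^ 2 * (β + 2)) / (β + 1) ^ 2 := by
      field_simp; ring
    rw [h7] at h6
    have h8 : α = 0 := by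
      by_contra hne
      have : 0 < α ^ 2 * (β + 2) := by positivity
      have h9 : -(α ^ 2 * (β + 2)) / (β + 1) ^ 2 < 0 := div_neg_of_neg_of_pos (by linarith) (by positivity)
      linarith
    linarith

end Mesh
end
end CordesLS

end

theorem theorem4p1 {d : ℕ} (hd : d = 2 ∨ d = 3)
    (Ω : Set (CordesLS.Pt d)) (hΩ_open : IsOpen Ω) (hΩ_ne : Ω.Nonempty)
    (hΩ_bdd : Bornology.IsBounded Ω) (hΩ_conv : Convex ℝ Ω)
    (A : CordesLS.Pt d → Matrix (Fin d) (Fin d) ℝ)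
    (hA_bdd : CordesLS.EssBounded Ω A) (hA_ell : CordesLS.UniformlyElliptic Ω A)
    (hA_cordes : CordesLS.Cordes Ω A)
    (μ : ℝ) (hμ : 0 < μ) (σ : ℝ) :
    -- boundedness
    (∃ C : ℝ, 0 < C ∧ ∀ T : CordesLS.Mesh Ω, T.ShapeRegular σ →
      ∀ p ∈ CordesLS.brokenH1 T, ∀ q ∈ CordesLS.brokenH1 T,
        |CordesLS.bilin T A μ p q| ≤
          C * (CordesLS.energyNorm T p * CordesLS.energyNorm T q)) ∧
    ∀ m : ℕ,
      -- coercivity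
      (∃ C : ℝ, 0 < C ∧ ∀ T : CordesLS.Mesh Ω, T.ShapeRegular σ →
        ∀ p ∈ CordesLS.irrotSpace T m,
          C * CordesLS.energyNorm T p ^ 2 ≤ CordesLS.bilin T A μ p p) ∧
      -- existence and uniqueness of the discrete gradient, and its minimality
      (∀ T : CordesLS.Mesh Ω, T.ShapeRegular σ → ∀ f g : CordesLS.Pt d → ℝ,
        MemLp f 2 (volume.restrict Ω) → CordesLS.BoundaryH1 T g →
          (∃! p : CordesLS.L2Vec Ω, CordesLS.IsDiscreteGradient T A μ m f g p) ∧
          ∀ p ∈ CordesLS.irrotSpace T m,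
            (CordesLS.IsDiscreteGradient T A μ m f g p ↔
              IsMinOn (fun q : CordesLS.L2Vec Ω => CordesLS.lsFunctional T A μ f g q)
                (CordesLS.irrotSpace T m) p)) := by
  have hd2 : 2 ≤ d := by omega
  have hd1 : 1 ≤ d := by omega
  obtain ⟨C, hC0, hC⟩ := CordesLS.Mesh.exists_abs_bilin_le hΩ_open hΩ_conv hA_bdd hμ
  refine ⟨⟨C, hC0, fun T _ p _ q _ => hC T p q⟩, fun m => ?_⟩
  have hcoer := CordesLS.Mesh.exists_coercive hd2 hΩ_open hΩ_conv hΩ_ne hA_bdd hA_ell hA_cordes hμ σ m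
  refine ⟨hcoer, fun T hT f g hf _ => ⟨?_, fun p hp =>
    CordesLS.Mesh.isDiscreteGradient_iff_isMinOn hd1 hΩ_open hΩ_conv hA_bdd hμ.le hf g hp⟩⟩
  obtain ⟨c, hc0, hc⟩ := hcoer
  have := T.finiteDimensional_irrotSubmodule hΩ_open hΩ_conv m
  -- Definiteness: by coercivity a(p,p) = 0 forces the energy norm to vanish, and this forces p = 0.
  obtain ⟨p, hp, hpu⟩ := CordesLS.existsUnique_of_definite
    (CordesLS.Mesh.bilinMap hd1 hΩ_open hΩ_conv hA_bdd T μ m) (fun p hp => by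
      have h1 := hc T hT p p.2
      have h2 : CordesLS.bilin T A μ (p : CordesLS.L2Vec Ω) (p : CordesLS.L2Vec Ω) = 0 := hp
      rw [h2] at h1
      have h3 : CordesLS.energyNorm T (p : CordesLS.L2Vec Ω) ^ 2 ≤ 0 :=
        nonpos_of_mul_nonpos_right h1 hc0
      exact Subtype.ext (CordesLS.Mesh.eq_zero_of_energyNorm_eq_zero hd2 hΩ_open hΩ_conv hΩ_ne p.2
        (pow_eq_zero_iff two_ne_zero |>.1 (le_antisymm h3 (sq_nonneg _)))))
    (CordesLS.Mesh.linMap hd1 hΩ_open hΩ_conv hA_bdd T μ m hf g)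
  refine ⟨p, ⟨p.2, fun q hq => hp ⟨q, hq⟩⟩, fun p' hp' => ?_⟩
  exact congrArg Subtype.val (hpu ⟨p', hp'.1⟩ fun q => hp'.2 q q.2)
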